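/- Let $p\ge 1$ and let $\{\varepsilon_t\}_{t\in\mathbb Z}$ be i.i.d. real random variables with distribution function having a density $g$, where $E\varepsilon_1=0$, $E\varepsilon_1^2<\infty$ and $g(x)>0$ for all $x$. Let $\beta_a>0$ be a constant with $E\varepsilon_1^2\ge\beta_a$, write $\|\cdot\|_1$, $\|\cdot\|$ for the $L_1$ and Euclidean norms on $\mathbb R^p$, and put $$\Theta=\{a\in\mathbb R^p:\ a_1,\dots,a_p\ge 0,\ \|a\|_1\le\beta_a^{-1}\}.$$ Fix $b\in\Theta$ and $\delta>0$ with $E\varepsilon_1^2\,(\|b\|_1+\delta)<1$, and let $\Theta^\delta=\{a\in\Theta:\|a-b\|_1\le\delta\}$. For $\theta\in\Theta$, $U\in\mathbb R^p$ let $s(\theta,U)=1+\theta_1U_1^2+\dots+\theta_pU_p^2$. For $a\in\Theta^\delta$ let $\{y^a_t\}_{t\in\mathbb Z}$ be the strictly stationary solution of the ARCH($p$) equation $y_t=s(a,Y_{t-1})^{1/2}\varepsilon_t$, where $Y^a_t=(y^a_t,\dots,y^a_{t-p+1})$. Put $\varepsilon^a_t(\theta)=y^a_t\,s(\theta,Y^a_{t-1})^{-1/2}$,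 and let $\varphi=(\varphi_1,\dots,\varphi_p):\mathbb R^p\times\Theta\to\mathbb R^p$ be measurable in its first argument. Assume: 1. $g$ is differentiable, $xg(x)\to0$ as $|x|\to\infty$, $\sup_x(1+x^2)|g'(x)|<\infty$ and $\int|x g'(x)|\,dx<\infty$. 2. There are measurable functions $\Phi,M:\mathbb R^p\to\mathbb R$ and $\beta_0>0$ such that (i) $|\varphi_j(U,\theta)|\le\Phi(U)$ for all $U\in\mathbb R^p$, $\theta\in\Theta$, $j=1,\dots,p$, and $\sup_{a\in\Theta^\delta}E\,\Phi(Y^a_0)^{4+\beta_0}<\infty$; (ii) for Lebesgue-almost every $U\in\mathbb R^p$ and all $j,k$ the partial derivative $d_{j,k}(U,\theta)=\partial\varphi_j(U,\theta)/\partial\theta_k$ exists (within $\Theta$ at boundary points) and is continuous in $\theta\in\Theta$, $|d_{j,k}(U,\theta)|\le M(U)$ for $\theta\in\Theta$, and $\sup_{a\in\Theta^\delta}E\,|M(Y^a_0)|^{2+\beta_0}<\infty$. 3. $E|\varepsilon_1|^{8+\beta_1}<\infty$ for some $\beta_1>0$. For $a\in\Theta^\delta$, $n\ge1$, $x\in\mathbb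 R$, $\theta\in\Theta$, $k=1,\dots,p$ define the residual empirical process of the sample $y^a_{1-p},\dots,y^a_n$ by $$W^a_{n,k}(x,\theta)=n^{-1/2}\sum_{t=1}^n\varphi_k(Y^a_{t-1},\theta)\bigl[I\{\varepsilon^a_t(\theta)\le x\}-G^a_n(x,\theta)\bigr],\qquad G^a_n(x,\theta)=n^{-1}\sum_{t=1}^nI\{\varepsilon^a_t(\theta)\le x\},$$ and let $$b^a_k(x,\theta)=E\,\varphi_k(Y^a_0,\theta)I\{\varepsilon^a_1(\theta)\le x\}-E\,\varphi_k(Y^a_0,\theta)\,P(\varepsilon^a_1(\theta)\le x).$$ Then for every $k=1,\dots,p$, every $\rho>0$ and each of the two choices of sign, the random variables $$\eta^{a,\pm}_n=\sup_{x\in\mathbb R,\ \theta\in\Theta}\Bigl(W^a_{n,k}(x,\theta)-n^{1/2}\bigl[b^a_k(x,\theta)\pm\rho\|\theta-a\|\bigr]\Bigr)^{\pm}$$ (where $u^+=\max(u,0)$, $u^-=\max(-u,0)$) are bounded in probability uniformly in $n$ and in the true parameter: $$\lim_{C\to\infty}\ \sup_{a\in\Theta^\delta,\ n\ge1}P\bigl(\eta^{a,\pm}_n\ge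 C\bigr)=0 .$$ In particular, if the sample of size $n$ comes from the solution with a parameter $a_n\in\Theta^\delta$ depending on $n$, then $\eta^{a_n,\pm}_n=O_p(1)$, uniformly over all such sequences $\{a_n\}$. -/

import Mathlib

open MeasureTheory ProbabilityTheory Filter Topology
open scoped ENNReal

noncomputable section

namespace ArchResidual

/-- The `L₁` norm on `ℝ^p`. -/
def l1norm {p : ℕ} (v : Fin p → ℝ) : ℝ := ∑ i, |v i|

/-- The Euclidean (`L₂`) norm on `ℝ^p`. -/
def l2norm {p : ℕ} (v : Fin p → ℝ) : ℝ := ‖WithLp.toLp 2 v‖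

/-- The parameter domain `Θ = {a : a_i ≥ 0, ‖a‖₁ ≤ βa⁻¹}`. -/
def Theta (p : ℕ) (βa : ℝ) : Set (Fin p → ℝ) :=
  {a | (∀ i, 0 ≤ a i) ∧ l1norm a ≤ βa⁻¹}

/-- The set `Θ^δ = {a : ‖a - b‖₁ ≤ δ} ∩ Θ` of admissible true parameters. -/
def ThetaNear (p : ℕ) (βa : ℝ) (b : Fin p → ℝ) (δ : ℝ) : Set (Fin p → ℝ) :=
  {a | l1norm (a - b) ≤ δ} ∩ Theta p βa

/-- `s(θ, U) = 1 + θ₁ U₁² + … + θ_p U_p²`. -/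
def vol {p : ℕ} (θ U : Fin p → ℝ) : ℝ := 1 + ∑ i, θ i * U i ^ 2

variable {Ω : Type*}

/-- The vector `Y_t = (y_t, y_{t-1}, …, y_{t-p+1})`. -/
def lags (p : ℕ) (y : ℤ → Ω → ℝ) (t : ℤ) (ω : Ω) : Fin p → ℝ :=
  fun i => y (t - (i : ℕ)) ω

/-- The residual `ε_t(θ) = y_t / s(θ, Y_{t-1})^{1/2}`. -/
def residual {p : ℕ} (y : ℤ → Ω → ℝ) (θ : Fin p → ℝ) (t : ℤ) (ω : Ω) : ℝ :=
  y t ω / √(vol θ (lags p y (t - 1) ω))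

/-- The indicator `I{ε_t(θ) ≤ x}`. -/
def residualInd {p : ℕ} (y : ℤ → Ω → ℝ) (x : ℝ) (θ : Fin p → ℝ) (t : ℤ) : Ω → ℝ :=
  Set.indicator {ω | residual y θ t ω ≤ x} 1

/-- The residual empirical distribution function `G_n(x, θ)`. -/
def Gemp {p : ℕ} (y : ℤ → Ω → ℝ) (n : ℕ) (x : ℝ) (θ : Fin p → ℝ) (ω : Ω) : ℝ :=
  (n : ℝ)⁻¹ * ∑ t ∈ Finset.Icc 1 n, residualInd y x θ (t : ℤ) ω

/-- The `k`-th component `W_{n,k}(x, θ)` of the residual empirical process. -/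
def Wproc {p : ℕ} (φ : (Fin p → ℝ) → (Fin p → ℝ) → Fin p → ℝ) (y : ℤ → Ω → ℝ)
    (k : Fin p) (n : ℕ) (x : ℝ) (θ : Fin p → ℝ) (ω : Ω) : ℝ :=
  (√(n : ℝ))⁻¹ * ∑ t ∈ Finset.Icc 1 n,
    φ (lags p y ((t : ℤ) - 1) ω) θ k * (residualInd y x θ (t : ℤ) ω - Gemp y n x θ ω)

variable [MeasurableSpace Ω]

/-- `b_k(x, θ) = E φ_k(Y_0, θ) I{ε_1(θ) ≤ x} - E φ_k(Y_0, θ) P(ε_1(θ) ≤ x)`. -/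
def bias {p : ℕ} (P : Measure Ω) (φ : (Fin p → ℝ) → (Fin p → ℝ) → Fin p → ℝ)
    (y : ℤ → Ω → ℝ) (k : Fin p) (x : ℝ) (θ : Fin p → ℝ) : ℝ :=
  (∫ ω, φ (lags p y 0 ω) θ k * residualInd y x θ 1 ω ∂P)
    - (∫ ω, φ (lags p y 0 ω) θ k ∂P) * P.real {ω | residual y θ 1 ω ≤ x}

/-- `y` is a strictly stationary solution of the ARCH(p) equation
`y_t = σ_t ε_t`, `σ_t² = 1 + a₁ y_{t-1}² + … + a_p y_{t-p}²`, `t ∈ ℤ`. -/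
structure IsStationaryArch {p : ℕ} (P : Measure Ω) (ε : ℤ → Ω → ℝ) (a : Fin p → ℝ)
    (y : ℤ → Ω → ℝ) : Prop where
  measurable : ∀ t, Measurable (y t)
  stationary : ∀ h : ℤ, P.map (fun ω (t : ℤ) => y (t + h) ω) = P.map (fun ω (t : ℤ) => y t ω)
  equation : ∀ t : ℤ, ∀ᵐ ω ∂P, y t ω = √(vol a (lags p y (t - 1) ω)) * ε t ω

/-- The innovations are i.i.d. with density `g > 0`, mean zero and finite variance. -/
structure IsInnovation (P : Measure Ω) (ε : ℤ → Ω → ℝ) (g : ℝ → ℝ) : Prop where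
  measurable : ∀ t, Measurable (ε t)
  indep : iIndepFun ε P
  density : ∀ t, P.map (ε t) = volume.withDensity (fun x => ENNReal.ofReal (g x))
  pos : ∀ x, 0 < g x
  sq_integrable : Integrable (fun ω => ε 1 ω ^ 2) P
  mean_zero : ∫ ω, ε 1 ω ∂P = 0

/-- Regularity of the density: `x g(x) → 0` as `|x| → ∞`, `sup (1 + x²)|g'(x)| < ∞`,
`∫ |x g'(x)| dx < ∞`. -/
structure DensityRegular (g : ℝ → ℝ) : Prop where
  differentiable : Differentiable ℝ g
  tail : Tendsto (fun x => x * g x) (cocompact ℝ) (𝓝 0)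
  deriv_bound : ∃ K : ℝ, ∀ x, (1 + x ^ 2) * |deriv g x| ≤ K
  deriv_integrable : Integrable (fun x => x * deriv g x)

/-- Domination and differentiability of the weight `φ` on `Θ = T`, with the moments of the
dominating functions bounded uniformly over the true parameters in `S`.  At a boundary point
of `T` the partial derivative in `θ_k` is taken along the part of the coordinate line that
lies in `T`. -/
def WeightRegular {p : ℕ} (P : Measure Ω) (T S : Set (Fin p → ℝ))
    (φ : (Fin p → ℝ) → (Fin p → ℝ) → Fin p → ℝ)
    (y : (Fin p → ℝ) → ℤ → Ω → ℝ) : Prop :=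
  (∀ θ ∈ T, ∀ j, Measurable fun U => φ U θ j) ∧
  ∃ (Φ M : (Fin p → ℝ) → ℝ) (d : Fin p → Fin p → (Fin p → ℝ) → (Fin p → ℝ) → ℝ) (β₀ : ℝ),
    Measurable Φ ∧ Measurable M ∧ 0 < β₀ ∧
    (∀ U, ∀ θ ∈ T, ∀ j, |φ U θ j| ≤ Φ U) ∧
    (⨆ a ∈ S, ∫⁻ ω, ‖Φ (lags p (y a) 0 ω)‖ₑ ^ (4 + β₀) ∂P) < ∞ ∧
    (∀ᵐ U : Fin p → ℝ, ∀ j k,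
      ContinuousOn (d j k U) T ∧
      ∀ θ ∈ T,
        HasDerivWithinAt (fun s : ℝ => φ U (Function.update θ k s) j) (d j k U θ)
          {s | Function.update θ k s ∈ T} (θ k) ∧
        |d j k U θ| ≤ M U) ∧
    (⨆ a ∈ S, ∫⁻ ω, ‖M (lags p (y a) 0 ω)‖ₑ ^ (2 + β₀) ∂P) < ∞

/-- `η^a_n = O^a_p(1)`: `lim_{C → ∞} sup_{a ∈ S, n ≥ 1} P(η^a_n ≥ C) = 0`
(`P` is applied as an outer measure, so that no measurability of `η` is presupposed). -/
def UniformOp {p : ℕ} (P : Measure Ω) (S : Set (Fin p → ℝ))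
    (η : (Fin p → ℝ) → ℕ → Ω → ℝ≥0∞) : Prop :=
  Tendsto (fun C : ℝ => ⨆ a ∈ S, ⨆ n : ℕ, ⨆ _ : 1 ≤ n, P {ω | ENNReal.ofReal C ≤ η a n ω})
    atTop (𝓝 0)

end ArchResidual

end

open MeasureTheory ProbabilityTheory Filter Topology
open scoped ENNReal

noncomputable section

namespace ArchResidual

set_option linter.unusedSectionVars false

/-- A differentiable density with `x g(x) → 0` at infinity is bounded. -/
theorem DensityRegular.exists_bound {g : ℝ → ℝ} (hg : DensityRegular g) :
    ∃ B : ℝ, ∀ x, |g x| ≤ B := by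
  have h1 : ∀ᶠ x in cocompact ℝ, |x * g x| < 1 := by
    have := hg.tail.abs
    simp only [abs_zero] at this
    exact this.eventually (gt_mem_nhds one_pos)
  obtain ⟨K, hK, hKs⟩ := Filter.mem_cocompact.1 h1
  have hK' : IsCompact (K ∪ Metric.closedBall (0 : ℝ) 1) :=
    hK.union (isCompact_closedBall _ _)
  obtain ⟨B, hB⟩ := hK'.exists_bound_of_continuousOn hg.differentiable.continuous.continuousOn
  refine ⟨max B 1, fun x => ?_⟩
  by_cases hx : x ∈ K ∪ Metric.closedBall (0 : ℝ) 1
  · exact (hB x hx).trans (le_max_left _ _)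
  · simp only [Set.mem_union, not_or, Metric.mem_closedBall, dist_zero_right, not_le,
      Real.norm_eq_abs] at hx
    have h2 : |x * g x| < 1 := hKs hx.1
    rw [abs_mul] at h2
    refine le_trans ?_ (le_max_right _ _)
    nlinarith [abs_nonneg (g x), hx.2]

theorem lintegral_enorm_comp_mul_left {w : ℝ → ℝ} (hw : Measurable w) {t : ℝ} (ht : 0 < t) :
    ∫⁻ y, ‖w (t * y)‖ₑ = ENNReal.ofReal t⁻¹ * ∫⁻ y, ‖w y‖ₑ := by
  have h := lintegral_map (μ := volume) hw.enorm (measurable_const_mul t)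
  rw [Real.map_volume_mul_left ht.ne', lintegral_smul_measure, abs_of_pos (inv_pos.2 ht)] at h
  exact h.symm

theorem hasDerivAt_scale {g : ℝ → ℝ} (hg : Differentiable ℝ g) (y t : ℝ) :
    HasDerivAt (fun t => t * g (t * y)) (g (t * y) + t * y * deriv g (t * y)) t := by
  have h1 : HasDerivAt (fun t => t * y) y t := by simpa using (hasDerivAt_id t).mul_const y
  have h2 : HasDerivAt (fun t => g (t * y)) (deriv g (t * y) * y) t :=
    (hg (t * y)).hasDerivAt.comp t h1
  have h3 := (hasDerivAt_id' t).mul h2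
  rw [show g (t * y) + t * y * deriv g (t * y) = 1 * g (t * y) + t * (deriv g (t * y) * y) by ring]
  exact h3

/-- The constant `∫ |g(x) + x g'(x)| dx`. -/
def tvConst (g : ℝ → ℝ) : ℝ := ∫ x, |g x + x * deriv g x|

theorem tvConst_nonneg (g : ℝ → ℝ) : 0 ≤ tvConst g := integral_nonneg fun _ => abs_nonneg _

theorem lintegral_scale_sub_le {g : ℝ → ℝ} (hg : DensityRegular g) (hint : Integrable g)
    {c' c : ℝ} (hc' : 0 < c') (hcc : c' ≤ c) :
    ∫⁻ y, ‖c * g (c * y) - c' * g (c' * y)‖ₑ ≤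
      ENNReal.ofReal ((c - c') * c'⁻¹ * tvConst g) := by
  set w : ℝ → ℝ := fun x => g x + x * deriv g x with hw
  have hwm : Measurable w := by
    have := hg.differentiable.continuous.measurable
    have := measurable_deriv g
    fun_prop
  have hwi : Integrable w := hint.add hg.deriv_integrable
  obtain ⟨B, hB⟩ := hg.exists_bound
  obtain ⟨K, hK⟩ := hg.deriv_bound
  have hwb : ∀ x, ‖w x‖ ≤ B + K := fun x => by
    have h1 : |x * deriv g x| ≤ K := by
      refine le_trans ?_ (hK x)
      rw [abs_mul]
      have : |x| ≤ 1 + x ^ 2 := by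
        rw [← sq_abs]; nlinarith [sq_nonneg (|x| - 1), abs_nonneg x]
      exact mul_le_mul_of_nonneg_right this (abs_nonneg _)
    exact (abs_add_le _ _).trans (add_le_add (hB x) h1)
  have key : ∀ y, ‖c * g (c * y) - c' * g (c' * y)‖ₑ ≤
      ∫⁻ t in Set.Ioc c' c, ‖w (t * y)‖ₑ := fun y => by
    have hii : IntervalIntegrable (fun t => w (t * y)) volume c' c := by
      rw [intervalIntegrable_iff]
      refine Measure.integrableOn_of_bounded (M := B + K) (by simp) ?_ ?_
      · exact (hwm.comp (by fun_prop)).aestronglyMeasurable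
      · exact Eventually.of_forall fun t => hwb _
    have h := intervalIntegral.integral_eq_sub_of_hasDerivAt
      (fun t _ => hasDerivAt_scale hg.differentiable y t) hii
    rw [← h, intervalIntegral.integral_of_le hcc]
    exact enorm_integral_le_lintegral_enorm _
  calc ∫⁻ y, ‖c * g (c * y) - c' * g (c' * y)‖ₑ
      ≤ ∫⁻ y, ∫⁻ t in Set.Ioc c' c, ‖w (t * y)‖ₑ := lintegral_mono key
    _ = ∫⁻ t in Set.Ioc c' c, ∫⁻ y, ‖w (t * y)‖ₑ := by
        apply lintegral_lintegral_swap
        apply Measurable.aemeasurable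
        apply Measurable.enorm
        exact hwm.comp (by fun_prop)
    _ ≤ ∫⁻ t in Set.Ioc c' c, ENNReal.ofReal c'⁻¹ * ∫⁻ y, ‖w y‖ₑ := by
        refine setLIntegral_mono measurable_const fun t ht => ?_
        rw [lintegral_enorm_comp_mul_left hwm (hc'.trans ht.1)]
        gcongr
        exact ht.1.le
    _ = ENNReal.ofReal ((c - c') * c'⁻¹ * tvConst g) := by
        rw [setLIntegral_const, Real.volume_Ioc]
        have : ∫⁻ y, ‖w y‖ₑ = ENNReal.ofReal (tvConst g) := by
          rw [tvConst, ← ofReal_integral_norm_eq_lintegral_enorm hwi]; rfl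
        rw [this, ← ENNReal.ofReal_mul (by positivity), ← ENNReal.ofReal_mul (by
          have := tvConst_nonneg g
          positivity)]
        congr 1
        ring

theorem integral_comp_scale (F g : ℝ → ℝ) {s : ℝ} (hs : 0 < s) :
    ∫ x, F (s * x) * g x = ∫ y, F y * (s⁻¹ * g (s⁻¹ * y)) := by
  have h := Measure.integral_comp_mul_left (fun y => F y * (s⁻¹ * g (s⁻¹ * y))) s
  rw [abs_of_pos (inv_pos.2 hs), smul_eq_mul] at h
  have h2 : ∫ x, F (s * x) * (s⁻¹ * g (s⁻¹ * (s * x))) = s⁻¹ * ∫ x, F (s * x) * g x := by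
    rw [← integral_const_mul]
    congr 1
    ext x
    rw [inv_mul_cancel_left₀ hs.ne']
    ring
  rw [h2] at h
  exact mul_left_cancel₀ (inv_pos.2 hs).ne' h

theorem integrable_comp_scale {g : ℝ → ℝ} (hint : Integrable g) {s : ℝ} (hs : 0 < s) :
    Integrable fun y => s⁻¹ * g (s⁻¹ * y) :=
  (hint.comp_mul_left' (inv_pos.2 hs).ne').const_mul _

theorem integral_scale_sub_le_aux {g : ℝ → ℝ} (hg : DensityRegular g) (hint : Integrable g)
    {F : ℝ → ℝ} (hF : Measurable F) {K : ℝ} (hK : ∀ x, |F x| ≤ K) {s s' : ℝ} (hs' : 1 ≤ s')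
    (hss : s' ≤ s) :
    |(∫ x, F (s * x) * g x) - ∫ x, F (s' * x) * g x| ≤ K * (tvConst g * (s - s')) := by
  have hs0' : 0 < s' := by linarith
  have hs0 : 0 < s := by linarith
  have hK0 : 0 ≤ K := (abs_nonneg _).trans (hK 0)
  have hi : ∀ {t : ℝ}, 0 < t → Integrable fun y => F y * (t⁻¹ * g (t⁻¹ * y)) := fun ht =>
    (integrable_comp_scale hint ht).bdd_mul hF.aestronglyMeasurable
      (Eventually.of_forall fun x => hK x)
  rw [integral_comp_scale F g hs0, integral_comp_scale F g hs0', ← integral_sub (hi hs0) (hi hs0')]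
  have hle := lintegral_scale_sub_le hg hint (inv_pos.2 hs0) (inv_anti₀ hs0' hss)
  have hint' : Integrable fun y => s'⁻¹ * g (s'⁻¹ * y) - s⁻¹ * g (s⁻¹ * y) :=
    (integrable_comp_scale hint hs0').sub (integrable_comp_scale hint hs0)
  have h1 : ∫ y, ‖s'⁻¹ * g (s'⁻¹ * y) - s⁻¹ * g (s⁻¹ * y)‖ ≤ (s'⁻¹ - s⁻¹) * s⁻¹⁻¹ * tvConst g := by
    rw [← ofReal_integral_norm_eq_lintegral_enorm hint'] at hle
    refine (ENNReal.ofReal_le_ofReal_iff ?_).1 hle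
    have := tvConst_nonneg g
    have : s⁻¹ ≤ s'⁻¹ := inv_anti₀ hs0' hss
    have : 0 ≤ s'⁻¹ - s⁻¹ := by linarith
    positivity
  have h2 : (s'⁻¹ - s⁻¹) * s⁻¹⁻¹ ≤ s - s' := by
    have : (s'⁻¹ - s⁻¹) * s⁻¹⁻¹ = (s - s') / s' := by field_simp
    rw [this]
    exact div_le_self (by linarith) hs'
  calc |∫ y, (F y * (s⁻¹ * g (s⁻¹ * y)) - F y * (s'⁻¹ * g (s'⁻¹ * y)))|
      ≤ ∫ y, K * ‖s'⁻¹ * g (s'⁻¹ * y) - s⁻¹ * g (s⁻¹ * y)‖ := by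
        rw [← Real.norm_eq_abs]
        refine norm_integral_le_of_norm_le (hint'.norm.const_mul K) (Eventually.of_forall fun y => ?_)
        rw [← mul_sub, norm_mul, norm_sub_rev]
        exact mul_le_mul_of_nonneg_right (hK y) (norm_nonneg _)
    _ ≤ K * (tvConst g * (s - s')) := by
        rw [integral_const_mul]
        refine mul_le_mul_of_nonneg_left (h1.trans ?_) hK0
        rw [mul_comm]
        exact mul_le_mul_of_nonneg_left h2 (tvConst_nonneg g)

/-- Scale families of a regular density are Lipschitz in total variation. -/
theorem integral_scale_sub_le {g : ℝ → ℝ} (hg : DensityRegular g) (hint : Integrable g)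
    {F : ℝ → ℝ} (hF : Measurable F) {K : ℝ} (hK : ∀ x, |F x| ≤ K) {s s' : ℝ} (hs : 1 ≤ s)
    (hs' : 1 ≤ s') :
    |(∫ x, F (s * x) * g x) - ∫ x, F (s' * x) * g x| ≤ K * (tvConst g * |s ^ 2 - s' ^ 2|) := by
  have hK0 : 0 ≤ K := (abs_nonneg _).trans (hK 0)
  have hgen : ∀ {u v : ℝ}, 1 ≤ u → u ≤ v →
      K * (tvConst g * (v - u)) ≤ K * (tvConst g * |v ^ 2 - u ^ 2|) := fun {u v} hu huv => by
    refine mul_le_mul_of_nonneg_left (mul_le_mul_of_nonneg_left ?_ (tvConst_nonneg g)) hK0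
    rw [abs_of_nonneg (by nlinarith)]
    nlinarith
  rcases le_total s' s with h | h
  · exact (integral_scale_sub_le_aux hg hint hF hK hs' h).trans (hgen hs' h)
  · rw [abs_sub_comm, abs_sub_comm (s ^ 2)]
    exact (integral_scale_sub_le_aux hg hint hF hK hs h).trans (hgen hs h)

/-- The law with density `g`. -/
def noiseLaw (g : ℝ → ℝ) : Measure ℝ := volume.withDensity fun x => ENNReal.ofReal (g x)

/-- A measure on `ℝ` for which the scale family `s ↦ law of s • e` is Lipschitz in total
variation, whose intervals of length `h` have mass at most `B h`, and which charges every
open half-line strictly monotonically. -/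
structure RegularNoise (ν : Measure ℝ) (m₂ C B : ℝ) : Prop where
  prob : IsProbabilityMeasure ν
  sq_integrable : Integrable (fun x => x ^ 2) ν
  sq_eq : ∫ x, x ^ 2 ∂ν = m₂
  scale_le : ∀ {F : ℝ → ℝ}, Measurable F → ∀ {K : ℝ}, (∀ x, |F x| ≤ K) → ∀ {s s' : ℝ}, 1 ≤ s →
    1 ≤ s' → |(∫ x, F (s * x) ∂ν) - ∫ x, F (s' * x) ∂ν| ≤ K * (C * |s ^ 2 - s' ^ 2|)
  interval_le : ∀ u h : ℝ, 0 ≤ h → ν.real (Set.Icc u (u + h)) ≤ B * h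
  strict : ∀ {u v : ℝ}, u < v → 0 < ν.real (Set.Ioc u v)
  ac : ν ≪ volume
  C_nonneg : 0 ≤ C
  B_nonneg : 0 ≤ B

theorem integral_noiseLaw {g : ℝ → ℝ} (hgm : Measurable g) (hg0 : ∀ x, 0 < g x) (F : ℝ → ℝ) :
    ∫ x, F x ∂(noiseLaw g) = ∫ x, F x * g x := by
  rw [noiseLaw, integral_withDensity_eq_integral_toReal_smul (by fun_prop)
    (Eventually.of_forall fun x => ENNReal.ofReal_lt_top)]
  congr 1
  ext x
  rw [ENNReal.toReal_ofReal (hg0 x).le, smul_eq_mul, mul_comm]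

theorem DensityRegular.regularNoise {g : ℝ → ℝ} (hg : DensityRegular g) (hg0 : ∀ x, 0 < g x)
    (hprob : IsProbabilityMeasure (noiseLaw g)) (hsq : Integrable (fun x => x ^ 2) (noiseLaw g)) :
    ∃ B, RegularNoise (noiseLaw g) (∫ x, x ^ 2 ∂(noiseLaw g)) (tvConst g) B := by
  have hgm : Measurable g := hg.differentiable.continuous.measurable
  have hint : Integrable g := by
    have h1 : ∫⁻ x, ENNReal.ofReal (g x) = 1 := by
      have := hprob.measure_univ
      rwa [noiseLaw, withDensity_apply _ MeasurableSet.univ, Measure.restrict_univ] at this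
    refine ⟨hgm.aestronglyMeasurable, ?_⟩
    rw [hasFiniteIntegral_iff_ofReal (Eventually.of_forall fun x => (hg0 x).le), h1]
    exact ENNReal.one_lt_top
  obtain ⟨B, hB⟩ := hg.exists_bound
  have hB0 : 0 ≤ B := (abs_nonneg _).trans (hB 0)
  refine ⟨B, hprob, hsq, rfl, ?_, ?_, ?_, withDensity_absolutelyContinuous _ _,
    tvConst_nonneg g, hB0⟩
  · intro F hF K hK s s' hs hs'
    rw [integral_noiseLaw hgm hg0 fun x => F (s * x), integral_noiseLaw hgm hg0 fun x => F (s' * x)]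
    exact integral_scale_sub_le hg hint hF hK hs hs'
  · intro u h hh
    refine ENNReal.toReal_le_of_le_ofReal (by positivity) ?_
    rw [noiseLaw, withDensity_apply _ measurableSet_Icc]
    calc ∫⁻ x in Set.Icc u (u + h), ENNReal.ofReal (g x)
        ≤ ∫⁻ x in Set.Icc u (u + h), ENNReal.ofReal B :=
          lintegral_mono fun x => ENNReal.ofReal_le_ofReal ((le_abs_self _).trans (hB x))
      _ = ENNReal.ofReal (B * h) := by
          rw [setLIntegral_const, Real.volume_Icc, ENNReal.ofReal_mul hB0]
          congr 2
          ring
  · intro u v huv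
    refine ENNReal.toReal_pos ?_ (measure_ne_top _ _)
    rw [noiseLaw, withDensity_apply _ measurableSet_Ioc]
    refine (setLIntegral_pos_iff (by fun_prop)).2 ?_ |>.ne'
    have : Function.support (fun x => ENNReal.ofReal (g x)) = Set.univ := by
      ext x
      simp [hg0 x]
    rw [this, Set.univ_inter, Real.volume_Ioc]
    simpa using huv

variable {q : ℕ}

/-- One step of the Markov chain `Y_t = (y_t, …, y_{t-q})` driven by the innovation `e`. -/
def step (a U : Fin (q + 1) → ℝ) (e : ℝ) : Fin (q + 1) → ℝ :=
  Fin.cons (√(vol a U) * e) fun i : Fin q => U i.castSucc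

/-- The transition operator of the chain. -/
def transOp (ν : Measure ℝ) (a : Fin (q + 1) → ℝ) (F : (Fin (q + 1) → ℝ) → ℝ)
    (U : Fin (q + 1) → ℝ) : ℝ :=
  ∫ e, F (step a U e) ∂ν

/-- The sum of squares of the coordinates. -/
def ssq (U : Fin (q + 1) → ℝ) : ℝ := ∑ i, U i ^ 2

theorem ssq_nonneg (U : Fin (q + 1) → ℝ) : 0 ≤ ssq U :=
  Finset.sum_nonneg fun _ _ => sq_nonneg _

@[simp] theorem step_zero (a U : Fin (q + 1) → ℝ) (e : ℝ) : step a U e 0 = √(vol a U) * e := rfl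

@[simp] theorem step_succ (a U : Fin (q + 1) → ℝ) (e : ℝ) (i : Fin q) :
    step a U e i.succ = U i.castSucc := rfl

@[fun_prop]
theorem measurable_vol {p : ℕ} (a : Fin p → ℝ) : Measurable (vol a) := by
  unfold vol
  fun_prop

@[fun_prop]
theorem measurable_ssq : Measurable (ssq : (Fin (q + 1) → ℝ) → ℝ) := by
  unfold ssq
  fun_prop

theorem measurable_step (a : Fin (q + 1) → ℝ) :
    Measurable fun z : (Fin (q + 1) → ℝ) × ℝ => step a z.1 z.2 := by
  refine measurable_pi_iff.2 fun i => ?_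
  refine Fin.cases ?_ (fun j => ?_) i
  · simp only [step_zero]
    have := measurable_vol a
    fun_prop
  · simp only [step_succ]
    fun_prop

theorem measurable_transOp (ν : Measure ℝ) [SFinite ν] (a : Fin (q + 1) → ℝ)
    {F : (Fin (q + 1) → ℝ) → ℝ} (hF : Measurable F) : Measurable (transOp ν a F) := by
  have h : StronglyMeasurable (Function.uncurry fun U e => F (step a U e)) :=
    (hF.comp (measurable_step a)).stronglyMeasurable
  exact (h.integral_prod_right (ν := ν)).measurable

theorem abs_transOp_le (ν : Measure ℝ) [IsProbabilityMeasure ν] (a : Fin (q + 1) → ℝ)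
    {F : (Fin (q + 1) → ℝ) → ℝ} {K : ℝ} (hK : ∀ U, |F U| ≤ K) (U : Fin (q + 1) → ℝ) :
    |transOp ν a F U| ≤ K := by
  have h := norm_integral_le_of_norm_le_const (μ := ν) (f := fun e => F (step a U e))
    (Eventually.of_forall fun e => hK (step a U e))
  simpa [transOp] using h

theorem measurable_transOp_iterate (ν : Measure ℝ) [SFinite ν] (a : Fin (q + 1) → ℝ)
    {F : (Fin (q + 1) → ℝ) → ℝ} (hF : Measurable F) (m : ℕ) :
    Measurable ((transOp ν a)^[m] F) := by
  induction m with
  | zero => exact hF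
  | succ m ih =>
    rw [Function.iterate_succ_apply']
    exact measurable_transOp ν a ih

theorem abs_transOp_iterate_le (ν : Measure ℝ) [IsProbabilityMeasure ν] (a : Fin (q + 1) → ℝ)
    {F : (Fin (q + 1) → ℝ) → ℝ} {K : ℝ} (hK : ∀ U, |F U| ≤ K) (m : ℕ) (U : Fin (q + 1) → ℝ) :
    |(transOp ν a)^[m] F U| ≤ K := by
  induction m generalizing U with
  | zero => exact hK U
  | succ m ih =>
    rw [Function.iterate_succ_apply']
    exact abs_transOp_le ν a ih U

theorem one_le_vol {p : ℕ} {a : Fin p → ℝ} (ha : ∀ i, 0 ≤ a i) (U : Fin p → ℝ) : 1 ≤ vol a U := by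
  unfold vol
  have : 0 ≤ ∑ i, a i * U i ^ 2 := Finset.sum_nonneg fun i _ => mul_nonneg (ha i) (sq_nonneg _)
  linarith

theorem one_le_sqrt_vol {p : ℕ} {a : Fin p → ℝ} (ha : ∀ i, 0 ≤ a i) (U : Fin p → ℝ) :
    1 ≤ √(vol a U) := by
  rw [Real.one_le_sqrt]
  exact one_le_vol ha U

theorem sq_sqrt_vol {p : ℕ} {a : Fin p → ℝ} (ha : ∀ i, 0 ≤ a i) (U : Fin p → ℝ) :
    √(vol a U) ^ 2 = vol a U :=
  Real.sq_sqrt (by linarith [one_le_vol ha U])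

theorem abs_vol_sub_le {p : ℕ} {a : Fin p → ℝ} (ha : ∀ i, 0 ≤ a i) (U U' : Fin p → ℝ) :
    |vol a U - vol a U'| ≤ ∑ i, a i * |U i ^ 2 - U' i ^ 2| := by
  have : vol a U - vol a U' = ∑ i, a i * (U i ^ 2 - U' i ^ 2) := by
    unfold vol
    rw [add_sub_add_left_eq_sub, ← Finset.sum_sub_distrib]
    simp [mul_sub]
  rw [this]
  refine (Finset.abs_sum_le_sum_abs _ _).trans (le_of_eq ?_)
  simp [abs_mul, abs_of_nonneg (ha _)]

theorem abs_step_zero_sq_sub_le {a : Fin (q + 1) → ℝ} (ha : ∀ i, 0 ≤ a i)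
    (U U' : Fin (q + 1) → ℝ) (e : ℝ) :
    |step a U e 0 ^ 2 - step a U' e 0 ^ 2| ≤ e ^ 2 * ∑ i, a i * |U i ^ 2 - U' i ^ 2| := by
  rw [step_zero, step_zero, mul_pow, mul_pow, sq_sqrt_vol ha, sq_sqrt_vol ha, ← sub_mul, abs_mul,
    abs_of_nonneg (sq_nonneg e), mul_comm]
  exact mul_le_mul_of_nonneg_left (abs_vol_sub_le ha U U') (sq_nonneg e)

/-- The coefficients of the squared increments after one application of the transition
operator. -/
def lipNext (m₂ : ℝ) (a c : Fin (q + 1) → ℝ) : Fin (q + 1) → ℝ :=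
  fun i => m₂ * a i * c 0 + (Fin.snoc (fun j : Fin q => c j.succ) (0 : ℝ) : Fin (q + 1) → ℝ) i

theorem lipNext_nonneg {m₂ : ℝ} (hm : 0 ≤ m₂) {a c : Fin (q + 1) → ℝ} (ha : ∀ i, 0 ≤ a i)
    (hc : ∀ i, 0 ≤ c i) (i : Fin (q + 1)) : 0 ≤ lipNext m₂ a c i := by
  unfold lipNext
  have h1 : 0 ≤ m₂ * a i * c 0 := mul_nonneg (mul_nonneg hm (ha i)) (hc 0)
  refine add_nonneg h1 ?_
  refine Fin.lastCases ?_ (fun j => ?_) i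
  · simp
  · simpa using hc j.succ

theorem sum_lipNext_mul (m₂ : ℝ) (a c D : Fin (q + 1) → ℝ) :
    ∑ i, lipNext m₂ a c i * D i =
      c 0 * (m₂ * ∑ i, a i * D i) + ∑ j : Fin q, c j.succ * D j.castSucc := by
  simp only [lipNext, add_mul, Finset.sum_add_distrib]
  congr 1
  · rw [Finset.mul_sum, Finset.mul_sum]
    exact Finset.sum_congr rfl fun i _ => by ring
  · rw [Fin.sum_univ_castSucc]
    simp

theorem sum_lipNext_weight_le {m₂ A γ : ℝ} (hm : 0 ≤ m₂) (hγ : 0 < γ) (hγ1 : γ ≤ 1)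
    (hA : m₂ * A ≤ γ ^ (q + 1)) {a c : Fin (q + 1) → ℝ} (ha : ∀ i, 0 ≤ a i) (haA : ∑ i, a i ≤ A)
    (hc : ∀ i, 0 ≤ c i) :
    ∑ i, lipNext m₂ a c i * (γ ^ (i : ℕ))⁻¹ ≤ γ * ∑ i, c i * (γ ^ (i : ℕ))⁻¹ := by
  rw [sum_lipNext_mul m₂ a c fun i => (γ ^ (i : ℕ))⁻¹,
    Fin.sum_univ_succ fun i : Fin (q + 1) => c i * (γ ^ (i : ℕ))⁻¹, mul_add]
  refine add_le_add ?_ (le_of_eq ?_)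
  · simp only [Fin.val_zero, pow_zero, inv_one, mul_one]
    rw [mul_comm γ]
    refine mul_le_mul_of_nonneg_left ?_ (hc 0)
    calc m₂ * ∑ i, a i * (γ ^ (i : ℕ))⁻¹ ≤ m₂ * ∑ i, a i * (γ ^ q)⁻¹ := by
          refine mul_le_mul_of_nonneg_left (Finset.sum_le_sum fun i _ => ?_) hm
          refine mul_le_mul_of_nonneg_left ?_ (ha i)
          exact inv_anti₀ (by positivity) (pow_le_pow_of_le_one hγ.le hγ1 (by omega))
      _ = (m₂ * ∑ i, a i) * (γ ^ q)⁻¹ := by rw [← Finset.sum_mul]; ring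
      _ ≤ γ ^ (q + 1) * (γ ^ q)⁻¹ := by
          refine mul_le_mul_of_nonneg_right ?_ (by positivity)
          exact (mul_le_mul_of_nonneg_left haA hm).trans hA
      _ = γ := by rw [pow_succ]; field_simp
  · rw [Finset.mul_sum]
    refine Finset.sum_congr rfl fun j _ => ?_
    simp only [Fin.val_castSucc, Fin.val_succ, pow_succ]
    field_simp

/-- `F` is Lipschitz in the squared coordinates with coefficients `c`. -/
def LipSq (c : Fin (q + 1) → ℝ) (F : (Fin (q + 1) → ℝ) → ℝ) : Prop :=
  ∀ U U', |F U - F U'| ≤ ∑ i, c i * |U i ^ 2 - U' i ^ 2|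

theorem LipSq.transOp {ν : Measure ℝ} {m₂ C B : ℝ} (hν : RegularNoise ν m₂ C B)
    {a c : Fin (q + 1) → ℝ} (ha : ∀ i, 0 ≤ a i) (hc : ∀ i, 0 ≤ c i)
    {F : (Fin (q + 1) → ℝ) → ℝ} (hF : Measurable F) {K : ℝ} (hK : ∀ U, |F U| ≤ K)
    (h : LipSq c F) : LipSq (lipNext m₂ a c) (transOp ν a F) := by
  have := hν.prob
  intro U U'
  have hi : ∀ U, Integrable (fun e => F (step a U e)) ν := fun U =>
    Integrable.of_bound ((hF.comp ((measurable_step a).comp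
      measurable_prodMk_left)).aestronglyMeasurable) K (Eventually.of_forall fun e => hK _)
  unfold ArchResidual.transOp
  rw [← integral_sub (hi U) (hi U'), ← Real.norm_eq_abs]
  set S := ∑ i, a i * |U i ^ 2 - U' i ^ 2|
  set R := ∑ j : Fin q, c j.succ * |U j.castSucc ^ 2 - U' j.castSucc ^ 2|
  have hint : Integrable (fun e : ℝ => c 0 * (e ^ 2 * S) + R) ν :=
    ((hν.sq_integrable.mul_const S).const_mul _).add (integrable_const _)
  refine (norm_integral_le_of_norm_le hint (Eventually.of_forall fun e => ?_)).trans (le_of_eq ?_)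
  · refine (h _ _).trans ?_
    rw [Fin.sum_univ_succ]
    refine add_le_add ?_ le_rfl
    exact mul_le_mul_of_nonneg_left (abs_step_zero_sq_sub_le ha U U' e) (hc 0)
  · rw [integral_add ((hν.sq_integrable.mul_const S).const_mul _) (integrable_const _),
      integral_const_mul, integral_mul_const, hν.sq_eq, sum_lipNext_mul]
    simp [S, R]

theorem LipSq.transOp_iterate {ν : Measure ℝ} {m₂ C B A γ : ℝ} (hν : RegularNoise ν m₂ C B)
    (hm : 0 ≤ m₂) (hγ : 0 < γ) (hγ1 : γ ≤ 1) (hA : m₂ * A ≤ γ ^ (q + 1))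
    {a : Fin (q + 1) → ℝ} (ha : ∀ i, 0 ≤ a i) (haA : ∑ i, a i ≤ A)
    {F : (Fin (q + 1) → ℝ) → ℝ} (hF : Measurable F) {K : ℝ} (hK : ∀ U, |F U| ≤ K)
    {c : Fin (q + 1) → ℝ} (hc : ∀ i, 0 ≤ c i) (h : LipSq c F) (m : ℕ) :
    ∃ c' : Fin (q + 1) → ℝ, (∀ i, 0 ≤ c' i) ∧ LipSq c' ((ArchResidual.transOp ν a)^[m] F) ∧
      ∑ i, c' i * (γ ^ (i : ℕ))⁻¹ ≤ γ ^ m * ∑ i, c i * (γ ^ (i : ℕ))⁻¹ := by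
  have := hν.prob
  induction m with
  | zero => exact ⟨c, hc, h, by simp⟩
  | succ m ih =>
    obtain ⟨c', hc', hl, hle⟩ := ih
    refine ⟨lipNext m₂ a c', lipNext_nonneg hm ha hc', ?_, ?_⟩
    · rw [Function.iterate_succ_apply']
      exact hl.transOp hν ha hc' (measurable_transOp_iterate ν a hF m)
        (abs_transOp_iterate_le ν a hK m)
    · refine (sum_lipNext_weight_le hm hγ hγ1 hA ha haA hc').trans ?_
      rw [pow_succ', mul_assoc]
      exact mul_le_mul_of_nonneg_left hle hγ.le

theorem measurable_cons_tail (U : Fin (q + 1) → ℝ) :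
    Measurable fun y : ℝ => (Fin.cons y fun i : Fin q => U i.castSucc : Fin (q + 1) → ℝ) := by
  refine measurable_pi_iff.2 fun i => ?_
  refine Fin.cases ?_ (fun j => ?_) i
  · simpa using measurable_id'
  · simp

/-- After `j` steps the dependence on the last `j` coordinates has become Lipschitz in their
squares. -/
theorem abs_transOp_iterate_sub_le_of_agree {ν : Measure ℝ} {m₂ C B A : ℝ}
    (hν : RegularNoise ν m₂ C B) {a : Fin (q + 1) → ℝ} (ha : ∀ i, 0 ≤ a i) (haA : ∑ i, a i ≤ A)
    {F : (Fin (q + 1) → ℝ) → ℝ} (hF : Measurable F) {K : ℝ} (hK : ∀ U, |F U| ≤ K) (j : ℕ)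
    (U U' : Fin (q + 1) → ℝ) (hU : ∀ i : Fin (q + 1), (i : ℕ) + j < q + 1 → U i = U' i) :
    |(transOp ν a)^[j] F U - (transOp ν a)^[j] F U'| ≤
      K * (j * (C * A)) * ∑ i, |U i ^ 2 - U' i ^ 2| := by
  have := hν.prob
  have hK0 : 0 ≤ K := (abs_nonneg _).trans (hK 0)
  have hA0 : 0 ≤ A := (Finset.sum_nonneg fun i _ => ha i).trans haA
  induction j generalizing U U' with
  | zero =>
    have : U = U' := funext fun i => hU i (by omega)
    simp [this]
  | succ j ih =>
    rw [Function.iterate_succ_apply']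
    set H := (transOp ν a)^[j] F with hH
    have hHm : Measurable H := measurable_transOp_iterate ν a hF j
    have hHK : ∀ U, |H U| ≤ K := abs_transOp_iterate_le ν a hK j
    set D := ∑ i, |U i ^ 2 - U' i ^ 2| with hD
    have hD0 : 0 ≤ D := Finset.sum_nonneg fun _ _ => abs_nonneg _
    let T : (Fin (q + 1) → ℝ) → ℝ → ℝ := fun V y => H (Fin.cons y fun i : Fin q => V i.castSucc)
    have hTm : ∀ V, Measurable (T V) := fun V => hHm.comp (measurable_cons_tail V)
    have h1 : |(∫ e, T U (√(vol a U) * e) ∂ν) - ∫ e, T U (√(vol a U') * e) ∂ν| ≤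
        K * (C * (A * D)) := by
      refine (hν.scale_le (hTm U) (fun x => hHK _) (one_le_sqrt_vol ha U)
        (one_le_sqrt_vol ha U')).trans ?_
      refine mul_le_mul_of_nonneg_left (mul_le_mul_of_nonneg_left ?_ hν.C_nonneg) hK0
      rw [sq_sqrt_vol ha, sq_sqrt_vol ha]
      refine (abs_vol_sub_le ha U U').trans ?_
      rw [hD, Finset.mul_sum]
      refine Finset.sum_le_sum fun i _ => mul_le_mul_of_nonneg_right ?_ (abs_nonneg _)
      exact (Finset.single_le_sum (fun i _ => ha i) (Finset.mem_univ i)).trans haA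
    have h2 : |(∫ e, T U (√(vol a U') * e) ∂ν) - ∫ e, T U' (√(vol a U') * e) ∂ν| ≤
        K * (j * (C * A)) * D := by
      have hi : ∀ V, Integrable (fun e => T V (√(vol a U') * e)) ν := fun V =>
        Integrable.of_bound ((hTm V).comp (by fun_prop)).aestronglyMeasurable K
          (Eventually.of_forall fun e => hHK _)
      rw [← integral_sub (hi U) (hi U'), ← Real.norm_eq_abs]
      have h3 := norm_integral_le_of_norm_le_const (μ := ν) (C := K * (j * (C * A)) * D)
        (f := fun e => T U (√(vol a U') * e) - T U' (√(vol a U') * e))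
        (Eventually.of_forall fun e => ?_)
      · simpa using h3
      · refine (ih _ _ fun i hi => ?_).trans ?_
        · revert hi
          refine Fin.cases ?_ (fun l => ?_) i
          · intro _; simp
          · intro hl
            simp only [Fin.cons_succ]
            apply hU
            simp only [Fin.val_succ] at hl
            simp only [Fin.val_castSucc]
            omega
        · have : 0 ≤ K * (j * (C * A)) := by
            have := hν.C_nonneg
            positivity
          refine mul_le_mul_of_nonneg_left ?_ this
          rw [Fin.sum_univ_succ, hD, Fin.sum_univ_castSucc]
          simp only [Fin.cons_zero, sub_self, abs_zero, zero_add, Fin.cons_succ]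
          linarith [abs_nonneg (U (Fin.last q) ^ 2 - U' (Fin.last q) ^ 2)]
    have h4 : |transOp ν a H U - transOp ν a H U'| ≤ K * (C * (A * D)) + K * (j * (C * A)) * D :=
      (abs_sub_le _ (∫ e, T U (√(vol a U') * e) ∂ν) _).trans (add_le_add h1 h2)
    refine h4.trans (le_of_eq ?_)
    push_cast
    ring

/-- Geometric ergodicity of the chain, with constants depending on the parameter only through
the bound `A` for its `L₁` norm. -/
theorem abs_transOp_iterate_sub_le {ν : Measure ℝ} {m₂ C B A γ : ℝ} (hν : RegularNoise ν m₂ C B)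
    (hm : 0 ≤ m₂) (hγ : 0 < γ) (hγ1 : γ ≤ 1) (hA : m₂ * A ≤ γ ^ (q + 1))
    {a : Fin (q + 1) → ℝ} (ha : ∀ i, 0 ≤ a i) (haA : ∑ i, a i ≤ A)
    {F : (Fin (q + 1) → ℝ) → ℝ} (hF : Measurable F) {K : ℝ} (hK : ∀ U, |F U| ≤ K)
    (m : ℕ) (U U' : Fin (q + 1) → ℝ) :
    |(transOp ν a)^[m] F U - (transOp ν a)^[m] F U'| ≤
      K * ((2 + (q + 1 : ℕ) * (C * A) * ∑ i : Fin (q + 1), (γ ^ (i : ℕ))⁻¹) * (γ ^ (q + 1))⁻¹) *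
        γ ^ m * (1 + ssq U + ssq U') := by
  have := hν.prob
  have hK0 : 0 ≤ K := (abs_nonneg _).trans (hK 0)
  have hA0 : 0 ≤ A := (Finset.sum_nonneg fun i _ => ha i).trans haA
  have hC := hν.C_nonneg
  have hs := ssq_nonneg U
  have hs' := ssq_nonneg U'
  set Γ := ∑ i : Fin (q + 1), (γ ^ (i : ℕ))⁻¹ with hΓ
  have hΓ0 : 0 ≤ Γ := Finset.sum_nonneg fun i _ => by positivity
  rcases lt_or_ge m (q + 1) with hlt | hge
  · have h1 : |(transOp ν a)^[m] F U - (transOp ν a)^[m] F U'| ≤ K * 2 := by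
      have := abs_transOp_iterate_le ν a hK m U
      have := abs_transOp_iterate_le ν a hK m U'
      exact (abs_sub _ _).trans (by linarith)
    refine h1.trans ?_
    have h2 : γ ^ (q + 1) ≤ γ ^ m := pow_le_pow_of_le_one hγ.le hγ1 hlt.le
    have h3 : 1 ≤ (γ ^ (q + 1))⁻¹ * γ ^ m := by
      rw [inv_mul_eq_div, one_le_div (by positivity)]
      exact h2
    rw [mul_assoc, mul_assoc]
    refine mul_le_mul_of_nonneg_left ?_ hK0
    calc (2 : ℝ) = 2 * 1 * 1 := by norm_num
      _ ≤ (2 + (q + 1 : ℕ) * (C * A) * Γ) * ((γ ^ (q + 1))⁻¹ * γ ^ m) * (1 + ssq U + ssq U') := by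
        gcongr
        · have : 0 ≤ (q + 1 : ℕ) * (C * A) * Γ := by positivity
          linarith
        · linarith
      _ = _ := by ring
  · obtain ⟨l, rfl⟩ := Nat.exists_eq_add_of_le' hge
    rw [Function.iterate_add_apply]
    set c : Fin (q + 1) → ℝ := fun _ => K * ((q + 1 : ℕ) * (C * A)) with hc
    have hc0 : ∀ i, 0 ≤ c i := fun i => by simp only [hc]; positivity
    have hl : LipSq c ((transOp ν a)^[q + 1] F) := fun V V' => by
      refine (abs_transOp_iterate_sub_le_of_agree hν ha haA hF hK (q + 1) V V' fun i hi => ?_).trans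
        (le_of_eq ?_)
      · omega
      · simp only [hc, Finset.mul_sum]
    obtain ⟨c', hc'0, hl', hle⟩ := hl.transOp_iterate hν hm hγ hγ1 hA ha haA
      (measurable_transOp_iterate ν a hF _) (abs_transOp_iterate_le ν a hK _) hc0 l
    have hle' : ∑ i, c i * (γ ^ (i : ℕ))⁻¹ = K * ((q + 1 : ℕ) * (C * A)) * Γ := by
      rw [hΓ, Finset.mul_sum]
    rw [hle'] at hle
    have hci : ∀ i, c' i ≤ γ ^ l * (K * ((q + 1 : ℕ) * (C * A)) * Γ) := fun i => by
      refine le_trans ?_ hle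
      refine le_trans ?_ (Finset.single_le_sum (f := fun i => c' i * (γ ^ (i : ℕ))⁻¹)
        (fun i _ => mul_nonneg (hc'0 i) (by positivity)) (Finset.mem_univ i))
      refine le_mul_of_one_le_right (hc'0 i) ?_
      exact (one_le_inv₀ (by positivity)).2 (pow_le_one₀ hγ.le hγ1)
    refine (hl' U U').trans ?_
    calc ∑ i, c' i * |U i ^ 2 - U' i ^ 2|
        ≤ ∑ i, γ ^ l * (K * ((q + 1 : ℕ) * (C * A)) * Γ) * (U i ^ 2 + U' i ^ 2) := by
          refine Finset.sum_le_sum fun i _ => mul_le_mul (hci i) ?_ (abs_nonneg _) (by positivity)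
          exact (abs_sub _ _).trans (le_of_eq (by simp))
      _ = γ ^ l * (K * ((q + 1 : ℕ) * (C * A)) * Γ) * (ssq U + ssq U') := by
          rw [← Finset.mul_sum, Finset.sum_add_distrib]; rfl
      _ ≤ γ ^ l * (K * (2 + (q + 1 : ℕ) * (C * A) * Γ)) * (1 + ssq U + ssq U') := by
          gcongr ?_ * ?_
          · rw [mul_assoc K]
            gcongr
            linarith
          · linarith
      _ = _ := by
          rw [pow_add γ l]
          have hne : γ ^ (q + 1) ≠ 0 := by positivity
          generalize γ ^ (q + 1) = x at *
          field_simp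

section

variable {q : ℕ} {Ω : Type*} [mΩ : MeasurableSpace Ω]

/-- A stationary Markov chain `X` with transitions `step a` driven by innovations `e` with law `ν`
that are independent of the past, geometrically ergodic with constants `C`, `γ`. -/
structure ErgodicChain (P : Measure Ω) (ν : Measure ℝ) (a : Fin (q + 1) → ℝ)
    (X : ℕ → Ω → Fin (q + 1) → ℝ) (e : ℕ → Ω → ℝ) (ℱ : Filtration ℕ mΩ) (C γ : ℝ) : Prop where
  prob : IsProbabilityMeasure ν
  adapted : ∀ t, Measurable[ℱ t] (X t)
  noise_adapted : ∀ t, Measurable[ℱ (t + 1)] (e t)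
  indep : ∀ t, Indep (ℱ t) (MeasurableSpace.comap (e t) inferInstance) P
  noise_law : ∀ t, P.map (e t) = ν
  recursion : ∀ t ω, X (t + 1) ω = step a (X t ω) (e t ω)
  stationary : ∀ t, P.map (X t) = P.map (X 0)
  ssq_integrable : Integrable (fun ω => ssq (X 0 ω)) P
  ssq_le : ∫ ω, ssq (X 0 ω) ∂P ≤ C
  C_nonneg : 0 ≤ C
  γ_pos : 0 < γ
  γ_lt_one : γ < 1
  mixing : ∀ {F : (Fin (q + 1) → ℝ) → ℝ}, Measurable F → ∀ {K : ℝ}, (∀ U, |F U| ≤ K) →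
    ∀ m U, |(transOp ν a)^[m] F U - ∫ ω, F (X 0 ω) ∂P| ≤ K * C * γ ^ m * (1 + ssq U)

namespace ErgodicChain

variable {P : Measure Ω} [IsProbabilityMeasure P] {ν : Measure ℝ} {a : Fin (q + 1) → ℝ}
  {X : ℕ → Ω → Fin (q + 1) → ℝ} {e : ℕ → Ω → ℝ} {ℱ : Filtration ℕ mΩ} {C γ : ℝ}

theorem measurable_X (h : ErgodicChain P ν a X e ℱ C γ) (t : ℕ) : Measurable (X t) :=
  (h.adapted t).mono (ℱ.le t) le_rfl

theorem measurable_e (h : ErgodicChain P ν a X e ℱ C γ) (t : ℕ) : Measurable (e t) :=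
  (h.noise_adapted t).mono (ℱ.le _) le_rfl

theorem indepFun (h : ErgodicChain P ν a X e ℱ C γ) {β : Type*} [MeasurableSpace β] {t : ℕ}
    {Z : Ω → β} (hZ : Measurable[ℱ t] Z) : IndepFun Z (e t) P := by
  rw [IndepFun_iff_Indep]
  exact indep_of_indep_of_le_left (h.indep t) hZ.comap_le

theorem integral_comp_X (h : ErgodicChain P ν a X e ℱ C γ) {F : (Fin (q + 1) → ℝ) → ℝ}
    (hF : Measurable F) (t : ℕ) : ∫ ω, F (X t ω) ∂P = ∫ ω, F (X 0 ω) ∂P := by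
  rw [← integral_map (h.measurable_X t).aemeasurable hF.aestronglyMeasurable, h.stationary t,
    integral_map (h.measurable_X 0).aemeasurable hF.aestronglyMeasurable]

theorem integrable_comp_X (h : ErgodicChain P ν a X e ℱ C γ) {F : (Fin (q + 1) → ℝ) → ℝ}
    (hF : Measurable F) (hi : Integrable (fun ω => F (X 0 ω)) P) (t : ℕ) :
    Integrable (fun ω => F (X t ω)) P := by
  have h1 := (integrable_map_measure (μ := P) hF.aestronglyMeasurable
    (h.measurable_X 0).aemeasurable).2 hi
  rw [← h.stationary t] at h1
  exact (integrable_map_measure hF.aestronglyMeasurable (h.measurable_X t).aemeasurable).1 h1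

theorem map_X_e (h : ErgodicChain P ν a X e ℱ C γ) (t : ℕ) :
    P.map (fun ω => (X t ω, e t ω)) = (P.map (X 0)).prod ν := by
  rw [(indepFun_iff_map_prod_eq_prod_map_map (h.measurable_X t).aemeasurable
    (h.measurable_e t).aemeasurable).1 (h.indepFun (h.adapted t)), h.stationary t, h.noise_law t]

/-- Integrating out the innovation of time `t`. -/
theorem integral_mul_noise (h : ErgodicChain P ν a X e ℱ C γ) {t : ℕ} {A : Ω → ℝ}
    (hA : Measurable[ℱ t] A) (hAi : Integrable A P) {f : (Fin (q + 1) → ℝ) → ℝ → ℝ}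
    (hf : Measurable (Function.uncurry f)) {K : ℝ} (hK : ∀ U u, |f U u| ≤ K) :
    ∫ ω, A ω * f (X t ω) (e t ω) ∂P = ∫ ω, A ω * ∫ u, f (X t ω) u ∂ν ∂P := by
  have := h.prob
  have hAm : Measurable A := hA.mono (ℱ.le t) le_rfl
  have hZ : Measurable[ℱ t] fun ω => (A ω, X t ω) := hA.prodMk (h.adapted t)
  have hZm : Measurable fun ω => (A ω, X t ω) := hAm.prodMk (h.measurable_X t)
  have hmap := (indepFun_iff_map_prod_eq_prod_map_map hZm.aemeasurable
    (h.measurable_e t).aemeasurable).1 (h.indepFun hZ)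
  rw [h.noise_law t] at hmap
  set H : (ℝ × (Fin (q + 1) → ℝ)) × ℝ → ℝ := fun z => z.1.1 * f z.1.2 z.2 with hH
  have hHm : Measurable H := by
    have : Measurable fun z : (ℝ × (Fin (q + 1) → ℝ)) × ℝ => f z.1.2 z.2 :=
      hf.comp (by fun_prop : Measurable fun z : (ℝ × (Fin (q + 1) → ℝ)) × ℝ => (z.1.2, z.2))
    fun_prop
  have hZe : Measurable fun ω => ((A ω, X t ω), e t ω) := hZm.prodMk (h.measurable_e t)
  have hi : Integrable H (P.map fun ω => ((A ω, X t ω), e t ω)) := by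
    rw [integrable_map_measure hHm.aestronglyMeasurable hZe.aemeasurable]
    refine Integrable.mono' (hAi.norm.mul_const K) (hHm.comp hZe).aestronglyMeasurable
      (Eventually.of_forall fun ω => ?_)
    simp only [hH, Function.comp, norm_mul]
    exact mul_le_mul_of_nonneg_left (hK _ _) (norm_nonneg _)
  have h1 : ∫ ω, A ω * f (X t ω) (e t ω) ∂P = ∫ z, H z ∂(P.map fun ω => ((A ω, X t ω), e t ω)) :=
    (integral_map hZe.aemeasurable hHm.aestronglyMeasurable).symm
  rw [hmap] at hi h1
  rw [h1, integral_prod _ hi, integral_map hZm.aemeasurable hi.aestronglyMeasurable.integral_prod_right']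
  simp only [hH, integral_const_mul]

theorem integral_mul_iterate (h : ErgodicChain P ν a X e ℱ C γ) {s : ℕ} {A : Ω → ℝ}
    (hA : Measurable[ℱ s] A) (hAi : Integrable A P) (m : ℕ) {F : (Fin (q + 1) → ℝ) → ℝ}
    (hF : Measurable F) {K : ℝ} (hK : ∀ U, |F U| ≤ K) :
    ∫ ω, A ω * F (X (s + m) ω) ∂P = ∫ ω, A ω * (transOp ν a)^[m] F (X s ω) ∂P := by
  have := h.prob
  induction m generalizing F with
  | zero => rfl
  | succ m ih =>
    have h1 := h.integral_mul_noise (t := s + m) (hA.mono (ℱ.mono (Nat.le_add_right s m)) le_rfl) hAi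
      (f := fun U u => F (step a U u)) (hF.comp (measurable_step a)) (fun U u => hK _)
    rw [Function.iterate_succ_apply, ← ih (measurable_transOp ν a hF) (abs_transOp_le ν a hK)]
    refine Eq.trans ?_ h1
    simp_rw [← add_assoc, h.recursion]

theorem integral_mul_noise_iterate (h : ErgodicChain P ν a X e ℱ C γ) {s : ℕ} {A : Ω → ℝ}
    (hA : Measurable[ℱ s] A) (hAi : Integrable A P) (m : ℕ) {f : (Fin (q + 1) → ℝ) → ℝ → ℝ}
    (hf : Measurable (Function.uncurry f)) {K : ℝ} (hK : ∀ U u, |f U u| ≤ K) :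
    ∫ ω, A ω * f (X (s + m) ω) (e (s + m) ω) ∂P =
      ∫ ω, A ω * (transOp ν a)^[m] (fun U => ∫ u, f U u ∂ν) (X s ω) ∂P := by
  have := h.prob
  rw [h.integral_mul_noise (hA.mono (ℱ.mono (Nat.le_add_right s m)) le_rfl) hAi hf hK]
  refine h.integral_mul_iterate hA hAi m (F := fun U => ∫ u, f U u ∂ν) ?_ (K := K) fun U => ?_
  · exact (hf.stronglyMeasurable.integral_prod_right (ν := ν)).measurable
  · simpa using norm_integral_le_of_norm_le_const (μ := ν) (f := f U)
      (Eventually.of_forall fun u => hK U u)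

end ErgodicChain

/-- The exponential supermartingale bound behind Freedman's inequality. -/
theorem integral_exp_le_one {P : Measure Ω} [IsProbabilityMeasure P] {𝒢 : ℕ → MeasurableSpace Ω}
    (hmono : Monotone 𝒢) (hle : ∀ k, 𝒢 k ≤ mΩ) {D w : ℕ → Ω → ℝ}
    (hD : ∀ k, Measurable[𝒢 (k + 1)] (D k)) (hw : ∀ k, Measurable[𝒢 k] (w k))
    {c W : ℝ} (hDc : ∀ k ω, |D k ω| ≤ c) (hw0 : ∀ k ω, 0 ≤ w k ω) (hwW : ∀ k ω, w k ω ≤ W)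
    (hmean : ∀ k (A : Ω → ℝ), Measurable[𝒢 k] A → (∀ ω, 0 ≤ A ω) → (∃ B, ∀ ω, A ω ≤ B) →
      ∫ ω, A ω * D k ω ∂P = 0)
    (hvar : ∀ k (A : Ω → ℝ), Measurable[𝒢 k] A → (∀ ω, 0 ≤ A ω) → (∃ B, ∀ ω, A ω ≤ B) →
      ∫ ω, A ω * D k ω ^ 2 ∂P ≤ ∫ ω, A ω * w k ω ∂P)
    {l : ℝ} (hl : 0 ≤ l) (hlc : l * c ≤ 1) (N : ℕ) :
    ∫ ω, Real.exp (∑ k ∈ Finset.range N, (l * D k ω - l ^ 2 * w k ω)) ∂P ≤ 1 := by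
  have hSm : ∀ N, Measurable[𝒢 N] fun ω => ∑ k ∈ Finset.range N, (l * D k ω - l ^ 2 * w k ω) := by
    intro N
    refine Finset.measurable_fun_sum _ fun k hk => ?_
    have hkN : k + 1 ≤ N := Finset.mem_range.1 hk
    exact (((hD k).mono (hmono hkN) le_rfl).const_mul l).sub
      (((hw k).mono (hmono (by omega)) le_rfl).const_mul _)
  have hSb : ∀ N ω, ∑ k ∈ Finset.range N, (l * D k ω - l ^ 2 * w k ω) ≤ N := by
    intro N ω
    have : ∀ k ∈ Finset.range N, l * D k ω - l ^ 2 * w k ω ≤ 1 := fun k _ => by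
      have h1 := (abs_le.1 (hDc k ω)).2
      have h2 := mul_le_mul_of_nonneg_left h1 hl
      have h3 : 0 ≤ l ^ 2 * w k ω := mul_nonneg (sq_nonneg _) (hw0 k ω)
      linarith
    simpa using Finset.sum_le_sum this
  induction N with
  | zero => simp
  | succ N ih =>
    refine le_trans ?_ ih
    set S : Ω → ℝ := fun ω => ∑ k ∈ Finset.range N, (l * D k ω - l ^ 2 * w k ω) with hS
    set A : Ω → ℝ := fun ω => Real.exp (S ω) * Real.exp (-(l ^ 2 * w N ω)) with hA
    have hAm : Measurable[𝒢 N] A :=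
      (Real.measurable_exp.comp (hSm N)).mul
        (Real.measurable_exp.comp ((hw N).const_mul _).neg)
    have hA0 : ∀ ω, 0 ≤ A ω := fun ω => by positivity
    have hAb : ∀ ω, A ω ≤ Real.exp N := fun ω => by
      have h1 : Real.exp (-(l ^ 2 * w N ω)) ≤ 1 := by
        rw [Real.exp_le_one_iff, neg_nonpos]
        exact mul_nonneg (sq_nonneg _) (hw0 N ω)
      calc A ω ≤ Real.exp (S ω) * 1 := mul_le_mul_of_nonneg_left h1 (Real.exp_pos _).le
        _ ≤ Real.exp N := by rw [mul_one]; exact Real.exp_le_exp.2 (hSb N ω)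
    have hAm' : Measurable A := hAm.mono (hle N) le_rfl
    have hDm' : Measurable (D N) := (hD N).mono (hle _) le_rfl
    have hwm' : Measurable (w N) := (hw N).mono (hle _) le_rfl
    have hSm' : Measurable S := (hSm N).mono (hle _) le_rfl
    have hc0 : ∀ ω : Ω, 0 ≤ c := fun ω => (abs_nonneg _).trans (hDc N ω)
    have hAi : Integrable A P := Integrable.of_bound hAm'.aestronglyMeasurable (Real.exp N)
      (Eventually.of_forall fun ω => by rw [Real.norm_of_nonneg (hA0 ω)]; exact hAb ω)
    have hADi : Integrable (fun ω => A ω * D N ω) P :=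
      hAi.mul_bdd hDm'.aestronglyMeasurable (Eventually.of_forall fun ω => hDc N ω)
    have hADDi : Integrable (fun ω => A ω * D N ω ^ 2) P :=
      hAi.mul_bdd (c := c ^ 2) (hDm'.pow_const 2).aestronglyMeasurable
        (Eventually.of_forall fun ω => by
          rw [norm_pow, Real.norm_eq_abs]
          exact pow_le_pow_left₀ (abs_nonneg _) (hDc N ω) 2)
    have hAwi : Integrable (fun ω => A ω * w N ω) P :=
      hAi.mul_bdd (c := W) hwm'.aestronglyMeasurable (Eventually.of_forall fun ω => by
        rw [Real.norm_of_nonneg (hw0 N ω)]; exact hwW N ω)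
    have hSi : Integrable (fun ω => Real.exp (S ω)) P :=
      Integrable.of_bound (Real.measurable_exp.comp hSm').aestronglyMeasurable (Real.exp N)
        (Eventually.of_forall fun ω => by
          rw [Real.norm_of_nonneg (Real.exp_pos _).le]; exact Real.exp_le_exp.2 (hSb N ω))
    calc ∫ ω, Real.exp (∑ k ∈ Finset.range (N + 1), (l * D k ω - l ^ 2 * w k ω)) ∂P
        ≤ ∫ ω, (A ω + l * (A ω * D N ω) + l ^ 2 * (A ω * D N ω ^ 2)) ∂P := by
          refine integral_mono_of_nonneg (Eventually.of_forall fun ω => (Real.exp_pos _).le)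
            ((hAi.add (hADi.const_mul l)).add (hADDi.const_mul _)) (Eventually.of_forall fun ω => ?_)
          have hx : |l * D N ω| ≤ 1 := by
            rw [abs_mul, abs_of_nonneg hl]
            exact (mul_le_mul_of_nonneg_left (hDc N ω) hl).trans hlc
          have h1 := (abs_le.1 (Real.abs_exp_sub_one_sub_id_le hx)).2
          have h2 : Real.exp (l * D N ω) ≤ 1 + l * D N ω + (l * D N ω) ^ 2 := by linarith
          have h3 : Real.exp (∑ k ∈ Finset.range (N + 1), (l * D k ω - l ^ 2 * w k ω)) =
              A ω * Real.exp (l * D N ω) := by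
            rw [Finset.sum_range_succ, hA]
            simp only
            rw [← Real.exp_add, ← Real.exp_add]
            congr 1
            simp only [hS]
            ring
          simp only [h3]
          refine (mul_le_mul_of_nonneg_left h2 (hA0 ω)).trans (le_of_eq (by ring))
      _ = ∫ ω, A ω ∂P + l * ∫ ω, A ω * D N ω ∂P + l ^ 2 * ∫ ω, A ω * D N ω ^ 2 ∂P := by
          have hi : Integrable (fun ω => A ω + l * (A ω * D N ω)) P := hAi.add (hADi.const_mul l)
          rw [integral_add hi (hADDi.const_mul _),
            integral_add hAi (hADi.const_mul l), integral_const_mul, integral_const_mul]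
      _ ≤ ∫ ω, A ω ∂P + l ^ 2 * ∫ ω, A ω * w N ω ∂P := by
          rw [hmean N A hAm hA0 ⟨_, hAb⟩, mul_zero, add_zero]
          have := mul_le_mul_of_nonneg_left (hvar N A hAm hA0 ⟨_, hAb⟩) (sq_nonneg l)
          linarith
      _ = ∫ ω, (A ω + l ^ 2 * (A ω * w N ω)) ∂P := by
          rw [integral_add hAi (hAwi.const_mul _), integral_const_mul]
      _ ≤ ∫ ω, Real.exp (S ω) ∂P := by
          refine integral_mono (hAi.add (hAwi.const_mul _)) hSi fun ω => ?_
          have h1 := Real.add_one_le_exp (l ^ 2 * w N ω)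
          calc A ω + l ^ 2 * (A ω * w N ω) = A ω * (l ^ 2 * w N ω + 1) := by ring
            _ ≤ A ω * Real.exp (l ^ 2 * w N ω) := mul_le_mul_of_nonneg_left h1 (hA0 ω)
            _ = Real.exp (S ω) := by
              simp only [hA]
              rw [mul_assoc, ← Real.exp_add]
              simp

/-- Freedman's inequality. -/
theorem freedman {P : Measure Ω} [IsProbabilityMeasure P] {𝒢 : ℕ → MeasurableSpace Ω}
    (hmono : Monotone 𝒢) (hle : ∀ k, 𝒢 k ≤ mΩ) {D w : ℕ → Ω → ℝ}
    (hD : ∀ k, Measurable[𝒢 (k + 1)] (D k)) (hw : ∀ k, Measurable[𝒢 k] (w k))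
    {c W : ℝ} (hDc : ∀ k ω, |D k ω| ≤ c) (hw0 : ∀ k ω, 0 ≤ w k ω) (hwW : ∀ k ω, w k ω ≤ W)
    (hmean : ∀ k (A : Ω → ℝ), Measurable[𝒢 k] A → (∀ ω, 0 ≤ A ω) → (∃ B, ∀ ω, A ω ≤ B) →
      ∫ ω, A ω * D k ω ∂P = 0)
    (hvar : ∀ k (A : Ω → ℝ), Measurable[𝒢 k] A → (∀ ω, 0 ≤ A ω) → (∃ B, ∀ ω, A ω ≤ B) →
      ∫ ω, A ω * D k ω ^ 2 ∂P ≤ ∫ ω, A ω * w k ω ∂P)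
    {l : ℝ} (hl : 0 ≤ l) (hlc : l * c ≤ 1) (N : ℕ) (u v : ℝ) :
    P.real {ω | u ≤ ∑ k ∈ Finset.range N, D k ω ∧ ∑ k ∈ Finset.range N, w k ω ≤ v} ≤
      Real.exp (-(l * u) + l ^ 2 * v) := by
  have h1 := integral_exp_le_one hmono hle hD hw hDc hw0 hwW hmean hvar hl hlc N
  have hm : Measurable fun ω => ∑ k ∈ Finset.range N, (l * D k ω - l ^ 2 * w k ω) :=
    Finset.measurable_fun_sum _ fun k _ =>
      (((hD k).mono (hle _) le_rfl).const_mul l).sub (((hw k).mono (hle _) le_rfl).const_mul _)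
  have hb : ∀ ω, ∑ k ∈ Finset.range N, (l * D k ω - l ^ 2 * w k ω) ≤ N := fun ω => by
    have : ∀ k ∈ Finset.range N, l * D k ω - l ^ 2 * w k ω ≤ 1 := fun k _ => by
      have h2 := mul_le_mul_of_nonneg_left (abs_le.1 (hDc k ω)).2 hl
      have h3 : 0 ≤ l ^ 2 * w k ω := mul_nonneg (sq_nonneg _) (hw0 k ω)
      linarith
    simpa using Finset.sum_le_sum this
  have hi : Integrable (fun ω => Real.exp (∑ k ∈ Finset.range N, (l * D k ω - l ^ 2 * w k ω))) P :=
    Integrable.of_bound (Real.measurable_exp.comp hm).aestronglyMeasurable (Real.exp N)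
      (Eventually.of_forall fun ω => by
        rw [Real.norm_of_nonneg (Real.exp_pos _).le]; exact Real.exp_le_exp.2 (hb ω))
  have h2 := mul_meas_ge_le_integral_of_nonneg
    (Eventually.of_forall fun ω => (Real.exp_pos
      (∑ k ∈ Finset.range N, (l * D k ω - l ^ 2 * w k ω))).le) hi (Real.exp (l * u - l ^ 2 * v))
  have h3 : P.real {ω | u ≤ ∑ k ∈ Finset.range N, D k ω ∧ ∑ k ∈ Finset.range N, w k ω ≤ v} ≤
      P.real {ω | Real.exp (l * u - l ^ 2 * v) ≤
        Real.exp (∑ k ∈ Finset.range N, (l * D k ω - l ^ 2 * w k ω))} := by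
    refine measureReal_mono fun ω hω => ?_
    simp only [Set.mem_ofPred_eq, Real.exp_le_exp, Finset.sum_sub_distrib, ← Finset.mul_sum] at hω ⊢
    have := mul_le_mul_of_nonneg_left hω.1 hl
    have := mul_le_mul_of_nonneg_left hω.2 (sq_nonneg l)
    linarith
  have h4 : Real.exp (-(l * u) + l ^ 2 * v) = (Real.exp (l * u - l ^ 2 * v))⁻¹ := by
    rw [← Real.exp_neg]
    congr 1
    ring
  rw [h4]
  refine h3.trans ?_
  rw [← one_div, le_div_iff₀' (Real.exp_pos _)]
  exact h2.trans h1

end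

section

variable {q : ℕ} {Ω : Type*} [mΩ : MeasurableSpace Ω]

theorem sum_range_mul_eq {M : Type*} [AddCommMonoid M] (D : ℕ → M) (N L : ℕ) :
    ∑ s ∈ Finset.range (N * L), D s = ∑ r ∈ Finset.range L, ∑ k ∈ Finset.range N, D (k * L + r) := by
  induction N with
  | zero => simp
  | succ N ih =>
    rw [add_mul, one_mul, Finset.sum_range_add, ih, ← Finset.sum_add_distrib]
    exact Finset.sum_congr rfl fun r _ => (Finset.sum_range_succ _ _).symm

theorem sum_range_masked {M : Type*} [AddCommMonoid M] (D : ℕ → M) {N N' : ℕ} (h : N ≤ N') :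
    ∑ s ∈ Finset.range N', (if s < N then D s else 0) = ∑ s ∈ Finset.range N, D s := by
  rw [← Finset.sum_filter]
  refine Finset.sum_congr ?_ fun _ _ => rfl
  ext s
  simp only [Finset.mem_filter, Finset.mem_range]
  omega

theorem sum_range_residues {M : Type*} [AddCommMonoid M] (D : ℕ → M) (N l : ℕ) :
    ∑ s ∈ Finset.range N, D s = ∑ r ∈ Finset.range (l + 1), ∑ k ∈ Finset.range N,
      (if k * (l + 1) + r < N then D (k * (l + 1) + r) else 0) := by
  rw [← sum_range_mul_eq (fun s => if s < N then D s else 0) N (l + 1),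
    sum_range_masked D (Nat.le_mul_of_pos_right N (Nat.succ_pos l))]

namespace ErgodicChain

variable {P : Measure Ω} [IsProbabilityMeasure P] {ν : Measure ℝ} {a : Fin (q + 1) → ℝ}
  {X : ℕ → Ω → Fin (q + 1) → ℝ} {e : ℕ → Ω → ℝ} {ℱ : Filtration ℕ mΩ} {C γ : ℝ}

theorem measurable_noise_integral (h : ErgodicChain P ν a X e ℱ C γ)
    {f : (Fin (q + 1) → ℝ) → ℝ → ℝ} (hf : Measurable (Function.uncurry f)) :
    Measurable fun U => ∫ u, f U u ∂ν := by
  have := h.prob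
  exact (hf.stronglyMeasurable.integral_prod_right (ν := ν)).measurable

theorem abs_noise_integral_le (h : ErgodicChain P ν a X e ℱ C γ)
    {f : (Fin (q + 1) → ℝ) → ℝ → ℝ} {K : ℝ} (hK : ∀ U u, |f U u| ≤ K) (U : Fin (q + 1) → ℝ) :
    |∫ u, f U u ∂ν| ≤ K := by
  have := h.prob
  simpa using norm_integral_le_of_norm_le_const (μ := ν) (f := f U)
    (Eventually.of_forall fun u => hK U u)

theorem integral_noise_integral (h : ErgodicChain P ν a X e ℱ C γ)
    {f : (Fin (q + 1) → ℝ) → ℝ → ℝ} (hf : Measurable (Function.uncurry f)) {K : ℝ}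
    (hK : ∀ U u, |f U u| ≤ K) (t : ℕ) :
    ∫ ω, (∫ u, f (X t ω) u ∂ν) ∂P = ∫ ω, f (X t ω) (e t ω) ∂P := by
  have := h.integral_mul_noise (t := t) (A := fun _ => 1) measurable_const (integrable_const _) hf hK
  simpa using this.symm

theorem abs_iterate_noise_sub_le (h : ErgodicChain P ν a X e ℱ C γ)
    {f : (Fin (q + 1) → ℝ) → ℝ → ℝ} (hf : Measurable (Function.uncurry f)) {K : ℝ}
    (hK : ∀ U u, |f U u| ≤ K) (m : ℕ) (U : Fin (q + 1) → ℝ) :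
    |(transOp ν a)^[m] (fun U => ∫ u, f U u ∂ν) U - ∫ ω, f (X 0 ω) (e 0 ω) ∂P| ≤
      K * C * γ ^ m * (1 + ssq U) := by
  rw [← h.integral_noise_integral hf hK 0]
  exact h.mixing (h.measurable_noise_integral hf) (h.abs_noise_integral_le hK) m U

/-- Freedman's inequality for the sums of `f (X t) (e t)` over one residue class modulo `l + 1`,
centred by their conditional expectations given the state `l` steps earlier. -/
theorem freedman_residue (h : ErgodicChain P ν a X e ℱ C γ)
    {f : (Fin (q + 1) → ℝ) → ℝ → ℝ} (hf : Measurable (Function.uncurry f)) {K : ℝ}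
    (hK : ∀ U u, |f U u| ≤ K) (N l r : ℕ) {b : ℝ} (hb : 0 ≤ b) (hbK : b * (2 * K) ≤ 1)
    (u v : ℝ) :
    P.real {ω | u ≤ ∑ k ∈ Finset.range N, (if k * (l + 1) + r < N then
          f (X (k * (l + 1) + r + l) ω) (e (k * (l + 1) + r + l) ω) -
            (transOp ν a)^[l] (fun U => ∫ u, f U u ∂ν) (X (k * (l + 1) + r) ω) else 0) ∧
        ∑ k ∈ Finset.range N, (if k * (l + 1) + r < N then
          (transOp ν a)^[l] (fun U => ∫ u, f U u ^ 2 ∂ν) (X (k * (l + 1) + r) ω) else 0) ≤ v} ≤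
      Real.exp (-(b * u) + b ^ 2 * v) := by
  have := h.prob
  have hf2 : Measurable (Function.uncurry fun U u => f U u ^ 2) := hf.pow_const 2
  have hK2 : ∀ U u, |f U u ^ 2| ≤ K ^ 2 := fun U u => by
    rw [abs_pow]
    exact pow_le_pow_left₀ (abs_nonneg _) (hK U u) 2
  set H := (transOp ν a)^[l] (fun U => ∫ u, f U u ∂ν) with hH
  set W := (transOp ν a)^[l] (fun U => ∫ u, f U u ^ 2 ∂ν) with hW
  have hHm : Measurable H := measurable_transOp_iterate ν a (h.measurable_noise_integral hf) l
  have hWm : Measurable W := measurable_transOp_iterate ν a (h.measurable_noise_integral hf2) l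
  have hHK : ∀ U, |H U| ≤ K := abs_transOp_iterate_le ν a (h.abs_noise_integral_le hK) l
  have hWK : ∀ U, |W U| ≤ K ^ 2 := abs_transOp_iterate_le ν a (h.abs_noise_integral_le hK2) l
  have hW0 : ∀ U, 0 ≤ W U := by
    have : ∀ (m : ℕ) (U : Fin (q + 1) → ℝ),
        0 ≤ (transOp ν a)^[m] (fun U => ∫ u, f U u ^ 2 ∂ν) U := by
      intro m
      induction m with
      | zero => exact fun U => integral_nonneg fun u => sq_nonneg _
      | succ m ih =>
        intro U
        rw [Function.iterate_succ_apply']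
        exact integral_nonneg fun u => ih _
    exact this l
  have hfm : ∀ t, Measurable[ℱ (t + 1)] fun ω => f (X t ω) (e t ω) := fun t =>
    hf.comp (((h.adapted t).mono (ℱ.mono (Nat.le_succ t)) le_rfl).prodMk (h.noise_adapted t))
  have hmean : ∀ (s : ℕ) (A : Ω → ℝ), Measurable[ℱ s] A → Integrable A P →
      ∫ ω, A ω * f (X (s + l) ω) (e (s + l) ω) ∂P = ∫ ω, A ω * H (X s ω) ∂P :=
    fun s A hA hAi => h.integral_mul_noise_iterate hA hAi l hf hK
  have hsq : ∀ (s : ℕ) (A : Ω → ℝ), Measurable[ℱ s] A → Integrable A P →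
      ∫ ω, A ω * f (X (s + l) ω) (e (s + l) ω) ^ 2 ∂P = ∫ ω, A ω * W (X s ω) ∂P :=
    fun s A hA hAi => h.integral_mul_noise_iterate hA hAi l hf2 hK2
  have hAint : ∀ (s : ℕ) (A : Ω → ℝ), Measurable[ℱ s] A → (∀ ω, 0 ≤ A ω) → (∃ B, ∀ ω, A ω ≤ B) →
      Integrable A P := by
    rintro s A hA hA0 ⟨B, hB⟩
    refine Integrable.of_bound (hA.mono (ℱ.le s) le_rfl).aestronglyMeasurable B
      (Eventually.of_forall fun ω => ?_)
    rw [Real.norm_of_nonneg (hA0 ω)]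
    exact hB ω
  have hfi : ∀ (t : ℕ) (A : Ω → ℝ), Integrable A P →
      Integrable (fun ω => A ω * f (X t ω) (e t ω)) P := fun t A hA =>
    hA.mul_bdd ((hfm t).mono (ℱ.le _) le_rfl).aestronglyMeasurable
      (Eventually.of_forall fun ω => hK _ _)
  have hHi : ∀ (t : ℕ) (A : Ω → ℝ), Integrable A P →
      Integrable (fun ω => A ω * H (X t ω)) P := fun t A hA =>
    hA.mul_bdd (hHm.comp (h.measurable_X t)).aestronglyMeasurable
      (Eventually.of_forall fun ω => hHK _)
  have hK0 : 0 ≤ K := (abs_nonneg _).trans (hK 0 0)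
  refine freedman (P := P) (𝒢 := fun k => ℱ (k * (l + 1) + r)) (c := 2 * K) (W := K ^ 2)
    (fun i j hij => ℱ.mono (by gcongr)) (fun k => ℱ.le _) ?_ ?_ ?_ ?_ ?_ ?_ ?_ hb hbK N u v
  · intro k
    by_cases hk : k * (l + 1) + r < N
    · simp only [hk, if_true]
      refine Measurable.sub ?_ ?_
      · refine (hfm _).mono (ℱ.mono ?_) le_rfl
        rw [add_mul]
        omega
      · refine (hHm.comp (h.adapted _)).mono (ℱ.mono ?_) le_rfl
        gcongr
        exact Nat.le_succ k
    · simp only [hk, if_false]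
      exact measurable_const
  · intro k
    by_cases hk : k * (l + 1) + r < N
    · simp only [hk, if_true]
      exact hWm.comp (h.adapted _)
    · simp only [hk, if_false]
      exact measurable_const
  · intro k ω
    split_ifs
    · refine (abs_sub _ _).trans ?_
      have := hK (X (k * (l + 1) + r + l) ω) (e (k * (l + 1) + r + l) ω)
      have := hHK (X (k * (l + 1) + r) ω)
      linarith
    · simpa using hK0
  · intro k ω
    split_ifs
    · exact hW0 _
    · exact le_rfl
  · intro k ω
    split_ifs
    · exact (le_abs_self _).trans (hWK _)
    · positivity
  · intro k A hA hA0 hAB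
    have hAi := hAint _ A hA hA0 hAB
    by_cases hk : k * (l + 1) + r < N
    · simp only [hk, if_true, mul_sub]
      rw [integral_sub (hfi _ A hAi) (hHi _ A hAi), hmean _ A hA hAi, sub_self]
    · simp [hk]
  · intro k A hA hA0 hAB
    have hAi := hAint _ A hA hA0 hAB
    by_cases hk : k * (l + 1) + r < N
    · simp only [hk, if_true]
      set s := k * (l + 1) + r
      have hAH : Measurable[ℱ s] fun ω => A ω * H (X s ω) := hA.mul (hHm.comp (h.adapted s))
      have hAHi := hHi s A hAi
      have hffi : Integrable (fun ω => A ω * f (X (s + l) ω) (e (s + l) ω) ^ 2) P := by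
        have := hfi (s + l) _ (hfi (s + l) A hAi)
        refine this.congr (Eventually.of_forall fun ω => ?_)
        simp only
        ring
      have hfHi := hfi (s + l) _ hAHi
      have hHHi := hHi s _ hAHi
      have e1 : ∀ ω, A ω * (f (X (s + l) ω) (e (s + l) ω) - H (X s ω)) ^ 2 =
          A ω * f (X (s + l) ω) (e (s + l) ω) ^ 2 -
            2 * (A ω * H (X s ω) * f (X (s + l) ω) (e (s + l) ω)) +
            A ω * H (X s ω) * H (X s ω) := fun ω => by ring
      simp only [e1]
      have i1 : Integrable (fun ω => A ω * f (X (s + l) ω) (e (s + l) ω) ^ 2 -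
            2 * (A ω * H (X s ω) * f (X (s + l) ω) (e (s + l) ω))) P :=
        hffi.sub (hfHi.const_mul 2)
      rw [integral_add i1 hHHi, integral_sub hffi (hfHi.const_mul 2), integral_const_mul,
        hmean s _ hAH hAHi, hsq s A hA hAi]
      have : 0 ≤ ∫ ω, A ω * H (X s ω) * H (X s ω) ∂P :=
        integral_nonneg fun ω => by
          have := mul_nonneg (hA0 ω) (mul_self_nonneg (H (X s ω)))
          simpa [mul_assoc] using this
      linarith
    · simp [hk]

/-- A deviation inequality for additive functionals of the chain, with blocks of length `l + 1`. -/
theorem deviation (h : ErgodicChain P ν a X e ℱ C γ)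
    {f : (Fin (q + 1) → ℝ) → ℝ → ℝ} (hf : Measurable (Function.uncurry f)) {K : ℝ}
    (hK : ∀ U u, |f U u| ≤ K) {n l : ℕ} (hln : l ≤ n) {b : ℝ} (hb : 0 ≤ b)
    (hbK : b * (2 * K) ≤ 1) {R : ℝ} :
    P.real {ω | ∑ t ∈ Finset.range n, (1 + ssq (X t ω)) ≤ (n : ℝ) ^ 2 ∧
        R + (2 * K * l + K * C * γ ^ l * (n : ℝ) ^ 2) <
          |∑ t ∈ Finset.range n, (f (X t ω) (e t ω) - ∫ ω, f (X 0 ω) (e 0 ω) ∂P)|} ≤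
      2 * (l + 1) * Real.exp (-(b * (R / (l + 1))) +
        b ^ 2 * (n * (∫ ω, f (X 0 ω) (e 0 ω) ^ 2 ∂P) + K ^ 2 * C * γ ^ l * (n : ℝ) ^ 2)) := by
  have := h.prob
  have hK0 : 0 ≤ K := (abs_nonneg _).trans (hK 0 0)
  have hγ := h.γ_pos
  have hC := h.C_nonneg
  set μ := ∫ ω, f (X 0 ω) (e 0 ω) ∂P with hμ
  set μ2 := ∫ ω, f (X 0 ω) (e 0 ω) ^ 2 ∂P with hμ2
  have hμK : |μ| ≤ K := by
    simpa using norm_integral_le_of_norm_le_const (μ := P) (f := fun ω => f (X 0 ω) (e 0 ω))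
      (Eventually.of_forall fun ω => hK (X 0 ω) (e 0 ω))
  have hμ20 : 0 ≤ μ2 := integral_nonneg fun _ => sq_nonneg _
  have hf2 : Measurable (Function.uncurry fun U u => f U u ^ 2) := hf.pow_const 2
  have hfn : Measurable (Function.uncurry fun U u => -f U u) := hf.neg
  have hK2 : ∀ U u, |f U u ^ 2| ≤ K ^ 2 := fun U u => by
    rw [abs_pow]
    exact pow_le_pow_left₀ (abs_nonneg _) (hK U u) 2
  obtain ⟨N, rfl⟩ := Nat.exists_eq_add_of_le hln
  set n := l + N with hn
  set H := (transOp ν a)^[l] (fun U => ∫ u, f U u ∂ν) with hH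
  set W := (transOp ν a)^[l] (fun U => ∫ u, f U u ^ 2 ∂ν) with hW
  have hHμ : ∀ U, |H U - μ| ≤ K * C * γ ^ l * (1 + ssq U) := h.abs_iterate_noise_sub_le hf hK l
  have hWμ : ∀ U, |W U - μ2| ≤ K ^ 2 * C * γ ^ l * (1 + ssq U) :=
    h.abs_iterate_noise_sub_le hf2 hK2 l
  have hneg : ∀ (m : ℕ) (U : Fin (q + 1) → ℝ), (transOp ν a)^[m] (fun U => ∫ u, -f U u ∂ν) U =
      -(transOp ν a)^[m] (fun U => ∫ u, f U u ∂ν) U := by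
    intro m
    induction m with
    | zero => exact fun U => integral_neg _
    | succ m ih =>
      intro U
      rw [Function.iterate_succ_apply', Function.iterate_succ_apply', transOp, transOp,
        ← integral_neg]
      simp only [ih]
  set V := (n : ℝ) * μ2 + K ^ 2 * C * γ ^ l * (n : ℝ) ^ 2 with hV
  let D : ℕ → Ω → ℝ := fun s ω => f (X (s + l) ω) (e (s + l) ω) - H (X s ω)
  let S : ℕ → Set Ω := fun r => {ω | R / (l + 1) ≤ ∑ k ∈ Finset.range N,
      (if k * (l + 1) + r < N then D (k * (l + 1) + r) ω else 0) ∧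
    ∑ k ∈ Finset.range N, (if k * (l + 1) + r < N then W (X (k * (l + 1) + r) ω) else 0) ≤ V}
  let S' : ℕ → Set Ω := fun r => {ω | R / (l + 1) ≤ ∑ k ∈ Finset.range N,
      (if k * (l + 1) + r < N then -D (k * (l + 1) + r) ω else 0) ∧
    ∑ k ∈ Finset.range N, (if k * (l + 1) + r < N then W (X (k * (l + 1) + r) ω) else 0) ≤ V}
  have hS : ∀ r, P.real (S r) ≤ Real.exp (-(b * (R / (l + 1))) + b ^ 2 * V) := fun r =>
    h.freedman_residue hf hK N l r hb hbK _ _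
  have hS' : ∀ r, P.real (S' r) ≤ Real.exp (-(b * (R / (l + 1))) + b ^ 2 * V) := fun r => by
    have := h.freedman_residue hfn (fun U u => by rw [abs_neg]; exact hK U u) N l r hb hbK
      (R / (l + 1)) V
    simp only [hneg, neg_sq] at this
    convert this using 6 with ω
    · refine Finset.sum_congr rfl fun k _ => ?_
      split_ifs
      · simp only [D, hH]; ring
      · rfl
  have hsub : {ω | ∑ t ∈ Finset.range n, (1 + ssq (X t ω)) ≤ (n : ℝ) ^ 2 ∧
        R + (2 * K * l + K * C * γ ^ l * (n : ℝ) ^ 2) <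
          |∑ t ∈ Finset.range n, (f (X t ω) (e t ω) - μ)|} ⊆
      ⋃ r ∈ Finset.range (l + 1), (S r ∪ S' r) := by
    rintro ω ⟨hg, hdev⟩
    have hgN : ∑ s ∈ Finset.range N, (1 + ssq (X s ω)) ≤ (n : ℝ) ^ 2 := by
      refine le_trans (Finset.sum_le_sum_of_subset_of_nonneg ?_ fun i _ _ => ?_) hg
      · exact Finset.range_subset_range.2 (by omega)
      · have := ssq_nonneg (X i ω)
        linarith
    have hWsum : ∀ r ∈ Finset.range (l + 1), ∑ k ∈ Finset.range N,
        (if k * (l + 1) + r < N then W (X (k * (l + 1) + r) ω) else 0) ≤ V := by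
      intro r hr
      have hb' : ∀ U, W U ≤ μ2 + K ^ 2 * C * γ ^ l * (1 + ssq U) := fun U => by
        have := (abs_le.1 (hWμ U)).2
        linarith
      have hb0 : ∀ U : Fin (q + 1) → ℝ, 0 ≤ μ2 + K ^ 2 * C * γ ^ l * (1 + ssq U) := fun U => by
        have := ssq_nonneg U
        positivity
      calc _ ≤ ∑ k ∈ Finset.range N, (if k * (l + 1) + r < N then
            (μ2 + K ^ 2 * C * γ ^ l * (1 + ssq (X (k * (l + 1) + r) ω))) else 0) := by
            refine Finset.sum_le_sum fun k _ => ?_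
            split_ifs
            · exact hb' _
            · exact le_rfl
        _ ≤ ∑ r ∈ Finset.range (l + 1), ∑ k ∈ Finset.range N, (if k * (l + 1) + r < N then
            (μ2 + K ^ 2 * C * γ ^ l * (1 + ssq (X (k * (l + 1) + r) ω))) else 0) := by
            refine Finset.single_le_sum (f := fun r => ∑ k ∈ Finset.range N,
              (if k * (l + 1) + r < N then
              (μ2 + K ^ 2 * C * γ ^ l * (1 + ssq (X (k * (l + 1) + r) ω))) else 0))
              (fun r _ => Finset.sum_nonneg fun k _ => ?_) hr
            split_ifs
            · exact hb0 _
            · exact le_rfl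
        _ = ∑ s ∈ Finset.range N, (μ2 + K ^ 2 * C * γ ^ l * (1 + ssq (X s ω))) :=
            (sum_range_residues (fun s => μ2 + K ^ 2 * C * γ ^ l * (1 + ssq (X s ω))) N l).symm
        _ = N * μ2 + K ^ 2 * C * γ ^ l * ∑ s ∈ Finset.range N, (1 + ssq (X s ω)) := by
            rw [Finset.sum_add_distrib, Finset.mul_sum]
            simp
        _ ≤ V := by
            rw [hV]
            gcongr
            omega
    by_contra hcon
    simp only [Set.mem_iUnion, Set.mem_union, not_exists, not_or] at hcon
    have hDsum : |∑ s ∈ Finset.range N, D s ω| ≤ R := by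
      rw [sum_range_residues (fun s => D s ω) N l]
      refine (Finset.abs_sum_le_sum_abs _ _).trans ?_
      have : ∀ r ∈ Finset.range (l + 1), |∑ k ∈ Finset.range N,
          (if k * (l + 1) + r < N then D (k * (l + 1) + r) ω else 0)| ≤ R / (l + 1) := by
        intro r hr
        obtain ⟨h1, h2⟩ := hcon r hr
        rw [abs_le']
        constructor
        · by_contra hlt
          exact h1 ⟨(not_le.1 hlt).le, hWsum r hr⟩
        · by_contra hlt
          refine h2 ⟨?_, hWsum r hr⟩
          refine (not_le.1 hlt).le.trans (le_of_eq ?_)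
          rw [← Finset.sum_neg_distrib]
          refine Finset.sum_congr rfl fun k _ => ?_
          split_ifs <;> simp
      refine (Finset.sum_le_sum this).trans (le_of_eq ?_)
      have : (l : ℝ) + 1 ≠ 0 := by positivity
      simp only [Finset.sum_const, Finset.card_range, nsmul_eq_mul, Nat.cast_add, Nat.cast_one]
      field_simp
    have hsplit : ∑ t ∈ Finset.range n, (f (X t ω) (e t ω) - μ) =
        ∑ t ∈ Finset.range l, (f (X t ω) (e t ω) - μ) + (∑ s ∈ Finset.range N, D s ω +
          ∑ s ∈ Finset.range N, (H (X s ω) - μ)) := by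
      rw [hn, Finset.sum_range_add, ← Finset.sum_add_distrib]
      congr 1
      refine Finset.sum_congr rfl fun s _ => ?_
      simp only [D, add_comm l s]
      ring
    have h1 : |∑ t ∈ Finset.range l, (f (X t ω) (e t ω) - μ)| ≤ 2 * K * l := by
      refine (Finset.abs_sum_le_sum_abs _ _).trans ?_
      have : ∀ t ∈ Finset.range l, |f (X t ω) (e t ω) - μ| ≤ 2 * K := fun t _ =>
        (abs_sub _ _).trans (by linarith [hK (X t ω) (e t ω)])
      refine (Finset.sum_le_sum this).trans (le_of_eq ?_)
      simp [mul_comm]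
    have h2 : |∑ s ∈ Finset.range N, (H (X s ω) - μ)| ≤ K * C * γ ^ l * (n : ℝ) ^ 2 := by
      refine (Finset.abs_sum_le_sum_abs _ _).trans ?_
      refine (Finset.sum_le_sum fun s _ => hHμ (X s ω)).trans ?_
      rw [← Finset.mul_sum]
      exact mul_le_mul_of_nonneg_left hgN (by positivity)
    rw [hsplit] at hdev
    have h3 := abs_add_le (∑ t ∈ Finset.range l, (f (X t ω) (e t ω) - μ))
      (∑ s ∈ Finset.range N, D s ω + ∑ s ∈ Finset.range N, (H (X s ω) - μ))
    have h4 := abs_add_le (∑ s ∈ Finset.range N, D s ω) (∑ s ∈ Finset.range N, (H (X s ω) - μ))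
    linarith
  refine (measureReal_mono hsub (measure_ne_top _ _)).trans ?_
  refine (measureReal_biUnion_finset_le _ _).trans ?_
  have : ∀ r ∈ Finset.range (l + 1), P.real (S r ∪ S' r) ≤
      2 * Real.exp (-(b * (R / (l + 1))) + b ^ 2 * V) := fun r _ =>
    (measureReal_union_le _ _).trans (by linarith [hS r, hS' r])
  refine (Finset.sum_le_sum this).trans (le_of_eq ?_)
  simp only [Finset.sum_const, Finset.card_range, nsmul_eq_mul, Nat.cast_add, Nat.cast_one]
  ring

end ErgodicChain

end

section

variable {q : ℕ} {Ω : Type*} [mΩ : MeasurableSpace Ω]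

theorem tendsto_pow_mul_pow_floor {γ : ℝ} (hγ : 0 < γ) (hγ1 : γ < 1) (k : ℕ) :
    Tendsto (fun s : ℝ => s ^ k * γ ^ ⌊s⌋₊) atTop (𝓝 0) := by
  have h1 := (tendsto_pow_const_mul_const_pow_of_abs_lt_one k (r := γ)
    (by rw [abs_of_pos hγ]; exact hγ1)).comp
      ((tendsto_add_atTop_nat 1).comp (tendsto_nat_floor_atTop (α := ℝ)))
  have h2 := h1.mul_const γ⁻¹
  rw [zero_mul] at h2
  refine squeeze_zero' ?_ ?_ h2
  · filter_upwards [eventually_ge_atTop 0] with s hs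
    positivity
  · filter_upwards [eventually_ge_atTop 0] with s hs
    simp only [Function.comp, pow_succ γ, Nat.cast_add, Nat.cast_one]
    rw [mul_assoc, mul_assoc (γ ^ ⌊s⌋₊) γ γ⁻¹, mul_inv_cancel₀ hγ.ne', mul_one]
    gcongr
    exact (Nat.lt_floor_add_one s).le

theorem eventually_scale_conditions {C γ : ℝ} (hγ : 0 < γ) (hγ1 : γ < 1) (C' : ℝ)
    (d : ℕ) {η : ℝ} (hη : 0 < η) :
    ∀ᶠ s : ℝ in atTop, 4 ≤ s ∧ 6 * C * (s ^ 80 * γ ^ ⌊s⌋₊) ≤ 1 ∧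
      s ^ (32 * d) * (2 * (2 * s) * Real.exp (-(s / 4) + (C' + 1))) ≤ η := by
  have h1 : Tendsto (fun s : ℝ => 6 * C * (s ^ 80 * γ ^ ⌊s⌋₊)) atTop (𝓝 0) := by
    simpa using (tendsto_pow_mul_pow_floor hγ hγ1 80).const_mul (6 * C)
  have h2 : Tendsto (fun s : ℝ => s ^ (32 * d) * (2 * (2 * s) * Real.exp (-(s / 4) + (C' + 1))))
      atTop (𝓝 0) := by
    have h3 := Real.tendsto_pow_mul_exp_neg_atTop_nhds_zero (32 * d + 1)
    have h4 := h3.comp (tendsto_id.atTop_div_const (show (0 : ℝ) < 4 by norm_num))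
    have h5 := h4.const_mul (4 ^ (32 * d + 1) * 4 * Real.exp (C' + 1))
    rw [mul_zero] at h5
    refine h5.congr fun s => ?_
    simp only [Function.comp, id, div_pow, Real.exp_add]
    have : (4 : ℝ) ^ (32 * d + 1) ≠ 0 := by positivity
    field_simp
    ring
  filter_upwards [eventually_ge_atTop 4, h1.eventually_le_const one_pos, h2.eventually_le_const hη]
    with s ha hb hc
  exact ⟨ha, hb, hc⟩

namespace ErgodicChain

variable {P : Measure Ω} [IsProbabilityMeasure P] {ν : Measure ℝ} {a : Fin (q + 1) → ℝ}
  {X : ℕ → Ω → Fin (q + 1) → ℝ} {e : ℕ → Ω → ℝ} {ℱ : Filtration ℕ mΩ} {C γ : ℝ}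

theorem deviation_scaled (h : ErgodicChain P ν a X e ℱ C γ)
    {f : (Fin (q + 1) → ℝ) → ℝ → ℝ} (hf : Measurable (Function.uncurry f)) {n : ℕ} {s : ℝ}
    (hs : s ^ 32 = n) (hs4 : 4 ≤ s) (hsγ : 6 * C * (s ^ 80 * γ ^ ⌊s⌋₊) ≤ 1)
    (hK : ∀ U u, |f U u| ≤ 2 * s ^ 8) {C' u : ℝ} (hC' : 0 ≤ C') (hu : 1 ≤ u)
    (hvar : ∫ ω, f (X 0 ω) (e 0 ω) ^ 2 ∂P ≤ C' / s ^ 8 * u ^ 2) :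
    P.real {ω | ∑ t ∈ Finset.range n, (1 + ssq (X t ω)) ≤ (n : ℝ) ^ 2 ∧
        u * s ^ 16 <
          |∑ t ∈ Finset.range n, (f (X t ω) (e t ω) - ∫ ω, f (X 0 ω) (e 0 ω) ∂P)|} ≤
      2 * (2 * s) * Real.exp (-(s / 4) + (C' + 1)) := by
  have hs0 : 0 < s := by linarith
  have hs1 : 1 ≤ s := by linarith
  have hγ := h.γ_pos
  have hC := h.C_nonneg
  set l := ⌊s⌋₊ with hl
  have hls : (l : ℝ) ≤ s := Nat.floor_le hs0.le
  have hln : l ≤ n := by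
    have : (l : ℝ) ≤ n := by
      rw [← hs]
      exact hls.trans (le_self_pow₀ hs1 (by norm_num))
    exact_mod_cast this
  set g := γ ^ l with hg
  have hg0 : 0 < g := by positivity
  set b := (s ^ 14 * u)⁻¹ with hb
  have hb0 : 0 ≤ b := by positivity
  have hp : ∀ k : ℕ, 1 ≤ s ^ k := fun k => one_le_pow₀ hs1
  have hCg : C * (s ^ 80 * g) ≤ 1 / 6 := by linarith
  have hbK : b * (2 * (2 * s ^ 8)) ≤ 1 := by
    rw [hb, inv_mul_le_iff₀ (by positivity)]
    have h1 : (4 : ℝ) ≤ s ^ 6 := hs4.trans (le_self_pow₀ hs1 (by norm_num))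
    have h2 : s ^ 14 = s ^ 8 * s ^ 6 := by ring
    have h3 : 0 < s ^ 8 := by positivity
    have h4 : s ^ 8 * 4 ≤ s ^ 8 * s ^ 6 := mul_le_mul_of_nonneg_left h1 h3.le
    rw [h2]
    nlinarith
  have hdev := h.deviation hf hK hln hb0 hbK
    (R := u * s ^ 16 - (2 * (2 * s ^ 8) * l + 2 * s ^ 8 * C * γ ^ l * (n : ℝ) ^ 2))
  simp only [sub_add_cancel] at hdev
  refine hdev.trans ?_
  have hR : u * s ^ 16 / 2 ≤
      u * s ^ 16 - (2 * (2 * s ^ 8) * l + 2 * s ^ 8 * C * γ ^ l * (n : ℝ) ^ 2) := by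
    have h1 : 2 * (2 * s ^ 8) * l ≤ s ^ 16 / 4 := by
      have h2 : (16 : ℝ) ≤ s ^ 7 := by
        calc (16 : ℝ) ≤ 4 ^ 7 := by norm_num
          _ ≤ s ^ 7 := pow_le_pow_left₀ (by norm_num) hs4 7
      have h3 : s ^ 16 = s ^ 8 * s * s ^ 7 := by ring
      rw [h3]
      calc 2 * (2 * s ^ 8) * l ≤ 2 * (2 * s ^ 8) * s := by gcongr
        _ = s ^ 8 * s * 16 / 4 := by ring
        _ ≤ s ^ 8 * s * s ^ 7 / 4 := by gcongr
    have h2 : 2 * s ^ 8 * C * γ ^ l * (n : ℝ) ^ 2 ≤ s ^ 16 / 4 := by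
      rw [← hs]
      have h3 : 2 * s ^ 8 * C * γ ^ l * (s ^ 32) ^ 2 ≤ 2 * (C * (s ^ 80 * g)) := by
        have : s ^ 72 ≤ s ^ 80 := pow_le_pow_right₀ hs1 (by norm_num)
        calc 2 * s ^ 8 * C * γ ^ l * (s ^ 32) ^ 2 = 2 * (C * (s ^ 72 * g)) := by rw [hg]; ring
          _ ≤ _ := by gcongr
      have h4 : (4 : ℝ) ≤ s ^ 16 := hs4.trans (le_self_pow₀ hs1 (by norm_num))
      linarith
    have h3 : s ^ 16 ≤ u * s ^ 16 := le_mul_of_one_le_left (by positivity) hu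
    linarith
  have hexp : -(b * ((u * s ^ 16 - (2 * (2 * s ^ 8) * l + 2 * s ^ 8 * C * γ ^ l * (n : ℝ) ^ 2)) /
      (l + 1))) + b ^ 2 * (n * (∫ ω, f (X 0 ω) (e 0 ω) ^ 2 ∂P) +
        (2 * s ^ 8) ^ 2 * C * γ ^ l * (n : ℝ) ^ 2) ≤ -(s / 4) + (C' + 1) := by
    refine add_le_add (neg_le_neg ?_) ?_
    · calc s / 4 = b * (u * s ^ 16 / 2 / (2 * s)) := by
            rw [hb]
            field_simp
            ring
        _ ≤ _ := by
            have h0 : 0 ≤ u * s ^ 16 / 2 := by positivity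
            gcongr
            · exact h0.trans hR
            · linarith
    · have h1 : (2 * s ^ 8) ^ 2 * C * γ ^ l * (n : ℝ) ^ 2 ≤ 1 := by
        rw [← hs]
        calc (2 * s ^ 8) ^ 2 * C * γ ^ l * (s ^ 32) ^ 2 = 4 * (C * (s ^ 80 * g)) := by rw [hg]; ring
          _ ≤ 1 := by linarith
      have h2 : (n : ℝ) * ∫ ω, f (X 0 ω) (e 0 ω) ^ 2 ∂P ≤ C' * s ^ 24 * u ^ 2 := by
        rw [← hs]
        calc s ^ 32 * ∫ ω, f (X 0 ω) (e 0 ω) ^ 2 ∂P ≤ s ^ 32 * (C' / s ^ 8 * u ^ 2) := by gcongr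
          _ = C' * s ^ 24 * u ^ 2 := by
            field_simp
      have hbu : b ^ 2 * (s ^ 28 * u ^ 2) = 1 := by
        rw [hb]
        field_simp
      have hb2 : b ^ 2 ≤ 1 := by
        rw [← hbu]
        refine le_mul_of_one_le_right (sq_nonneg _) ?_
        exact one_le_mul_of_one_le_of_one_le (hp 28) (one_le_pow₀ hu)
      calc b ^ 2 * (n * (∫ ω, f (X 0 ω) (e 0 ω) ^ 2 ∂P) +
            (2 * s ^ 8) ^ 2 * C * γ ^ l * (n : ℝ) ^ 2)
          ≤ b ^ 2 * (C' * s ^ 24 * u ^ 2 + 1) := by gcongr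
        _ ≤ b ^ 2 * (C' * s ^ 28 * u ^ 2 + 1) := by
            gcongr
            norm_num
        _ = C' * (b ^ 2 * (s ^ 28 * u ^ 2)) + b ^ 2 := by ring
        _ ≤ C' + 1 := by rw [hbu, mul_one]; linarith
  have hexp' := Real.exp_le_exp.2 hexp
  refine mul_le_mul ?_ hexp' (Real.exp_pos _).le (by positivity)
  linarith

/-- Simultaneous deviations for polynomially many functions. -/
theorem deviation_family (h : ErgodicChain P ν a X e ℱ C γ) {ι : Type*} [Fintype ι]
    {f : ι → (Fin (q + 1) → ℝ) → ℝ → ℝ} (hf : ∀ i, Measurable (Function.uncurry (f i)))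
    {n : ℕ} {s : ℝ} (hs : s ^ 32 = n) (hs4 : 4 ≤ s) (hsγ : 6 * C * (s ^ 80 * γ ^ ⌊s⌋₊) ≤ 1)
    (hK : ∀ i U u, |f i U u| ≤ 2 * s ^ 8) {C' : ℝ} (hC' : 0 ≤ C') {u : ι → ℝ} (hu : ∀ i, 1 ≤ u i)
    (hvar : ∀ i, ∫ ω, f i (X 0 ω) (e 0 ω) ^ 2 ∂P ≤ C' / s ^ 8 * u i ^ 2) {d : ℕ}
    (hcard : (Fintype.card ι : ℝ) ≤ s ^ (32 * d)) {η : ℝ}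
    (hη : s ^ (32 * d) * (2 * (2 * s) * Real.exp (-(s / 4) + (C' + 1))) ≤ η) :
    P.real {ω | ∑ t ∈ Finset.range n, (1 + ssq (X t ω)) ≤ (n : ℝ) ^ 2 ∧
        ∃ i, u i * s ^ 16 <
          |∑ t ∈ Finset.range n, (f i (X t ω) (e t ω) - ∫ ω, f i (X 0 ω) (e 0 ω) ∂P)|} ≤ η := by
  have hsub : {ω | ∑ t ∈ Finset.range n, (1 + ssq (X t ω)) ≤ (n : ℝ) ^ 2 ∧
        ∃ i, u i * s ^ 16 <
          |∑ t ∈ Finset.range n, (f i (X t ω) (e t ω) - ∫ ω, f i (X 0 ω) (e 0 ω) ∂P)|} ⊆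
      ⋃ i ∈ (Finset.univ : Finset ι), {ω | ∑ t ∈ Finset.range n, (1 + ssq (X t ω)) ≤ (n : ℝ) ^ 2 ∧
        u i * s ^ 16 <
          |∑ t ∈ Finset.range n, (f i (X t ω) (e t ω) - ∫ ω, f i (X 0 ω) (e 0 ω) ∂P)|} := by
    rintro ω ⟨h1, i, h2⟩
    simp only [Set.mem_iUnion]
    exact ⟨i, Finset.mem_univ i, h1, h2⟩
  refine (measureReal_mono hsub (measure_ne_top _ _)).trans ?_
  refine (measureReal_biUnion_finset_le _ _).trans ?_
  refine (Finset.sum_le_sum fun i _ => h.deviation_scaled (hf i) hs hs4 hsγ (hK i) hC' (hu i)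
    (hvar i)).trans ?_
  rw [Finset.sum_const, Finset.card_univ, nsmul_eq_mul]
  refine le_trans ?_ hη
  have : 0 ≤ s := by linarith
  gcongr

end ErgodicChain

end

section

variable {q : ℕ} {Ω : Type*} [mΩ : MeasurableSpace Ω]

namespace ErgodicChain

variable {P : Measure Ω} [IsProbabilityMeasure P] {ν : Measure ℝ} {a : Fin (q + 1) → ℝ}
  {X : ℕ → Ω → Fin (q + 1) → ℝ} {e : ℕ → Ω → ℝ} {ℱ : Filtration ℕ mΩ} {C γ : ℝ}

theorem integral_mul_comp_noise (h : ErgodicChain P ν a X e ℱ C γ) {t : ℕ} {A : Ω → ℝ}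
    (hA : Measurable[ℱ t] A) {χ : ℝ → ℝ} (hχ : Measurable χ) :
    ∫ ω, A ω * χ (e t ω) ∂P = (∫ ω, A ω ∂P) * ∫ u, χ u ∂ν := by
  have h1 : IndepFun A (fun ω => χ (e t ω)) P :=
    (h.indepFun hA).comp measurable_id hχ
  rw [h1.integral_fun_mul_eq_mul_integral (hA.mono (ℱ.le t) le_rfl).aestronglyMeasurable
    (hχ.comp (h.measurable_e t)).aestronglyMeasurable, ← h.noise_law t,
    integral_map (h.measurable_e t).aemeasurable hχ.aestronglyMeasurable]

theorem measurable_weighted_sum (h : ErgodicChain P ν a X e ℱ C γ) {ψ : (Fin (q + 1) → ℝ) → ℝ}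
    (hψ : Measurable ψ) {χ : ℝ → ℝ} (hχ : Measurable χ) (n : ℕ) :
    Measurable[ℱ n] fun ω => ∑ t ∈ Finset.range n, ψ (X t ω) * χ (e t ω) := by
  refine Finset.measurable_fun_sum _ fun t ht => ?_
  have htn : t + 1 ≤ n := Finset.mem_range.1 ht
  exact ((hψ.comp (h.adapted t)).mono (ℱ.mono (by omega)) le_rfl).mul
    ((hχ.comp (h.noise_adapted t)).mono (ℱ.mono htn) le_rfl)

theorem fourth_moment (h : ErgodicChain P ν a X e ℱ C γ) {ψ : (Fin (q + 1) → ℝ) → ℝ}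
    (hψ : Measurable ψ) {B : ℝ} (hψi : Integrable (fun ω => ψ (X 0 ω) ^ 4) P)
    (hψB : ∫ ω, ψ (X 0 ω) ^ 4 ∂P ≤ B) {χ : ℝ → ℝ} (hχ : Measurable χ) (hχ1 : ∀ x, |χ x| ≤ 1)
    (hχ0 : ∫ x, χ x ∂ν = 0) {u : ℝ} (hu : 0 ≤ u) (hχu : ∫ x, χ x ^ 2 ∂ν ≤ u) (n : ℕ) :
    Integrable (fun ω => (∑ t ∈ Finset.range n, ψ (X t ω) * χ (e t ω)) ^ 4) P ∧
      ∫ ω, (∑ t ∈ Finset.range n, ψ (X t ω) * χ (e t ω)) ^ 4 ∂P ≤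
        100 * B * ((n : ℝ) ^ 2 * u ^ 2 + n * u) := by
  have := h.prob
  have hB0 : 0 ≤ B := (integral_nonneg fun ω => by positivity).trans hψB
  induction n with
  | zero => simp
  | succ n ih =>
    obtain ⟨hSi, hSle⟩ := ih
    set S : Ω → ℝ := fun ω => ∑ t ∈ Finset.range n, ψ (X t ω) * χ (e t ω) with hS
    set Y : Ω → ℝ := fun ω => ψ (X n ω) with hY
    have hSm : Measurable[ℱ n] S := h.measurable_weighted_sum hψ hχ n
    have hYm : Measurable[ℱ n] Y := hψ.comp (h.adapted n)
    have hSm' : Measurable S := hSm.mono (ℱ.le n) le_rfl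
    have hYm' : Measurable Y := hYm.mono (ℱ.le n) le_rfl
    have hχm' : Measurable fun ω => χ (e n ω) := hχ.comp (h.measurable_e n)
    have hψ4 : Measurable fun U => ψ U ^ 4 := hψ.pow_const 4
    have hYi : Integrable (fun ω => Y ω ^ 4) P := h.integrable_comp_X hψ4 hψi n
    have hYB : ∫ ω, Y ω ^ 4 ∂P ≤ B := by rw [h.integral_comp_X hψ4 n]; exact hψB
    set D : Ω → ℝ := fun ω => Y ω * χ (e n ω) with hD
    have hDm : Measurable D := hYm'.mul hχm'
    have hχ4 : ∀ x, χ x ^ 4 ≤ χ x ^ 2 := fun x => by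
      have h1 : χ x ^ 2 ≤ 1 := (sq_le_one_iff_abs_le_one _).2 (hχ1 x)
      nlinarith [sq_nonneg (χ x)]
    have hχ21 : ∀ x, χ x ^ 2 ≤ 1 := fun x => (sq_le_one_iff_abs_le_one _).2 (hχ1 x)
    have hDY : ∀ ω, D ω ^ 4 ≤ Y ω ^ 4 := fun ω => by
      simp only [hD, mul_pow]
      refine mul_le_of_le_one_right (by positivity) ((hχ4 _).trans (hχ21 _))
    have hDi : Integrable (fun ω => D ω ^ 4) P :=
      hYi.mono' (hDm.pow_const 4).aestronglyMeasurable (Eventually.of_forall fun ω => by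
        rw [Real.norm_of_nonneg (by positivity)]; exact hDY ω)
    have young1 : ∀ x y : ℝ, |x ^ 3 * y| ≤ x ^ 4 + y ^ 4 := fun x y => by
      rw [abs_le]
      constructor <;> nlinarith [sq_nonneg (x ^ 2 - y ^ 2), sq_nonneg (x * (x - y)),
        sq_nonneg (x * (x + y)), sq_nonneg (x ^ 2), sq_nonneg (y ^ 2)]
    have young2 : ∀ x y : ℝ, |x ^ 2 * y ^ 2| ≤ x ^ 4 + y ^ 4 := fun x y => by
      rw [abs_of_nonneg (by positivity)]
      nlinarith [sq_nonneg (x ^ 2 - y ^ 2), sq_nonneg (x ^ 2), sq_nonneg (y ^ 2)]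
    have i31 : Integrable (fun ω => S ω ^ 3 * D ω) P :=
      (hSi.add hDi).mono' ((hSm'.pow_const 3).mul hDm).aestronglyMeasurable
        (Eventually.of_forall fun ω => young1 _ _)
    have i22 : Integrable (fun ω => S ω ^ 2 * D ω ^ 2) P :=
      (hSi.add hDi).mono' ((hSm'.pow_const 2).mul (hDm.pow_const 2)).aestronglyMeasurable
        (Eventually.of_forall fun ω => young2 _ _)
    have i22' : Integrable (fun ω => S ω ^ 2 * Y ω ^ 2) P :=
      (hSi.add hYi).mono' ((hSm'.pow_const 2).mul (hYm'.pow_const 2)).aestronglyMeasurable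
        (Eventually.of_forall fun ω => young2 _ _)
    have e31 : ∫ ω, S ω ^ 3 * D ω ∂P = 0 := by
      have := h.integral_mul_comp_noise ((hSm.pow_const 3).mul hYm) hχ
      rw [hχ0, mul_zero] at this
      rw [← this]
      exact integral_congr_ae (Eventually.of_forall fun ω => by simp only [hD, Pi.mul_apply]; ring)
    have e22 : ∫ ω, S ω ^ 2 * D ω ^ 2 ∂P ≤ u * ∫ ω, S ω ^ 2 * Y ω ^ 2 ∂P := by
      have := h.integral_mul_comp_noise ((hSm.pow_const 2).mul (hYm.pow_const 2)) (hχ.pow_const 2)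
      have h2 : ∫ ω, S ω ^ 2 * D ω ^ 2 ∂P = (∫ ω, S ω ^ 2 * Y ω ^ 2 ∂P) * ∫ x, χ x ^ 2 ∂ν := by
        refine Eq.trans ?_ this
        exact integral_congr_ae (Eventually.of_forall fun ω => by
          simp only [hD, Pi.mul_apply]; ring)
      rw [h2, mul_comm u]
      exact mul_le_mul_of_nonneg_left hχu (integral_nonneg fun ω => by positivity)
    have e4 : ∫ ω, D ω ^ 4 ∂P ≤ B * u := by
      have := h.integral_mul_comp_noise (hYm.pow_const 4) (hχ.pow_const 4)
      have h2 : ∫ ω, D ω ^ 4 ∂P = (∫ ω, Y ω ^ 4 ∂P) * ∫ x, χ x ^ 4 ∂ν := by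
        refine Eq.trans ?_ this
        exact integral_congr_ae (Eventually.of_forall fun ω => by
          simp only [hD]; ring)
      have hχi : Integrable (fun x => χ x ^ 2) ν :=
        Integrable.of_bound (hχ.pow_const 2).aestronglyMeasurable 1 (Eventually.of_forall fun x => by
          rw [Real.norm_of_nonneg (sq_nonneg _)]; exact hχ21 x)
      rw [h2]
      refine mul_le_mul hYB ?_ (integral_nonneg fun x => by positivity) hB0
      refine le_trans (integral_mono_of_nonneg (Eventually.of_forall fun x => by positivity) hχi
        (Eventually.of_forall hχ4)) hχu
    have e22Y : ∫ ω, S ω ^ 2 * Y ω ^ 2 ∂P ≤ 10 * B * (n * u + 1 / 2) := by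
      set κ : ℝ := (10 * (n * u + 1 / 2))⁻¹ with hκ
      have hκ0 : 0 < κ := by positivity
      have hpt : ∀ ω, S ω ^ 2 * Y ω ^ 2 ≤ κ / 2 * S ω ^ 4 + κ⁻¹ / 2 * Y ω ^ 4 := fun ω => by
        have h1 := sq_nonneg (κ * S ω ^ 2 - Y ω ^ 2)
        have h2 : 0 ≤ κ⁻¹ * (κ * S ω ^ 2 - Y ω ^ 2) ^ 2 := by positivity
        have h3 : κ⁻¹ * (κ * S ω ^ 2 - Y ω ^ 2) ^ 2 =
            κ * S ω ^ 4 - 2 * (S ω ^ 2 * Y ω ^ 2) + κ⁻¹ * Y ω ^ 4 := by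
          field_simp
          ring
        linarith
      have h1 := integral_mono i22' ((hSi.const_mul (κ / 2)).add (hYi.const_mul (κ⁻¹ / 2))) hpt
      simp only [Pi.add_apply] at h1
      rw [integral_add (hSi.const_mul _) (hYi.const_mul _), integral_const_mul,
        integral_const_mul] at h1
      refine h1.trans ?_
      have hw : (n : ℝ) ^ 2 * u ^ 2 + n * u ≤ (n * u + 1 / 2) ^ 2 := by nlinarith
      have h2 : κ / 2 * ∫ ω, S ω ^ 4 ∂P ≤ 5 * B * (n * u + 1 / 2) := by
        calc κ / 2 * ∫ ω, S ω ^ 4 ∂P ≤ κ / 2 * (100 * B * (n * u + 1 / 2) ^ 2) := by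
              gcongr
              exact hSle.trans (by gcongr)
          _ = 5 * B * (n * u + 1 / 2) := by
              rw [hκ]
              have : (n : ℝ) * u + 1 / 2 ≠ 0 := by positivity
              field_simp
              ring
      have h3 : κ⁻¹ / 2 * ∫ ω, Y ω ^ 4 ∂P ≤ 5 * B * (n * u + 1 / 2) := by
        calc κ⁻¹ / 2 * ∫ ω, Y ω ^ 4 ∂P ≤ κ⁻¹ / 2 * B := by gcongr
          _ = 5 * B * (n * u + 1 / 2) := by rw [hκ, inv_inv]; ring
      linarith
    have hpt : ∀ ω, (∑ t ∈ Finset.range (n + 1), ψ (X t ω) * χ (e t ω)) ^ 4 ≤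
        S ω ^ 4 + 4 * (S ω ^ 3 * D ω) + 8 * (S ω ^ 2 * D ω ^ 2) + 3 * D ω ^ 4 := fun ω => by
      rw [Finset.sum_range_succ]
      change (S ω + D ω) ^ 4 ≤ _
      nlinarith [sq_nonneg (S ω * D ω - D ω ^ 2)]
    have hdom : Integrable (fun ω =>
        S ω ^ 4 + 4 * (S ω ^ 3 * D ω) + 8 * (S ω ^ 2 * D ω ^ 2) + 3 * D ω ^ 4) P :=
      ((hSi.add (i31.const_mul 4)).add (i22.const_mul 8)).add (hDi.const_mul 3)
    have hmeas : Measurable fun ω => (∑ t ∈ Finset.range (n + 1), ψ (X t ω) * χ (e t ω)) ^ 4 :=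
      ((h.measurable_weighted_sum hψ hχ (n + 1)).mono (ℱ.le _) le_rfl).pow_const 4
    refine ⟨hdom.mono' hmeas.aestronglyMeasurable (Eventually.of_forall fun ω => ?_), ?_⟩
    · rw [Real.norm_of_nonneg (by positivity)]
      exact hpt ω
    · refine (integral_mono_of_nonneg (Eventually.of_forall fun ω => by positivity) hdom
        (Eventually.of_forall hpt)).trans ?_
      have j1 : Integrable (fun ω => S ω ^ 4 + 4 * (S ω ^ 3 * D ω)) P := hSi.add (i31.const_mul 4)
      have j2 : Integrable (fun ω => S ω ^ 4 + 4 * (S ω ^ 3 * D ω) + 8 * (S ω ^ 2 * D ω ^ 2)) P :=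
        j1.add (i22.const_mul 8)
      rw [integral_add j2 (hDi.const_mul 3), integral_add j1 (i22.const_mul 8),
        integral_add hSi (i31.const_mul 4), integral_const_mul, integral_const_mul,
        integral_const_mul, e31]
      have k1 : u * ∫ ω, S ω ^ 2 * Y ω ^ 2 ∂P ≤ u * (10 * B * (n * u + 1 / 2)) := by gcongr
      push_cast
      have hBu : 0 ≤ B * u := by positivity
      have hBuu : 0 ≤ B * u ^ 2 := by positivity
      have hnB : 0 ≤ n * (B * u ^ 2) := by positivity
      nlinarith

end ErgodicChain

end

section

variable {q : ℕ} {Ω : Type*} [mΩ : MeasurableSpace Ω]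

theorem sq_le_one_add_pow_four (x : ℝ) : x ^ 2 ≤ 1 + x ^ 4 := by
  nlinarith [sq_nonneg (x ^ 2 - 1), sq_nonneg x]

theorem abs_le_one_add_pow_four (x : ℝ) : |x| ≤ 1 + x ^ 4 := by
  have h1 : x ^ 4 = |x| ^ 4 := by rw [← abs_pow, abs_of_nonneg (by positivity)]
  rw [h1]
  nlinarith [sq_nonneg (|x| ^ 2 - 1 / 2), sq_nonneg (|x| - 1 / 2), abs_nonneg x]

theorem mul_le_half_add {x y l : ℝ} (hl : 0 < l) : x * y ≤ (l * x ^ 2 + l⁻¹ * y ^ 2) / 2 := by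
  have h2 : 0 ≤ l⁻¹ * (l * x - y) ^ 2 := by positivity
  have h3 : l⁻¹ * (l * x - y) ^ 2 = l * x ^ 2 - 2 * (x * y) + l⁻¹ * y ^ 2 := by
    field_simp
    ring
  linarith

namespace ErgodicChain

variable {P : Measure Ω} [IsProbabilityMeasure P] {ν : Measure ℝ} {a : Fin (q + 1) → ℝ}
  {X : ℕ → Ω → Fin (q + 1) → ℝ} {e : ℕ → Ω → ℝ} {ℱ : Filtration ℕ mΩ} {C γ : ℝ}

/-- Geometric decay of the autocovariances of a function of the chain with four moments. -/
theorem abs_covariance_le (h : ErgodicChain P ν a X e ℱ C γ) {ψ : (Fin (q + 1) → ℝ) → ℝ}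
    (hψ : Measurable ψ) {B : ℝ} (hψi : Integrable (fun ω => ψ (X 0 ω) ^ 4) P)
    (hψB : ∫ ω, ψ (X 0 ω) ^ 4 ∂P ≤ B) {κ : ℝ} (hκ : 0 < κ) (hκγ : κ ^ 4 = γ) (s d : ℕ) :
    |∫ ω, ψ (X s ω) * ψ (X (s + d) ω) ∂P - (∫ ω, ψ (X 0 ω) ∂P) ^ 2| ≤
      (1 + 2 * B + C * (1 + C) + (1 + B) ^ 2) * κ ^ d := by
  have := h.prob
  have hC := h.C_nonneg
  have hB0 : 0 ≤ B := (integral_nonneg fun ω => by positivity).trans hψB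
  have hψ4 : Measurable fun U => ψ U ^ 4 := hψ.pow_const 4
  have hi4 : ∀ t, Integrable (fun ω => ψ (X t ω) ^ 4) P := h.integrable_comp_X hψ4 hψi
  have hB4 : ∀ t, ∫ ω, ψ (X t ω) ^ 4 ∂P ≤ B := fun t => by rw [h.integral_comp_X hψ4 t]; exact hψB
  have hm : ∀ t, Measurable fun ω => ψ (X t ω) := fun t => hψ.comp (h.measurable_X t)
  have hi2 : ∀ t, Integrable (fun ω => ψ (X t ω) ^ 2) P := fun t =>
    ((integrable_const 1).add (hi4 t)).mono' ((hm t).pow_const 2).aestronglyMeasurable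
      (Eventually.of_forall fun ω => by
        rw [Real.norm_of_nonneg (sq_nonneg _)]; exact sq_le_one_add_pow_four _)
  have hi1 : ∀ t, Integrable (fun ω => ψ (X t ω)) P := fun t =>
    ((integrable_const 1).add (hi4 t)).mono' (hm t).aestronglyMeasurable
      (Eventually.of_forall fun ω => abs_le_one_add_pow_four _)
  have hB2 : ∀ t, ∫ ω, ψ (X t ω) ^ 2 ∂P ≤ 1 + B := fun t => by
    refine (integral_mono (hi2 t) ((integrable_const 1).add (hi4 t)) fun ω =>
      sq_le_one_add_pow_four _).trans ?_
    simp only [Pi.add_apply]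
    rw [integral_add (integrable_const _) (hi4 t)]
    simpa using hB4 t
  have hK : 0 < κ ^ d := by positivity
  set k := κ ^ d with hk
  have hγd : γ ^ d = k ^ 4 := by rw [← hκγ, hk, ← pow_mul, ← pow_mul, mul_comm]
  set ψs : (Fin (q + 1) → ℝ) → ℝ := fun U => if |ψ U| ≤ k⁻¹ then ψ U else 0 with hψs
  set ψl : (Fin (q + 1) → ℝ) → ℝ := fun U => if |ψ U| ≤ k⁻¹ then 0 else ψ U with hψl
  have hset : MeasurableSet {U | |ψ U| ≤ k⁻¹} := measurableSet_le hψ.abs measurable_const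
  have hψsm : Measurable ψs := Measurable.ite hset hψ measurable_const
  have hψlm : Measurable ψl := Measurable.ite hset measurable_const hψ
  have hsum : ∀ U, ψ U = ψs U + ψl U := fun U => by
    simp only [hψs, hψl]
    split_ifs <;> simp
  have hψsb : ∀ U, |ψs U| ≤ k⁻¹ := fun U => by
    simp only [hψs]
    split_ifs with hU
    · exact hU
    · simpa using hK.le
  have hψl2 : ∀ U, ψl U ^ 2 ≤ k ^ 2 * ψ U ^ 4 := fun U => by
    simp only [hψl]
    split_ifs with hU
    · simp only [ne_eq, OfNat.ofNat_ne_zero, not_false_eq_true, zero_pow]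
      positivity
    · have h1 : 1 ≤ k * |ψ U| := by
        rw [not_le, inv_lt_iff_one_lt_mul₀' hK] at hU
        exact hU.le
      have h2 : 1 ≤ (k * |ψ U|) ^ 2 := one_le_pow₀ h1
      rw [mul_pow, sq_abs] at h2
      nlinarith [sq_nonneg (ψ U)]
  have hψl1 : ∀ U, |ψl U| ≤ k * (1 + ψ U ^ 4) := fun U => by
    simp only [hψl]
    split_ifs with hU
    · simp only [abs_zero]
      positivity
    · have h1 : 1 ≤ k * |ψ U| := by
        rw [not_le, inv_lt_iff_one_lt_mul₀' hK] at hU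
        exact hU.le
      have h2 := sq_le_one_add_pow_four (ψ U)
      calc |ψ U| ≤ k * |ψ U| * |ψ U| := le_mul_of_one_le_left (abs_nonneg _) h1
        _ = k * ψ U ^ 2 := by rw [mul_assoc, ← sq, sq_abs]
        _ ≤ _ := by gcongr
  set m := ∫ ω, ψ (X 0 ω) ∂P with hm0
  set ms := ∫ ω, ψs (X 0 ω) ∂P with hms
  set ml := ∫ ω, ψl (X 0 ω) ∂P with hml
  have hsi : ∀ t, Integrable (fun ω => ψs (X t ω)) P := fun t =>
    Integrable.of_bound (hψsm.comp (h.measurable_X t)).aestronglyMeasurable k⁻¹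
      (Eventually.of_forall fun ω => hψsb _)
  have hli : ∀ t, Integrable (fun ω => ψl (X t ω)) P := fun t =>
    (((integrable_const 1).add (hi4 t)).const_mul k).mono'
      (hψlm.comp (h.measurable_X t)).aestronglyMeasurable (Eventually.of_forall fun ω => hψl1 _)
  have hmsum : m = ms + ml := by
    rw [hm0, hms, hml, ← integral_add (hsi 0) (hli 0)]
    exact integral_congr_ae (Eventually.of_forall fun ω => hsum _)
  have hmb : |m| ≤ 1 + B := by
    refine (abs_integral_le_integral_abs).trans ?_
    refine (integral_mono (hi1 0).abs ((integrable_const 1).add (hi4 0)) fun ω =>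
      abs_le_one_add_pow_four _).trans ?_
    simp only [Pi.add_apply]
    rw [integral_add (integrable_const _) (hi4 0)]
    simpa using hB4 0
  have hmlb : |ml| ≤ k * (1 + B) := by
    refine (abs_integral_le_integral_abs).trans ?_
    refine (integral_mono (hli 0).abs (((integrable_const 1).add (hi4 0)).const_mul k) fun ω =>
      hψl1 _).trans ?_
    simp only [Pi.add_apply]
    rw [integral_const_mul, integral_add (integrable_const _) (hi4 0)]
    gcongr
    simp
  have hAs : Measurable[ℱ s] fun ω => ψ (X s ω) := hψ.comp (h.adapted s)
  set H := (transOp ν a)^[d] ψs with hH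
  have hHm : Measurable H := measurable_transOp_iterate ν a hψsm d
  have hHb : ∀ U, |H U| ≤ k⁻¹ := abs_transOp_iterate_le ν a hψsb d
  have hmsb : |ms| ≤ k⁻¹ := by
    simpa using norm_integral_le_of_norm_le_const (μ := P) (f := fun ω => ψs (X 0 ω))
      (Eventually.of_forall fun ω => hψsb (X 0 ω))
  have hmix : ∀ U, |H U - ms| ≤ k⁻¹ * C * k ^ 4 * (1 + ssq U) := fun U => by
    rw [← hγd]
    exact h.mixing hψsm hψsb d U
  have hssqi : Integrable (fun ω => ssq (X s ω)) P :=
    h.integrable_comp_X measurable_ssq h.ssq_integrable s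
  have hssq : ∫ ω, ssq (X s ω) ∂P ≤ C := by
    rw [h.integral_comp_X measurable_ssq s]; exact h.ssq_le
  have hHi : Integrable (fun ω => ψ (X s ω) * H (X s ω)) P :=
    (hi1 s).mul_bdd (hHm.comp (h.measurable_X s)).aestronglyMeasurable
      (Eventually.of_forall fun ω => hHb _)
  have hpt1 : ∀ ω, |ψ (X s ω) * (H (X s ω) - ms)| ≤
      k / 2 * ψ (X s ω) ^ 2 + k * C * (1 + ssq (X s ω)) := fun ω => by
    set z := k * |H (X s ω) - ms| with hz
    have hz0 : 0 ≤ z := by positivity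
    have hz2 : z ≤ 2 := by
      have h1 : |H (X s ω) - ms| ≤ k⁻¹ + k⁻¹ := (abs_sub _ _).trans (add_le_add (hHb _) hmsb)
      calc z ≤ k * (k⁻¹ + k⁻¹) := by rw [hz]; gcongr
        _ = 2 := by field_simp; norm_num
    have hzm : z ≤ C * k ^ 4 * (1 + ssq (X s ω)) := by
      calc z ≤ k * (k⁻¹ * C * k ^ 4 * (1 + ssq (X s ω))) := by rw [hz]; gcongr; exact hmix _
        _ = _ := by field_simp
    have hzz : z ^ 2 ≤ 2 * (C * k ^ 4 * (1 + ssq (X s ω))) := by nlinarith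
    have h1 := mul_le_half_add (x := |ψ (X s ω)|) (y := z) (l := k ^ 2) (by positivity)
    have h2 : |ψ (X s ω) * (H (X s ω) - ms)| = k⁻¹ * (|ψ (X s ω)| * z) := by
      rw [abs_mul, hz]
      field_simp
    rw [h2]
    calc k⁻¹ * (|ψ (X s ω)| * z)
        ≤ k⁻¹ * ((k ^ 2 * |ψ (X s ω)| ^ 2 + (k ^ 2)⁻¹ * z ^ 2) / 2) := by gcongr
      _ ≤ k⁻¹ * ((k ^ 2 * |ψ (X s ω)| ^ 2 +
            (k ^ 2)⁻¹ * (2 * (C * k ^ 4 * (1 + ssq (X s ω))))) / 2) := by gcongr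
      _ = _ := by
        rw [sq_abs]
        field_simp
  have hpt2 : ∀ ω, |ψ (X s ω) * ψl (X (s + d) ω)| ≤
      k / 2 * ψ (X s ω) ^ 2 + k / 2 * ψ (X (s + d) ω) ^ 4 := fun ω => by
    have h1 := mul_le_half_add (x := |ψ (X s ω)|) (y := |ψl (X (s + d) ω)|) (l := k) hK
    rw [abs_mul]
    refine h1.trans ?_
    rw [sq_abs, sq_abs]
    have h2 : k⁻¹ * ψl (X (s + d) ω) ^ 2 ≤ k * ψ (X (s + d) ω) ^ 4 := by
      calc k⁻¹ * ψl (X (s + d) ω) ^ 2 ≤ k⁻¹ * (k ^ 2 * ψ (X (s + d) ω) ^ 4) := by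
            gcongr; exact hψl2 _
        _ = _ := by field_simp
    linarith
  have hdom1 : Integrable (fun ω => k / 2 * ψ (X s ω) ^ 2 + k * C * (1 + ssq (X s ω))) P :=
    ((hi2 s).const_mul _).add (((integrable_const 1).add hssqi).const_mul _)
  have hdom2 : Integrable (fun ω => k / 2 * ψ (X s ω) ^ 2 + k / 2 * ψ (X (s + d) ω) ^ 4) P :=
    ((hi2 s).const_mul _).add ((hi4 _).const_mul _)
  have hψli : Integrable (fun ω => ψ (X s ω) * ψl (X (s + d) ω)) P :=
    hdom2.mono' ((hm s).mul (hψlm.comp (h.measurable_X _))).aestronglyMeasurable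
      (Eventually.of_forall hpt2)
  have hψsi : Integrable (fun ω => ψ (X s ω) * ψs (X (s + d) ω)) P :=
    (hi1 s).mul_bdd (hψsm.comp (h.measurable_X _)).aestronglyMeasurable
      (Eventually.of_forall fun ω => hψsb _)
  have b1 : |∫ ω, ψ (X s ω) * (H (X s ω) - ms) ∂P| ≤ k / 2 * (1 + B) + k * C * (1 + C) := by
    have h1 := norm_integral_le_of_norm_le (f := fun ω => ψ (X s ω) * (H (X s ω) - ms)) hdom1
      (Eventually.of_forall hpt1)
    refine h1.trans ?_
    have j : Integrable (fun ω => 1 + ssq (X s ω)) P := (integrable_const 1).add hssqi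
    rw [integral_add ((hi2 s).const_mul _) (j.const_mul _), integral_const_mul, integral_const_mul,
      integral_add (integrable_const _) hssqi]
    gcongr
    · exact hB2 s
    · simp
  have b2 : |∫ ω, ψ (X s ω) * ψl (X (s + d) ω) ∂P| ≤ k / 2 * (1 + B) + k / 2 * B := by
    have h1 := norm_integral_le_of_norm_le (f := fun ω => ψ (X s ω) * ψl (X (s + d) ω)) hdom2
      (Eventually.of_forall hpt2)
    refine h1.trans ?_
    rw [integral_add ((hi2 s).const_mul _) ((hi4 _).const_mul _), integral_const_mul,
      integral_const_mul]
    gcongr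
    · exact hB2 s
    · exact hB4 _
  have hdecomp : ∫ ω, ψ (X s ω) * ψ (X (s + d) ω) ∂P - m ^ 2 =
      ∫ ω, ψ (X s ω) * (H (X s ω) - ms) ∂P + ∫ ω, ψ (X s ω) * ψl (X (s + d) ω) ∂P - m * ml := by
    have h1 : ∫ ω, ψ (X s ω) * ψ (X (s + d) ω) ∂P =
        ∫ ω, ψ (X s ω) * ψs (X (s + d) ω) ∂P + ∫ ω, ψ (X s ω) * ψl (X (s + d) ω) ∂P := by
      rw [← integral_add hψsi hψli]
      refine integral_congr_ae (Eventually.of_forall fun ω => ?_)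
      simp only [hsum (X (s + d) ω)]
      ring
    have h2 : ∫ ω, ψ (X s ω) * (H (X s ω) - ms) ∂P =
        ∫ ω, ψ (X s ω) * ψs (X (s + d) ω) ∂P - m * ms := by
      rw [h.integral_mul_iterate hAs (hi1 s) d hψsm hψsb]
      simp only [mul_sub]
      rw [integral_sub hHi ((hi1 s).mul_const ms), integral_mul_const, h.integral_comp_X hψ s]
    rw [h1, h2, hmsum]
    ring
  rw [hdecomp]
  have b3 : |m * ml| ≤ (1 + B) * (k * (1 + B)) := by
    rw [abs_mul]
    gcongr
  have t1 := abs_sub (∫ ω, ψ (X s ω) * (H (X s ω) - ms) ∂P +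
    ∫ ω, ψ (X s ω) * ψl (X (s + d) ω) ∂P) (m * ml)
  have t2 := abs_add_le (∫ ω, ψ (X s ω) * (H (X s ω) - ms) ∂P)
    (∫ ω, ψ (X s ω) * ψl (X (s + d) ω) ∂P)
  nlinarith

/-- The variance of the partial sums grows at most linearly, uniformly in the chain. -/
theorem variance_sum_le (h : ErgodicChain P ν a X e ℱ C γ) {ψ : (Fin (q + 1) → ℝ) → ℝ}
    (hψ : Measurable ψ) {B : ℝ} (hψi : Integrable (fun ω => ψ (X 0 ω) ^ 4) P)
    (hψB : ∫ ω, ψ (X 0 ω) ^ 4 ∂P ≤ B) {κ : ℝ} (hκ : 0 < κ) (hκ1 : κ < 1) (hκγ : κ ^ 4 = γ) (n : ℕ) :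
    Integrable (fun ω => (∑ t ∈ Finset.range n, (ψ (X t ω) - ∫ ω, ψ (X 0 ω) ∂P)) ^ 2) P ∧
    ∫ ω, (∑ t ∈ Finset.range n, (ψ (X t ω) - ∫ ω, ψ (X 0 ω) ∂P)) ^ 2 ∂P ≤
      n * ((1 + 2 * B + C * (1 + C) + (1 + B) ^ 2) * (2 * (1 - κ)⁻¹)) := by
  have hC := h.C_nonneg
  have hB0 : 0 ≤ B := (integral_nonneg fun ω => by positivity).trans hψB
  set c := 1 + 2 * B + C * (1 + C) + (1 + B) ^ 2 with hc
  have hc0 : 0 ≤ c := by positivity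
  set m := ∫ ω, ψ (X 0 ω) ∂P with hm0
  have hm : ∀ t, Measurable fun ω => ψ (X t ω) := fun t => hψ.comp (h.measurable_X t)
  have hi4 : ∀ t, Integrable (fun ω => ψ (X t ω) ^ 4) P :=
    h.integrable_comp_X (hψ.pow_const 4) hψi
  have hL2 : ∀ t, MemLp (fun ω => ψ (X t ω)) 2 P := fun t => by
    rw [memLp_two_iff_integrable_sq (hm t).aestronglyMeasurable]
    exact ((integrable_const 1).add (hi4 t)).mono' ((hm t).pow_const 2).aestronglyMeasurable
      (Eventually.of_forall fun ω => by
        rw [Real.norm_of_nonneg (sq_nonneg _)]; exact sq_le_one_add_pow_four _)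
  have hL2c : ∀ t, MemLp (fun ω => ψ (X t ω) - m) 2 P := fun t => (hL2 t).sub (memLp_const m)
  have hS2 : ∀ n, MemLp (fun ω => ∑ t ∈ Finset.range n, (ψ (X t ω) - m)) 2 P := fun n =>
    memLp_finsetSum _ fun t _ => hL2c t
  have hcov : ∀ s d, ∫ ω, (ψ (X s ω) - m) * (ψ (X (s + d) ω) - m) ∂P ≤ c * κ ^ d := fun s d => by
    have hi1 : ∀ t, Integrable (fun ω => ψ (X t ω)) P := fun t => (hL2 t).integrable (by norm_num)
    have hii := (hL2 s).integrable_mul (hL2 (s + d))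
    simp only [Pi.mul_def] at hii
    have e1 : ∫ ω, (ψ (X s ω) - m) * (ψ (X (s + d) ω) - m) ∂P =
        ∫ ω, ψ (X s ω) * ψ (X (s + d) ω) ∂P - m ^ 2 := by
      have e2 : ∀ ω, (ψ (X s ω) - m) * (ψ (X (s + d) ω) - m) =
          ψ (X s ω) * ψ (X (s + d) ω) - (m * ψ (X s ω) + m * ψ (X (s + d) ω) - m ^ 2) := fun ω => by
        ring
      simp only [e2]
      have j1 : Integrable (fun ω => m * ψ (X s ω) + m * ψ (X (s + d) ω)) P :=
        ((hi1 s).const_mul m).add ((hi1 _).const_mul m)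
      have j2 : Integrable (fun ω => m * ψ (X s ω) + m * ψ (X (s + d) ω) - m ^ 2) P :=
        j1.sub (integrable_const _)
      rw [integral_sub hii j2, integral_sub j1 (integrable_const _),
        integral_add ((hi1 s).const_mul m) ((hi1 _).const_mul m), integral_const_mul,
        integral_const_mul, h.integral_comp_X hψ s, h.integral_comp_X hψ (s + d)]
      simp
      ring
    rw [e1]
    exact (le_abs_self _).trans (h.abs_covariance_le hψ hψi hψB hκ hκγ s d)
  refine ⟨(memLp_two_iff_integrable_sq (hS2 n).aestronglyMeasurable).1 (hS2 n), ?_⟩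
  induction n with
  | zero => simp
  | succ n ih =>
    set S : Ω → ℝ := fun ω => ∑ t ∈ Finset.range n, (ψ (X t ω) - m) with hS
    set D : Ω → ℝ := fun ω => ψ (X n ω) - m with hD
    have hSi : Integrable (fun ω => S ω ^ 2) P :=
      (memLp_two_iff_integrable_sq (hS2 n).aestronglyMeasurable).1 (hS2 n)
    have hDi : Integrable (fun ω => D ω ^ 2) P :=
      (memLp_two_iff_integrable_sq (hL2c n).aestronglyMeasurable).1 (hL2c n)
    have hprod : ∀ t, Integrable (fun ω => (ψ (X t ω) - m) * D ω) P := fun t =>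
      (hL2c t).integrable_mul (hL2c n)
    have hSDi : Integrable (fun ω => S ω * D ω) P := (hS2 n).integrable_mul (hL2c n)
    have e1 : ∀ ω, (∑ t ∈ Finset.range (n + 1), (ψ (X t ω) - m)) ^ 2 =
        S ω ^ 2 + 2 * (S ω * D ω) + D ω ^ 2 := fun ω => by
      rw [Finset.sum_range_succ]
      change (S ω + D ω) ^ 2 = _
      ring
    simp only [e1]
    have j1 : Integrable (fun ω => S ω ^ 2 + 2 * (S ω * D ω)) P := hSi.add (hSDi.const_mul 2)
    rw [integral_add j1 hDi, integral_add hSi (hSDi.const_mul 2), integral_const_mul]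
    have hDD : ∫ ω, D ω ^ 2 ∂P ≤ c := by
      have := hcov n 0
      simp only [add_zero, pow_zero, mul_one] at this
      simpa only [sq] using this
    have hSD : ∫ ω, S ω * D ω ∂P ≤ c * (κ * (1 - κ)⁻¹) := by
      have e2 : ∀ ω, S ω * D ω = ∑ t ∈ Finset.range n, (ψ (X t ω) - m) * D ω := fun ω => by
        rw [hS, Finset.sum_mul]
      simp only [e2]
      rw [integral_finsetSum _ fun t _ => hprod t]
      have h1 : ∀ t ∈ Finset.range n, ∫ ω, (ψ (X t ω) - m) * D ω ∂P ≤ c * κ ^ (n - t) :=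
        fun t ht => by
          have := hcov t (n - t)
          rwa [Nat.add_sub_cancel' (Finset.mem_range.1 ht).le] at this
      refine (Finset.sum_le_sum h1).trans ?_
      rw [← Finset.mul_sum]
      gcongr
      have h2 : ∑ t ∈ Finset.range n, κ ^ (n - t) = κ * ∑ t ∈ Finset.range n, κ ^ t := by
        rw [← Finset.sum_range_reflect, Finset.mul_sum]
        refine Finset.sum_congr rfl fun t ht => ?_
        rw [← pow_succ']
        congr 1
        have := Finset.mem_range.1 ht
        omega
      rw [h2]
      gcongr
      have h3 : (∑ t ∈ Finset.range n, κ ^ t) * (1 - κ) = 1 - κ ^ n := geom_sum_mul_neg κ n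
      rw [← div_eq_mul_inv 1 (1 - κ) |>.trans (one_mul _), le_div_iff₀ (by linarith), h3]
      have : 0 ≤ κ ^ n := by positivity
      linarith
    push_cast
    have hid : 2 * (c * (κ * (1 - κ)⁻¹)) + c ≤ c * (2 * (1 - κ)⁻¹) := by
      have h1 : (1 - κ)⁻¹ * (1 - κ) = 1 := inv_mul_cancel₀ (by linarith)
      have h2 : c * (2 * (1 - κ)⁻¹) - 2 * (c * (κ * (1 - κ)⁻¹)) = 2 * c := by
        linear_combination 2 * c * h1
      linarith
    linarith

end ErgodicChain

end

section

variable {q : ℕ} {Ω : Type*} [mΩ : MeasurableSpace Ω]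

namespace RegularNoise

variable {ν : Measure ℝ} {m₂ C B : ℝ}

theorem strictMono_cdf (hν : RegularNoise ν m₂ C B) : StrictMono (cdf ν) := by
  have := hν.prob
  intro u v huv
  rw [cdf_eq_real, cdf_eq_real, ← Set.Iic_union_Ioc_eq_Iic huv.le,
    measureReal_union (Set.Iic_disjoint_Ioc le_rfl) measurableSet_Ioc]
  linarith [hν.strict huv]

theorem continuous_cdf (hν : RegularNoise ν m₂ C B) : Continuous (cdf ν) := by
  have := hν.prob
  have key : ∀ u v, u ≤ v → cdf ν v - cdf ν u ≤ B * (v - u) := fun u v huv => by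
    rw [cdf_eq_real, cdf_eq_real, ← Set.Iic_union_Ioc_eq_Iic huv,
      measureReal_union (Set.Iic_disjoint_Ioc le_rfl) measurableSet_Ioc, add_sub_cancel_left]
    have h1 := hν.interval_le u (v - u) (by linarith)
    rw [add_sub_cancel] at h1
    exact (measureReal_mono Set.Ioc_subset_Icc_self).trans h1
  have hB := hν.B_nonneg
  refine (LipschitzWith.of_dist_le_mul (K := B.toNNReal) fun u v => ?_).continuous
  rw [Real.dist_eq, Real.dist_eq, Real.coe_toNNReal B hB]
  rcases le_total u v with h | h
  · rw [abs_sub_comm, abs_sub_comm u, abs_of_nonneg (by linarith [monotone_cdf ν h]),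
      abs_of_nonneg (by linarith)]
    exact key u v h
  · rw [abs_of_nonneg (by linarith [monotone_cdf ν h]), abs_of_nonneg (by linarith)]
    exact key v u h

theorem cdf_pos (hν : RegularNoise ν m₂ C B) (x : ℝ) : 0 < cdf ν x :=
  (cdf_nonneg ν (x - 1)).trans_lt (hν.strictMono_cdf (by linarith))

theorem cdf_lt_one (hν : RegularNoise ν m₂ C B) (x : ℝ) : cdf ν x < 1 :=
  (hν.strictMono_cdf (by linarith)).trans_le (cdf_le_one ν (x + 1))

/-- The probability integral transform. -/
theorem measureReal_cdf_le (hν : RegularNoise ν m₂ C B) {u : ℝ} (hu : 0 ≤ u) (hu1 : u ≤ 1) :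
    ν.real {x | cdf ν x ≤ u} = u := by
  have := hν.prob
  rcases hu.eq_or_lt with rfl | hu0
  · have : {x | cdf ν x ≤ 0} = ∅ := by
      ext x
      simpa using hν.cdf_pos x
    simp [this]
  rcases hu1.eq_or_lt with rfl | hu1'
  · have : {x | cdf ν x ≤ 1} = Set.univ := by
      ext x
      simpa using cdf_le_one ν x
    simp [this]
  obtain ⟨x₁, h₁⟩ := ((tendsto_cdf_atBot ν).eventually (gt_mem_nhds hu0)).exists
  obtain ⟨x₂, h₂⟩ := ((tendsto_cdf_atTop ν).eventually (lt_mem_nhds hu1')).exists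
  obtain ⟨x, hx⟩ := mem_range_of_exists_le_of_exists_ge hν.continuous_cdf ⟨x₁, h₁.le⟩ ⟨x₂, h₂.le⟩
  have : {y | cdf ν y ≤ u} = Set.Iic x := by
    ext y
    rw [Set.mem_ofPred_eq, ← hx, hν.strictMono_cdf.le_iff_le, Set.mem_Iic]
  rw [this, ← cdf_eq_real, hx]

end RegularNoise

/-- The centred weighted empirical process of points `v t`. -/
def wemp (n : ℕ) (w v : ℕ → ℝ) (u : ℝ) : ℝ :=
  ∑ t ∈ Finset.range n, w t * ((if v t ≤ u then 1 else 0) - u)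

/-- The weighted sum of the fourth powers of the dyadic increments up to level `J`. -/
def dyadicEnergy (n J : ℕ) (w v : ℕ → ℝ) : ℝ :=
  ∑ j ∈ Finset.range (J + 1), ∑ i ∈ Finset.range (2 ^ j),
    ((10 / 9 : ℝ) ^ 4) ^ j * (wemp n w v ((i + 1) / 2 ^ j) - wemp n w v (i / 2 ^ j)) ^ 4

theorem abs_dyadic_increment_le {n J : ℕ} {w v : ℕ → ℝ} {T : ℝ} (hT : 0 ≤ T)
    (hQ : dyadicEnergy n J w v ≤ T ^ 4) {j i : ℕ} (hj : j ≤ J) (hi : i < 2 ^ j) :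
    |wemp n w v ((i + 1) / 2 ^ j) - wemp n w v (i / 2 ^ j)| ≤ T * (9 / 10) ^ j := by
  set x := wemp n w v ((i + 1) / 2 ^ j) - wemp n w v (i / 2 ^ j) with hx
  have h1 : ((10 / 9 : ℝ) ^ 4) ^ j * x ^ 4 ≤ T ^ 4 := by
    refine le_trans ?_ hQ
    unfold dyadicEnergy
    refine le_trans ?_ (Finset.single_le_sum (f := fun j => ∑ i ∈ Finset.range (2 ^ j),
      ((10 / 9 : ℝ) ^ 4) ^ j * (wemp n w v ((i + 1) / 2 ^ j) - wemp n w v (i / 2 ^ j)) ^ 4)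
      (fun j _ => Finset.sum_nonneg fun i _ => by positivity) (Finset.mem_range.2 (show j < J + 1 by omega)))
    exact Finset.single_le_sum (f := fun i : ℕ => ((10 / 9 : ℝ) ^ 4) ^ j *
      (wemp n w v ((i + 1) / 2 ^ j) - wemp n w v (i / 2 ^ j)) ^ 4)
      (fun i _ => by positivity) (Finset.mem_range.2 hi)
  have h2 : ((10 / 9 : ℝ) ^ j * |x|) ^ 4 ≤ T ^ 4 := by
    refine le_trans (le_of_eq ?_) h1
    rw [mul_pow, ← abs_pow, abs_of_nonneg (show 0 ≤ x ^ 4 by positivity), ← pow_mul, ← pow_mul,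
      mul_comm j 4]
  have h3 : (10 / 9 : ℝ) ^ j * |x| ≤ T := le_of_pow_le_pow_left₀ (by norm_num) hT h2
  have h4 : (9 / 10 : ℝ) ^ j * (10 / 9) ^ j = 1 := by
    rw [← mul_pow]
    norm_num
  calc |x| = (9 / 10 : ℝ) ^ j * ((10 / 9) ^ j * |x|) := by rw [← mul_assoc, h4, one_mul]
    _ ≤ (9 / 10) ^ j * T := by gcongr
    _ = _ := mul_comm _ _

theorem abs_wemp_dyadic_le {n J : ℕ} {w v : ℕ → ℝ} (hv : ∀ t, 0 < v t) {T : ℝ} (hT : 0 ≤ T)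
    (hQ : dyadicEnergy n J w v ≤ T ^ 4) {u : ℝ} (hu : 0 ≤ u) (hu1 : u < 1) {j : ℕ} (hj : j ≤ J) :
    |wemp n w v (⌊2 ^ j * u⌋₊ / 2 ^ j)| ≤ T * (9 * (1 - (9 / 10) ^ j)) := by
  induction j with
  | zero =>
    have h0 : ⌊u⌋₊ = 0 := Nat.floor_eq_zero.2 hu1
    simp [h0, wemp, not_le.2 (hv _)]
  | succ j ih =>
    have ih' := ih (by omega)
    set k := ⌊2 ^ j * u⌋₊ with hk
    have hk1 : (k : ℝ) ≤ 2 ^ j * u := Nat.floor_le (by positivity)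
    have hk2 : 2 ^ j * u < k + 1 := Nat.lt_floor_add_one _
    set k' := ⌊2 ^ (j + 1) * u⌋₊ with hk'
    have hk'1 : (k' : ℝ) ≤ 2 ^ (j + 1) * u := Nat.floor_le (by positivity)
    have hk'2 : 2 ^ (j + 1) * u < k' + 1 := Nat.lt_floor_add_one _
    have e1 : (2 : ℝ) ^ (j + 1) * u = 2 * (2 ^ j * u) := by ring
    rw [e1] at hk'1 hk'2
    have c1 : 2 * k < k' + 1 := by
      have : (2 * k : ℝ) < k' + 1 := by linarith
      exact_mod_cast this
    have c2 : k' < 2 * k + 2 := by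
      have : (k' : ℝ) < 2 * k + 2 := by linarith
      exact_mod_cast this
    have hstep : T * (9 * (1 - (9 / 10) ^ j)) + T * (9 / 10) ^ (j + 1) =
        T * (9 * (1 - (9 / 10) ^ (j + 1))) := by
      rw [pow_succ]
      ring
    rw [← hstep]
    have hpow : 0 ≤ T * (9 / 10 : ℝ) ^ (j + 1) := by positivity
    have hfrac : (k : ℝ) / 2 ^ j = (2 * k : ℕ) / 2 ^ (j + 1) := by
      rw [pow_succ]
      push_cast
      field_simp
    rcases (by omega : k' = 2 * k ∨ k' = 2 * k + 1) with hc | hc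
    · rw [hc, ← hfrac]
      linarith
    · have hi : 2 * k < 2 ^ (j + 1) := by
        have : (k' : ℝ) < 2 ^ (j + 1) := by
          refine hk'1.trans_lt ?_
          rw [pow_succ']
          have : (2 : ℝ) ^ j * u < 2 ^ j * 1 := by gcongr
          linarith
        have : k' < 2 ^ (j + 1) := by exact_mod_cast this
        omega
      have hinc := abs_dyadic_increment_le hT hQ hj hi
      rw [hfrac] at ih'
      rw [hc]
      have e2 : ((2 * k + 1 : ℕ) : ℝ) = ((2 * k : ℕ) : ℝ) + 1 := by push_cast; ring
      rw [e2]
      have := abs_add_le (wemp n w v (((2 * k : ℕ) : ℝ) / 2 ^ (j + 1)))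
        (wemp n w v ((((2 * k : ℕ) : ℝ) + 1) / 2 ^ (j + 1)) -
          wemp n w v (((2 * k : ℕ) : ℝ) / 2 ^ (j + 1)))
      rw [add_sub_cancel] at this
      linarith

/-- Chaining along dyadic points. -/
theorem abs_wemp_le {n J : ℕ} {w v : ℕ → ℝ} (hv : ∀ t, 0 < v t) {T : ℝ} (hT : 0 ≤ T)
    (hQ : dyadicEnergy n J w v ≤ T ^ 4) (hQ' : dyadicEnergy n J (fun t => |w t|) v ≤ T ^ 4)
    {u : ℝ} (hu : 0 ≤ u) (hu1 : u < 1) :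
    |wemp n w v u| ≤ 10 * T + 2 / 2 ^ J * ∑ t ∈ Finset.range n, |w t| := by
  set k := ⌊2 ^ J * u⌋₊ with hk
  have hk1 : (k : ℝ) ≤ 2 ^ J * u := Nat.floor_le (by positivity)
  have hk2 : 2 ^ J * u < k + 1 := Nat.lt_floor_add_one _
  set a : ℝ := k / 2 ^ J with ha
  set b : ℝ := (k + 1) / 2 ^ J with hb
  have hau : a ≤ u := by rw [ha, div_le_iff₀ (by positivity)]; linarith
  have hub : u ≤ b := by rw [hb, le_div_iff₀ (by positivity)]; linarith
  have hba : b - a = 1 / 2 ^ J := by rw [hb, ha]; ring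
  have hki : k < 2 ^ J := by
    have : (k : ℝ) < 2 ^ J := by
      refine hk1.trans_lt ?_
      have : (2 : ℝ) ^ J * u < 2 ^ J * 1 := by gcongr
      linarith
    exact_mod_cast this
  have h1 : |wemp n w v a| ≤ T * 9 := by
    refine (abs_wemp_dyadic_le hv hT hQ hu hu1 le_rfl).trans ?_
    gcongr
    have : (0 : ℝ) ≤ (9 / 10) ^ J := by positivity
    linarith
  have h2 : |wemp n w v u - wemp n w v a| ≤
      (wemp n (fun t => |w t|) v b - wemp n (fun t => |w t|) v a) +
        2 / 2 ^ J * ∑ t ∈ Finset.range n, |w t| := by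
    unfold wemp
    rw [← Finset.sum_sub_distrib, ← Finset.sum_sub_distrib, Finset.mul_sum,
      ← Finset.sum_add_distrib]
    refine (Finset.abs_sum_le_sum_abs _ _).trans (Finset.sum_le_sum fun t _ => ?_)
    rw [← mul_sub, ← mul_sub, abs_mul, mul_comm (2 / 2 ^ J), ← mul_add]
    refine mul_le_mul_of_nonneg_left ?_ (abs_nonneg _)
    have e1 : (2 : ℝ) / 2 ^ J = 2 * (b - a) := by rw [hba]; ring
    rw [e1]
    rw [abs_le]
    split_ifs <;> constructor <;> linarith
  have h3 : wemp n (fun t => |w t|) v b - wemp n (fun t => |w t|) v a ≤ T := by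
    refine (le_abs_self _).trans ((abs_dyadic_increment_le hT hQ' le_rfl hki).trans ?_)
    exact mul_le_of_le_one_right hT (pow_le_one₀ (by norm_num) (by norm_num))
  have h4 := abs_add_le (wemp n w v a) (wemp n w v u - wemp n w v a)
  rw [add_sub_cancel] at h4
  linarith

theorem sum_dyadic_weights_le {J : ℕ} {n : ℝ} (hJ : (2 : ℝ) ^ J ≤ n) :
    ∑ j ∈ Finset.range (J + 1), ((10 / 9 : ℝ) ^ 4) ^ j * (n ^ 2 / 2 ^ j + n) ≤ 8 * n ^ 2 := by
  obtain ⟨x, hx⟩ : ∃ x : ℝ, x = (10 / 9) ^ 4 := ⟨_, rfl⟩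
  rw [← hx]
  have hn : 0 ≤ n := le_trans (by positivity) hJ
  have hx2 : x ≤ 8 / 5 := by rw [hx]; norm_num
  have hx0 : 0 ≤ x := by rw [hx]; positivity
  have h1 : ∀ J : ℕ, ∑ j ∈ Finset.range (J + 1), x ^ j ≤ 3 * 2 ^ J := by
    intro J
    induction J with
    | zero => norm_num
    | succ J ih =>
      rw [Finset.sum_range_succ]
      have h2 : x ^ (J + 1) ≤ 2 ^ (J + 1) := pow_le_pow_left₀ hx0 (by linarith) _
      have h3 : (0 : ℝ) ≤ 2 ^ J := by positivity
      rw [pow_succ] at h2 ⊢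
      rw [pow_succ] at h2 ⊢
      linarith
  have h2 : ∑ j ∈ Finset.range (J + 1), (x / 2) ^ j ≤ 5 := by
    have h3 := geom_sum_mul_neg (x / 2) (J + 1)
    have h4 : 0 ≤ (x / 2) ^ (J + 1) := by positivity
    have h5 : 0 ≤ ∑ j ∈ Finset.range (J + 1), (x / 2) ^ j :=
      Finset.sum_nonneg fun j _ => by positivity
    nlinarith
  have h3 : ∀ j ∈ Finset.range (J + 1), x ^ j * (n ^ 2 / 2 ^ j + n) =
      n ^ 2 * (x / 2) ^ j + n * x ^ j := fun j _ => by
    rw [div_pow]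
    ring
  rw [Finset.sum_congr rfl h3, Finset.sum_add_distrib, ← Finset.mul_sum, ← Finset.mul_sum]
  have h4 : n ^ 2 * ∑ j ∈ Finset.range (J + 1), (x / 2) ^ j ≤ n ^ 2 * 5 := by gcongr
  have h5 : n * ∑ j ∈ Finset.range (J + 1), x ^ j ≤ n * (3 * n) := by
    gcongr
    exact (h1 J).trans (by linarith)
  nlinarith

namespace ErgodicChain

variable {P : Measure Ω} [IsProbabilityMeasure P] {ν : Measure ℝ} {a : Fin (q + 1) → ℝ}
  {X : ℕ → Ω → Fin (q + 1) → ℝ} {e : ℕ → Ω → ℝ} {ℱ : Filtration ℕ mΩ} {C γ : ℝ}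

theorem wemp_increment_moment (h : ErgodicChain P ν a X e ℱ C γ) {m₂ Ct Bt : ℝ}
    (hν : RegularNoise ν m₂ Ct Bt) {ψ : (Fin (q + 1) → ℝ) → ℝ}
    (hψ : Measurable ψ) {B : ℝ} (hψi : Integrable (fun ω => ψ (X 0 ω) ^ 4) P)
    (hψB : ∫ ω, ψ (X 0 ω) ^ 4 ∂P ≤ B) (n : ℕ) {u v : ℝ} (hu : 0 ≤ u) (huv : u ≤ v) (hv : v ≤ 1) :
    Integrable (fun ω => (wemp n (fun t => ψ (X t ω)) (fun t => cdf ν (e t ω)) v -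
      wemp n (fun t => ψ (X t ω)) (fun t => cdf ν (e t ω)) u) ^ 4) P ∧
    ∫ ω, (wemp n (fun t => ψ (X t ω)) (fun t => cdf ν (e t ω)) v -
      wemp n (fun t => ψ (X t ω)) (fun t => cdf ν (e t ω)) u) ^ 4 ∂P ≤
        100 * B * ((n : ℝ) ^ 2 * (v - u) ^ 2 + n * (v - u)) := by
  have := h.prob
  have hcm : Measurable (cdf ν) := hν.continuous_cdf.measurable
  let A : ℝ → Set ℝ := fun u => {x | cdf ν x ≤ u}
  have hAm : ∀ u, MeasurableSet (A u) := fun u => measurableSet_le hcm measurable_const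
  set χ : ℝ → ℝ := fun x => (if cdf ν x ≤ v then 1 else 0) - (if cdf ν x ≤ u then 1 else 0) -
    (v - u) with hχdef
  have hI : ∀ w, Measurable fun x => (if cdf ν x ≤ w then (1 : ℝ) else 0) := fun w =>
    Measurable.ite (hAm w) measurable_const measurable_const
  have hχ : Measurable χ := ((hI v).sub (hI u)).sub measurable_const
  have hIi : ∀ w, Integrable (fun x => (if cdf ν x ≤ w then (1 : ℝ) else 0)) ν := fun w =>
    Integrable.of_bound (hI w).aestronglyMeasurable 1 (Eventually.of_forall fun x => by
      split_ifs <;> simp)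
  have hIe : ∀ w, 0 ≤ w → w ≤ 1 → ∫ x, (if cdf ν x ≤ w then (1 : ℝ) else 0) ∂ν = w :=
    fun w hw hw1 => by
      have : (fun x => (if cdf ν x ≤ w then (1 : ℝ) else 0)) = (A w).indicator 1 := by
        ext x
        simp [A, Set.indicator_apply]
      rw [this, integral_indicator_one (hAm w)]
      exact hν.measureReal_cdf_le hw hw1
  set D : ℝ → ℝ := fun x => (if cdf ν x ≤ v then 1 else 0) - (if cdf ν x ≤ u then 1 else 0) with hD
  have hDi : Integrable D ν := (hIi v).sub (hIi u)
  have hDe : ∫ x, D x ∂ν = v - u := by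
    rw [hD, integral_sub (hIi v) (hIi u), hIe v (by linarith) hv, hIe u hu (by linarith)]
  have hD01 : ∀ x, D x ^ 2 = D x ∧ 0 ≤ D x ∧ D x ≤ 1 := fun x => by
    simp only [hD]
    split_ifs with h1 h2 h2
    · norm_num
    · norm_num
    · exact absurd (h2.trans huv) h1
    · norm_num
  have hχ0 : ∫ x, χ x ∂ν = 0 := by
    have : ∫ x, χ x ∂ν = ∫ x, (D x - (v - u)) ∂ν := rfl
    rw [this, integral_sub hDi (integrable_const _), hDe]
    simp
  have hχ1 : ∀ x, |χ x| ≤ 1 := fun x => by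
    have : χ x = D x - (v - u) := rfl
    have := hD01 x
    rw [abs_le]
    constructor <;> linarith
  have hχu : ∫ x, χ x ^ 2 ∂ν ≤ v - u := by
    have h1 : ∀ x, χ x ^ 2 = (1 - 2 * (v - u)) * D x + (v - u) ^ 2 := fun x => by
      have h2 : χ x = D x - (v - u) := rfl
      have h3 := (hD01 x).1
      rw [h2]
      linear_combination h3
    simp only [h1]
    rw [integral_add (hDi.const_mul _) (integrable_const _), integral_const_mul, hDe]
    simp
    nlinarith
  have hmain := h.fourth_moment hψ hψi hψB hχ hχ1 hχ0 (sub_nonneg.2 huv) hχu n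
  have he : ∀ ω, wemp n (fun t => ψ (X t ω)) (fun t => cdf ν (e t ω)) v -
      wemp n (fun t => ψ (X t ω)) (fun t => cdf ν (e t ω)) u =
      ∑ t ∈ Finset.range n, ψ (X t ω) * χ (e t ω) := fun ω => by
    unfold wemp
    rw [← Finset.sum_sub_distrib]
    refine Finset.sum_congr rfl fun t _ => ?_
    simp only [hχdef]
    ring
  simp only [he]
  exact hmain

theorem dyadicEnergy_moment (h : ErgodicChain P ν a X e ℱ C γ) {m₂ Ct Bt : ℝ}
    (hν : RegularNoise ν m₂ Ct Bt) {ψ : (Fin (q + 1) → ℝ) → ℝ}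
    (hψ : Measurable ψ) {B : ℝ} (hψi : Integrable (fun ω => ψ (X 0 ω) ^ 4) P)
    (hψB : ∫ ω, ψ (X 0 ω) ^ 4 ∂P ≤ B) {n J : ℕ} (hJ : (2 : ℝ) ^ J ≤ n) :
    Integrable (fun ω => dyadicEnergy n J (fun t => ψ (X t ω)) (fun t => cdf ν (e t ω))) P ∧
    ∫ ω, dyadicEnergy n J (fun t => ψ (X t ω)) (fun t => cdf ν (e t ω)) ∂P ≤
      800 * B * (n : ℝ) ^ 2 := by
  have hB0 : 0 ≤ B := (integral_nonneg fun ω => by positivity).trans hψB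
  have hinc : ∀ j i : ℕ, i < 2 ^ j → _ := fun j i hi =>
    h.wemp_increment_moment hν hψ hψi hψB n (u := i / 2 ^ j) (v := (i + 1) / 2 ^ j)
      (by positivity) (by gcongr; linarith) (by
        rw [div_le_one (by positivity)]
        exact_mod_cast hi)
  unfold dyadicEnergy
  have hi1 : ∀ j : ℕ, ∀ i ∈ Finset.range (2 ^ j), Integrable (fun ω => ((10 / 9 : ℝ) ^ 4) ^ j *
      (wemp n (fun t => ψ (X t ω)) (fun t => cdf ν (e t ω)) ((i + 1) / 2 ^ j) -
        wemp n (fun t => ψ (X t ω)) (fun t => cdf ν (e t ω)) (i / 2 ^ j)) ^ 4) P :=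
    fun j i hi => (hinc j i (Finset.mem_range.1 hi)).1.const_mul _
  refine ⟨integrable_finsetSum _ fun j _ => integrable_finsetSum _ fun i hi => hi1 j i hi, ?_⟩
  rw [integral_finsetSum _ fun j _ => integrable_finsetSum _ fun i hi => hi1 j i hi]
  calc _ ≤ ∑ j ∈ Finset.range (J + 1), 100 * B * (((10 / 9 : ℝ) ^ 4) ^ j *
        ((n : ℝ) ^ 2 / 2 ^ j + n)) := by
        refine Finset.sum_le_sum fun j _ => ?_
        rw [integral_finsetSum _ fun i hi => hi1 j i hi]
        have hle : ∀ i ∈ Finset.range (2 ^ j), ∫ ω, ((10 / 9 : ℝ) ^ 4) ^ j *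
            (wemp n (fun t => ψ (X t ω)) (fun t => cdf ν (e t ω)) ((i + 1) / 2 ^ j) -
            wemp n (fun t => ψ (X t ω)) (fun t => cdf ν (e t ω)) (i / 2 ^ j)) ^ 4 ∂P ≤
            ((10 / 9 : ℝ) ^ 4) ^ j * (100 * B * ((n : ℝ) ^ 2 * (1 / 2 ^ j) ^ 2 + n * (1 / 2 ^ j))) :=
          fun i hi => by
            rw [integral_const_mul]
            have := (hinc j i (Finset.mem_range.1 hi)).2
            have e1 : ((i : ℝ) + 1) / 2 ^ j - i / 2 ^ j = 1 / 2 ^ j := by ring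
            rw [e1] at this
            gcongr
        refine (Finset.sum_le_sum hle).trans (le_of_eq ?_)
        rw [Finset.sum_const, Finset.card_range, nsmul_eq_mul]
        push_cast
        field_simp
    _ ≤ 800 * B * (n : ℝ) ^ 2 := by
        rw [← Finset.mul_sum]
        have := sum_dyadic_weights_le hJ
        calc 100 * B * _ ≤ 100 * B * (8 * (n : ℝ) ^ 2) := by gcongr
          _ = _ := by ring

end ErgodicChain

end

section

variable {q : ℕ} {Ω : Type*} [mΩ : MeasurableSpace Ω]

theorem measureReal_lt_le_div {P : Measure Ω} [IsProbabilityMeasure P] {f : Ω → ℝ}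
    (hf0 : ∀ ω, 0 ≤ f ω) (hf : Integrable f P) {c K : ℝ} (hc : 0 < c) (hK : ∫ ω, f ω ∂P ≤ K) :
    P.real {ω | c < f ω} ≤ K / c := by
  rw [le_div_iff₀' hc]
  refine le_trans ?_ ((mul_meas_ge_le_integral_of_nonneg (Eventually.of_forall hf0) hf c).trans hK)
  refine mul_le_mul_of_nonneg_left (measureReal_mono ?_ (measure_ne_top _ _)) hc.le
  intro ω (hω : c < f ω)
  exact hω.le

theorem exists_fourth_root {γ : ℝ} (hγ : 0 < γ) (hγ1 : γ < 1) : ∃ κ : ℝ, 0 < κ ∧ κ < 1 ∧ κ ^ 4 = γ := by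
  refine ⟨γ ^ (1 / 4 : ℝ), by positivity, Real.rpow_lt_one hγ.le hγ1 (by norm_num), ?_⟩
  rw [← Real.rpow_natCast, ← Real.rpow_mul hγ.le]
  norm_num

/-- At the true parameter the weighted empirical process is bounded in probability, uniformly in
its argument, the sample size and the chain. -/
theorem exists_bound_at_true {P : Measure Ω} [IsProbabilityMeasure P] {ν : Measure ℝ}
    {m₂ Ct Bt : ℝ} (hν : RegularNoise ν m₂ Ct Bt) {C γ : ℝ} (hC : 0 ≤ C) (hγ : 0 < γ) (hγ1 : γ < 1)
    {B : ℝ} (hB : 0 ≤ B) {η : ℝ} (hη : 0 < η) :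
    ∃ T : ℝ, 0 ≤ T ∧ ∀ {a : Fin (q + 1) → ℝ} {X : ℕ → Ω → Fin (q + 1) → ℝ} {e : ℕ → Ω → ℝ}
      {ℱ : Filtration ℕ mΩ}, ErgodicChain P ν a X e ℱ C γ →
      ∀ {ψ : (Fin (q + 1) → ℝ) → ℝ}, Measurable ψ → Integrable (fun ω => ψ (X 0 ω) ^ 4) P →
      ∫ ω, ψ (X 0 ω) ^ 4 ∂P ≤ B → ∀ {n : ℕ}, 1 ≤ n →
      ∃ S : Set Ω, P.real S ≤ η ∧ ∀ ω ∉ S, ∀ x : ℝ,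
        |∑ t ∈ Finset.range n, (ψ (X t ω) * (if e t ω ≤ x then 1 else 0) -
          ∫ ω, ψ (X 0 ω) * (if e 0 ω ≤ x then 1 else 0) ∂P)| ≤ T * √n := by
  obtain ⟨κ, hκ, hκ1, hκγ⟩ := exists_fourth_root hγ hγ1
  set cV := (1 + 2 * B + C * (1 + C) + (1 + B) ^ 2) * (2 * (1 - κ)⁻¹) with hcV
  have hcV0 : 0 ≤ cV := by
    have : 0 < 1 - κ := by linarith
    positivity
  set T : ℝ := max 1 ((1601 * B + 1 + cV) / η) with hT
  have hT1 : 1 ≤ T := le_max_left _ _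
  have hT0 : 0 < T := by linarith
  have hTη : (1601 * B + 1 + cV) / T ≤ η := by
    rw [div_le_iff₀ hT0, mul_comm η, ← div_le_iff₀ hη]
    exact le_max_right _ _
  refine ⟨15 * T, by positivity, ?_⟩
  intro a X e ℱ h ψ hψ hψi hψB n hn
  have := h.prob
  have hn0 : (0 : ℝ) < n := by exact_mod_cast hn
  have hsn : 0 < √(n : ℝ) := Real.sqrt_pos.2 hn0
  have hsn2 : √(n : ℝ) ^ 2 = n := Real.sq_sqrt hn0.le
  have hsn1 : 1 ≤ √(n : ℝ) := Real.one_le_sqrt.2 (by exact_mod_cast hn)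
  set J := Nat.log 2 n with hJ
  have hJ1 : (2 : ℝ) ^ J ≤ n := by exact_mod_cast Nat.pow_log_le_self 2 (by omega)
  have hJ2 : (n : ℝ) < 2 ^ J * 2 := by
    have := Nat.lt_pow_succ_log_self (b := 2) (by norm_num) n
    rw [pow_succ] at this
    exact_mod_cast this
  have hψa4 : ∀ U, |ψ U| ^ 4 = ψ U ^ 4 := fun U => by
    rw [← abs_pow, abs_of_nonneg (by positivity)]
  obtain ⟨Qi, QB⟩ := h.dyadicEnergy_moment hν hψ hψi hψB hJ1
  obtain ⟨Qi', QB'⟩ := h.dyadicEnergy_moment hν (ψ := fun U => |ψ U|) hψ.abs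
    (by simpa only [hψa4] using hψi) (by simpa only [hψa4] using hψB) hJ1
  obtain ⟨Vi, VB⟩ := h.variance_sum_le hψ hψi hψB hκ hκ1 hκγ n
  have hi4 : ∀ t, Integrable (fun ω => ψ (X t ω) ^ 4) P :=
    h.integrable_comp_X (hψ.pow_const 4) hψi
  have hi1 : ∀ t, Integrable (fun ω => ψ (X t ω)) P := fun t =>
    ((integrable_const 1).add (hi4 t)).mono' (hψ.comp (h.measurable_X t)).aestronglyMeasurable
      (Eventually.of_forall fun ω => abs_le_one_add_pow_four _)
  set m := ∫ ω, ψ (X 0 ω) ∂P with hm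
  let S₁ : Set Ω := {ω | (T * √n) ^ 4 <
    dyadicEnergy n J (fun t => ψ (X t ω)) (fun t => cdf ν (e t ω))}
  let S₂ : Set Ω := {ω | (T * √n) ^ 4 <
    dyadicEnergy n J (fun t => |ψ (X t ω)|) (fun t => cdf ν (e t ω))}
  let S₃ : Set Ω := {ω | T * n < ∑ t ∈ Finset.range n, |ψ (X t ω)|}
  let S₄ : Set Ω := {ω | (T * √n) ^ 2 < (∑ t ∈ Finset.range n, (ψ (X t ω) - m)) ^ 2}
  have hQ0 : ∀ w v : ℕ → ℝ, 0 ≤ dyadicEnergy n J w v := fun w v =>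
    Finset.sum_nonneg fun j _ => Finset.sum_nonneg fun i _ => by positivity
  have hT4 : (T * √n) ^ 4 = T ^ 4 * (n : ℝ) ^ 2 := by
    calc (T * √n) ^ 4 = T ^ 4 * (√n ^ 2) ^ 2 := by ring
      _ = _ := by rw [hsn2]
  have hTT4 : T ≤ T ^ 4 := le_self_pow₀ hT1 (by norm_num)
  have hTT2 : T ≤ T ^ 2 := le_self_pow₀ hT1 (by norm_num)
  have b1 : P.real S₁ ≤ 800 * B / T := by
    refine (measureReal_lt_le_div (fun ω => hQ0 _ _) Qi (by positivity) QB).trans ?_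
    rw [hT4, mul_div_mul_right _ _ (by positivity)]
    gcongr
  have b2 : P.real S₂ ≤ 800 * B / T := by
    refine (measureReal_lt_le_div (fun ω => hQ0 _ _) Qi' (by positivity) QB').trans ?_
    rw [hT4, mul_div_mul_right _ _ (by positivity)]
    gcongr
  have b3 : P.real S₃ ≤ (1 + B) / T := by
    have hE : ∫ ω, ∑ t ∈ Finset.range n, |ψ (X t ω)| ∂P ≤ (1 + B) * n := by
      rw [integral_finsetSum _ fun t _ => (hi1 t).abs]
      have : ∀ t ∈ Finset.range n, ∫ ω, |ψ (X t ω)| ∂P ≤ 1 + B := fun t _ => by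
        refine (integral_mono (hi1 t).abs ((integrable_const 1).add (hi4 t)) fun ω =>
          abs_le_one_add_pow_four _).trans ?_
        simp only [Pi.add_apply]
        rw [integral_add (integrable_const _) (hi4 t)]
        rw [h.integral_comp_X (hψ.pow_const 4) t]
        simpa using hψB
      refine (Finset.sum_le_sum this).trans (le_of_eq ?_)
      rw [Finset.sum_const, Finset.card_range, nsmul_eq_mul, mul_comm]
    refine (measureReal_lt_le_div (fun ω => Finset.sum_nonneg fun t _ => abs_nonneg _)
      (integrable_finsetSum _ fun t _ => (hi1 t).abs) (by positivity) hE).trans (le_of_eq ?_)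
    rw [mul_div_mul_right _ _ hn0.ne']
  have b4 : P.real S₄ ≤ cV / T := by
    refine (measureReal_lt_le_div (fun ω => sq_nonneg _) Vi (by positivity) VB).trans ?_
    rw [mul_pow, hsn2, mul_comm (n : ℝ), mul_div_mul_right _ _ hn0.ne']
    gcongr
  refine ⟨S₁ ∪ S₂ ∪ S₃ ∪ S₄, ?_, ?_⟩
  · have u1 := measureReal_union_le (μ := P) (S₁ ∪ S₂ ∪ S₃) S₄
    have u2 := measureReal_union_le (μ := P) (S₁ ∪ S₂) S₃
    have u3 := measureReal_union_le (μ := P) S₁ S₂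
    have e1 : 800 * B / T + 800 * B / T + (1 + B) / T + cV / T = (1601 * B + 1 + cV) / T := by ring
    linarith
  · intro ω hω x
    simp only [Set.mem_union, not_or] at hω
    obtain ⟨⟨⟨h1, h2⟩, h3⟩, h4⟩ := hω
    simp only [S₁, S₂, S₃, S₄, Set.mem_ofPred_eq, not_lt] at h1 h2 h3 h4
    have hG0 := hν.cdf_pos x
    have hG1 := hν.cdf_lt_one x
    have hmean : ∫ ω, ψ (X 0 ω) * (if e 0 ω ≤ x then 1 else 0) ∂P = m * cdf ν x := by
      have hχ : Measurable fun u : ℝ => (if u ≤ x then (1 : ℝ) else 0) :=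
        Measurable.ite measurableSet_Iic measurable_const measurable_const
      have hA : Measurable[ℱ 0] fun ω => ψ (X 0 ω) := hψ.comp (h.adapted 0)
      rw [h.integral_mul_comp_noise hA hχ, cdf_eq_real,
        ← integral_indicator_one measurableSet_Iic]
      congr 1
    have hiff : ∀ t, (e t ω ≤ x ↔ cdf ν (e t ω) ≤ cdf ν x) := fun t =>
      hν.strictMono_cdf.le_iff_le.symm
    have hdec : ∑ t ∈ Finset.range n, (ψ (X t ω) * (if e t ω ≤ x then 1 else 0) -
          ∫ ω, ψ (X 0 ω) * (if e 0 ω ≤ x then 1 else 0) ∂P) =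
        wemp n (fun t => ψ (X t ω)) (fun t => cdf ν (e t ω)) (cdf ν x) +
          cdf ν x * ∑ t ∈ Finset.range n, (ψ (X t ω) - m) := by
      rw [hmean, wemp, Finset.mul_sum, ← Finset.sum_add_distrib]
      refine Finset.sum_congr rfl fun t _ => ?_
      simp only [hiff t]
      ring
    rw [hdec]
    have c1 := abs_wemp_le (fun t => hν.cdf_pos (e t ω)) (by positivity) h1 h2 hG0.le hG1
    have c2 : |cdf ν x * ∑ t ∈ Finset.range n, (ψ (X t ω) - m)| ≤ T * √n := by
      rw [abs_mul, abs_of_pos hG0]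
      have := abs_le_of_sq_le_sq h4 (by positivity)
      exact (mul_le_of_le_one_left (abs_nonneg _) hG1.le).trans this
    have c3 : 2 / 2 ^ J * ∑ t ∈ Finset.range n, |ψ (X t ω)| ≤ 4 * T * √n := by
      calc 2 / 2 ^ J * ∑ t ∈ Finset.range n, |ψ (X t ω)| ≤ 2 / 2 ^ J * (T * n) := by gcongr
        _ ≤ 4 * T := by
          rw [div_mul_eq_mul_div, div_le_iff₀ (by positivity)]
          nlinarith
        _ ≤ 4 * T * √n := le_mul_of_one_le_right (by positivity) hsn1
    have c4 := abs_add_le (wemp n (fun t => ψ (X t ω)) (fun t => cdf ν (e t ω)) (cdf ν x))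
      (cdf ν x * ∑ t ∈ Finset.range n, (ψ (X t ω) - m))
    linarith

end

section

variable {q : ℕ} {Ω : Type*} [mΩ : MeasurableSpace Ω]

/-- The indicator of the event that the residual at `θ` is at most `x`, when the true parameter is
`a`, the state is `U` and the innovation is `e`. -/
def resInd (a θ : Fin (q + 1) → ℝ) (x : ℝ) (U : Fin (q + 1) → ℝ) (e : ℝ) : ℝ :=
  if √(vol a U) * e ≤ x * √(vol θ U) then 1 else 0

theorem resInd_nonneg (a θ : Fin (q + 1) → ℝ) (x : ℝ) (U : Fin (q + 1) → ℝ) (e : ℝ) :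
    0 ≤ resInd a θ x U e := by
  unfold resInd
  split_ifs <;> norm_num

theorem resInd_le_one (a θ : Fin (q + 1) → ℝ) (x : ℝ) (U : Fin (q + 1) → ℝ) (e : ℝ) :
    resInd a θ x U e ≤ 1 := by
  unfold resInd
  split_ifs <;> norm_num

theorem measurable_resInd (a θ : Fin (q + 1) → ℝ) (x : ℝ) :
    Measurable (Function.uncurry (resInd a θ x)) := by
  have h1 := measurable_vol a
  have h2 := measurable_vol θ
  refine Measurable.ite ?_ measurable_const measurable_const
  exact measurableSet_le (by fun_prop) (by fun_prop)

theorem resInd_self {a : Fin (q + 1) → ℝ} (ha : ∀ i, 0 ≤ a i) (x : ℝ) (U : Fin (q + 1) → ℝ)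
    (e : ℝ) : resInd a a x U e = if e ≤ x then 1 else 0 := by
  have h1 : 0 < √(vol a U) := by linarith [one_le_sqrt_vol ha U]
  unfold resInd
  simp only [mul_comm x, mul_le_mul_iff_right₀ h1]

theorem abs_vol_param_sub_le (θ θ' U : Fin (q + 1) → ℝ) :
    |vol θ U - vol θ' U| ≤ l1norm (θ - θ') * ssq U := by
  have : vol θ U - vol θ' U = ∑ i, (θ i - θ' i) * U i ^ 2 := by
    unfold vol
    rw [add_sub_add_left_eq_sub, ← Finset.sum_sub_distrib]
    simp [sub_mul]
  rw [this, l1norm, Finset.sum_mul]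
  refine (Finset.abs_sum_le_sum_abs _ _).trans (Finset.sum_le_sum fun i _ => ?_)
  rw [abs_mul, abs_of_nonneg (sq_nonneg (U i)), Pi.sub_apply]
  refine mul_le_mul_of_nonneg_left ?_ (abs_nonneg _)
  exact Finset.single_le_sum (f := fun i => U i ^ 2) (fun i _ => sq_nonneg _) (Finset.mem_univ i)

theorem integral_abs_indicator_sub (ν : Measure ℝ) [IsProbabilityMeasure ν] (c d : ℝ) :
    ∫ x, |(if x ≤ c then (1 : ℝ) else 0) - (if x ≤ d then 1 else 0)| ∂ν =
      |∫ x, (if x ≤ c then (1 : ℝ) else 0) ∂ν - ∫ x, (if x ≤ d then (1 : ℝ) else 0) ∂ν| := by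
  have hi : ∀ c : ℝ, Integrable (fun x => if x ≤ c then (1 : ℝ) else 0) ν := fun c =>
    Integrable.of_bound (Measurable.ite measurableSet_Iic measurable_const
      measurable_const).aestronglyMeasurable 1 (Eventually.of_forall fun x => by split_ifs <;> simp)
  have key : ∀ c d : ℝ, c ≤ d → ∀ x : ℝ,
      (if x ≤ c then (1 : ℝ) else 0) ≤ (if x ≤ d then 1 else 0) := fun c d hcd x => by
    split_ifs with h1 h2 h2
    · exact le_rfl
    · exact absurd (h1.trans hcd) h2
    · norm_num
    · exact le_rfl
  rw [← integral_sub (hi c) (hi d)]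
  rcases le_total c d with hcd | hcd
  · rw [abs_of_nonpos (integral_nonpos fun x => by simpa using key c d hcd x), ← integral_neg]
    refine integral_congr_ae (Eventually.of_forall fun x => ?_)
    simp only
    rw [abs_of_nonpos (by simpa using key c d hcd x)]
  · rw [abs_of_nonneg (integral_nonneg fun x => by simpa using key d c hcd x)]
    refine integral_congr_ae (Eventually.of_forall fun x => ?_)
    simp only
    rw [abs_of_nonneg (by simpa using key d c hcd x)]

/-- The conditional probability that the indicators at `θ` and at the true parameter differ. -/
theorem integral_abs_resInd_sub_le {ν : Measure ℝ} {m₂ Ct Bt : ℝ} (hν : RegularNoise ν m₂ Ct Bt)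
    {a θ : Fin (q + 1) → ℝ} (ha : ∀ i, 0 ≤ a i) (hθ : ∀ i, 0 ≤ θ i) (x : ℝ)
    (U : Fin (q + 1) → ℝ) :
    ∫ e, |resInd a θ x U e - resInd a a x U e| ∂ν ≤ Ct * (l1norm (θ - a) * ssq U) := by
  have := hν.prob
  have ha1 := one_le_sqrt_vol ha U
  have hθ1 := one_le_sqrt_vol hθ U
  have e1 : ∀ e, resInd a θ x U e = if e ≤ x * √(vol θ U) / √(vol a U) then 1 else 0 := fun e => by
    have h0 : 0 < √(vol a U) := by linarith
    simp only [resInd, le_div_iff₀' h0]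
  simp only [resInd_self ha]
  simp only [e1]
  rw [integral_abs_indicator_sub]
  set F : ℝ → ℝ := fun y => if y ≤ x * √(vol θ U) then 1 else 0 with hF
  have hFm : Measurable F := Measurable.ite measurableSet_Iic measurable_const measurable_const
  have h1 := hν.scale_le hFm (K := 1) (fun y => by simp only [hF]; split_ifs <;> simp) ha1 hθ1
  have e2 : ∀ y, F (√(vol a U) * y) = if y ≤ x * √(vol θ U) / √(vol a U) then 1 else 0 := fun y => by
    have h0 : 0 < √(vol a U) := by linarith
    simp only [hF, le_div_iff₀' h0]
  have e3 : ∀ y, F (√(vol θ U) * y) = if y ≤ x then 1 else 0 := fun y => by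
    have h0 : 0 < √(vol θ U) := by linarith
    simp only [hF, mul_comm x, mul_le_mul_iff_right₀ h0]
  simp only [e2, e3, one_mul] at h1
  refine h1.trans (mul_le_mul_of_nonneg_left ?_ hν.C_nonneg)
  rw [sq_sqrt_vol ha, sq_sqrt_vol hθ, abs_sub_comm]
  exact abs_vol_param_sub_le θ a U

/-- The conditional probability that the observation falls in a short interval. -/
theorem integral_band_le {ν : Measure ℝ} {m₂ Ct Bt : ℝ} (hν : RegularNoise ν m₂ Ct Bt)
    {σ : ℝ} (hσ : 1 ≤ σ) (c : ℝ) {κ : ℝ} (hκ : 0 ≤ κ) :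
    ∫ e, (if |σ * e - c| ≤ κ then (1 : ℝ) else 0) ∂ν ≤ Bt * (2 * κ) := by
  have := hν.prob
  have hσ0 : 0 < σ := by linarith
  have hm : MeasurableSet {e : ℝ | |σ * e - c| ≤ κ} :=
    measurableSet_le (by fun_prop) measurable_const
  have e1 : (fun e => if |σ * e - c| ≤ κ then (1 : ℝ) else 0) =
      Set.indicator {e : ℝ | |σ * e - c| ≤ κ} 1 := by
    ext e
    simp [Set.indicator_apply]
  rw [e1, integral_indicator_one hm]
  refine le_trans (measureReal_mono ?_) (hν.interval_le ((c - κ) / σ) (2 * κ) (by linarith))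
  intro e (he : |σ * e - c| ≤ κ)
  rw [abs_le] at he
  constructor
  · rw [div_le_iff₀ hσ0]
    linarith
  · have h2 : e ≤ (c + κ) / σ := by
      rw [le_div_iff₀ hσ0]
      linarith
    have h3 : (c + κ) / σ = (c - κ) / σ + 2 * κ / σ := by ring
    have h4 : 2 * κ / σ ≤ 2 * κ := div_le_self (by linarith) hσ
    linarith

/-- Two indicators with nearby thresholds differ only if the observation is near a threshold. -/
theorem abs_indicator_sub_le_band {y c c' κ : ℝ} (h : |c - c'| ≤ κ) :
    |(if y ≤ c then (1 : ℝ) else 0) - (if y ≤ c' then 1 else 0)| ≤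
      if |y - c'| ≤ κ then 1 else 0 := by
  rw [abs_le] at h
  split_ifs with h1 h2 h3 h3 h3 h3 h3
  all_goals try norm_num
  · exact h3 (abs_le.2 ⟨by linarith, by linarith⟩)
  · exact h3 (abs_le.2 ⟨by linarith, by linarith⟩)

/-- Clipping the argument does not change the indicator when the observation is bounded by `n`. -/
theorem indicator_clip {y σ n : ℝ} (hy : |y| ≤ n) (hσ : 1 ≤ σ) (x : ℝ) :
    (if y ≤ x * σ then (1 : ℝ) else 0) =
      if y ≤ max (-(n + 1)) (min x (n + 1)) * σ then 1 else 0 := by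
  rw [abs_le] at hy
  rcases le_total x (n + 1) with h1 | h1
  · rw [min_eq_left h1]
    rcases le_total (-(n + 1)) x with h2 | h2
    · rw [max_eq_right h2]
    · rw [max_eq_left h2, if_neg, if_neg]
      · nlinarith
      · nlinarith
  · rw [min_eq_right h1, max_eq_right (by linarith), if_pos, if_pos]
    · nlinarith
    · nlinarith

theorem abs_threshold_sub_le {θ θ' U : Fin (q + 1) → ℝ} (hθ : ∀ i, 0 ≤ θ i) (hθ' : ∀ i, 0 ≤ θ' i)
    {R n δ x x' : ℝ} (hθR : l1norm θ ≤ R) (hR : 0 ≤ R) (hn : 1 ≤ n) (hU : ssq U ≤ n ^ 2)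
    (hδ : 0 ≤ δ) (hx : |x - x'| ≤ δ) (hx' : |x'| ≤ n + 2) (hd : l1norm (θ - θ') ≤ δ) :
    |x * √(vol θ U) - x' * √(vol θ' U)| ≤ (4 + R) * n ^ 3 * δ := by
  have h1 := one_le_sqrt_vol hθ U
  have h1' := one_le_sqrt_vol hθ' U
  have hs := ssq_nonneg U
  have hv : √(vol θ U) ≤ 1 + R * n ^ 2 := by
    have h2 : vol θ U ≤ 1 + R * n ^ 2 := by
      have := abs_vol_param_sub_le θ 0 U
      have h0 : vol (0 : Fin (q + 1) → ℝ) U = 1 := by simp [vol]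
      rw [h0, sub_zero] at this
      have h3 := (le_abs_self _).trans this
      have h4 : l1norm θ * ssq U ≤ R * n ^ 2 := mul_le_mul hθR hU hs hR
      linarith
    have h3 : √(vol θ U) ≤ vol θ U := by
      have := sq_sqrt_vol hθ U
      nlinarith
    exact h3.trans h2
  have hd2 : |√(vol θ U) - √(vol θ' U)| ≤ δ * n ^ 2 := by
    have h2 : |vol θ U - vol θ' U| ≤ δ * n ^ 2 :=
      (abs_vol_param_sub_le θ θ' U).trans (mul_le_mul hd hU hs hδ)
    rw [← sq_sqrt_vol hθ U, ← sq_sqrt_vol hθ' U, sq_sub_sq, abs_mul] at h2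
    refine le_trans ?_ h2
    refine le_mul_of_one_le_left (abs_nonneg _) ?_
    rw [abs_of_nonneg (by linarith)]
    linarith
  have e1 : x * √(vol θ U) - x' * √(vol θ' U) =
      (x - x') * √(vol θ U) + x' * (√(vol θ U) - √(vol θ' U)) := by ring
  rw [e1]
  refine (abs_add_le _ _).trans ?_
  rw [abs_mul, abs_mul, abs_of_nonneg (by linarith : 0 ≤ √(vol θ U))]
  have t1 : |x - x'| * √(vol θ U) ≤ δ * (1 + R * n ^ 2) := mul_le_mul hx hv (by linarith) hδ
  have t2 : |x'| * |√(vol θ U) - √(vol θ' U)| ≤ (n + 2) * (δ * n ^ 2) :=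
    mul_le_mul hx' hd2 (abs_nonneg _) (by linarith)
  have hn2 : n ^ 2 ≤ n ^ 3 := pow_le_pow_right₀ hn (by norm_num)
  have hn3 : 1 ≤ n ^ 3 := one_le_pow₀ hn
  have : δ * (1 + R * n ^ 2) + (n + 2) * (δ * n ^ 2) ≤ (4 + R) * n ^ 3 * δ := by
    have h5 : 1 + R * n ^ 2 + (n + 2) * n ^ 2 ≤ (4 + R) * n ^ 3 := by
      have := mul_le_mul_of_nonneg_left hn2 hR
      nlinarith
    nlinarith
  linarith

/-- A weight function `ψ` with envelope `Φ` and Lipschitz constant `M` in the parameter, with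
moments along the stationary law bounded by `B`. -/
structure WeightBound (P : Measure Ω) (X₀ : Ω → Fin (q + 1) → ℝ) (Θ : Set (Fin (q + 1) → ℝ))
    (ψ : (Fin (q + 1) → ℝ) → (Fin (q + 1) → ℝ) → ℝ) (Φ M : (Fin (q + 1) → ℝ) → ℝ)
    (B β : ℝ) : Prop where
  measurable : ∀ θ ∈ Θ, Measurable fun U => ψ U θ
  measurable_Φ : Measurable Φ
  measurable_M : Measurable M
  le_Φ : ∀ U, ∀ θ ∈ Θ, |ψ U θ| ≤ Φ U
  Φ_nonneg : ∀ U, 0 ≤ Φ U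
  M_nonneg : ∀ U, 0 ≤ M U
  lipschitz : ∀ U, ∀ θ ∈ Θ, ∀ θ' ∈ Θ, |ψ U θ - ψ U θ'| ≤ M U * l1norm (θ - θ')
  integrable_Φ : Integrable (fun ω => Φ (X₀ ω) ^ 4) P
  moment_Φ : ∫ ω, Φ (X₀ ω) ^ 4 ∂P ≤ B
  tail_Φ : ∀ x : ℝ, 1 ≤ x → P.real {ω | x < Φ (X₀ ω)} ≤ B * x ^ (-(4 + β))
  integrable_M : Integrable (fun ω => M (X₀ ω) ^ 2) P
  moment_M : ∫ ω, M (X₀ ω) ^ 2 ∂P ≤ B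

end

section

variable {q : ℕ} {Ω : Type*} [mΩ : MeasurableSpace Ω]

/-- The partial sum of `f (X t) (e t)`, centred at its stationary mean. -/
def centeredSum (P : Measure Ω) (X : ℕ → Ω → Fin (q + 1) → ℝ) (e : ℕ → Ω → ℝ) (n : ℕ)
    (f : (Fin (q + 1) → ℝ) → ℝ → ℝ) (ω : Ω) : ℝ :=
  ∑ t ∈ Finset.range n, (f (X t ω) (e t ω) - ∫ ω, f (X 0 ω) (e 0 ω) ∂P)

theorem centeredSum_eq (P : Measure Ω) (X : ℕ → Ω → Fin (q + 1) → ℝ) (e : ℕ → Ω → ℝ) (n : ℕ)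
    (f : (Fin (q + 1) → ℝ) → ℝ → ℝ) (ω : Ω) :
    centeredSum P X e n f ω = ∑ t ∈ Finset.range n, f (X t ω) (e t ω) -
      n * ∫ ω, f (X 0 ω) (e 0 ω) ∂P := by
  simp [centeredSum, Finset.sum_sub_distrib]

theorem centeredSum_add {P : Measure Ω} {X : ℕ → Ω → Fin (q + 1) → ℝ} {e : ℕ → Ω → ℝ} {n : ℕ}
    {f f' : (Fin (q + 1) → ℝ) → ℝ → ℝ} (hf : Integrable (fun ω => f (X 0 ω) (e 0 ω)) P)
    (hf' : Integrable (fun ω => f' (X 0 ω) (e 0 ω)) P) (ω : Ω) :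
    centeredSum P X e n (fun U u => f U u + f' U u) ω =
      centeredSum P X e n f ω + centeredSum P X e n f' ω := by
  simp only [centeredSum_eq]
  rw [integral_add hf hf', Finset.sum_add_distrib]
  ring

theorem abs_centeredSum_le {P : Measure Ω} {X : ℕ → Ω → Fin (q + 1) → ℝ} {e : ℕ → Ω → ℝ} {n : ℕ}
    {f H : (Fin (q + 1) → ℝ) → ℝ → ℝ} (hH : Integrable (fun ω => H (X 0 ω) (e 0 ω)) P)
    (hfH : ∀ U u, |f U u| ≤ H U u) (ω : Ω) :
    |centeredSum P X e n f ω| ≤ ∑ t ∈ Finset.range n, H (X t ω) (e t ω) +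
      n * ∫ ω, H (X 0 ω) (e 0 ω) ∂P := by
  rw [centeredSum_eq]
  refine (abs_sub _ _).trans (add_le_add ?_ ?_)
  · exact (Finset.abs_sum_le_sum_abs _ _).trans (Finset.sum_le_sum fun t _ => hfH _ _)
  · rw [abs_mul, abs_of_nonneg (Nat.cast_nonneg n)]
    refine mul_le_mul_of_nonneg_left ?_ (Nat.cast_nonneg n)
    exact norm_integral_le_of_norm_le (f := fun ω => f (X 0 ω) (e 0 ω)) hH
      (Eventually.of_forall fun ω => hfH _ _)

namespace WeightBound

variable {P : Measure Ω} [IsProbabilityMeasure P] {X₀ : Ω → Fin (q + 1) → ℝ}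
  {Θ : Set (Fin (q + 1) → ℝ)} {ψ : (Fin (q + 1) → ℝ) → (Fin (q + 1) → ℝ) → ℝ}
  {Φ M : (Fin (q + 1) → ℝ) → ℝ} {B β : ℝ}

theorem B_nonneg (h : WeightBound P X₀ Θ ψ Φ M B β) : 0 ≤ B :=
  (integral_nonneg fun ω => by positivity).trans h.moment_Φ

theorem integrable_envelope (h : WeightBound P X₀ Θ ψ Φ M B β) (hX : Measurable X₀) :
    Integrable (fun ω => Φ (X₀ ω)) P := by
  refine ((integrable_const (1 : ℝ)).add h.integrable_Φ).mono'
    (h.measurable_Φ.comp hX).aestronglyMeasurable (Eventually.of_forall fun ω => ?_)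
  exact abs_le_one_add_pow_four _

theorem integral_envelope_le (h : WeightBound P X₀ Θ ψ Φ M B β) (hX : Measurable X₀) :
    ∫ ω, Φ (X₀ ω) ∂P ≤ 1 + B := by
  calc ∫ ω, Φ (X₀ ω) ∂P ≤ ∫ ω, (1 + Φ (X₀ ω) ^ 4) ∂P :=
        integral_mono (h.integrable_envelope hX) ((integrable_const (1 : ℝ)).add h.integrable_Φ)
          fun ω => (le_abs_self _).trans (abs_le_one_add_pow_four _)
    _ = 1 + ∫ ω, Φ (X₀ ω) ^ 4 ∂P := by
        rw [integral_add (integrable_const _) h.integrable_Φ]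
        simp
    _ ≤ 1 + B := by linarith [h.moment_Φ]

theorem integrable_lip (h : WeightBound P X₀ Θ ψ Φ M B β) (hX : Measurable X₀) :
    Integrable (fun ω => M (X₀ ω)) P := by
  refine ((integrable_const (1 : ℝ)).add h.integrable_M).mono'
    (h.measurable_M.comp hX).aestronglyMeasurable (Eventually.of_forall fun ω => ?_)
  rw [Real.norm_eq_abs, abs_of_nonneg (h.M_nonneg _)]
  simp only [Pi.add_apply]
  nlinarith [sq_nonneg (M (X₀ ω) - 1)]

theorem integral_lip_le (h : WeightBound P X₀ Θ ψ Φ M B β) (hX : Measurable X₀) :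
    ∫ ω, M (X₀ ω) ∂P ≤ 1 + B := by
  calc ∫ ω, M (X₀ ω) ∂P ≤ ∫ ω, (1 + M (X₀ ω) ^ 2) ∂P :=
        integral_mono (h.integrable_lip hX) ((integrable_const (1 : ℝ)).add h.integrable_M)
          fun ω => by
            simp only
            nlinarith [sq_nonneg (M (X₀ ω) - 1)]
    _ = 1 + ∫ ω, M (X₀ ω) ^ 2 ∂P := by
        rw [integral_add (integrable_const _) h.integrable_M]
        simp
    _ ≤ 1 + B := by linarith [h.moment_M]

/-- Truncation of the weight where its envelope exceeds `K`. -/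
theorem truncate (h : WeightBound P X₀ Θ ψ Φ M B β) (hX : Measurable X₀) (K : ℝ) :
    WeightBound P X₀ Θ (fun U θ => if Φ U ≤ K then ψ U θ else 0)
      (fun U => if Φ U ≤ K then Φ U else 0) M B β := by
  have hset : MeasurableSet {U | Φ U ≤ K} := measurableSet_le h.measurable_Φ measurable_const
  have hm : Measurable fun U => if Φ U ≤ K then Φ U else 0 :=
    Measurable.ite hset h.measurable_Φ measurable_const
  have hle : ∀ U, (if Φ U ≤ K then Φ U else 0) ≤ Φ U := fun U => by
    split_ifs
    · exact le_rfl
    · exact h.Φ_nonneg U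
  have h0 : ∀ U, 0 ≤ (if Φ U ≤ K then Φ U else 0) := fun U => by
    split_ifs
    · exact h.Φ_nonneg U
    · exact le_rfl
  have h4 : ∀ ω, (if Φ (X₀ ω) ≤ K then Φ (X₀ ω) else 0) ^ 4 ≤ Φ (X₀ ω) ^ 4 := fun ω =>
    pow_le_pow_left₀ (h0 _) (hle _) 4
  have hi : Integrable (fun ω => (if Φ (X₀ ω) ≤ K then Φ (X₀ ω) else 0) ^ 4) P :=
    h.integrable_Φ.mono' ((hm.comp hX).pow_const 4).aestronglyMeasurable
      (Eventually.of_forall fun ω => by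
        rw [Real.norm_eq_abs, abs_of_nonneg (pow_nonneg (h0 _) 4)]
        exact h4 ω)
  exact
    { measurable := fun θ hθ => Measurable.ite hset (h.measurable θ hθ) measurable_const
      measurable_Φ := hm
      measurable_M := h.measurable_M
      le_Φ := fun U θ hθ => by
        split_ifs
        · exact h.le_Φ U θ hθ
        · simp
      Φ_nonneg := h0
      M_nonneg := h.M_nonneg
      lipschitz := fun U θ hθ θ' hθ' => by
        split_ifs
        · exact h.lipschitz U θ hθ θ' hθ'
        · rw [sub_zero, abs_zero]
          exact mul_nonneg (h.M_nonneg U) (Finset.sum_nonneg fun i _ => abs_nonneg _)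
      integrable_Φ := hi
      moment_Φ := (integral_mono hi h.integrable_Φ h4).trans h.moment_Φ
      tail_Φ := fun x hx =>
        (measureReal_mono (fun ω (hω : x < _) => hω.trans_le (hle _)) (measure_ne_top _ _)).trans
          (h.tail_Φ x hx)
      integrable_M := h.integrable_M
      moment_M := h.moment_M }

end WeightBound

theorem l1norm_nonneg {p : ℕ} (v : Fin p → ℝ) : 0 ≤ l1norm v :=
  Finset.sum_nonneg fun _ _ => abs_nonneg _

/-- Mean-square continuity of the weighted indicators in the parameter. -/
theorem ErgodicChain.integral_increment_sq_le {P : Measure Ω} [IsProbabilityMeasure P]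
    {ν : Measure ℝ} {m₂ Ct Bt : ℝ} (hν : RegularNoise ν m₂ Ct Bt) {a : Fin (q + 1) → ℝ}
    {X : ℕ → Ω → Fin (q + 1) → ℝ} {e : ℕ → Ω → ℝ} {ℱ : Filtration ℕ mΩ} {C γ : ℝ}
    (h : ErgodicChain P ν a X e ℱ C γ) {Θ : Set (Fin (q + 1) → ℝ)}
    (hΘ : ∀ θ ∈ Θ, ∀ i, 0 ≤ θ i)
    {ψ : (Fin (q + 1) → ℝ) → (Fin (q + 1) → ℝ) → ℝ} {Φ M : (Fin (q + 1) → ℝ) → ℝ} {B β : ℝ}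
    (w : WeightBound P (X 0) Θ ψ Φ M B β) (ha : a ∈ Θ) {θ : Fin (q + 1) → ℝ} (hθ : θ ∈ Θ)
    {ρ s : ℝ} (hρ : 0 < ρ) (hs : 1 ≤ s) (x : ℝ) :
    ∫ ω, (ψ (X 0 ω) θ * resInd a θ x (X 0 ω) (e 0 ω) -
      ψ (X 0 ω) a * resInd a a x (X 0 ω) (e 0 ω)) ^ 2 ∂P ≤
      (2 * B / ρ ^ 2 + B + Ct * C / ρ) / s ^ 8 * (1 + ρ * (s ^ 16 * l1norm (θ - a))) ^ 2 := by
  have hB := w.B_nonneg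
  have hCt := hν.C_nonneg
  have hC := h.C_nonneg
  obtain ⟨τ, hτ⟩ : ∃ τ, τ = l1norm (θ - a) := ⟨_, rfl⟩
  have hτ0 : 0 ≤ τ := hτ ▸ l1norm_nonneg _
  obtain ⟨u, hu⟩ : ∃ u, u = 1 + ρ * (s ^ 16 * τ) := ⟨_, rfl⟩
  have hu1 : 1 ≤ u := by
    rw [hu]
    have : 0 ≤ ρ * (s ^ 16 * τ) := by positivity
    linarith
  rw [← hτ, ← hu]
  have hs8 : 1 ≤ s ^ 8 := one_le_pow₀ hs
  obtain ⟨l, hl⟩ : ∃ l, l = u ^ 2 / s ^ 8 := ⟨_, rfl⟩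
  have hl0 : 0 < l := by rw [hl]; positivity
  have hd1 : ∀ U v, |resInd a θ x U v - resInd a a x U v| ≤ 1 := fun U v => by
    have := resInd_nonneg a θ x U v
    have := resInd_nonneg a a x U v
    have := resInd_le_one a θ x U v
    have := resInd_le_one a a x U v
    exact abs_le.2 ⟨by linarith, by linarith⟩
  have hdm : Measurable (Function.uncurry fun U v => |resInd a θ x U v - resInd a a x U v|) :=
    continuous_abs.measurable.comp ((measurable_resInd a θ x).sub (measurable_resInd a a x))
  have hX := h.measurable_X 0
  have hd := hdm.comp (hX.prodMk (h.measurable_e 0))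
  have hdi : Integrable (fun ω => |resInd a θ x (X 0 ω) (e 0 ω) - resInd a a x (X 0 ω) (e 0 ω)|) P :=
    Integrable.of_bound hd.aestronglyMeasurable 1 (Eventually.of_forall fun ω => by
      rw [Real.norm_eq_abs, abs_abs]
      exact hd1 _ _)
  have hdint : ∫ ω, |resInd a θ x (X 0 ω) (e 0 ω) - resInd a a x (X 0 ω) (e 0 ω)| ∂P ≤
      Ct * τ * C := by
    rw [← h.integral_noise_integral hdm (K := 1) (fun U v => by rw [abs_abs]; exact hd1 U v)]
    have h2 : ∫ ω, Ct * (τ * ssq (X 0 ω)) ∂P = Ct * τ * ∫ ω, ssq (X 0 ω) ∂P := by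
      simp only [← mul_assoc]
      rw [integral_const_mul]
    calc _ ≤ ∫ ω, Ct * (τ * ssq (X 0 ω)) ∂P := by
          refine integral_mono_of_nonneg (Eventually.of_forall fun ω => ?_) ?_
            (Eventually.of_forall fun ω => ?_)
          · exact integral_nonneg fun v => abs_nonneg _
          · exact (h.ssq_integrable.const_mul τ).const_mul Ct
          · rw [hτ]
            exact integral_abs_resInd_sub_le hν (hΘ a ha) (hΘ θ hθ) x (X 0 ω)
      _ ≤ Ct * τ * C := by
          rw [h2]
          exact mul_le_mul_of_nonneg_left h.ssq_le (by positivity)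
  have hpt : ∀ U v, (ψ U θ * resInd a θ x U v - ψ U a * resInd a a x U v) ^ 2 ≤
      2 * τ ^ 2 * M U ^ 2 + l * Φ U ^ 4 + l⁻¹ * |resInd a θ x U v - resInd a a x U v| := by
    intro U v
    obtain ⟨I, hI⟩ : ∃ I, I = resInd a θ x U v := ⟨_, rfl⟩
    obtain ⟨J, hJ⟩ : ∃ J, J = resInd a a x U v := ⟨_, rfl⟩
    have hI0 := resInd_nonneg a θ x U v
    have hI1 := resInd_le_one a θ x U v
    have hd := hd1 U v
    rw [← hI, ← hJ] at *
    have e1 : (ψ U θ * I - ψ U a * J) = (ψ U θ - ψ U a) * I + ψ U a * (I - J) := by ring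
    have k1 : ((ψ U θ - ψ U a) * I) ^ 2 ≤ (M U * τ) ^ 2 := by
      rw [← sq_abs]
      refine pow_le_pow_left₀ (abs_nonneg _) ?_ 2
      rw [abs_mul, abs_of_nonneg hI0]
      have := w.lipschitz U θ hθ a ha
      rw [← hτ] at this
      exact (mul_le_of_le_one_right (abs_nonneg _) hI1).trans this
    have k2 : (ψ U a * (I - J)) ^ 2 ≤ Φ U ^ 2 * |I - J| := by
      rw [mul_pow]
      refine mul_le_mul ?_ ?_ (sq_nonneg _) (sq_nonneg _)
      · rw [← sq_abs]
        exact pow_le_pow_left₀ (abs_nonneg _) (w.le_Φ U a ha) 2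
      · rw [← sq_abs]
        nlinarith [abs_nonneg (I - J)]
    have k3 := mul_le_half_add (x := Φ U ^ 2) (y := |I - J|) hl0
    have k4 : |I - J| ^ 2 ≤ |I - J| := by nlinarith [abs_nonneg (I - J)]
    have k5 := mul_le_mul_of_nonneg_left k4 (inv_pos.2 hl0).le
    rw [e1]
    nlinarith [sq_nonneg ((ψ U θ - ψ U a) * I - ψ U a * (I - J))]
  have hi1 : Integrable (fun ω => 2 * τ ^ 2 * M (X 0 ω) ^ 2) P := w.integrable_M.const_mul _
  have hi2 : Integrable (fun ω => l * Φ (X 0 ω) ^ 4) P := w.integrable_Φ.const_mul _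
  have hi3 := hdi.const_mul l⁻¹
  have hi12 : Integrable (fun ω => 2 * τ ^ 2 * M (X 0 ω) ^ 2 + l * Φ (X 0 ω) ^ 4) P := hi1.add hi2
  calc _ ≤ ∫ ω, (2 * τ ^ 2 * M (X 0 ω) ^ 2 + l * Φ (X 0 ω) ^ 4 +
        l⁻¹ * |resInd a θ x (X 0 ω) (e 0 ω) - resInd a a x (X 0 ω) (e 0 ω)|) ∂P :=
        integral_mono_of_nonneg (Eventually.of_forall fun ω => sq_nonneg _) (hi12.add hi3)
          (Eventually.of_forall fun ω => hpt _ _)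
    _ = 2 * τ ^ 2 * ∫ ω, M (X 0 ω) ^ 2 ∂P + l * ∫ ω, Φ (X 0 ω) ^ 4 ∂P +
        l⁻¹ * ∫ ω, |resInd a θ x (X 0 ω) (e 0 ω) - resInd a a x (X 0 ω) (e 0 ω)| ∂P := by
        rw [integral_add hi12 hi3, integral_add hi1 hi2, integral_const_mul, integral_const_mul,
          integral_const_mul]
    _ ≤ 2 * τ ^ 2 * B + l * B + l⁻¹ * (Ct * τ * C) := by
        have hm1 := mul_le_mul_of_nonneg_left w.moment_M (by positivity : 0 ≤ 2 * τ ^ 2)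
        have hm2 := mul_le_mul_of_nonneg_left w.moment_Φ hl0.le
        have hm3 := mul_le_mul_of_nonneg_left hdint (inv_pos.2 hl0).le
        linarith
    _ ≤ 2 * (u ^ 2 / (ρ ^ 2 * s ^ 8)) * B + l * B + u ^ 2 / (ρ * s ^ 8) * (Ct * C) := by
        have g0 : ρ * (s ^ 16 * τ) ≤ u := by rw [hu]; linarith
        have g1 : τ ^ 2 ≤ u ^ 2 / (ρ ^ 2 * s ^ 8) := by
          rw [le_div_iff₀ (by positivity)]
          have : (ρ * (s ^ 16 * τ)) ^ 2 ≤ u ^ 2 := pow_le_pow_left₀ (by positivity) g0 2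
          have h32 : s ^ 8 ≤ s ^ 32 := pow_le_pow_right₀ hs (by norm_num)
          have h33 := mul_le_mul_of_nonneg_left h32 (by positivity : 0 ≤ τ ^ 2 * ρ ^ 2)
          calc _ = τ ^ 2 * ρ ^ 2 * s ^ 8 := by ring
            _ ≤ τ ^ 2 * ρ ^ 2 * s ^ 32 := h33
            _ = (ρ * (s ^ 16 * τ)) ^ 2 := by ring
            _ ≤ _ := this
        have g2 : l⁻¹ * τ ≤ u ^ 2 / (ρ * s ^ 8) := by
          rw [hl, inv_div, le_div_iff₀ (by positivity), div_mul_eq_mul_div, div_mul_eq_mul_div,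
            div_le_iff₀ (by positivity)]
          have h4 : u ≤ u ^ 2 * u ^ 2 := by
            have : 1 ≤ u ^ 3 := one_le_pow₀ hu1
            nlinarith
          calc s ^ 8 * τ * (ρ * s ^ 8) = ρ * (s ^ 16 * τ) := by ring
            _ ≤ u := g0
            _ ≤ _ := h4
        have g3 := mul_le_mul_of_nonneg_right g1 hB
        have g4 := mul_le_mul_of_nonneg_right g2 (mul_nonneg hCt hC)
        calc _ = 2 * (τ ^ 2 * B) + l * B + l⁻¹ * τ * (Ct * C) := by ring
          _ ≤ 2 * (u ^ 2 / (ρ ^ 2 * s ^ 8) * B) + l * B + u ^ 2 / (ρ * s ^ 8) * (Ct * C) := by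
            linarith
          _ = _ := by ring
    _ = _ := by
        rw [hl]
        field_simp

end

section

variable {q : ℕ} {Ω : Type*} [mΩ : MeasurableSpace Ω]

/-- The grid of parameters with mesh `n⁻⁵`. -/
def gridParam (n : ℕ) (v : Fin (q + 1) → Fin (n ^ 8)) : Fin (q + 1) → ℝ :=
  fun i => ((v i : ℕ) : ℝ) / (n : ℝ) ^ 5

/-- The grid of levels with mesh `n⁻⁵`. -/
def gridLevel (n : ℕ) (j : Fin (n ^ 8)) : ℝ := ((j : ℕ) : ℝ) / (n : ℝ) ^ 5 - (n + 1)

theorem floor_div_bounds {z m : ℝ} (hz : 0 ≤ z) (hm : 0 < m) :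
    (⌊z * m⌋₊ : ℝ) / m ≤ z ∧ z - (⌊z * m⌋₊ : ℝ) / m ≤ 1 / m := by
  have h1 := Nat.floor_le (mul_nonneg hz hm.le)
  have h2 := (Nat.lt_floor_add_one (z * m)).le
  constructor
  · rwa [div_le_iff₀ hm]
  · rw [sub_le_iff_le_add, ← add_div, le_div_iff₀ hm]
    linarith

theorem exists_gridParam {βa : ℝ} {θ : Fin (q + 1) → ℝ} (hθ : θ ∈ Theta (q + 1) βa) {n : ℕ}
    (hn : 4 ≤ n) (hR : βa⁻¹ ≤ n) :
    ∃ v : Fin (q + 1) → Fin (n ^ 8), gridParam n v ∈ Theta (q + 1) βa ∧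
      l1norm (θ - gridParam n v) ≤ (q + 1) / (n : ℝ) ^ 5 := by
  have hn4 : (4 : ℝ) ≤ n := by exact_mod_cast hn
  have hm : (0 : ℝ) < (n : ℝ) ^ 5 := by positivity
  have hle : ∀ i, θ i ≤ n := fun i => by
    have h1 : |θ i| ≤ l1norm θ :=
      Finset.single_le_sum (f := fun i => |θ i|) (fun _ _ => abs_nonneg _) (Finset.mem_univ i)
    exact (le_abs_self _).trans (h1.trans (hθ.2.trans hR))
  have hlt : ∀ i, ⌊θ i * (n : ℝ) ^ 5⌋₊ < n ^ 8 := fun i => by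
    rw [Nat.floor_lt (mul_nonneg (hθ.1 i) hm.le)]
    push_cast
    calc θ i * (n : ℝ) ^ 5 ≤ n * (n : ℝ) ^ 5 := mul_le_mul_of_nonneg_right (hle i) hm.le
      _ = (n : ℝ) ^ 6 := by ring
      _ < (n : ℝ) ^ 8 := pow_lt_pow_right₀ (by linarith) (by norm_num)
  have hb := fun i => floor_div_bounds (hθ.1 i) hm
  have h0 : ∀ i, 0 ≤ (⌊θ i * (n : ℝ) ^ 5⌋₊ : ℝ) / (n : ℝ) ^ 5 := fun i => by positivity
  refine ⟨fun i => ⟨_, hlt i⟩, ⟨fun i => h0 i, ?_⟩, ?_⟩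
  · refine le_trans (Finset.sum_le_sum fun i _ => ?_) hθ.2
    simp only [gridParam]
    rw [abs_of_nonneg (h0 i), abs_of_nonneg (hθ.1 i)]
    exact (hb i).1
  · calc _ ≤ ∑ _i : Fin (q + 1), 1 / (n : ℝ) ^ 5 := by
          refine Finset.sum_le_sum fun i _ => ?_
          simp only [gridParam, Pi.sub_apply]
          rw [abs_of_nonneg (sub_nonneg.2 (hb i).1)]
          exact (hb i).2
      _ = _ := by
          simp
          ring

theorem exists_gridLevel {n : ℕ} (hn : 4 ≤ n) {x : ℝ} (hx : |x| ≤ n + 1) :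
    ∃ j : Fin (n ^ 8), |x - gridLevel n j| ≤ 1 / (n : ℝ) ^ 5 ∧ |gridLevel n j| ≤ n + 2 := by
  have hn4 : (4 : ℝ) ≤ n := by exact_mod_cast hn
  have hm : (0 : ℝ) < (n : ℝ) ^ 5 := by positivity
  rw [abs_le] at hx
  have hz : 0 ≤ x + (n + 1) := by linarith
  have hb := floor_div_bounds hz hm
  have hlt : ⌊(x + (n + 1)) * (n : ℝ) ^ 5⌋₊ < n ^ 8 := by
    rw [Nat.floor_lt (mul_nonneg hz hm.le)]
    push_cast
    have h1 : x + (n + 1) < (n : ℝ) ^ 3 := by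
      have h2 : (16 : ℝ) ≤ (n : ℝ) ^ 2 := by nlinarith
      have h3 := mul_le_mul_of_nonneg_left h2 (by linarith : (0 : ℝ) ≤ n)
      have h4 : (n : ℝ) ^ 3 = n * (n : ℝ) ^ 2 := by ring
      rw [h4]
      linarith
    calc (x + (n + 1)) * (n : ℝ) ^ 5 < (n : ℝ) ^ 3 * (n : ℝ) ^ 5 := mul_lt_mul_of_pos_right h1 hm
      _ = (n : ℝ) ^ 8 := by ring
  have h0 : 0 ≤ (⌊(x + (n + 1)) * (n : ℝ) ^ 5⌋₊ : ℝ) / (n : ℝ) ^ 5 := by positivity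
  have h5 : 1 / (n : ℝ) ^ 5 ≤ 1 := by
    rw [div_le_one hm]
    exact one_le_pow₀ (by linarith)
  refine ⟨⟨_, hlt⟩, ?_, ?_⟩
  · simp only [gridLevel]
    rw [abs_le]
    constructor <;> linarith
  · simp only [gridLevel]
    rw [abs_le]
    constructor <;> linarith

/-- The indicator that the observation lies within `κ` of the level `x * √(vol θ U)`. -/
def bandInd (a θ : Fin (q + 1) → ℝ) (x κ : ℝ) (U : Fin (q + 1) → ℝ) (e : ℝ) : ℝ :=
  if |√(vol a U) * e - x * √(vol θ U)| ≤ κ then 1 else 0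

theorem bandInd_nonneg (a θ : Fin (q + 1) → ℝ) (x κ : ℝ) (U : Fin (q + 1) → ℝ) (e : ℝ) :
    0 ≤ bandInd a θ x κ U e := by
  unfold bandInd
  split_ifs <;> norm_num

theorem bandInd_le_one (a θ : Fin (q + 1) → ℝ) (x κ : ℝ) (U : Fin (q + 1) → ℝ) (e : ℝ) :
    bandInd a θ x κ U e ≤ 1 := by
  unfold bandInd
  split_ifs <;> norm_num

theorem measurable_bandInd (a θ : Fin (q + 1) → ℝ) (x κ : ℝ) :
    Measurable (Function.uncurry (bandInd a θ x κ)) := by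
  have h1 := measurable_vol a
  have h2 := measurable_vol θ
  refine Measurable.ite ?_ measurable_const measurable_const
  exact measurableSet_le (by fun_prop) measurable_const

/-- The indicator that the state or the next observation is large. -/
def largeInd (a : Fin (q + 1) → ℝ) (n : ℕ) (U : Fin (q + 1) → ℝ) (e : ℝ) : ℝ :=
  if (n : ℝ) ^ 2 < ssq U + (√(vol a U) * e) ^ 2 then 1 else 0

theorem largeInd_nonneg (a : Fin (q + 1) → ℝ) (n : ℕ) (U : Fin (q + 1) → ℝ) (e : ℝ) :
    0 ≤ largeInd a n U e := by
  unfold largeInd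
  split_ifs <;> norm_num

theorem largeInd_le_one (a : Fin (q + 1) → ℝ) (n : ℕ) (U : Fin (q + 1) → ℝ) (e : ℝ) :
    largeInd a n U e ≤ 1 := by
  unfold largeInd
  split_ifs <;> norm_num

theorem measurable_largeInd (a : Fin (q + 1) → ℝ) (n : ℕ) :
    Measurable (Function.uncurry (largeInd a n)) := by
  have h1 := measurable_vol a
  have h2 := measurable_ssq (q := q)
  refine Measurable.ite ?_ measurable_const measurable_const
  exact measurableSet_lt measurable_const (by fun_prop)

/-- Comparison of the weighted indicator at an arbitrary point with that at a grid point. -/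
theorem abs_weighted_sub_grid_le {Θ : Set (Fin (q + 1) → ℝ)} {R : ℝ} (hR : 0 ≤ R)
    (hΘ : ∀ θ ∈ Θ, (∀ i, 0 ≤ θ i) ∧ l1norm θ ≤ R)
    {P : Measure Ω} {X₀ : Ω → Fin (q + 1) → ℝ}
    {ψ : (Fin (q + 1) → ℝ) → (Fin (q + 1) → ℝ) → ℝ} {Φ M : (Fin (q + 1) → ℝ) → ℝ} {B β : ℝ}
    (w : WeightBound P X₀ Θ ψ Φ M B β) {K : ℝ} (hK : ∀ U, Φ U ≤ K)
    {a θ θ' : Fin (q + 1) → ℝ} (hθ : θ ∈ Θ) (hθ' : θ' ∈ Θ)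
    {n : ℕ} (hn : 1 ≤ n) {d x x' : ℝ} (hd : 0 ≤ d)
    (hx : |max (-((n : ℝ) + 1)) (min x (n + 1)) - x'| ≤ d) (hx' : |x'| ≤ n + 2)
    (hdθ : l1norm (θ - θ') ≤ d) (U : Fin (q + 1) → ℝ) (e : ℝ) :
    |ψ U θ * resInd a θ x U e - ψ U θ' * resInd a θ' x' U e| ≤
      M U * d + Φ U * bandInd a θ' x' ((4 + R) * (n : ℝ) ^ 3 * d) U e +
        2 * K * largeInd a n U e := by
  have hn1 : (1 : ℝ) ≤ n := by exact_mod_cast hn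
  have hΦ := w.Φ_nonneg U
  have hM := w.M_nonneg U
  have hb := bandInd_nonneg a θ' x' ((4 + R) * (n : ℝ) ^ 3 * d) U e
  have i0 := resInd_nonneg a θ x U e
  have i1 := resInd_le_one a θ x U e
  have j0 := resInd_nonneg a θ' x' U e
  have j1 := resInd_le_one a θ' x' U e
  have hψ := w.le_Φ U θ hθ
  have hψ' := w.le_Φ U θ' hθ'
  by_cases hl : (n : ℝ) ^ 2 < ssq U + (√(vol a U) * e) ^ 2
  · have hl1 : largeInd a n U e = 1 := by simp [largeInd, hl]
    rw [hl1, mul_one]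
    have h1 : |ψ U θ * resInd a θ x U e| ≤ K := by
      rw [abs_mul, abs_of_nonneg i0]
      exact (mul_le_of_le_one_right (abs_nonneg _) i1).trans (hψ.trans (hK U))
    have h2 : |ψ U θ' * resInd a θ' x' U e| ≤ K := by
      rw [abs_mul, abs_of_nonneg j0]
      exact (mul_le_of_le_one_right (abs_nonneg _) j1).trans (hψ'.trans (hK U))
    have h3 := mul_nonneg hM hd
    have h4 := mul_nonneg hΦ hb
    have h5 := abs_sub (ψ U θ * resInd a θ x U e) (ψ U θ' * resInd a θ' x' U e)
    linarith
  · have hl1 : largeInd a n U e = 0 := by simp [largeInd, hl]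
    rw [hl1, mul_zero, add_zero]
    rw [not_lt] at hl
    have hU : ssq U ≤ (n : ℝ) ^ 2 := by linarith [sq_nonneg (√(vol a U) * e)]
    have hy : |√(vol a U) * e| ≤ n :=
      abs_le_of_sq_le_sq (by linarith [ssq_nonneg U]) (by linarith)
    have hc : resInd a θ x U e = resInd a θ (max (-((n : ℝ) + 1)) (min x (n + 1))) U e :=
      indicator_clip hy (one_le_sqrt_vol (hΘ θ hθ).1 U) x
    have ht := abs_threshold_sub_le (hΘ θ hθ).1 (hΘ θ' hθ').1 (hΘ θ hθ).2 hR hn1 hU hd hx hx' hdθ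
    have hI : |resInd a θ x U e - resInd a θ' x' U e| ≤
        bandInd a θ' x' ((4 + R) * (n : ℝ) ^ 3 * d) U e := by
      rw [hc]
      exact abs_indicator_sub_le_band ht
    have e1 : ψ U θ * resInd a θ x U e - ψ U θ' * resInd a θ' x' U e =
        (ψ U θ - ψ U θ') * resInd a θ x U e +
          ψ U θ' * (resInd a θ x U e - resInd a θ' x' U e) := by ring
    rw [e1]
    refine (abs_add_le _ _).trans (add_le_add ?_ ?_)
    · rw [abs_mul, abs_of_nonneg i0]
      exact (mul_le_of_le_one_right (abs_nonneg _) i1).trans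
        ((w.lipschitz U θ hθ θ' hθ').trans (mul_le_mul_of_nonneg_left hdθ hM))
    · rw [abs_mul]
      exact mul_le_mul hψ' hI (abs_nonneg _) hΦ

namespace ErgodicChain

variable {P : Measure Ω} [IsProbabilityMeasure P] {ν : Measure ℝ} {a : Fin (q + 1) → ℝ}
  {X : ℕ → Ω → Fin (q + 1) → ℝ} {e : ℕ → Ω → ℝ} {ℱ : Filtration ℕ mΩ} {C γ : ℝ}

theorem integral_largeInd_le (h : ErgodicChain P ν a X e ℱ C γ) {n : ℕ} (hn : 1 ≤ n) :
    ∫ ω, largeInd a n (X 0 ω) (e 0 ω) ∂P ≤ 2 * C / (n : ℝ) ^ 2 := by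
  have hn1 : (1 : ℝ) ≤ n := by exact_mod_cast hn
  have hi1 := h.integrable_comp_X measurable_ssq h.ssq_integrable 1
  have hi : Integrable (fun ω => ssq (X 0 ω) + ssq (X 1 ω)) P := h.ssq_integrable.add hi1
  have hle : ∀ ω, largeInd a n (X 0 ω) (e 0 ω) ≤
      ((n : ℝ) ^ 2)⁻¹ * (ssq (X 0 ω) + ssq (X 1 ω)) := fun ω => by
    have h1 : (√(vol a (X 0 ω)) * e 0 ω) ^ 2 ≤ ssq (X 1 ω) := by
      have := h.recursion 0 ω
      rw [zero_add] at this
      rw [← step_zero, ← this]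
      exact Finset.single_le_sum (f := fun i => X 1 ω i ^ 2) (fun i _ => sq_nonneg _)
        (Finset.mem_univ 0)
    have h2 := ssq_nonneg (X 0 ω)
    have h3 := ssq_nonneg (X 1 ω)
    unfold largeInd
    split_ifs with hl
    · rw [inv_mul_eq_div, le_div_iff₀ (by positivity)]
      linarith
    · positivity
  calc _ ≤ ∫ ω, ((n : ℝ) ^ 2)⁻¹ * (ssq (X 0 ω) + ssq (X 1 ω)) ∂P :=
        integral_mono_of_nonneg (Eventually.of_forall fun ω => largeInd_nonneg _ _ _ _)
          (hi.const_mul _) (Eventually.of_forall hle)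
    _ = ((n : ℝ) ^ 2)⁻¹ * (∫ ω, ssq (X 0 ω) ∂P + ∫ ω, ssq (X 0 ω) ∂P) := by
        rw [integral_const_mul, integral_add h.ssq_integrable hi1, h.integral_comp_X measurable_ssq 1]
    _ ≤ ((n : ℝ) ^ 2)⁻¹ * (C + C) :=
        mul_le_mul_of_nonneg_left (add_le_add h.ssq_le h.ssq_le) (by positivity)
    _ = _ := by ring

theorem integral_bandInd_le {m₂ Ct Bt : ℝ} (hν : RegularNoise ν m₂ Ct Bt)
    (h : ErgodicChain P ν a X e ℱ C γ) (ha : ∀ i, 0 ≤ a i) (θ : Fin (q + 1) → ℝ) (x : ℝ) {κ : ℝ}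
    (hκ : 0 ≤ κ) : ∫ ω, bandInd a θ x κ (X 0 ω) (e 0 ω) ∂P ≤ Bt * (2 * κ) := by
  rw [← h.integral_noise_integral (measurable_bandInd a θ x κ) (K := 1) (fun U v => by
    rw [abs_of_nonneg (bandInd_nonneg _ _ _ _ _ _)]
    exact bandInd_le_one _ _ _ _ _ _)]
  calc _ ≤ ∫ _ : Ω, Bt * (2 * κ) ∂P :=
        integral_mono_of_nonneg
          (Eventually.of_forall fun ω => integral_nonneg fun v => bandInd_nonneg _ _ _ _ _ _)
          (integrable_const _)
          (Eventually.of_forall fun ω => integral_band_le hν (one_le_sqrt_vol ha _) _ hκ)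
    _ = _ := by simp

theorem largeInd_eq_zero (h : ErgodicChain P ν a X e ℱ C γ) {n : ℕ} {ω : Ω}
    (hω : ∑ t ∈ Finset.range (n + 1), ssq (X t ω) ≤ (n : ℝ) ^ 2) {t : ℕ} (ht : t < n) :
    largeInd a n (X t ω) (e t ω) = 0 := by
  have h1 : (√(vol a (X t ω)) * e t ω) ^ 2 ≤ ssq (X (t + 1) ω) := by
    rw [← step_zero, ← h.recursion t ω]
    exact Finset.single_le_sum (f := fun i => X (t + 1) ω i ^ 2) (fun i _ => sq_nonneg _)
      (Finset.mem_univ 0)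
  have h2 : ssq (X t ω) + ssq (X (t + 1) ω) ≤ ∑ t ∈ Finset.range (n + 1), ssq (X t ω) := by
    have h3 : ({t, t + 1} : Finset ℕ) ⊆ Finset.range (n + 1) := by
      intro s hs
      simp only [Finset.mem_insert, Finset.mem_singleton] at hs
      rw [Finset.mem_range]
      omega
    have h4 := Finset.sum_le_sum_of_subset_of_nonneg h3 (f := fun t => ssq (X t ω))
      fun i _ _ => ssq_nonneg _
    rwa [Finset.sum_pair (by omega)] at h4
  unfold largeInd
  rw [if_neg]
  rw [not_lt]
  linarith

end ErgodicChain

end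

section

variable {q : ℕ} {Ω : Type*} [mΩ : MeasurableSpace Ω]

theorem ErgodicChain.integrable_bounded {P : Measure Ω} [IsProbabilityMeasure P] {ν : Measure ℝ}
    {a : Fin (q + 1) → ℝ} {X : ℕ → Ω → Fin (q + 1) → ℝ} {e : ℕ → Ω → ℝ} {ℱ : Filtration ℕ mΩ}
    {C γ : ℝ} (h : ErgodicChain P ν a X e ℱ C γ) {f : (Fin (q + 1) → ℝ) → ℝ → ℝ}
    (hf : Measurable (Function.uncurry f)) {K : ℝ} (hK : ∀ U u, |f U u| ≤ K) (t : ℕ) :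
    Integrable (fun ω => f (X t ω) (e t ω)) P :=
  Integrable.of_bound
    (hf.comp ((h.measurable_X t).prodMk (h.measurable_e t))).aestronglyMeasurable K
    (Eventually.of_forall fun _ => hK _ _)

theorem abs_mul_unit_le {z w K : ℝ} (hz : |z| ≤ K) (hw0 : 0 ≤ w) (hw1 : w ≤ 1) : |z * w| ≤ K := by
  rw [abs_mul, abs_of_nonneg hw0]
  exact (mul_le_of_le_one_right (abs_nonneg _) hw1).trans hz

/-- Discretization error of the weighted residual empirical process on a typical event. -/
theorem ErgodicChain.abs_centeredSum_sub_grid_le {P : Measure Ω} [IsProbabilityMeasure P]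
    {ν : Measure ℝ} {m₂ Ct Bt : ℝ} (hν : RegularNoise ν m₂ Ct Bt) {a : Fin (q + 1) → ℝ}
    {X : ℕ → Ω → Fin (q + 1) → ℝ} {e : ℕ → Ω → ℝ} {ℱ : Filtration ℕ mΩ} {C γ : ℝ}
    (h : ErgodicChain P ν a X e ℱ C γ) {Θ : Set (Fin (q + 1) → ℝ)} {R : ℝ} (hR : 0 ≤ R)
    (hΘ : ∀ θ ∈ Θ, (∀ i, 0 ≤ θ i) ∧ l1norm θ ≤ R) (ha : a ∈ Θ)
    {ψ : (Fin (q + 1) → ℝ) → (Fin (q + 1) → ℝ) → ℝ} {Φ M : (Fin (q + 1) → ℝ) → ℝ} {B β : ℝ}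
    (w : WeightBound P (X 0) Θ ψ Φ M B β) {s : ℝ} (hs : 1 ≤ s) (hK : ∀ U, Φ U ≤ s ^ 8)
    {n : ℕ} (hsn : s ^ 32 = n) {θ θ' : Fin (q + 1) → ℝ} (hθ : θ ∈ Θ) (hθ' : θ' ∈ Θ)
    {d x x' : ℝ} (hd : d = (q + 1) / (n : ℝ) ^ 5)
    (hx : |max (-((n : ℝ) + 1)) (min x (n + 1)) - x'| ≤ d) (hx' : |x'| ≤ n + 2)
    (hdθ : l1norm (θ - θ') ≤ d) {ω : Ω}
    (hssq : ∑ t ∈ Finset.range (n + 1), ssq (X t ω) ≤ (n : ℝ) ^ 2)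
    (hM : ∑ t ∈ Finset.range n, M (X t ω) ≤ (n : ℝ) ^ 2)
    (hband : |centeredSum P X e n
      (fun U u => Φ U * bandInd a θ' x' ((4 + R) * (n : ℝ) ^ 3 * d) U u) ω| ≤ s ^ 16) :
    |centeredSum P X e n (fun U u => ψ U θ * resInd a θ x U u - ψ U θ' * resInd a θ' x' U u) ω| ≤
      s ^ 16 * (1 + (q + 1) * (2 + B) + 4 * ((4 + R) * (q + 1)) * Bt + 4 * C) := by
  have hB := w.B_nonneg
  have hBt := hν.B_nonneg
  have hC := h.C_nonneg
  have hnR : (1 : ℝ) ≤ n := by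
    rw [← hsn]
    exact one_le_pow₀ hs
  have hn : 1 ≤ n := by exact_mod_cast hnR
  have hq : (0 : ℝ) ≤ q + 1 := by positivity
  have hd0 : 0 ≤ d := by rw [hd]; positivity
  obtain ⟨κ, hκ⟩ : ∃ κ, κ = (4 + R) * (n : ℝ) ^ 3 * d := ⟨_, rfl⟩
  have hκ0 : 0 ≤ κ := by rw [hκ]; positivity
  rw [← hκ] at hband
  have hX := h.measurable_X 0
  have hbm : Measurable (Function.uncurry fun U u => Φ U * bandInd a θ' x' κ U u) :=
    (w.measurable_Φ.comp measurable_fst).mul (measurable_bandInd a θ' x' κ)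
  have hbK : ∀ U u, |Φ U * bandInd a θ' x' κ U u| ≤ s ^ 8 := fun U u =>
    abs_mul_unit_le (by rw [abs_of_nonneg (w.Φ_nonneg U)]; exact hK U) (bandInd_nonneg _ _ _ _ _ _)
      (bandInd_le_one _ _ _ _ _ _)
  have ib := h.integrable_bounded hbm hbK 0
  have il : Integrable (fun ω => largeInd a n (X 0 ω) (e 0 ω)) P :=
    h.integrable_bounded (measurable_largeInd a n) (K := 1) (fun U u => by
      rw [abs_of_nonneg (largeInd_nonneg _ _ _ _)]
      exact largeInd_le_one _ _ _ _) 0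
  have iM := w.integrable_lip hX
  have iMd : Integrable (fun ω => M (X 0 ω) * d) P := iM.mul_const d
  have il2 : Integrable (fun ω => 2 * s ^ 8 * largeInd a n (X 0 ω) (e 0 ω)) P := il.const_mul _
  have i12 : Integrable (fun ω => M (X 0 ω) * d + Φ (X 0 ω) * bandInd a θ' x' κ (X 0 ω) (e 0 ω)) P :=
    iMd.add ib
  have hpt := abs_weighted_sub_grid_le hR hΘ w hK (a := a) hθ hθ' hn hd0 hx hx' hdθ
  rw [← hκ] at hpt
  have hmain := abs_centeredSum_le (P := P) (X := X) (e := e) (n := n)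
    (f := fun U u => ψ U θ * resInd a θ x U u - ψ U θ' * resInd a θ' x' U u)
    (H := fun U u => M U * d + Φ U * bandInd a θ' x' κ U u + 2 * s ^ 8 * largeInd a n U u)
    (i12.add il2) hpt ω
  refine hmain.trans ?_
  have hsum : ∑ t ∈ Finset.range n, (M (X t ω) * d + Φ (X t ω) * bandInd a θ' x' κ (X t ω) (e t ω) +
      2 * s ^ 8 * largeInd a n (X t ω) (e t ω)) = (∑ t ∈ Finset.range n, M (X t ω)) * d +
      ∑ t ∈ Finset.range n, Φ (X t ω) * bandInd a θ' x' κ (X t ω) (e t ω) := by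
    rw [Finset.sum_mul, ← Finset.sum_add_distrib]
    refine Finset.sum_congr rfl fun t ht => ?_
    rw [h.largeInd_eq_zero hssq (Finset.mem_range.1 ht), mul_zero, add_zero]
  have hint : ∫ ω, (M (X 0 ω) * d + Φ (X 0 ω) * bandInd a θ' x' κ (X 0 ω) (e 0 ω) +
      2 * s ^ 8 * largeInd a n (X 0 ω) (e 0 ω)) ∂P = (∫ ω, M (X 0 ω) ∂P) * d +
      ∫ ω, Φ (X 0 ω) * bandInd a θ' x' κ (X 0 ω) (e 0 ω) ∂P +
      2 * s ^ 8 * ∫ ω, largeInd a n (X 0 ω) (e 0 ω) ∂P := by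
    rw [integral_add i12 il2, integral_add iMd ib, integral_mul_const, integral_const_mul]
  rw [hsum, hint]
  rw [centeredSum_eq] at hband
  obtain ⟨b, hb⟩ : ∃ b, b = ∫ ω, Φ (X 0 ω) * bandInd a θ' x' κ (X 0 ω) (e 0 ω) ∂P := ⟨_, rfl⟩
  have hble : b ≤ s ^ 8 * (Bt * (2 * κ)) := by
    have hbi : Integrable (fun ω => bandInd a θ' x' κ (X 0 ω) (e 0 ω)) P :=
      h.integrable_bounded (measurable_bandInd a θ' x' κ) (K := 1) (fun U u => by
        rw [abs_of_nonneg (bandInd_nonneg _ _ _ _ _ _)]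
        exact bandInd_le_one _ _ _ _ _ _) 0
    calc b ≤ ∫ ω, s ^ 8 * bandInd a θ' x' κ (X 0 ω) (e 0 ω) ∂P := by
          rw [hb]
          exact integral_mono ib (hbi.const_mul _) fun ω =>
            mul_le_mul_of_nonneg_right (hK _) (bandInd_nonneg _ _ _ _ _ _)
      _ ≤ _ := by
          rw [integral_const_mul]
          exact mul_le_mul_of_nonneg_left (h.integral_bandInd_le hν (hΘ a ha).1 θ' x' hκ0)
            (by positivity)
  have hl := h.integral_largeInd_le hn
  have hMi := w.integral_lip_le hX
  rw [← hb] at hband ⊢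
  have hband' := (abs_le.1 hband).2
  have t1 : (∑ t ∈ Finset.range n, M (X t ω)) * d ≤ q + 1 := by
    refine (mul_le_mul_of_nonneg_right hM hd0).trans ?_
    rw [hd, mul_div_assoc', div_le_iff₀ (by positivity)]
    have : (n : ℝ) ^ 2 ≤ (n : ℝ) ^ 5 := pow_le_pow_right₀ hnR (by norm_num)
    nlinarith
  have t2 : n * ((∫ ω, M (X 0 ω) ∂P) * d) ≤ (q + 1) * (1 + B) := by
    have h1 : n * d ≤ q + 1 := by
      rw [hd, mul_div_assoc', div_le_iff₀ (by positivity)]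
      have : (n : ℝ) ≤ (n : ℝ) ^ 5 := le_self_pow₀ hnR (by norm_num)
      nlinarith
    have h2 : 0 ≤ ∫ ω, M (X 0 ω) ∂P := integral_nonneg fun ω => w.M_nonneg _
    calc n * ((∫ ω, M (X 0 ω) ∂P) * d) = (n * d) * ∫ ω, M (X 0 ω) ∂P := by ring
      _ ≤ (q + 1) * (1 + B) := mul_le_mul h1 hMi h2 hq
  have hs8 : s ^ 8 ≤ n := by
    rw [← hsn]
    exact pow_le_pow_right₀ hs (by norm_num)
  have t3 : n * b ≤ 2 * ((4 + R) * (q + 1)) * Bt := by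
    have h1 : n * s ^ 8 * κ ≤ (4 + R) * (q + 1) := by
      have h2 : κ = (4 + R) * (q + 1) / (n : ℝ) ^ 2 := by
        rw [hκ, hd]
        field_simp
      rw [h2, mul_div_assoc', div_le_iff₀ (by positivity)]
      have h3 : n * s ^ 8 ≤ (n : ℝ) ^ 2 := by
        rw [sq]
        exact mul_le_mul_of_nonneg_left hs8 (by positivity)
      have := mul_le_mul_of_nonneg_left h3 (by positivity : 0 ≤ (4 + R) * ((q : ℝ) + 1))
      linarith
    calc n * b ≤ n * (s ^ 8 * (Bt * (2 * κ))) := mul_le_mul_of_nonneg_left hble (by positivity)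
      _ = n * s ^ 8 * κ * (2 * Bt) := by ring
      _ ≤ (4 + R) * (q + 1) * (2 * Bt) := mul_le_mul_of_nonneg_right h1 (by positivity)
      _ = _ := by ring
  have t4 : n * (2 * s ^ 8 * ∫ ω, largeInd a n (X 0 ω) (e 0 ω) ∂P) ≤ 4 * C := by
    calc n * (2 * s ^ 8 * ∫ ω, largeInd a n (X 0 ω) (e 0 ω) ∂P)
        ≤ n * (2 * s ^ 8 * (2 * C / (n : ℝ) ^ 2)) := by gcongr
      _ = 4 * C * (s ^ 8 / n) := by field_simp; ring
      _ ≤ 4 * C * 1 := by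
          refine mul_le_mul_of_nonneg_left ?_ (by positivity)
          rwa [div_le_one (by positivity)]
      _ = 4 * C := mul_one _
  have hs16 : 1 ≤ s ^ 16 := one_le_pow₀ hs
  have hT : 0 ≤ (q + 1) * (2 + B) + 4 * ((4 + R) * (q + 1)) * Bt + 4 * C := by positivity
  have hfin : (q + 1) * (2 + B) + 4 * ((4 + R) * (q + 1)) * Bt + 4 * C ≤
      s ^ 16 * ((q + 1) * (2 + B) + 4 * ((4 + R) * (q + 1)) * Bt + 4 * C) :=
    le_mul_of_one_le_left hT hs16
  have : s ^ 16 * (1 + (q + 1) * (2 + B) + 4 * ((4 + R) * (q + 1)) * Bt + 4 * C) =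
      s ^ 16 + s ^ 16 * ((q + 1) * (2 + B) + 4 * ((4 + R) * (q + 1)) * Bt + 4 * C) := by ring
  rw [this]
  linarith

end

section

variable {q : ℕ} {Ω : Type*} [mΩ : MeasurableSpace Ω]

theorem l1norm_sub_le {p : ℕ} (u v w : Fin p → ℝ) :
    l1norm (u - w) ≤ l1norm (v - u) + l1norm (v - w) := by
  unfold l1norm
  rw [← Finset.sum_add_distrib]
  refine Finset.sum_le_sum fun i _ => ?_
  simp only [Pi.sub_apply]
  have := abs_sub_le (u i) (v i) (w i)
  rwa [abs_sub_comm (u i) (v i)] at this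

theorem measureReal_union_le_of_le {P : Measure Ω} {S S' : Set Ω} {η η' : ℝ} (h : P.real S ≤ η)
    (h' : P.real S' ≤ η') : P.real (S ∪ S') ≤ η + η' :=
  (measureReal_union_le S S').trans (add_le_add h h')

/-- Uniform bound for the weighted residual empirical process with a bounded weight, for large
samples. -/
theorem exists_bound_bounded_weight {P : Measure Ω} [IsProbabilityMeasure P] {ν : Measure ℝ}
    {m₂ Ct Bt : ℝ} (hν : RegularNoise ν m₂ Ct Bt) {C γ : ℝ} (hC : 0 ≤ C) (hγ : 0 < γ) (hγ1 : γ < 1)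
    {βa : ℝ} (hβa : 0 < βa) {B : ℝ} (hB : 0 ≤ B) (β : ℝ) {ρ : ℝ} (hρ : 0 < ρ) {η : ℝ} (hη : 0 < η) :
    ∃ T : ℝ, 0 ≤ T ∧ ∀ᶠ s : ℝ in atTop,
      ∀ {a : Fin (q + 1) → ℝ} {X : ℕ → Ω → Fin (q + 1) → ℝ} {e : ℕ → Ω → ℝ}
      {ℱ : Filtration ℕ mΩ}, ErgodicChain P ν a X e ℱ C γ → a ∈ Theta (q + 1) βa →
      ∀ {ψ : (Fin (q + 1) → ℝ) → (Fin (q + 1) → ℝ) → ℝ} {Φ M : (Fin (q + 1) → ℝ) → ℝ},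
      WeightBound P (X 0) (Theta (q + 1) βa) ψ Φ M B β → ∀ {n : ℕ}, s ^ 32 = n →
      (∀ U, Φ U ≤ s ^ 8) →
      ∃ S : Set Ω, P.real S ≤ η ∧ ∀ ω ∉ S, ∀ x : ℝ, ∀ θ ∈ Theta (q + 1) βa,
        |centeredSum P X e n (fun U u => ψ U θ * resInd a θ x U u) ω| ≤
          s ^ 16 * (T + ρ * (s ^ 16 * l1norm (θ - a))) := by
  classical
  have hη5 : 0 < η / 5 := by positivity
  obtain ⟨T₀, hT₀, hT⟩ := exists_bound_at_true (q := q) (P := P) hν hC hγ hγ1 hB hη5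
  have hCt := hν.C_nonneg
  have hBt := hν.B_nonneg
  obtain ⟨R, hRdef⟩ : ∃ R, R = βa⁻¹ := ⟨_, rfl⟩
  have hR : 0 ≤ R := by rw [hRdef]; positivity
  obtain ⟨C₁, hC₁⟩ : ∃ c, c = 2 * B / ρ ^ 2 + B + Ct * C / ρ := ⟨_, rfl⟩
  obtain ⟨C₂, hC₂⟩ : ∃ c, c = 2 * ((4 + R) * (q + 1)) * Bt := ⟨_, rfl⟩
  have hC₁0 : 0 ≤ C₁ := by rw [hC₁]; positivity
  have hC₂0 : 0 ≤ C₂ := by rw [hC₂]; positivity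
  refine ⟨T₀ + (1 + ρ * (q + 1)) +
    (1 + (q + 1) * (2 + B) + 4 * ((4 + R) * (q + 1)) * Bt + 4 * C), by positivity, ?_⟩
  filter_upwards [eventually_scale_conditions (C := C) hγ hγ1 (C₁ + C₂) (8 * (q + 2)) hη5,
    eventually_ge_atTop (2 * (1 + C) / (η / 5)), eventually_ge_atTop ((1 + B) / (η / 5)),
    eventually_ge_atTop R] with s hs hs1 hs2 hsR
  obtain ⟨hs4, hsγ, hsη⟩ := hs
  intro a X e ℱ h ha ψ Φ M w n hsn hΦ
  have hs_one : 1 ≤ s := by linarith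
  have hsn_le : s ≤ n := by
    rw [← hsn]
    exact le_self_pow₀ hs_one (by norm_num)
  have hn4R : (4 : ℝ) ≤ n := by linarith
  have hn4 : 4 ≤ n := by exact_mod_cast hn4R
  have hn1 : 1 ≤ n := by omega
  have hn0 : (0 : ℝ) < n := by linarith
  have hX := h.measurable_X 0
  have hΘ : ∀ θ ∈ Theta (q + 1) βa, (∀ i, 0 ≤ θ i) ∧ l1norm θ ≤ R := fun θ hθ => by
    rw [hRdef]
    exact hθ
  obtain ⟨d, hd⟩ : ∃ d, d = ((q : ℝ) + 1) / (n : ℝ) ^ 5 := ⟨_, rfl⟩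
  obtain ⟨κ, hκ⟩ : ∃ κ, κ = (4 + R) * (n : ℝ) ^ 3 * d := ⟨_, rfl⟩
  have hd0 : 0 ≤ d := by rw [hd]; positivity
  have hκ0 : 0 ≤ κ := by rw [hκ]; positivity
  let ι := {i : (Fin (q + 1) → Fin (n ^ 8)) × Fin (n ^ 8) //
    gridParam n i.1 ∈ Theta (q + 1) βa}
  have hcard : (Fintype.card ι : ℝ) ≤ s ^ (32 * (8 * (q + 2))) := by
    have h1 : Fintype.card ι ≤ n ^ (8 * (q + 2)) := by
      refine (Fintype.card_subtype_le _).trans (le_of_eq ?_)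
      rw [Fintype.card_prod, Fintype.card_fun, Fintype.card_fin, Fintype.card_fin]
      ring
    calc (Fintype.card ι : ℝ) ≤ ((n ^ (8 * (q + 2)) : ℕ) : ℝ) := by exact_mod_cast h1
      _ = s ^ (32 * (8 * (q + 2))) := by
        push_cast
        rw [← hsn, ← pow_mul]
  have hres : ∀ θ ∈ Theta (q + 1) βa, ∀ x, Measurable (Function.uncurry
      fun U u => ψ U θ * resInd a θ x U u) := fun θ hθ x =>
    ((w.measurable θ hθ).comp measurable_fst).mul (measurable_resInd a θ x)
  have hresK : ∀ θ ∈ Theta (q + 1) βa, ∀ x U u, |ψ U θ * resInd a θ x U u| ≤ s ^ 8 :=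
    fun θ hθ x U u => abs_mul_unit_le ((w.le_Φ U θ hθ).trans (hΦ U)) (resInd_nonneg _ _ _ _ _)
      (resInd_le_one _ _ _ _ _)
  -- increments along the grid of parameters
  have hfam := h.deviation_family (ι := ι)
    (f := fun i U u => ψ U (gridParam n i.1.1) * resInd a (gridParam n i.1.1) (gridLevel n i.1.2) U u -
      ψ U a * resInd a a (gridLevel n i.1.2) U u)
    (fun i => (hres _ i.2 _).sub (hres a ha _)) hsn hs4 hsγ
    (fun i U u => by
      have h1 := abs_sub (ψ U (gridParam n i.1.1) * resInd a (gridParam n i.1.1) (gridLevel n i.1.2) U u)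
        (ψ U a * resInd a a (gridLevel n i.1.2) U u)
      have h2 := hresK _ i.2 (gridLevel n i.1.2) U u
      have h3 := hresK a ha (gridLevel n i.1.2) U u
      linarith) (C' := C₁ + C₂) (by positivity)
    (u := fun i => 1 + ρ * (s ^ 16 * l1norm (gridParam n i.1.1 - a)))
    (fun i => by
      have : 0 ≤ ρ * (s ^ 16 * l1norm (gridParam n i.1.1 - a)) :=
        mul_nonneg hρ.le (mul_nonneg (by positivity) (l1norm_nonneg _))
      linarith)
    (fun i => by
      refine (h.integral_increment_sq_le hν (fun θ hθ => hθ.1) w ha i.2 hρ hs_one _).trans ?_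
      rw [← hC₁]
      refine mul_le_mul_of_nonneg_right ?_ (sq_nonneg _)
      refine div_le_div_of_nonneg_right ?_ (by positivity)
      linarith)
    hcard hsη
  -- bands around the grid of levels
  have hbm : ∀ θ x, Measurable (Function.uncurry fun U u => Φ U * bandInd a θ x κ U u) := fun θ x =>
    (w.measurable_Φ.comp measurable_fst).mul (measurable_bandInd a θ x κ)
  have hbK : ∀ θ x U u, |Φ U * bandInd a θ x κ U u| ≤ s ^ 8 := fun θ x U u =>
    abs_mul_unit_le (by rw [abs_of_nonneg (w.Φ_nonneg U)]; exact hΦ U) (bandInd_nonneg _ _ _ _ _ _)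
      (bandInd_le_one _ _ _ _ _ _)
  have hfam' := h.deviation_family (ι := ι)
    (f := fun i U u => Φ U * bandInd a (gridParam n i.1.1) (gridLevel n i.1.2) κ U u)
    (fun i => hbm _ _) hsn hs4 hsγ
    (fun i U u => (hbK _ _ U u).trans (by nlinarith [one_le_pow₀ hs_one (n := 8)]))
    (C' := C₁ + C₂) (by positivity)
    (u := fun _ => 1) (fun _ => le_rfl)
    (fun i => by
      have hbi : Integrable (fun ω => bandInd a (gridParam n i.1.1) (gridLevel n i.1.2) κ
          (X 0 ω) (e 0 ω)) P :=
        h.integrable_bounded (measurable_bandInd a _ _ κ) (K := 1) (fun U u => by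
          rw [abs_of_nonneg (bandInd_nonneg _ _ _ _ _ _)]
          exact bandInd_le_one _ _ _ _ _ _) 0
      have hκs : s ^ 16 * (Bt * (2 * κ)) = C₂ / s ^ 48 := by
        rw [hκ, hd, hC₂, ← hsn]
        field_simp
      calc _ ≤ ∫ ω, s ^ 16 * bandInd a (gridParam n i.1.1) (gridLevel n i.1.2) κ
            (X 0 ω) (e 0 ω) ∂P := by
            refine integral_mono_of_nonneg (Eventually.of_forall fun ω => sq_nonneg _)
              (hbi.const_mul _) (Eventually.of_forall fun ω => ?_)
            have b0 := bandInd_nonneg a (gridParam n i.1.1) (gridLevel n i.1.2) κ (X 0 ω) (e 0 ω)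
            have b1 := bandInd_le_one a (gridParam n i.1.1) (gridLevel n i.1.2) κ (X 0 ω) (e 0 ω)
            simp only [mul_pow]
            refine mul_le_mul ?_ (by nlinarith) (sq_nonneg _) (by positivity)
            calc Φ (X 0 ω) ^ 2 ≤ (s ^ 8) ^ 2 := pow_le_pow_left₀ (w.Φ_nonneg _) (hΦ _) 2
              _ = s ^ 16 := by ring
        _ ≤ s ^ 16 * (Bt * (2 * κ)) := by
            rw [integral_const_mul]
            exact mul_le_mul_of_nonneg_left (h.integral_bandInd_le hν (hΘ a ha).1 _ _ hκ0)
              (by positivity)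
        _ = C₂ / s ^ 48 := hκs
        _ ≤ C₂ / s ^ 8 :=
            div_le_div_of_nonneg_left hC₂0 (by positivity) (pow_le_pow_right₀ hs_one (by norm_num))
        _ ≤ (C₁ + C₂) / s ^ 8 * 1 ^ 2 := by
            rw [one_pow, mul_one]
            exact div_le_div_of_nonneg_right (by linarith) (by positivity))
    hcard hsη
  -- moment events
  have hev1 : P.real {ω | (n : ℝ) ^ 2 < ∑ t ∈ Finset.range (n + 1), (1 + ssq (X t ω))} ≤ η / 5 := by
    have hi : ∀ t, Integrable (fun ω => 1 + ssq (X t ω)) P := fun t =>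
      (integrable_const _).add (h.integrable_comp_X measurable_ssq h.ssq_integrable t)
    refine (measureReal_lt_le_div (K := (n + 1) * (1 + C))
      (fun ω => Finset.sum_nonneg fun t _ => by linarith [ssq_nonneg (X t ω)])
      (integrable_finsetSum _ fun t _ => hi t) (by positivity) ?_).trans ?_
    · rw [integral_finsetSum _ fun t _ => hi t]
      calc _ ≤ ∑ _t ∈ Finset.range (n + 1), (1 + C) := by
            refine Finset.sum_le_sum fun t _ => ?_
            rw [integral_add (integrable_const _) (h.integrable_comp_X measurable_ssq
              h.ssq_integrable t), h.integral_comp_X measurable_ssq t]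
            simpa using h.ssq_le
        _ = _ := by rw [Finset.sum_const, Finset.card_range, nsmul_eq_mul]; push_cast; ring
    · rw [div_le_iff₀ hη5] at hs1
      rw [div_le_iff₀ (by positivity)]
      calc (n + 1) * (1 + C) ≤ n * (2 * (1 + C)) := by nlinarith
        _ ≤ n * (s * (η / 5)) := mul_le_mul_of_nonneg_left hs1 hn0.le
        _ ≤ n * (n * (η / 5)) := by gcongr
        _ = _ := by ring
  have hev2 : P.real {ω | (n : ℝ) ^ 2 < ∑ t ∈ Finset.range n, M (X t ω)} ≤ η / 5 := by
    have hi : ∀ t, Integrable (fun ω => M (X t ω)) P :=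
      h.integrable_comp_X w.measurable_M (w.integrable_lip hX)
    refine (measureReal_lt_le_div (K := n * (1 + B))
      (fun ω => Finset.sum_nonneg fun t _ => w.M_nonneg _)
      (integrable_finsetSum _ fun t _ => hi t) (by positivity) ?_).trans ?_
    · rw [integral_finsetSum _ fun t _ => hi t]
      calc _ ≤ ∑ _t ∈ Finset.range n, (1 + B) := by
            refine Finset.sum_le_sum fun t _ => ?_
            rw [h.integral_comp_X w.measurable_M t]
            exact w.integral_lip_le hX
        _ = _ := by rw [Finset.sum_const, Finset.card_range, nsmul_eq_mul]
    · rw [div_le_iff₀ hη5] at hs2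
      rw [div_le_iff₀ (by positivity)]
      calc n * (1 + B) ≤ n * (s * (η / 5)) := mul_le_mul_of_nonneg_left hs2 hn0.le
        _ ≤ n * (n * (η / 5)) := by gcongr
        _ = _ := by ring
  -- the process at the true parameter
  have hψ4 : ∀ ω, ψ (X 0 ω) a ^ 4 ≤ Φ (X 0 ω) ^ 4 := fun ω => by
    rw [← Even.pow_abs (by decide : Even 4)]
    exact pow_le_pow_left₀ (abs_nonneg _) (w.le_Φ _ a ha) 4
  have hψi : Integrable (fun ω => ψ (X 0 ω) a ^ 4) P :=
    w.integrable_Φ.mono' (((w.measurable a ha).comp hX).pow_const 4).aestronglyMeasurable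
      (Eventually.of_forall fun ω => by
        rw [Real.norm_eq_abs, abs_of_nonneg (by positivity)]
        exact hψ4 ω)
  obtain ⟨S₃, hS₃, htrue⟩ := hT h (w.measurable a ha) hψi
    ((integral_mono hψi w.integrable_Φ hψ4).trans w.moment_Φ) hn1
  refine ⟨_, (measureReal_union_le_of_le (measureReal_union_le_of_le (measureReal_union_le_of_le
    (measureReal_union_le_of_le hev1 hev2) hS₃) hfam) hfam').trans (by linarith), ?_⟩
  intro ω hω x θ hθ
  simp only [Set.mem_union, not_or, Set.mem_ofPred_eq, not_lt, not_and, not_exists] at hω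
  obtain ⟨⟨⟨⟨hω1, hω2⟩, hω3⟩, hω4⟩, hω5⟩ := hω
  have hω1' : ∑ t ∈ Finset.range n, (1 + ssq (X t ω)) ≤ (n : ℝ) ^ 2 := by
    refine le_trans ?_ hω1
    rw [Finset.sum_range_succ]
    linarith [ssq_nonneg (X n ω)]
  have hω1'' : ∑ t ∈ Finset.range (n + 1), ssq (X t ω) ≤ (n : ℝ) ^ 2 :=
    (Finset.sum_le_sum fun t _ => by linarith).trans hω1
  obtain ⟨v, hv, hvd⟩ := exists_gridParam hθ hn4 (by rw [← hRdef]; linarith)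
  have hclip : |max (-((n : ℝ) + 1)) (min x (n + 1))| ≤ n + 1 := by
    rw [abs_le]
    exact ⟨le_max_left _ _, max_le (by linarith) (min_le_right _ _)⟩
  obtain ⟨j, hj, hj2⟩ := exists_gridLevel hn4 hclip
  have hj' : |max (-((n : ℝ) + 1)) (min x (n + 1)) - gridLevel n j| ≤ d := by
    refine hj.trans ?_
    rw [hd]
    exact div_le_div_of_nonneg_right (by linarith [Nat.cast_nonneg (α := ℝ) q]) (by positivity)
  rw [← hd] at hvd
  have k4 := hω4 hω1' ⟨(v, j), hv⟩
  have k5 := hω5 hω1' ⟨(v, j), hv⟩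
  simp only [one_mul] at k4 k5
  have k1 := h.abs_centeredSum_sub_grid_le hν hR hΘ ha w hs_one hΦ hsn hθ hv hd hj' hj2 hvd hω1'' hω2
    (by rw [← hκ]; exact k5)
  have k3 := htrue ω hω3 (gridLevel n j)
  have hsqrt : √(n : ℝ) = s ^ 16 := by
    rw [← hsn, Real.sqrt_eq_iff_mul_self_eq (by positivity) (by positivity)]
    ring
  rw [hsqrt] at k3
  have k3' : |centeredSum P X e n (fun U u => ψ U a * resInd a a (gridLevel n j) U u) ω| ≤
      T₀ * s ^ 16 := by
    simp only [centeredSum, resInd_self ha.1]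
    exact k3
  have k4' : |centeredSum P X e n (fun U u => ψ U (gridParam n v) *
      resInd a (gridParam n v) (gridLevel n j) U u - ψ U a * resInd a a (gridLevel n j) U u) ω| ≤
      (1 + ρ * (s ^ 16 * l1norm (gridParam n v - a))) * s ^ 16 := k4
  have iθ := h.integrable_bounded (hres θ hθ x) (hresK θ hθ x) 0
  have iv := h.integrable_bounded (hres _ hv (gridLevel n j)) (hresK _ hv (gridLevel n j)) 0
  have ia := h.integrable_bounded (hres a ha (gridLevel n j)) (hresK a ha (gridLevel n j)) 0
  have hdec : centeredSum P X e n (fun U u => ψ U θ * resInd a θ x U u) ω =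
      centeredSum P X e n (fun U u => ψ U θ * resInd a θ x U u -
        ψ U (gridParam n v) * resInd a (gridParam n v) (gridLevel n j) U u) ω +
      (centeredSum P X e n (fun U u => ψ U (gridParam n v) *
        resInd a (gridParam n v) (gridLevel n j) U u - ψ U a * resInd a a (gridLevel n j) U u) ω +
      centeredSum P X e n (fun U u => ψ U a * resInd a a (gridLevel n j) U u) ω) := by
    rw [← centeredSum_add (iv.sub ia) ia, ← centeredSum_add (iθ.sub iv)]
    · simp
    · simpa using iv
  rw [hdec]
  refine (abs_add_le _ _).trans ((add_le_add_right (abs_add_le _ _) _).trans ?_)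
  have hτ : s ^ 16 * l1norm (gridParam n v - a) ≤ s ^ 16 * l1norm (θ - a) + (q + 1) := by
    have h1 := l1norm_sub_le (gridParam n v) θ a
    have h2 : s ^ 16 * d ≤ q + 1 := by
      rw [hd, mul_div_assoc', div_le_iff₀ (by positivity)]
      have h3 : s ^ 16 ≤ (n : ℝ) ^ 5 := by
        rw [← hsn, ← pow_mul]
        exact pow_le_pow_right₀ hs_one (by norm_num)
      have := mul_le_mul_of_nonneg_left h3 (by positivity : (0 : ℝ) ≤ q + 1)
      linarith
    have h4 := mul_le_mul_of_nonneg_left (h1.trans (add_le_add_left hvd _))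
      (by positivity : 0 ≤ s ^ 16)
    linarith
  have hτ' := mul_le_mul_of_nonneg_left hτ hρ.le
  have hτ'' := mul_le_mul_of_nonneg_left hτ' (by positivity : 0 ≤ s ^ 16)
  linarith

end

section

variable {q : ℕ} {Ω : Type*} [mΩ : MeasurableSpace Ω]

/-- A crude bound for the weighted residual empirical process in samples of bounded size. -/
theorem ErgodicChain.exists_bound_small {P : Measure Ω} [IsProbabilityMeasure P] {ν : Measure ℝ}
    {a : Fin (q + 1) → ℝ} {X : ℕ → Ω → Fin (q + 1) → ℝ} {e : ℕ → Ω → ℝ} {ℱ : Filtration ℕ mΩ}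
    {C γ : ℝ} (h : ErgodicChain P ν a X e ℱ C γ) {Θ : Set (Fin (q + 1) → ℝ)}
    {ψ : (Fin (q + 1) → ℝ) → (Fin (q + 1) → ℝ) → ℝ} {Φ M : (Fin (q + 1) → ℝ) → ℝ} {B β : ℝ}
    (w : WeightBound P (X 0) Θ ψ Φ M B β) {η : ℝ} (hη : 0 < η) {n n₀ : ℕ} (hn : n ≤ n₀)
    (hn₀ : 1 ≤ n₀) :
    ∃ S : Set Ω, P.real S ≤ η ∧ ∀ ω ∉ S, ∀ x : ℝ, ∀ θ ∈ Θ,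
        |centeredSum P X e n (fun U u => ψ U θ * resInd a θ x U u) ω| ≤
          n₀ * (1 + B) / η + n₀ * (1 + B) := by
  have hB := w.B_nonneg
  have hX := h.measurable_X 0
  have hn₀R : (1 : ℝ) ≤ n₀ := by exact_mod_cast hn₀
  have hnR : (n : ℝ) ≤ n₀ := by exact_mod_cast hn
  have hi : ∀ t, Integrable (fun ω => Φ (X t ω)) P :=
    h.integrable_comp_X w.measurable_Φ (w.integrable_envelope hX)
  have hm := w.integral_envelope_le hX
  have hpos : 0 < n₀ * (1 + B) := by positivity
  have hS := measureReal_lt_le_div (P := P) (f := fun ω => ∑ t ∈ Finset.range n, Φ (X t ω))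
    (c := n₀ * (1 + B) / η) (K := n₀ * (1 + B))
    (fun ω => Finset.sum_nonneg fun t _ => w.Φ_nonneg _)
    (integrable_finsetSum _ fun t _ => hi t) (by positivity) (by
      rw [integral_finsetSum _ fun t _ => hi t]
      calc _ ≤ ∑ _t ∈ Finset.range n, (1 + B) := by
            refine Finset.sum_le_sum fun t _ => ?_
            rw [h.integral_comp_X w.measurable_Φ t]
            exact hm
        _ = n * (1 + B) := by rw [Finset.sum_const, Finset.card_range, nsmul_eq_mul]
        _ ≤ _ := mul_le_mul_of_nonneg_right hnR (by positivity))
  refine ⟨_, hS.trans (by rw [div_div_cancel₀ hpos.ne']), ?_⟩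
  intro ω hω x θ hθ
  simp only [Set.mem_ofPred_eq, not_lt] at hω
  have hb := abs_centeredSum_le (P := P) (X := X) (e := e) (n := n)
    (f := fun U u => ψ U θ * resInd a θ x U u) (H := fun U _ => Φ U) (hi 0)
    (fun U u => abs_mul_unit_le (w.le_Φ U θ hθ) (resInd_nonneg _ _ _ _ _) (resInd_le_one _ _ _ _ _))
    ω
  have : n * ∫ ω, Φ (X 0 ω) ∂P ≤ n₀ * (1 + B) :=
    mul_le_mul hnR hm (integral_nonneg fun ω => w.Φ_nonneg _) (by positivity)
  linarith

/-- Replacing the weight by its truncation changes the centred sums little. -/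
theorem ErgodicChain.abs_centeredSum_sub_truncate_le {P : Measure Ω} [IsProbabilityMeasure P]
    {ν : Measure ℝ} {a : Fin (q + 1) → ℝ} {X : ℕ → Ω → Fin (q + 1) → ℝ} {e : ℕ → Ω → ℝ}
    {ℱ : Filtration ℕ mΩ} {C γ : ℝ} (h : ErgodicChain P ν a X e ℱ C γ)
    {Θ : Set (Fin (q + 1) → ℝ)}
    {ψ : (Fin (q + 1) → ℝ) → (Fin (q + 1) → ℝ) → ℝ} {Φ M : (Fin (q + 1) → ℝ) → ℝ} {B β : ℝ}
    (w : WeightBound P (X 0) Θ ψ Φ M B β) {s : ℝ} (hs : 1 ≤ s) {n : ℕ} (hsn : s ^ 32 = n)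
    {θ : Fin (q + 1) → ℝ} (hθ : θ ∈ Θ) (x : ℝ) {ω : Ω} (hω : ∀ t < n, Φ (X t ω) ≤ s ^ 8) :
    |centeredSum P X e n (fun U u => ψ U θ * resInd a θ x U u) ω -
      centeredSum P X e n (fun U u => (if Φ U ≤ s ^ 8 then ψ U θ else 0) * resInd a θ x U u) ω| ≤
      s ^ 16 * B := by
  have hB := w.B_nonneg
  have hX := h.measurable_X 0
  have he := h.measurable_e 0
  have hs0 : 0 < s := by linarith
  have hI : Measurable fun ω => resInd a θ x (X 0 ω) (e 0 ω) := by
    have := (measurable_resInd a θ x).comp (hX.prodMk he)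
    exact this
  have hψ : Measurable fun ω => ψ (X 0 ω) θ := (w.measurable θ hθ).comp hX
  have hψ' : Measurable fun ω => if Φ (X 0 ω) ≤ s ^ 8 then ψ (X 0 ω) θ else 0 :=
    ((w.truncate hX (s ^ 8)).measurable θ hθ).comp hX
  have hm1 : Measurable fun ω => ψ (X 0 ω) θ * resInd a θ x (X 0 ω) (e 0 ω) := hψ.mul hI
  have hm2 : Measurable fun ω => (if Φ (X 0 ω) ≤ s ^ 8 then ψ (X 0 ω) θ else 0) *
      resInd a θ x (X 0 ω) (e 0 ω) := hψ'.mul hI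
  have hi := w.integrable_envelope hX
  have hi1 : Integrable (fun ω => ψ (X 0 ω) θ * resInd a θ x (X 0 ω) (e 0 ω)) P :=
    hi.mono' hm1.aestronglyMeasurable (Eventually.of_forall fun ω =>
      abs_mul_unit_le (w.le_Φ _ θ hθ) (resInd_nonneg _ _ _ _ _) (resInd_le_one _ _ _ _ _))
  have hi2 : Integrable (fun ω => (if Φ (X 0 ω) ≤ s ^ 8 then ψ (X 0 ω) θ else 0) *
      resInd a θ x (X 0 ω) (e 0 ω)) P :=
    hi.mono' hm2.aestronglyMeasurable (Eventually.of_forall fun ω => by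
      refine abs_mul_unit_le ?_ (resInd_nonneg _ _ _ _ _) (resInd_le_one _ _ _ _ _)
      split_ifs
      · exact w.le_Φ _ θ hθ
      · rw [abs_zero]
        exact w.Φ_nonneg _)
  have hsum : ∑ t ∈ Finset.range n, ψ (X t ω) θ * resInd a θ x (X t ω) (e t ω) =
      ∑ t ∈ Finset.range n, (if Φ (X t ω) ≤ s ^ 8 then ψ (X t ω) θ else 0) *
        resInd a θ x (X t ω) (e t ω) :=
    Finset.sum_congr rfl fun t ht => by rw [if_pos (hω t (Finset.mem_range.1 ht))]
  rw [centeredSum_eq, centeredSum_eq, hsum, sub_sub_sub_cancel_left, ← mul_sub,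
    ← integral_sub hi2 hi1, abs_mul, abs_of_nonneg (Nat.cast_nonneg n)]
  have hbound : |∫ ω, ((if Φ (X 0 ω) ≤ s ^ 8 then ψ (X 0 ω) θ else 0) *
      resInd a θ x (X 0 ω) (e 0 ω) - ψ (X 0 ω) θ * resInd a θ x (X 0 ω) (e 0 ω)) ∂P| ≤
      (s ^ 24)⁻¹ * B := by
    have h1 := norm_integral_le_of_norm_le (f := fun ω => (if Φ (X 0 ω) ≤ s ^ 8 then ψ (X 0 ω) θ else 0) *
      resInd a θ x (X 0 ω) (e 0 ω) - ψ (X 0 ω) θ * resInd a θ x (X 0 ω) (e 0 ω))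
      (w.integrable_Φ.const_mul (s ^ 24)⁻¹) (Eventually.of_forall fun ω => by
        split_ifs with hc
        · rw [sub_self, norm_zero]
          have := w.Φ_nonneg (X 0 ω)
          positivity
        · rw [zero_mul, zero_sub, norm_neg]
          refine (abs_mul_unit_le (w.le_Φ _ θ hθ) (resInd_nonneg _ _ _ _ _)
            (resInd_le_one _ _ _ _ _)).trans ?_
          rw [not_le] at hc
          have h3 : s ^ 24 ≤ Φ (X 0 ω) ^ 3 := by
            calc s ^ 24 = (s ^ 8) ^ 3 := by ring
              _ ≤ _ := pow_le_pow_left₀ (by positivity) hc.le 3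
          rw [inv_mul_eq_div, le_div_iff₀ (by positivity)]
          calc Φ (X 0 ω) * s ^ 24 ≤ Φ (X 0 ω) * Φ (X 0 ω) ^ 3 :=
                mul_le_mul_of_nonneg_left h3 (w.Φ_nonneg _)
            _ = _ := by ring)
    rw [integral_const_mul] at h1
    exact h1.trans (mul_le_mul_of_nonneg_left w.moment_Φ (by positivity))
  calc _ ≤ n * ((s ^ 24)⁻¹ * B) := mul_le_mul_of_nonneg_left hbound (Nat.cast_nonneg n)
    _ = s ^ 8 * B := by
        rw [← hsn]
        field_simp
    _ ≤ s ^ 16 * B := mul_le_mul_of_nonneg_right (pow_le_pow_right₀ hs (by norm_num)) hB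

theorem ErgodicChain.measureReal_exists_envelope_le {P : Measure Ω} [IsProbabilityMeasure P]
    {ν : Measure ℝ} {a : Fin (q + 1) → ℝ} {X : ℕ → Ω → Fin (q + 1) → ℝ} {e : ℕ → Ω → ℝ}
    {ℱ : Filtration ℕ mΩ} {C γ : ℝ} (h : ErgodicChain P ν a X e ℱ C γ)
    {Θ : Set (Fin (q + 1) → ℝ)}
    {ψ : (Fin (q + 1) → ℝ) → (Fin (q + 1) → ℝ) → ℝ} {Φ M : (Fin (q + 1) → ℝ) → ℝ} {B β : ℝ}
    (w : WeightBound P (X 0) Θ ψ Φ M B β) {s : ℝ} (hs : 1 ≤ s) {n : ℕ} (hsn : s ^ 32 = n) :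
    P.real {ω | ∃ t < n, s ^ 8 < Φ (X t ω)} ≤ B * (s ^ 8) ^ (-β) := by
  have hs0 : 0 < s := by linarith
  have hset : ∀ t, P.real {ω | s ^ 8 < Φ (X t ω)} ≤ B * (s ^ 8) ^ (-(4 + β)) := fun t => by
    have hm : MeasurableSet {U | s ^ 8 < Φ U} := measurableSet_lt measurable_const w.measurable_Φ
    have e1 : ∀ t, P.real {ω | s ^ 8 < Φ (X t ω)} = (P.map (X t)).real {U | s ^ 8 < Φ U} := fun t => by
      rw [map_measureReal_apply (h.measurable_X t) hm]
      rfl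
    rw [e1 t, h.stationary t, ← e1 0]
    exact w.tail_Φ _ (one_le_pow₀ hs)
  have e2 : {ω | ∃ t < n, s ^ 8 < Φ (X t ω)} =
      ⋃ t ∈ Finset.range n, {ω | s ^ 8 < Φ (X t ω)} := by
    ext ω
    simp
  rw [e2]
  refine (measureReal_biUnion_finset_le _ _).trans ((Finset.sum_le_sum fun t _ => hset t).trans ?_)
  rw [Finset.sum_const, Finset.card_range, nsmul_eq_mul, ← hsn]
  refine le_of_eq ?_
  rw [neg_add, Real.rpow_add (by positivity)]
  have : (s ^ 8) ^ (-4 : ℝ) = (s ^ 32)⁻¹ := by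
    rw [Real.rpow_neg (by positivity)]
    norm_cast
    rw [← pow_mul]
  rw [this]
  field_simp

/-- Uniform bound for the weighted residual empirical process. -/
theorem exists_bound_process {P : Measure Ω} [IsProbabilityMeasure P] {ν : Measure ℝ}
    {m₂ Ct Bt : ℝ} (hν : RegularNoise ν m₂ Ct Bt) {C γ : ℝ} (hC : 0 ≤ C) (hγ : 0 < γ) (hγ1 : γ < 1)
    {βa : ℝ} (hβa : 0 < βa) {B : ℝ} (hB : 0 ≤ B) {β : ℝ} (hβ : 0 < β) {ρ : ℝ} (hρ : 0 < ρ) {η : ℝ}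
    (hη : 0 < η) :
    ∃ T : ℝ, 0 ≤ T ∧ ∀ {a : Fin (q + 1) → ℝ} {X : ℕ → Ω → Fin (q + 1) → ℝ} {e : ℕ → Ω → ℝ}
      {ℱ : Filtration ℕ mΩ}, ErgodicChain P ν a X e ℱ C γ → a ∈ Theta (q + 1) βa →
      ∀ {ψ : (Fin (q + 1) → ℝ) → (Fin (q + 1) → ℝ) → ℝ} {Φ M : (Fin (q + 1) → ℝ) → ℝ},
      WeightBound P (X 0) (Theta (q + 1) βa) ψ Φ M B β → ∀ {n : ℕ}, 1 ≤ n →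
      ∃ S : Set Ω, P.real S ≤ η ∧ ∀ ω ∉ S, ∀ x : ℝ, ∀ θ ∈ Theta (q + 1) βa,
        |centeredSum P X e n (fun U u => ψ U θ * resInd a θ x U u) ω| ≤
          √n * (T + ρ * (√n * l1norm (θ - a))) := by
  have hη2 : 0 < η / 2 := by positivity
  obtain ⟨T, hT0, hT⟩ := exists_bound_bounded_weight (q := q) (P := P) hν hC hγ hγ1 hβa hB β hρ hη2
  have hlim : Tendsto (fun s : ℝ => B * (s ^ 8) ^ (-β)) atTop (𝓝 0) := by
    have := ((tendsto_rpow_neg_atTop hβ).comp (tendsto_pow_atTop (α := ℝ) (n := 8) (by norm_num))).const_mul B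
    simpa using this
  have hev := (hT.and (hlim.eventually_le_const hη2)).and (eventually_ge_atTop (1 : ℝ))
  have hroot : Tendsto (fun n : ℕ => (n : ℝ) ^ (1 / 32 : ℝ)) atTop atTop :=
    (tendsto_rpow_atTop (by norm_num)).comp tendsto_natCast_atTop_atTop
  obtain ⟨n₁, hn₁⟩ := eventually_atTop.1 (hroot.eventually hev)
  obtain ⟨n₀, hn₀⟩ : ∃ n₀, n₀ = max n₁ 1 := ⟨_, rfl⟩
  have hn₀1 : 1 ≤ n₀ := hn₀ ▸ le_max_right _ _
  refine ⟨T + B + (n₀ * (1 + B) / η + n₀ * (1 + B)), by positivity, ?_⟩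
  intro a X e ℱ h ha ψ Φ M w n hn
  have hsqrt1 : 1 ≤ √(n : ℝ) := Real.one_le_sqrt.2 (by exact_mod_cast hn)
  have hpos : 0 ≤ n₀ * (1 + B) / η + n₀ * (1 + B) := by positivity
  have hτ : ∀ θ, 0 ≤ ρ * (√(n : ℝ) * l1norm (θ - a)) := fun θ =>
    mul_nonneg hρ.le (mul_nonneg (by positivity) (l1norm_nonneg _))
  rcases le_total n n₀ with hle | hle
  · obtain ⟨S, hS, hS'⟩ := h.exists_bound_small w hη hle hn₀1
    refine ⟨S, hS, fun ω hω x θ hθ => (hS' ω hω x θ hθ).trans ?_⟩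
    have h1 := hτ θ
    have h2 : 0 ≤ T + B + (n₀ * (1 + B) / η + n₀ * (1 + B)) +
        ρ * (√(n : ℝ) * l1norm (θ - a)) := by positivity
    exact le_trans (by linarith) (le_mul_of_one_le_left h2 hsqrt1)
  · obtain ⟨⟨hT', htail⟩, hs1⟩ := hn₁ n ((le_max_left _ _).trans (hn₀ ▸ hle))
    obtain ⟨s, hs⟩ : ∃ s, s = (n : ℝ) ^ (1 / 32 : ℝ) := ⟨_, rfl⟩
    rw [← hs] at hT' htail hs1
    have hsn : s ^ 32 = n := by
      rw [hs, ← Real.rpow_natCast, ← Real.rpow_mul (Nat.cast_nonneg n)]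
      norm_num
    have hsqrt : √(n : ℝ) = s ^ 16 := by
      rw [← hsn, Real.sqrt_eq_iff_mul_self_eq (by positivity) (by positivity)]
      ring
    obtain ⟨S, hS, hS'⟩ := hT' h ha (w.truncate (h.measurable_X 0) (s ^ 8)) hsn (fun U => by
      split_ifs with hc
      · exact hc
      · positivity)
    refine ⟨_, (measureReal_union_le_of_le hS
      ((h.measureReal_exists_envelope_le w hs1 hsn).trans htail)).trans (by linarith), ?_⟩
    intro ω hω x θ hθ
    simp only [Set.mem_union, not_or, Set.mem_ofPred_eq, not_exists, not_and, not_lt] at hω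
    have h1 := hS' ω hω.1 x θ hθ
    have h2 := h.abs_centeredSum_sub_truncate_le w hs1 hsn hθ x hω.2
    have h3 := abs_sub_abs_le_abs_sub
      (centeredSum P X e n (fun U u => ψ U θ * resInd a θ x U u) ω)
      (centeredSum P X e n (fun U u => (if Φ U ≤ s ^ 8 then ψ U θ else 0) * resInd a θ x U u) ω)
    rw [hsqrt]
    have h4 : 0 ≤ s ^ 16 * (n₀ * (1 + B) / η + n₀ * (1 + B)) := by positivity
    have h5 : s ^ 16 * (T + B + (n₀ * (1 + B) / η + n₀ * (1 + B)) +
        ρ * (s ^ 16 * l1norm (θ - a))) = s ^ 16 * (T + ρ * (s ^ 16 * l1norm (θ - a))) + s ^ 16 * B +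
        s ^ 16 * (n₀ * (1 + B) / η + n₀ * (1 + B)) := by ring
    rw [h5]
    linarith

end

section

variable {q : ℕ} {Ω : Type*} [mΩ : MeasurableSpace Ω]

theorem integral_sq_mul_of_indep {P : Measure Ω} [IsProbabilityMeasure P] {𝒢 : MeasurableSpace Ω}
    {u f : Ω → ℝ} (hind : Indep 𝒢 (MeasurableSpace.comap u inferInstance) P)
    (hf : Measurable[𝒢] f) (hfi : Integrable f P) (hui : Integrable (fun ω => u ω ^ 2) P) :
    Integrable (fun ω => u ω ^ 2 * f ω) P ∧
      ∫ ω, u ω ^ 2 * f ω ∂P = (∫ ω, u ω ^ 2 ∂P) * ∫ ω, f ω ∂P := by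
  have h1 : IndepFun u f P := by
    rw [IndepFun_iff_Indep]
    exact (indep_of_indep_of_le_left hind hf.comap_le).symm
  have h2 : IndepFun (fun ω => u ω ^ 2) f P :=
    h1.comp (measurable_id.pow_const 2) measurable_id
  exact ⟨h2.integrable_mul hui hfi, h2.integral_fun_mul_eq_mul_integral hui.aestronglyMeasurable
    hfi.aestronglyMeasurable⟩

/-- The path of the recursion started from zero. -/
def zeroStart (a : Fin (q + 1) → ℝ) (u : ℕ → Ω → ℝ) : ℕ → Ω → Fin (q + 1) → ℝ
  | 0 => fun _ => 0
  | j + 1 => fun ω => step a (zeroStart a u j ω) (u j ω)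

/-- The homogeneous recursion that dominates the distance between squared paths. -/
def dominating (a : Fin (q + 1) → ℝ) (u : ℕ → Ω → ℝ) : ℕ → Ω → Fin (q + 1) → ℝ
  | 0 => fun _ _ => 1
  | j + 1 => fun ω => Fin.cons (u j ω ^ 2 * ∑ i, a i * dominating a u j ω i)
      fun i : Fin q => dominating a u j ω i.castSucc

theorem dominating_succ_zero (a : Fin (q + 1) → ℝ) (u : ℕ → Ω → ℝ) (j : ℕ) (ω : Ω) :
    dominating a u (j + 1) ω 0 = u j ω ^ 2 * ∑ i, a i * dominating a u j ω i := rfl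

theorem dominating_succ_succ (a : Fin (q + 1) → ℝ) (u : ℕ → Ω → ℝ) (j : ℕ) (ω : Ω) (i : Fin q) :
    dominating a u (j + 1) ω i.succ = dominating a u j ω i.castSucc := rfl

theorem dominating_nonneg {a : Fin (q + 1) → ℝ} (ha : ∀ i, 0 ≤ a i) (u : ℕ → Ω → ℝ) (j : ℕ) (ω : Ω)
    (i : Fin (q + 1)) : 0 ≤ dominating a u j ω i := by
  induction j generalizing i with
  | zero => exact zero_le_one
  | succ j ih =>
    refine Fin.cases ?_ (fun i => ?_) i
    · rw [dominating_succ_zero]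
      exact mul_nonneg (sq_nonneg _) (Finset.sum_nonneg fun i _ => mul_nonneg (ha i) (ih i))
    · exact ih _

/-- Comparison of an arbitrary path with the path started from zero. -/
theorem abs_sq_sub_zeroStart_le {a : Fin (q + 1) → ℝ} (ha : ∀ i, 0 ≤ a i) {u : ℕ → Ω → ℝ}
    {Y : ℕ → Fin (q + 1) → ℝ} {ω : Ω} (hY : ∀ j, Y (j + 1) = step a (Y j) (u j ω)) {K : ℝ}
    (hK : ∀ i, Y 0 i ^ 2 ≤ K) (j : ℕ) (i : Fin (q + 1)) :
    |Y j i ^ 2 - zeroStart a u j ω i ^ 2| ≤ K * dominating a u j ω i ∧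
      0 ≤ Y j i * zeroStart a u j ω i := by
  induction j generalizing i with
  | zero =>
    simp only [zeroStart, dominating, Pi.zero_apply, mul_zero, mul_one, le_refl, and_true]
    rw [zero_pow two_ne_zero, sub_zero, abs_of_nonneg (sq_nonneg _)]
    exact hK i
  | succ j ih =>
    rw [hY j]
    refine Fin.cases ?_ (fun i => ?_) i
    · constructor
      · refine (abs_step_zero_sq_sub_le ha _ _ _).trans ?_
        rw [dominating_succ_zero, mul_left_comm]
        refine mul_le_mul_of_nonneg_left ?_ (sq_nonneg _)
        rw [Finset.mul_sum]
        refine Finset.sum_le_sum fun i _ => ?_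
        rw [mul_left_comm]
        exact mul_le_mul_of_nonneg_left (ih i).1 (ha i)
      · simp only [zeroStart, step_zero]
        have h1 := Real.sqrt_nonneg (vol a (Y j))
        have h2 := Real.sqrt_nonneg (vol a (zeroStart a u j ω))
        have : √(vol a (Y j)) * u j ω * (√(vol a (zeroStart a u j ω)) * u j ω) =
          √(vol a (Y j)) * √(vol a (zeroStart a u j ω)) * u j ω ^ 2 := by ring
        rw [this]
        positivity
    · exact ih i.castSucc

theorem sq_sub_le_abs_sq_sub {x z : ℝ} (h : 0 ≤ x * z) : (x - z) ^ 2 ≤ |x ^ 2 - z ^ 2| := by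
  have key : ∀ {x z : ℝ}, 0 ≤ x * z → x ^ 2 ≤ z ^ 2 → x ^ 2 ≤ x * z := fun {x z} h h1 =>
    le_trans (le_abs_self _) (abs_le_of_sq_le_sq (by nlinarith [sq_nonneg x]) h)
  rcases le_total (x ^ 2) (z ^ 2) with h1 | h1
  · rw [abs_of_nonpos (by linarith)]
    linarith [key h h1]
  · rw [abs_of_nonneg (by linarith)]
    linarith [key (mul_comm x z ▸ h) h1]

/-- An innovation sequence adapted to an increasing family, each term being independent of the
past. -/
structure NoiseSequence (P : Measure Ω) (u : ℕ → Ω → ℝ) (𝒢 : ℕ → MeasurableSpace Ω) (m₂ : ℝ) :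
    Prop where
  mono : ∀ j, 𝒢 j ≤ 𝒢 (j + 1)
  adapted : ∀ j, Measurable[𝒢 (j + 1)] (u j)
  indep : ∀ j, Indep (𝒢 j) (MeasurableSpace.comap (u j) inferInstance) P
  sq_integrable : ∀ j, Integrable (fun ω => u j ω ^ 2) P
  sq_eq : ∀ j, ∫ ω, u j ω ^ 2 ∂P = m₂

namespace NoiseSequence

variable {P : Measure Ω} [IsProbabilityMeasure P] {u : ℕ → Ω → ℝ} {𝒢 : ℕ → MeasurableSpace Ω}
  {m₂ : ℝ} {a : Fin (q + 1) → ℝ}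

theorem measurable_zeroStart (h : NoiseSequence P u 𝒢 m₂) (j : ℕ) :
    Measurable[𝒢 j] (zeroStart a u j) := by
  induction j with
  | zero => exact measurable_const
  | succ j ih =>
    have := (measurable_step a).comp ((ih.mono (h.mono j) le_rfl).prodMk (h.adapted j))
    exact this

theorem measurable_dominating (h : NoiseSequence P u 𝒢 m₂) (j : ℕ) (i : Fin (q + 1)) :
    Measurable[𝒢 j] fun ω => dominating a u j ω i := by
  induction j generalizing i with
  | zero => exact measurable_const
  | succ j ih =>
    have ih' := fun i => (ih i).mono (h.mono j) le_rfl
    refine Fin.cases ?_ (fun i => ?_) i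
    · simp only [dominating_succ_zero]
      exact ((h.adapted j).pow_const 2).mul
        (Finset.measurable_sum _ fun i _ => (ih' i).const_mul (a i))
    · exact ih' _

theorem integral_dominating_le (h : NoiseSequence P u 𝒢 m₂) (ha : ∀ i, 0 ≤ a i) {A γ : ℝ}
    (hγ : 0 < γ) (hγ1 : γ ≤ 1) (hA : m₂ * A ≤ γ ^ (q + 1)) (hm : 0 ≤ m₂) (haA : ∑ i, a i ≤ A)
    (j : ℕ) (i : Fin (q + 1)) :
    Integrable (fun ω => dominating a u j ω i) P ∧
      ∫ ω, dominating a u j ω i ∂P ≤ γ ^ j * (γ ^ (i : ℕ))⁻¹ := by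
  induction j generalizing i with
  | zero =>
    refine ⟨integrable_const _, ?_⟩
    simp only [dominating, integral_const, probReal_univ, one_smul, pow_zero, one_mul]
    exact (one_le_inv₀ (by positivity)).2 (pow_le_one₀ hγ.le hγ1)
  | succ j ih =>
    refine Fin.cases ?_ (fun i => ?_) i
    · have hsm : Measurable[𝒢 j] fun ω => ∑ i, a i * dominating a u j ω i :=
        Finset.measurable_sum _ fun i _ => (h.measurable_dominating j i).const_mul (a i)
      have hsi : Integrable (fun ω => ∑ i, a i * dominating a u j ω i) P :=
        integrable_finsetSum _ fun i _ => (ih i).1.const_mul (a i)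
      have h1 := integral_sq_mul_of_indep (h.indep j) hsm hsi (h.sq_integrable j)
      simp only [dominating_succ_zero]
      refine ⟨h1.1, ?_⟩
      rw [h1.2, h.sq_eq j, integral_finsetSum _ fun i _ => (ih i).1.const_mul (a i)]
      simp only [integral_const_mul]
      have h2 : ∑ i, a i * ∫ ω, dominating a u j ω i ∂P ≤ A * (γ ^ j * (γ ^ q)⁻¹) := by
        calc _ ≤ ∑ i, a i * (γ ^ j * (γ ^ q)⁻¹) := by
              refine Finset.sum_le_sum fun i _ => mul_le_mul_of_nonneg_left ?_ (ha i)
              refine (ih i).2.trans (mul_le_mul_of_nonneg_left ?_ (by positivity))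
              refine inv_anti₀ (by positivity) ?_
              exact pow_le_pow_of_le_one hγ.le hγ1 (Nat.lt_succ_iff.1 i.2)
          _ ≤ _ := by
              rw [← Finset.sum_mul]
              exact mul_le_mul_of_nonneg_right haA (by positivity)
      calc _ ≤ m₂ * (A * (γ ^ j * (γ ^ q)⁻¹)) := mul_le_mul_of_nonneg_left h2 hm
        _ = m₂ * A * (γ ^ j * (γ ^ q)⁻¹) := by ring
        _ ≤ γ ^ (q + 1) * (γ ^ j * (γ ^ q)⁻¹) := mul_le_mul_of_nonneg_right hA (by positivity)
        _ = _ := by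
            rw [Fin.val_zero, pow_zero, inv_one, mul_one]
            field_simp
            ring
    · refine ⟨(ih i.castSucc).1, ?_⟩
      simp only [dominating_succ_succ]
      refine (ih i.castSucc).2.trans (le_of_eq ?_)
      rw [Fin.val_castSucc, Fin.val_succ]
      field_simp
      ring

theorem integral_zeroStart_sq_le (h : NoiseSequence P u 𝒢 m₂) (ha : ∀ i, 0 ≤ a i) {A : ℝ}
    (hm : 0 ≤ m₂) (hA : m₂ * A < 1) (haA : ∑ i, a i ≤ A) (j : ℕ) (i : Fin (q + 1)) :
    Integrable (fun ω => zeroStart a u j ω i ^ 2) P ∧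
      ∫ ω, zeroStart a u j ω i ^ 2 ∂P ≤ m₂ / (1 - m₂ * A) := by
  have hS : 0 ≤ m₂ / (1 - m₂ * A) := div_nonneg hm (by linarith)
  induction j generalizing i with
  | zero => simpa [zeroStart] using hS
  | succ j ih =>
    refine Fin.cases ?_ (fun i => ih i.castSucc) i
    have hvm : Measurable[𝒢 j] fun ω => vol a (zeroStart a u j ω) :=
      (measurable_vol a).comp (h.measurable_zeroStart j)
    have hsi : Integrable (fun ω => ∑ i, a i * zeroStart a u j ω i ^ 2) P :=
      integrable_finsetSum _ fun i _ => (ih i).1.const_mul (a i)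
    have hvi : Integrable (fun ω => vol a (zeroStart a u j ω)) P := (integrable_const _).add hsi
    have h1 := integral_sq_mul_of_indep (h.indep j) hvm hvi (h.sq_integrable j)
    have e1 : ∀ ω, zeroStart a u (j + 1) ω 0 ^ 2 = u j ω ^ 2 * vol a (zeroStart a u j ω) := fun ω => by
      simp only [zeroStart, step_zero]
      rw [mul_pow, sq_sqrt_vol ha, mul_comm]
    simp only [e1]
    refine ⟨h1.1, ?_⟩
    rw [h1.2, h.sq_eq j]
    have h2 : ∫ ω, vol a (zeroStart a u j ω) ∂P ≤ 1 + A * (m₂ / (1 - m₂ * A)) := by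
      unfold vol
      rw [integral_add (integrable_const _) hsi,
        integral_finsetSum _ fun i _ => (ih i).1.const_mul (a i)]
      simp only [integral_const_mul, integral_const, probReal_univ, one_smul]
      refine add_le_add le_rfl ?_
      calc _ ≤ ∑ i, a i * (m₂ / (1 - m₂ * A)) :=
            Finset.sum_le_sum fun i _ => mul_le_mul_of_nonneg_left (ih i).2 (ha i)
        _ ≤ _ := by
            rw [← Finset.sum_mul]
            exact mul_le_mul_of_nonneg_right haA hS
    refine (mul_le_mul_of_nonneg_left h2 hm).trans (le_of_eq ?_)
    have : 1 - m₂ * A ≠ 0 := by linarith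
    field_simp
    ring

end NoiseSequence

end

section

variable {q : ℕ} {Ω : Type*} [mΩ : MeasurableSpace Ω]

/-- The σ-algebra generated by the innovations up to time `t`. -/
@[reducible]
def pastSigma (ε : ℤ → Ω → ℝ) (t : ℤ) : MeasurableSpace Ω :=
  ⨆ s ∈ Set.Iic t, MeasurableSpace.comap (ε s) inferInstance

theorem pastSigma_mono (ε : ℤ → Ω → ℝ) {s t : ℤ} (h : s ≤ t) : pastSigma ε s ≤ pastSigma ε t :=
  biSup_mono fun _ hr => le_trans hr h

theorem measurable_pastSigma (ε : ℤ → Ω → ℝ) {s t : ℤ} (h : s ≤ t) :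
    Measurable[pastSigma ε t] (ε s) :=
  measurable_iff_comap_le.2
    (le_biSup (fun s => MeasurableSpace.comap (ε s) inferInstance) (Set.mem_Iic.2 h))

namespace IsInnovation

variable {P : Measure Ω} [IsProbabilityMeasure P] {ε : ℤ → Ω → ℝ} {g : ℝ → ℝ}

theorem pastSigma_le (h : IsInnovation P ε g) (t : ℤ) : pastSigma ε t ≤ mΩ :=
  iSup₂_le fun s _ => (h.measurable s).comap_le

theorem indep_pastSigma (h : IsInnovation P ε g) (t : ℤ) :
    Indep (pastSigma ε t) (MeasurableSpace.comap (ε (t + 1)) inferInstance) P := by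
  have h1 := indep_iSup_of_disjoint (fun s => (h.measurable s).comap_le) h.indep.iIndep
    (S := Set.Iic t) (T := {t + 1}) (by simp)
  simpa [pastSigma] using h1

theorem measurable_sq_real : Measurable fun x : ℝ => x ^ 2 := by fun_prop

theorem integral_sq (h : IsInnovation P ε g) (t : ℤ) :
    ∫ ω, ε t ω ^ 2 ∂P = ∫ x, x ^ 2 ∂(noiseLaw g) := by
  rw [noiseLaw, ← h.density t, integral_map (h.measurable t).aemeasurable
    measurable_sq_real.aestronglyMeasurable]

theorem integrable_sq_noiseLaw (h : IsInnovation P ε g) :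
    Integrable (fun x => x ^ 2) (noiseLaw g) := by
  rw [noiseLaw, ← h.density 1, integrable_map_measure
    measurable_sq_real.aestronglyMeasurable (h.measurable 1).aemeasurable]
  exact h.sq_integrable

theorem integrable_sq (h : IsInnovation P ε g) (t : ℤ) : Integrable (fun ω => ε t ω ^ 2) P := by
  have h1 := h.integrable_sq_noiseLaw
  rw [noiseLaw, ← h.density t, integrable_map_measure
    measurable_sq_real.aestronglyMeasurable (h.measurable t).aemeasurable] at h1
  exact h1

theorem noiseSequence (h : IsInnovation P ε g) (s : ℤ) :
    NoiseSequence P (fun j : ℕ => ε (s + j + 1)) (fun j : ℕ => pastSigma ε (s + j))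
      (∫ x, x ^ 2 ∂(noiseLaw g)) where
  mono j := pastSigma_mono ε (by push_cast; linarith)
  adapted j := measurable_pastSigma ε (by push_cast; linarith)
  indep j := h.indep_pastSigma _
  sq_integrable j := h.integrable_sq _
  sq_eq j := h.integral_sq _

end IsInnovation

namespace IsStationaryArch

variable {P : Measure Ω} [IsProbabilityMeasure P] {ε : ℤ → Ω → ℝ} {g : ℝ → ℝ}
  {a : Fin (q + 1) → ℝ} {y : ℤ → Ω → ℝ}

theorem measurable_lags (hy : IsStationaryArch P ε a y) (t : ℤ) :
    Measurable (lags (q + 1) y t) :=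
  measurable_pi_iff.2 fun _ => hy.measurable _

theorem map_lags (hy : IsStationaryArch P ε a y) (t : ℤ) :
    P.map (lags (q + 1) y t) = P.map (lags (q + 1) y 0) := by
  have hm : ∀ h : ℤ, Measurable fun ω (t : ℤ) => y (t + h) ω := fun h =>
    measurable_pi_iff.2 fun _ => hy.measurable _
  have hp : Measurable fun (z : ℤ → ℝ) (i : Fin (q + 1)) => z (-(i : ℕ)) :=
    measurable_pi_iff.2 fun _ => measurable_pi_apply _
  have key : ∀ t, P.map (lags (q + 1) y t) = (P.map fun ω (s : ℤ) => y (s + t) ω).map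
      fun (z : ℤ → ℝ) (i : Fin (q + 1)) => z (-(i : ℕ)) := fun t => by
    rw [Measure.map_map hp (hm t)]
    congr 1
    ext ω i
    simp only [lags, Function.comp]
    congr 1
    ring
  rw [key t, key 0, hy.stationary t, hy.stationary 0]

theorem lags_succ (hy : IsStationaryArch P ε a y) :
    ∀ᵐ ω ∂P, ∀ t : ℤ, lags (q + 1) y (t + 1) ω = step a (lags (q + 1) y t ω) (ε (t + 1) ω) := by
  rw [ae_all_iff]
  intro t
  filter_upwards [hy.equation (t + 1)] with ω hω
  rw [add_sub_cancel_right] at hω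
  ext i
  refine Fin.cases ?_ (fun i => ?_) i
  · rw [step_zero, ← hω]
    simp [lags]
  · rw [step_succ]
    simp only [lags, Fin.val_succ, Fin.val_castSucc]
    congr 1
    push_cast
    ring

theorem tendsto_measureReal_ssq_lags (hy : IsStationaryArch P ε a y) :
    Tendsto (fun K : ℝ => P.real {ω | K < ssq (lags (q + 1) y 0 ω)}) atTop (𝓝 0) := by
  have hm : Measurable fun ω => ssq (lags (q + 1) y 0 ω) :=
    measurable_ssq.comp (hy.measurable_lags 0)
  have : IsProbabilityMeasure (P.map fun ω => ssq (lags (q + 1) y 0 ω)) :=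
    Measure.isProbabilityMeasure_map hm.aemeasurable
  have h1 := (tendsto_cdf_atTop (P.map fun ω => ssq (lags (q + 1) y 0 ω))).const_sub 1
  rw [sub_self] at h1
  refine h1.congr fun K => ?_
  have hset : MeasurableSet {ω | ssq (lags (q + 1) y 0 ω) ≤ K} :=
    measurableSet_le hm measurable_const
  rw [cdf_eq_real, map_measureReal_apply hm measurableSet_Iic]
  change 1 - P.real {ω | ssq (lags (q + 1) y 0 ω) ≤ K} = _
  rw [← probReal_compl_eq_one_sub hset]
  congr 1
  ext ω
  simp

/-- The stationary solution is the limit in probability of the paths started from zero in the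
remote past. -/
theorem tendstoInMeasure_zeroStart (hy : IsStationaryArch P ε a y) (hε : IsInnovation P ε g)
    (ha : ∀ i, 0 ≤ a i) {m₂ A γ : ℝ} (hm₂ : m₂ = ∫ x, x ^ 2 ∂(noiseLaw g)) (hγ : 0 < γ)
    (hγ1 : γ < 1) (hA : m₂ * A ≤ γ ^ (q + 1)) (haA : ∑ i, a i ≤ A) (t : ℤ) :
    TendstoInMeasure P (fun (m : ℕ) ω => zeroStart a (fun j : ℕ => ε (t - m + j + 1)) m ω 0) atTop
      (y t) := by
  have hm : 0 ≤ m₂ := by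
    rw [hm₂]
    exact integral_nonneg fun x => sq_nonneg x
  rw [tendstoInMeasure_iff_norm]
  intro d hd
  have hbound : ∀ {K : ℝ}, 0 < K → ∀ m : ℕ,
      P.real {ω | d ≤ ‖zeroStart a (fun j : ℕ => ε (t - m + j + 1)) m ω 0 - y t ω‖} ≤
        P.real {ω | K < ssq (lags (q + 1) y 0 ω)} + K / d ^ 2 * γ ^ m := by
    intro K hK m
    have hN := hε.noiseSequence (t - m)
    rw [← hm₂] at hN
    have hH := hN.integral_dominating_le ha hγ hγ1.le hA hm haA m 0
    simp only [Fin.val_zero, pow_zero, inv_one, mul_one] at hH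
    have hmap : P.real {ω | K < ssq (lags (q + 1) y (t - m) ω)} =
        P.real {ω | K < ssq (lags (q + 1) y 0 ω)} := by
      have hms : MeasurableSet {U : Fin (q + 1) → ℝ | K < ssq U} :=
        measurableSet_lt measurable_const measurable_ssq
      have e1 : ∀ s, P.real {ω | K < ssq (lags (q + 1) y s ω)} =
          (P.map (lags (q + 1) y s)).real {U | K < ssq U} := fun s => by
        rw [map_measureReal_apply (hy.measurable_lags s) hms]
        rfl
      rw [e1, e1, hy.map_lags]
    have hmarkov : P.real {ω | d ^ 2 / K ≤
        dominating a (fun j : ℕ => ε (t - m + j + 1)) m ω 0} ≤ K / d ^ 2 * γ ^ m := by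
      have h1 := mul_meas_ge_le_integral_of_nonneg
        (Eventually.of_forall fun ω => dominating_nonneg ha (fun j : ℕ => ε (t - m + j + 1)) m ω 0)
        hH.1 (d ^ 2 / K)
      have h2 := h1.trans hH.2
      have h3 : K / d ^ 2 * γ ^ m = γ ^ m / (d ^ 2 / K) := by
        field_simp
      rw [h3, le_div_iff₀' (by positivity)]
      exact h2
    rw [← hmap]
    refine le_trans (ENNReal.toReal_mono (measure_ne_top P ({ω | K < ssq (lags (q + 1) y (t - m) ω)} ∪
      {ω | d ^ 2 / K ≤ dominating a (fun j : ℕ => ε (t - m + j + 1)) m ω 0})) (measure_mono_ae ?_))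
      ((measureReal_union_le _ _).trans (add_le_add le_rfl hmarkov))
    filter_upwards [hy.lags_succ] with ω hω
    intro hdω
    by_contra hcon
    have hcon' : ω ∉ {ω | K < ssq (lags (q + 1) y (t - m) ω)} ∪
      {ω | d ^ 2 / K ≤ dominating a (fun j : ℕ => ε (t - m + j + 1)) m ω 0} := hcon
    simp only [Set.mem_union, Set.mem_ofPred_eq, not_or, not_lt, not_le] at hcon'
    have hdω' : d ≤ ‖zeroStart a (fun j : ℕ => ε (t - m + j + 1)) m ω 0 - y t ω‖ := hdω
    have hcmp := abs_sq_sub_zeroStart_le ha (u := fun j : ℕ => ε (t - m + j + 1)) (ω := ω)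
      (Y := fun j : ℕ => lags (q + 1) y (t - m + j) ω) (K := K)
      (fun j => by
        have := hω (t - m + j)
        rw [← this]
        push_cast
        rw [add_assoc])
      (fun i => by
        refine le_trans ?_ hcon'.1
        simp only [Nat.cast_zero, add_zero]
        exact Finset.single_le_sum (f := fun i => lags (q + 1) y (t - m) ω i ^ 2)
          (fun i _ => sq_nonneg _) (Finset.mem_univ i)) m 0
    have hlag : lags (q + 1) y (t - m + m) ω 0 = y t ω := by
      simp [lags]
    simp only [hlag] at hcmp
    have h1 := sq_sub_le_abs_sq_sub hcmp.2
    have h2 : K * dominating a (fun j : ℕ => ε (t - m + j + 1)) m ω 0 < d ^ 2 := by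
      have := mul_lt_mul_of_pos_left hcon'.2 hK
      rwa [mul_div_cancel₀ _ hK.ne'] at this
    rw [Real.norm_eq_abs, abs_sub_comm] at hdω'
    have h3 := pow_le_pow_left₀ hd.le hdω' 2
    rw [sq_abs] at h3
    linarith [hcmp.1]
  have hreal : Tendsto (fun m : ℕ => P.real {ω | d ≤ ‖zeroStart a
      (fun j : ℕ => ε (t - m + j + 1)) m ω 0 - y t ω‖}) atTop (𝓝 0) := by
    rw [Metric.tendsto_atTop]
    intro η hη
    obtain ⟨K, hK1, hK0⟩ := ((hy.tendsto_measureReal_ssq_lags.eventually_lt_const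
      (half_pos hη)).and (eventually_gt_atTop 0)).exists
    have hgeo : Tendsto (fun m : ℕ => K / d ^ 2 * γ ^ m) atTop (𝓝 0) := by
      simpa using (tendsto_pow_atTop_nhds_zero_of_lt_one hγ.le hγ1).const_mul (K / d ^ 2)
    obtain ⟨N, hN⟩ := eventually_atTop.1 (hgeo.eventually_lt_const (half_pos hη))
    refine ⟨N, fun m hm => ?_⟩
    rw [Real.dist_eq, sub_zero, abs_of_nonneg measureReal_nonneg]
    linarith [hbound hK0 m, hN m hm]
  have := ENNReal.tendsto_ofReal hreal
  simpa [ofReal_measureReal] using this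

/-- The stationary solution is a causal function of the innovations, with bounded variance. -/
theorem exists_version (hy : IsStationaryArch P ε a y) (hε : IsInnovation P ε g)
    (ha : ∀ i, 0 ≤ a i) {m₂ A γ : ℝ} (hm₂ : m₂ = ∫ x, x ^ 2 ∂(noiseLaw g)) (hγ : 0 < γ)
    (hγ1 : γ < 1) (hA : m₂ * A ≤ γ ^ (q + 1)) (hA1 : m₂ * A < 1) (haA : ∑ i, a i ≤ A) (t : ℤ) :
    (∃ v : Ω → ℝ, Measurable[pastSigma ε t] v ∧ y t =ᵐ[P] v) ∧
      Integrable (fun ω => y t ω ^ 2) P ∧ ∫ ω, y t ω ^ 2 ∂P ≤ m₂ / (1 - m₂ * A) := by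
  have hm : 0 ≤ m₂ := by
    rw [hm₂]
    exact integral_nonneg fun x => sq_nonneg x
  have hS : 0 ≤ m₂ / (1 - m₂ * A) := div_nonneg hm (by linarith)
  obtain ⟨ns, -, hns⟩ :=
    (hy.tendstoInMeasure_zeroStart hε ha hm₂ hγ hγ1 hA haA t).exists_seq_tendsto_ae
  have hN : ∀ m : ℕ, NoiseSequence P (fun j : ℕ => ε (t - m + j + 1))
      (fun j : ℕ => pastSigma ε (t - m + j)) m₂ := fun m => by
    rw [hm₂]
    exact hε.noiseSequence (t - m)
  obtain ⟨Z, hZ⟩ : ∃ Z : ℕ → Ω → ℝ, Z = fun (m : ℕ) ω =>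
    zeroStart a (fun j : ℕ => ε (t - m + j + 1)) m ω 0 := ⟨_, rfl⟩
  have hZm : ∀ m, Measurable[pastSigma ε t] (Z m) := fun m => by
    have h1 := (hN m).measurable_zeroStart (a := a) m
    rw [sub_add_cancel] at h1
    have h2 := (measurable_pi_apply (0 : Fin (q + 1))).comp h1
    rw [hZ]
    exact h2
  have hZm' : ∀ m, Measurable (Z m) := fun m => (hZm m).mono (hε.pastSigma_le t) le_rfl
  have hlim : ∀ᵐ ω ∂P, Tendsto (fun i => Z (ns i) ω) atTop (𝓝 (y t ω)) := by
    rw [hZ]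
    exact hns
  have hZsq : ∀ m, Integrable (fun ω => Z m ω ^ 2) P ∧ ∫ ω, Z m ω ^ 2 ∂P ≤ m₂ / (1 - m₂ * A) :=
    fun m => by
      rw [hZ]
      exact (hN m).integral_zeroStart_sq_le ha hm hA1 haA m 0
  have hfatou : ∫⁻ ω, ENNReal.ofReal (y t ω ^ 2) ∂P ≤ ENNReal.ofReal (m₂ / (1 - m₂ * A)) := by
    calc ∫⁻ ω, ENNReal.ofReal (y t ω ^ 2) ∂P
        = ∫⁻ ω, liminf (fun i => ENNReal.ofReal (Z (ns i) ω ^ 2)) atTop ∂P := by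
          refine lintegral_congr_ae ?_
          filter_upwards [hlim] with ω hω
          exact (ENNReal.tendsto_ofReal (hω.pow 2)).liminf_eq.symm
      _ ≤ liminf (fun i => ∫⁻ ω, ENNReal.ofReal (Z (ns i) ω ^ 2) ∂P) atTop :=
          lintegral_liminf_le fun i => ((hZm' (ns i)).pow_const 2).ennreal_ofReal
      _ ≤ liminf (fun _ : ℕ => ENNReal.ofReal (m₂ / (1 - m₂ * A))) atTop := by
          refine liminf_le_liminf (Eventually.of_forall fun i => ?_)
          rw [← ofReal_integral_eq_lintegral_ofReal (hZsq _).1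
            (Eventually.of_forall fun ω => sq_nonneg _)]
          exact ENNReal.ofReal_le_ofReal (hZsq _).2
      _ = _ := liminf_const _
  refine ⟨⟨fun ω => limsup (fun i => Z (ns i) ω) atTop, ?_, ?_⟩, ?_, ?_⟩
  · exact .limsup fun i => hZm (ns i)
  · filter_upwards [hlim] with ω hω
    exact hω.limsup_eq.symm
  · refine ⟨((hy.measurable t).pow_const 2).aestronglyMeasurable, ?_⟩
    rw [hasFiniteIntegral_iff_ofReal (Eventually.of_forall fun ω => sq_nonneg _)]
    exact hfatou.trans_lt ENNReal.ofReal_lt_top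
  · rw [integral_eq_lintegral_of_nonneg_ae (Eventually.of_forall fun ω => sq_nonneg _)
      ((hy.measurable t).pow_const 2).aestronglyMeasurable]
    exact ENNReal.toReal_le_of_le_ofReal hS hfatou

end IsStationaryArch

end

section

variable {q : ℕ} {Ω : Type*} [mΩ : MeasurableSpace Ω]

/-- The path of the chain with initial state `X₀`. -/
def chainFrom (a : Fin (q + 1) → ℝ) (e : ℕ → Ω → ℝ) (X₀ : Ω → Fin (q + 1) → ℝ) :
    ℕ → Ω → Fin (q + 1) → ℝ
  | 0 => X₀
  | t + 1 => fun ω => step a (chainFrom a e X₀ t ω) (e t ω)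

/-- The natural filtration of the innovations, from time zero on. -/
def innovationFiltration {P : Measure Ω} [IsProbabilityMeasure P] {ε : ℤ → Ω → ℝ} {g : ℝ → ℝ}
    (hε : IsInnovation P ε g) : Filtration ℕ mΩ where
  seq t := pastSigma ε t
  mono' _ _ h := pastSigma_mono ε (by exact_mod_cast h)
  le' t := hε.pastSigma_le t

/-- Invariance of a stationary law under the transition operator. -/
theorem integral_transOp_iterate_of_invariant {P : Measure Ω} [IsProbabilityMeasure P]
    {ν : Measure ℝ} [IsProbabilityMeasure ν] {a : Fin (q + 1) → ℝ} {X₀ : Ω → Fin (q + 1) → ℝ}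
    {e : Ω → ℝ} (hX : Measurable X₀) (he : Measurable e) (hlaw : P.map e = ν)
    (hind : IndepFun X₀ e P) (hinv : P.map (fun ω => step a (X₀ ω) (e ω)) = P.map X₀)
    {F : (Fin (q + 1) → ℝ) → ℝ} (hF : Measurable F) {K : ℝ} (hK : ∀ U, |F U| ≤ K) (m : ℕ) :
    ∫ ω, (transOp ν a)^[m] F (X₀ ω) ∂P = ∫ ω, F (X₀ ω) ∂P := by
  have hstep : Measurable fun ω => step a (X₀ ω) (e ω) := by
    have := (measurable_step a).comp (hX.prodMk he)
    exact this
  have one : ∀ {F : (Fin (q + 1) → ℝ) → ℝ}, Measurable F → (∀ U, |F U| ≤ K) →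
      ∫ ω, transOp ν a F (X₀ ω) ∂P = ∫ ω, F (X₀ ω) ∂P := by
    intro F hF hK
    have hH : Measurable fun z : (Fin (q + 1) → ℝ) × ℝ => F (step a z.1 z.2) :=
      hF.comp (measurable_step a)
    have hmap := (indepFun_iff_map_prod_eq_prod_map_map hX.aemeasurable he.aemeasurable).1 hind
    rw [hlaw] at hmap
    have := Measure.isProbabilityMeasure_map (μ := P) hX.aemeasurable
    have hi : Integrable (fun z : (Fin (q + 1) → ℝ) × ℝ => F (step a z.1 z.2))
        ((P.map X₀).prod ν) :=
      Integrable.of_bound hH.aestronglyMeasurable K (Eventually.of_forall fun z => hK _)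
    have h1 : ∫ ω, F (step a (X₀ ω) (e ω)) ∂P = ∫ z, F (step a z.1 z.2) ∂((P.map X₀).prod ν) := by
      rw [← hmap, integral_map (hX.prodMk he).aemeasurable hH.aestronglyMeasurable]
    rw [integral_prod _ hi, integral_map hX.aemeasurable
      hi.aestronglyMeasurable.integral_prod_right'] at h1
    have h2 : ∫ ω, F (step a (X₀ ω) (e ω)) ∂P = ∫ ω, F (X₀ ω) ∂P := by
      rw [← integral_map (f := F) hstep.aemeasurable hF.aestronglyMeasurable, hinv,
        integral_map hX.aemeasurable hF.aestronglyMeasurable]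
    rw [← h2, h1]
    rfl
  induction m with
  | zero => rfl
  | succ m ih =>
    rw [Function.iterate_succ_apply', one (measurable_transOp_iterate ν a hF m)
      (abs_transOp_iterate_le ν a hK m), ih]

/-- A stationary solution of the ARCH equation gives rise to an ergodic chain, with constants that
are uniform in the parameter. -/
theorem exists_ergodicChain {P : Measure Ω} [IsProbabilityMeasure P] {ε : ℤ → Ω → ℝ} {g : ℝ → ℝ}
    (hε : IsInnovation P ε g) {m₂ Ct Bt : ℝ} (hν : RegularNoise (noiseLaw g) m₂ Ct Bt) {A γ : ℝ}
    (hA0 : 0 ≤ A) (hγ : 0 < γ) (hγ1 : γ < 1) (hA : m₂ * A ≤ γ ^ (q + 1)) (hA1 : m₂ * A < 1) :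
    ∃ C : ℝ, 0 ≤ C ∧ ∀ {a : Fin (q + 1) → ℝ} {y : ℤ → Ω → ℝ}, (∀ i, 0 ≤ a i) → ∑ i, a i ≤ A →
      IsStationaryArch P ε a y → ∃ (X : ℕ → Ω → Fin (q + 1) → ℝ) (ℱ : Filtration ℕ mΩ),
        ErgodicChain P (noiseLaw g) a X (fun t : ℕ => ε (t + 1)) ℱ C γ ∧
          ∀ t : ℕ, X t =ᵐ[P] lags (q + 1) y t := by
  have := hν.prob
  have hCt := hν.C_nonneg
  have hm : 0 ≤ m₂ := by
    rw [← hν.sq_eq]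
    exact integral_nonneg fun x => sq_nonneg x
  obtain ⟨c, hc⟩ : ∃ c, c = (2 + (q + 1 : ℕ) * (Ct * A) * ∑ i : Fin (q + 1), (γ ^ (i : ℕ))⁻¹) *
    (γ ^ (q + 1))⁻¹ := ⟨_, rfl⟩
  obtain ⟨S, hS⟩ : ∃ S, S = (q + 1 : ℕ) * (m₂ / (1 - m₂ * A)) := ⟨_, rfl⟩
  have hS0 : 0 ≤ S := by
    rw [hS]
    exact mul_nonneg (Nat.cast_nonneg _) (div_nonneg hm (by linarith))
  have hc0 : 0 ≤ c := by
    rw [hc]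
    have : 0 ≤ ∑ i : Fin (q + 1), (γ ^ (i : ℕ))⁻¹ := Finset.sum_nonneg fun i _ => by positivity
    positivity
  refine ⟨c * (1 + S) + S, by positivity, ?_⟩
  intro a y ha haA hy
  have hver := hy.exists_version hε ha hν.sq_eq.symm hγ hγ1 hA hA1 haA
  choose v hv hyv using fun t => (hver t).1
  obtain ⟨X₀, hX₀⟩ : ∃ X₀ : Ω → Fin (q + 1) → ℝ, X₀ = fun ω (i : Fin (q + 1)) => v (-((i : ℕ) : ℤ)) ω := ⟨_, rfl⟩
  have hX₀m : Measurable[pastSigma ε 0] X₀ := by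
    rw [hX₀]
    refine @measurable_pi_iff _ _ _ (pastSigma ε 0) _ _ |>.2 fun i => ?_
    exact (hv (-(i : ℕ))).mono (pastSigma_mono ε (by omega)) le_rfl
  have hX₀y : X₀ =ᵐ[P] lags (q + 1) y 0 := by
    have : ∀ᵐ ω ∂P, ∀ i : Fin (q + 1), y (-(i : ℕ)) ω = v (-(i : ℕ)) ω :=
      ae_all_iff.2 fun i => hyv _
    filter_upwards [this] with ω hω
    ext i
    rw [hX₀]
    simp only [lags, zero_sub]
    exact (hω i).symm
  obtain ⟨X, hX⟩ : ∃ X, X = chainFrom a (fun t : ℕ => ε (t + 1)) X₀ := ⟨_, rfl⟩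
  have hX0 : X 0 = X₀ := by rw [hX]; rfl
  have hXs : ∀ t ω, X (t + 1) ω = step a (X t ω) (ε (t + 1) ω) := fun t ω => by rw [hX]; rfl
  have hXy : ∀ t : ℕ, X t =ᵐ[P] lags (q + 1) y t := by
    intro t
    induction t with
    | zero => rw [hX0]; exact hX₀y
    | succ t ih =>
      filter_upwards [ih, hy.lags_succ] with ω h1 h2
      rw [hXs, h1, ← h2 t]
      push_cast
      rfl
  have hXm : ∀ t : ℕ, Measurable[pastSigma ε t] (X t) := by
    intro t
    induction t with
    | zero => rw [hX0]; exact hX₀m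
    | succ t ih =>
      have h1 : Measurable[pastSigma ε ((t + 1 : ℕ) : ℤ)] (ε (t + 1)) :=
        measurable_pastSigma ε (by push_cast; exact le_rfl)
      have h2 := (measurable_step a).comp
        ((ih.mono (pastSigma_mono ε (by push_cast; linarith)) le_rfl).prodMk h1)
      have h3 : X (t + 1) = fun ω => step a (X t ω) (ε (t + 1) ω) := funext (hXs t)
      rw [h3]
      exact h2
  have hXm' : ∀ t, Measurable (X t) := fun t => (hXm t).mono (hε.pastSigma_le _) le_rfl
  have hstat : ∀ t, P.map (X t) = P.map (X 0) := fun t => by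
    rw [Measure.map_congr (hXy t), Measure.map_congr (hXy 0), hy.map_lags, Nat.cast_zero]
  have hsq : ∀ i : Fin (q + 1), (fun ω => X 0 ω i ^ 2) =ᵐ[P] fun ω => y (-(i : ℕ)) ω ^ 2 := fun i => by
    filter_upwards [hXy 0] with ω hω
    rw [hω]
    simp [lags]
  have hsqi : ∀ i : Fin (q + 1), Integrable (fun ω => X 0 ω i ^ 2) P := fun i =>
    (hver _).2.1.congr (hsq i).symm
  have hssqi : Integrable (fun ω => ssq (X 0 ω)) P := integrable_finsetSum _ fun i _ => hsqi i
  have hssq : ∫ ω, ssq (X 0 ω) ∂P ≤ S := by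
    unfold ssq
    rw [integral_finsetSum _ fun i _ => hsqi i, hS]
    calc _ ≤ ∑ _i : Fin (q + 1), m₂ / (1 - m₂ * A) := by
          refine Finset.sum_le_sum fun i _ => ?_
          rw [integral_congr_ae (hsq i)]
          exact (hver _).2.2
      _ = _ := by rw [Finset.sum_const, Finset.card_univ, Fintype.card_fin, nsmul_eq_mul]
  have hlaw : ∀ t : ℕ, P.map (ε (t + 1)) = noiseLaw g := fun t => hε.density _
  have hind : ∀ t : ℕ, Indep (pastSigma ε t) (MeasurableSpace.comap (ε (t + 1)) inferInstance) P :=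
    fun t => hε.indep_pastSigma t
  refine ⟨X, innovationFiltration hε,
    { prob := hν.prob
      adapted := hXm
      noise_adapted := fun t => measurable_pastSigma ε (by push_cast; exact le_rfl)
      indep := hind
      noise_law := fun t => hlaw t
      recursion := hXs
      stationary := hstat
      ssq_integrable := hssqi
      ssq_le := hssq.trans (by nlinarith [mul_nonneg hc0 (by linarith : 0 ≤ 1 + S)])
      C_nonneg := by positivity
      γ_pos := hγ
      γ_lt_one := hγ1
      mixing := ?_ }, hXy⟩
  intro F hF K hK m U
  have hK0 : 0 ≤ K := (abs_nonneg _).trans (hK 0)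
  have hif : IndepFun (X 0) (ε ((0 : ℕ) + 1)) P := by
    rw [IndepFun_iff_Indep]
    exact indep_of_indep_of_le_left (hind 0) (hXm 0).comap_le
  have hinv := integral_transOp_iterate_of_invariant (a := a) (hXm' 0) (hε.measurable _)
    (hlaw 0) hif (by
      have h1 : (fun ω => step a (X 0 ω) (ε ((0 : ℕ) + 1) ω)) = X 1 := by
        ext1 ω
        exact (hXs 0 ω).symm
      rw [h1, hstat 1]) hF hK m
  change ∫ ω, (transOp (noiseLaw g) a)^[m] F (X 0 ω) ∂P = _ at hinv
  rw [← hinv]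
  have hPm := measurable_transOp_iterate (noiseLaw g) a hF m
  have hPK := abs_transOp_iterate_le (noiseLaw g) a hK m
  have hPi : Integrable (fun ω => (transOp (noiseLaw g) a)^[m] F (X 0 ω)) P :=
    Integrable.of_bound (hPm.comp (hXm' 0)).aestronglyMeasurable K
      (Eventually.of_forall fun ω => hPK _)
  have e1 : (transOp (noiseLaw g) a)^[m] F U - ∫ ω, (transOp (noiseLaw g) a)^[m] F (X 0 ω) ∂P =
      ∫ ω, ((transOp (noiseLaw g) a)^[m] F U - (transOp (noiseLaw g) a)^[m] F (X 0 ω)) ∂P := by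
    rw [integral_sub (integrable_const _) hPi]
    simp
  have hi1 : Integrable (fun ω => 1 + ssq U + ssq (X 0 ω)) P := (integrable_const _).add hssqi
  rw [e1]
  have h2 := norm_integral_le_of_norm_le
    (f := fun ω => (transOp (noiseLaw g) a)^[m] F U - (transOp (noiseLaw g) a)^[m] F (X 0 ω))
    (hi1.const_mul (K * c * γ ^ m)) (Eventually.of_forall fun ω => by
      rw [hc]
      exact abs_transOp_iterate_sub_le hν hm hγ hγ1.le hA ha haA hF hK m U (X 0 ω))
  rw [integral_const_mul, integral_add (integrable_const _) hssqi] at h2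
  simp only [integral_const, probReal_univ, one_smul] at h2
  refine h2.trans ?_
  have hU := ssq_nonneg U
  have h3 : 1 + ssq U + ∫ ω, ssq (X 0 ω) ∂P ≤ (1 + S) * (1 + ssq U) := by nlinarith
  calc _ ≤ K * c * γ ^ m * ((1 + S) * (1 + ssq U)) :=
        mul_le_mul_of_nonneg_left h3 (by positivity)
    _ = K * (c * (1 + S)) * γ ^ m * (1 + ssq U) := by ring
    _ ≤ K * (c * (1 + S) + S) * γ ^ m * (1 + ssq U) := by
        have : c * (1 + S) ≤ c * (1 + S) + S := by linarith
        gcongr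

namespace ErgodicChain

variable {P : Measure Ω} [IsProbabilityMeasure P] {ν : Measure ℝ} {a : Fin (q + 1) → ℝ}
  {X : ℕ → Ω → Fin (q + 1) → ℝ} {e : ℕ → Ω → ℝ} {ℱ : Filtration ℕ mΩ} {C γ : ℝ}

theorem map_first_absolutelyContinuous (h : ErgodicChain P ν a X e ℱ C γ) (ha : ∀ i, 0 ≤ a i)
    (hac : ν ≪ volume) (j : ℕ) (hj : j ≤ q + 1) :
    P.map (fun ω (i : Fin j) => X j ω (Fin.castLE hj i)) ≪ volume := by
  have := h.prob
  induction j with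
  | zero =>
    refine Measure.AbsolutelyContinuous.mk fun N hN h0 => ?_
    rcases N.eq_empty_or_nonempty with hE | ⟨x, hx⟩
    · rw [hE, measure_empty]
    · exfalso
      have : N = Set.univ := Set.eq_univ_of_forall fun z => (Subsingleton.elim x z) ▸ hx
      rw [this] at h0
      simp [volume_pi] at h0
  | succ j ih =>
    have ih' := ih (by omega)
    have hVm : ∀ (j : ℕ) (hj : j ≤ q + 1),
        Measurable fun ω (i : Fin j) => X j ω (Fin.castLE hj i) := fun j hj =>
      measurable_pi_iff.2 fun i => (measurable_pi_apply _).comp (h.measurable_X j)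
    obtain ⟨V, hV⟩ : ∃ V : (Fin (q + 1) → ℝ) → Fin j → ℝ,
      V = fun U i => U (Fin.castLE (by omega) i) := ⟨_, rfl⟩
    have hVmeas : Measurable V := by
      rw [hV]
      exact measurable_pi_iff.2 fun i => measurable_pi_apply _
    refine Measure.AbsolutelyContinuous.mk fun N hN h0 => ?_
    rw [Measure.map_apply (hVm _ hj) hN]
    have hmp := (volume_preserving_piFinSuccAbove (fun _ : Fin (j + 1) => ℝ) 0).symm
    have h0' : (volume : Measure (ℝ × (Fin j → ℝ)))
        ((MeasurableEquiv.piFinSuccAbove (fun _ : Fin (j + 1) => ℝ) 0).symm ⁻¹' N) = 0 := by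
      rw [hmp.measure_preimage hN.nullMeasurableSet, h0]
    have hcons : ∀ z : ℝ × (Fin j → ℝ),
        (MeasurableEquiv.piFinSuccAbove (fun _ : Fin (j + 1) => ℝ) 0).symm z = Fin.cons z.1 z.2 := by
      intro z
      ext i
      refine Fin.cases ?_ (fun i => ?_) i <;> simp [MeasurableEquiv.piFinSuccAbove]
    have hconsm : Measurable fun z : ℝ × (Fin j → ℝ) => (Fin.cons z.1 z.2 : Fin (j + 1) → ℝ) := by
      have := hmp.measurable
      convert this using 1
      ext1 z
      exact (hcons z).symm
    have hsec : ∀ᵐ w : Fin j → ℝ, ∀ᵐ z : ℝ, (Fin.cons z w : Fin (j + 1) → ℝ) ∉ N := by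
      have h1 : ∀ᵐ z : ℝ × (Fin j → ℝ), (Fin.cons z.1 z.2 : Fin (j + 1) → ℝ) ∉ N := by
        rw [ae_iff]
        refine measure_mono_null (fun z hz => ?_) h0'
        rw [Set.mem_preimage, hcons]
        exact not_not.1 hz
      have h2 : ∀ᵐ z ∂((volume : Measure (Fin j → ℝ)).prod (volume : Measure ℝ)),
          (Fin.cons z.2 z.1 : Fin (j + 1) → ℝ) ∉ N := by
        have h3 := (Measure.measurePreserving_swap (μ := (volume : Measure (Fin j → ℝ)))
          (ν := (volume : Measure ℝ))).quasiMeasurePreserving.ae h1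
        exact h3
      exact Measure.ae_ae_of_ae_prod h2
    have hXV : ∀ᵐ U ∂(P.map (X j)), ∀ᵐ z : ℝ, (Fin.cons z (V U) : Fin (j + 1) → ℝ) ∉ N := by
      have h1 := ih'.ae_le hsec
      have e1 : (fun ω (i : Fin j) => X j ω (Fin.castLE (by omega : j ≤ q + 1) i)) = V ∘ X j := by
        rw [hV]
        rfl
      rw [e1, ← Measure.map_map hVmeas (h.measurable_X j)] at h1
      exact ae_of_ae_map hVmeas.aemeasurable h1
    have hXe : ∀ᵐ U ∂(P.map (X j)), ∀ᵐ u ∂ν,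
        (Fin.cons (√(vol a U) * u) (V U) : Fin (j + 1) → ℝ) ∉ N := by
      filter_upwards [hXV] with U hU
      have hσ : √(vol a U) ≠ 0 := by linarith [one_le_sqrt_vol ha U]
      refine hac.ae_le (mem_ae_iff.2 ?_)
      rw [ae_iff] at hU
      have h1 := Real.volume_preimage_mul_left hσ {z : ℝ | ¬ (Fin.cons z (V U) : Fin (j + 1) → ℝ) ∉ N}
      rw [hU, mul_zero] at h1
      exact h1
    have hprod : ∀ᵐ z ∂((P.map (X 0)).prod ν),
        (Fin.cons (√(vol a z.1) * z.2) (V z.1) : Fin (j + 1) → ℝ) ∉ N := by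
      rw [← h.stationary j]
      have : IsProbabilityMeasure (P.map (X j)) :=
        Measure.isProbabilityMeasure_map (h.measurable_X j).aemeasurable
      have hm1 : Measurable fun z : (Fin (q + 1) → ℝ) × ℝ =>
          (Fin.cons (√(vol a z.1) * z.2) (V z.1) : Fin (j + 1) → ℝ) := by
        have hv := measurable_vol a
        have h2 : Measurable fun z : (Fin (q + 1) → ℝ) × ℝ => (√(vol a z.1) * z.2, V z.1) := by
          fun_prop
        exact hconsm.comp h2
      exact (Measure.ae_prod_iff_ae_ae
        (p := fun z : (Fin (q + 1) → ℝ) × ℝ =>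
          (Fin.cons (√(vol a z.1) * z.2) (V z.1) : Fin (j + 1) → ℝ) ∉ N) (hm1 hN.compl)).2 hXe
    rw [← h.map_X_e j] at hprod
    have hfin := ae_of_ae_map ((h.measurable_X j).prodMk (h.measurable_e j)).aemeasurable hprod
    rw [ae_iff] at hfin
    refine measure_mono_null (fun ω hω => ?_) hfin
    simp only [Set.mem_ofPred_eq, not_not]
    have hω' : (fun i : Fin (j + 1) => X (j + 1) ω (Fin.castLE hj i)) ∈ N := hω
    convert hω' using 1
    ext i
    rw [h.recursion j ω]
    refine Fin.cases ?_ (fun i => ?_) i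
    · rfl
    · rw [hV]
      rfl

/-- The stationary law is absolutely continuous. -/
theorem map_absolutelyContinuous (h : ErgodicChain P ν a X e ℱ C γ) (ha : ∀ i, 0 ≤ a i)
    (hac : ν ≪ volume) : P.map (X 0) ≪ volume := by
  rw [← h.stationary (q + 1)]
  exact h.map_first_absolutelyContinuous ha hac (q + 1) le_rfl

end ErgodicChain

end

section

variable {q : ℕ} {Ω : Type*} [mΩ : MeasurableSpace Ω]

theorem l1norm_le_mul_l2norm {p : ℕ} (v : Fin p → ℝ) : l1norm v ≤ p * l2norm v := by
  have h : ∀ i, |v i| ≤ l2norm v := fun i => by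
    have := PiLp.norm_apply_le (WithLp.toLp 2 v) i
    simpa [l2norm] using this
  calc l1norm v ≤ ∑ _i : Fin p, l2norm v := Finset.sum_le_sum fun i _ => h i
    _ = p * l2norm v := by rw [Finset.sum_const, Finset.card_univ, Fintype.card_fin, nsmul_eq_mul]

theorem convex_Theta (p : ℕ) (βa : ℝ) : Convex ℝ (Theta p βa) := by
  intro u hu v hv s t hs ht hst
  refine ⟨fun i => ?_, ?_⟩
  · have := mul_nonneg hs (hu.1 i)
    have := mul_nonneg ht (hv.1 i)
    simp only [Pi.add_apply, Pi.smul_apply, smul_eq_mul]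
    linarith
  · calc l1norm (s • u + t • v) ≤ s * l1norm u + t * l1norm v := by
          unfold l1norm
          rw [Finset.mul_sum, Finset.mul_sum, ← Finset.sum_add_distrib]
          refine Finset.sum_le_sum fun i _ => ?_
          simp only [Pi.add_apply, Pi.smul_apply, smul_eq_mul]
          refine (abs_add_le _ _).trans (le_of_eq ?_)
          rw [abs_mul, abs_mul, abs_of_nonneg hs, abs_of_nonneg ht]
      _ ≤ s * βa⁻¹ + t * βa⁻¹ :=
          add_le_add (mul_le_mul_of_nonneg_left hu.2 hs) (mul_le_mul_of_nonneg_left hv.2 ht)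
      _ = βa⁻¹ := by rw [← add_mul, hst, one_mul]

theorem mem_Theta_of_le {p : ℕ} {βa : ℝ} {θ θ' : Fin p → ℝ} (hθ : θ ∈ Theta p βa)
    (h0 : ∀ i, 0 ≤ θ' i) (hle : ∀ i, θ' i ≤ θ i) : θ' ∈ Theta p βa := by
  refine ⟨h0, le_trans (Finset.sum_le_sum fun i _ => ?_) hθ.2⟩
  rw [abs_of_nonneg (h0 i), abs_of_nonneg (hθ.1 i)]
  exact hle i

/-- A function on `Θ` with partial derivatives bounded by `K` is Lipschitz in the `L₁` norm. -/
theorem abs_sub_le_of_partial_deriv {p : ℕ} {βa : ℝ} {f : (Fin p → ℝ) → ℝ}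
    {d : Fin p → (Fin p → ℝ) → ℝ} {K : ℝ}
    (hd : ∀ k, ∀ θ ∈ Theta p βa, HasDerivWithinAt (fun s : ℝ => f (Function.update θ k s)) (d k θ)
      {s | Function.update θ k s ∈ Theta p βa} (θ k) ∧ |d k θ| ≤ K)
    {θ θ' : Fin p → ℝ} (hθ : θ ∈ Theta p βa) (hθ' : θ' ∈ Theta p βa) :
    |f θ - f θ'| ≤ K * l1norm (θ - θ') := by
  have coord : ∀ θ ∈ Theta p βa, ∀ i s, Function.update θ i s ∈ Theta p βa →
      |f (Function.update θ i s) - f θ| ≤ K * |s - θ i| := by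
    intro θ hθ i s hs
    have hconv : Convex ℝ {s | Function.update θ i s ∈ Theta p βa} := by
      intro u hu v hv b c hb hc hbc
      have h1 := convex_Theta p βa hu hv hb hc hbc
      have h2 : b • Function.update θ i u + c • Function.update θ i v =
          Function.update θ i (b • u + c • v) := by
        ext j
        by_cases hj : j = i
        · subst hj
          simp
        · simp only [Pi.add_apply, Pi.smul_apply, smul_eq_mul, ne_eq, hj, not_false_eq_true,
            Function.update_of_ne]
          rw [← add_mul, hbc, one_mul]
      rw [h2] at h1
      exact h1
    have h1 := hconv.norm_image_sub_le_of_norm_hasDerivWithin_le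
      (f := fun s : ℝ => f (Function.update θ i s)) (f' := fun s => d i (Function.update θ i s))
      (s := {s | Function.update θ i s ∈ Theta p βa}) (C := K) (x := θ i) (y := s)
      (fun r hr => by
        have h2 := (hd i (Function.update θ i r) hr).1
        simp only [Function.update_idem, Function.update_self] at h2
        exact h2)
      (fun r hr => (hd i (Function.update θ i r) hr).2)
      (by rw [Set.mem_ofPred_eq, Function.update_eq_self]; exact hθ) hs
    simpa using h1
  have mono : ∀ θ ∈ Theta p βa, ∀ θ' : Fin p → ℝ, (∀ i, 0 ≤ θ' i) → (∀ i, θ' i ≤ θ i) →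
      |f θ - f θ'| ≤ K * ∑ i, |θ i - θ' i| := by
    intro θ hθ θ' h0 hle
    have hmem : ∀ S : Finset (Fin p), S.piecewise θ' θ ∈ Theta p βa := fun S => by
      refine mem_Theta_of_le hθ (fun i => ?_) fun i => ?_
      · by_cases hi : i ∈ S
        · simpa [hi] using h0 i
        · simpa [hi] using hθ.1 i
      · by_cases hi : i ∈ S
        · simpa [hi] using hle i
        · simp [hi]
    have key : ∀ S : Finset (Fin p), |f θ - f (S.piecewise θ' θ)| ≤ K * ∑ i ∈ S, |θ i - θ' i| := by
      intro S
      induction S using Finset.induction_on with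
      | empty => simp
      | insert i S hi ih =>
        have h1 := hmem (insert i S)
        rw [Finset.piecewise_insert] at h1 ⊢
        have h2 := coord _ (hmem S) i (θ' i) h1
        have h3 : S.piecewise θ' θ i = θ i := by simp [hi]
        rw [h3, abs_sub_comm (θ' i)] at h2
        rw [Finset.sum_insert hi, mul_add]
        have h4 := abs_sub_le (f θ) (f (S.piecewise θ' θ))
          (f (Function.update (S.piecewise θ' θ) i (θ' i)))
        rw [abs_sub_comm (f (S.piecewise θ' θ))] at h4
        linarith
    have := key Finset.univ
    rwa [Finset.piecewise_univ] at this
  obtain ⟨μ, hμ⟩ : ∃ μ : Fin p → ℝ, μ = fun i => min (θ i) (θ' i) := ⟨_, rfl⟩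
  have hμ0 : ∀ i, 0 ≤ μ i := fun i => by
    rw [hμ]
    exact le_min (hθ.1 i) (hθ'.1 i)
  have h1 := mono θ hθ μ hμ0 fun i => by
    rw [hμ]
    exact min_le_left _ _
  have h2 := mono θ' hθ' μ hμ0 fun i => by
    rw [hμ]
    exact min_le_right _ _
  have h3 : l1norm (θ - θ') = ∑ i, |θ i - μ i| + ∑ i, |θ' i - μ i| := by
    unfold l1norm
    rw [← Finset.sum_add_distrib]
    refine Finset.sum_congr rfl fun i _ => ?_
    rw [hμ, Pi.sub_apply]
    rcases le_total (θ i) (θ' i) with h | h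
    · simp only [min_eq_left h, sub_self, abs_zero, zero_add]
      exact abs_sub_comm _ _
    · simp only [min_eq_right h, sub_self, abs_zero, add_zero]
  have h4 := abs_sub_le (f θ) (f μ) (f θ')
  rw [abs_sub_comm (f μ)] at h4
  rw [h3, mul_add]
  linarith

theorem integrable_rpow_of_lintegral_le {P : Measure Ω} {f : Ω → ℝ} (hf : Measurable f)
    (hf0 : ∀ ω, 0 ≤ f ω) {r D : ℝ} (hr : 0 ≤ r) (hD : 0 ≤ D)
    (h : ∫⁻ ω, ‖f ω‖ₑ ^ r ∂P ≤ ENNReal.ofReal D) :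
    Integrable (fun ω => f ω ^ r) P ∧ ∫ ω, f ω ^ r ∂P ≤ D := by
  have e1 : ∀ ω, ‖f ω‖ₑ ^ r = ENNReal.ofReal (f ω ^ r) := fun ω => by
    rw [Real.enorm_eq_ofReal (hf0 ω), ENNReal.ofReal_rpow_of_nonneg (hf0 ω) hr]
  simp only [e1] at h
  have h0 : 0 ≤ᵐ[P] fun ω => f ω ^ r := Eventually.of_forall fun ω => Real.rpow_nonneg (hf0 ω) r
  have hm : AEStronglyMeasurable (fun ω => f ω ^ r) P := (hf.pow_const r).aestronglyMeasurable
  refine ⟨⟨hm, ?_⟩, ?_⟩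
  · rw [hasFiniteIntegral_iff_ofReal h0]
    exact h.trans_lt ENNReal.ofReal_lt_top
  · rw [integral_eq_lintegral_of_nonneg_ae h0 hm]
    exact ENNReal.toReal_le_of_le_ofReal hD h

theorem pow_le_one_add_rpow {x r : ℝ} (hx : 0 ≤ x) {m : ℕ} (hr : (m : ℝ) ≤ r) :
    x ^ m ≤ 1 + x ^ r := by
  have h0 := Real.rpow_nonneg hx r
  rcases le_total x 1 with h | h
  · have := pow_le_one₀ hx h (n := m)
    linarith
  · have := Real.rpow_le_rpow_of_exponent_le h hr
    rw [Real.rpow_natCast] at this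
    linarith

theorem integral_pow_le_of_rpow {P : Measure Ω} [IsProbabilityMeasure P] {f : Ω → ℝ}
    (hf : Measurable f) (hf0 : ∀ ω, 0 ≤ f ω) {r D : ℝ} {m : ℕ} (hr : (m : ℝ) ≤ r)
    (hi : Integrable (fun ω => f ω ^ r) P) (hD : ∫ ω, f ω ^ r ∂P ≤ D) :
    Integrable (fun ω => f ω ^ m) P ∧ ∫ ω, f ω ^ m ∂P ≤ 1 + D := by
  have hi1 : Integrable (fun ω => 1 + f ω ^ r) P := (integrable_const _).add hi
  have him : Integrable (fun ω => f ω ^ m) P :=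
    hi1.mono' (hf.pow_const m).aestronglyMeasurable (Eventually.of_forall fun ω => by
      rw [Real.norm_eq_abs, abs_of_nonneg (pow_nonneg (hf0 ω) m)]
      exact pow_le_one_add_rpow (hf0 ω) hr)
  refine ⟨him, (integral_mono him hi1 fun ω => pow_le_one_add_rpow (hf0 ω) hr).trans ?_⟩
  rw [integral_add (integrable_const _) hi]
  simpa using hD

theorem measureReal_lt_le_rpow {P : Measure Ω} [IsProbabilityMeasure P] {f : Ω → ℝ}
    (hf0 : ∀ ω, 0 ≤ f ω) {r D : ℝ} (hr : 0 < r) (hi : Integrable (fun ω => f ω ^ r) P)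
    (hD : ∫ ω, f ω ^ r ∂P ≤ D) {x : ℝ} (hx : 1 ≤ x) : P.real {ω | x < f ω} ≤ D * x ^ (-r) := by
  have hx0 : 0 < x := by linarith
  have h1 := measureReal_lt_le_div (P := P) (c := x ^ r)
    (fun ω => Real.rpow_nonneg (hf0 ω) r) hi (by positivity) hD
  rw [Real.rpow_neg hx0.le, ← div_eq_mul_inv]
  refine le_trans (measureReal_mono (fun ω (hω : x < f ω) => ?_) (measure_ne_top _ _)) h1
  exact Real.rpow_lt_rpow hx0.le hω hr

theorem tendsto_centeredSum_resInd {P : Measure Ω} [IsProbabilityMeasure P]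
    {X : ℕ → Ω → Fin (q + 1) → ℝ} {e : ℕ → Ω → ℝ} (hX : Measurable (X 0)) (he : Measurable (e 0))
    {a θ : Fin (q + 1) → ℝ} (hθ : ∀ i, 0 ≤ θ i)
    {ψ : (Fin (q + 1) → ℝ) → ℝ} (hψ : Measurable ψ) (hi : Integrable (fun ω => ψ (X 0 ω)) P)
    (n : ℕ) (ω : Ω) :
    Tendsto (fun x : ℝ => centeredSum P X e n (fun U u => ψ U * resInd a θ x U u) ω) atTop
      (𝓝 (centeredSum P X e n (fun U _ => ψ U) ω)) := by
  have hpt : ∀ U u, Tendsto (fun x : ℝ => ψ U * resInd a θ x U u) atTop (𝓝 (ψ U)) := fun U u => by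
    refine tendsto_const_nhds.congr' ?_
    filter_upwards [eventually_ge_atTop |√(vol a U) * u|] with x hx
    have h1 := one_le_sqrt_vol hθ U
    have h2 : √(vol a U) * u ≤ x * √(vol θ U) := by
      have h3 := le_abs_self (√(vol a U) * u)
      have h4 : 0 ≤ x := (abs_nonneg _).trans hx
      nlinarith
    simp [resInd, h2]
  refine tendsto_finsetSum _ fun t _ => (hpt _ _).sub ?_
  refine tendsto_integral_filter_of_dominated_convergence (fun ω => |ψ (X 0 ω)|)
    (Eventually.of_forall fun x => ?_) (Eventually.of_forall fun x => Eventually.of_forall fun ω => ?_)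
    hi.abs (Eventually.of_forall fun ω => hpt _ _)
  · have h1 := (measurable_resInd a θ x).comp (hX.prodMk he)
    have h2 : Measurable fun ω => resInd a θ x (X 0 ω) (e 0 ω) := h1
    have h3 : Measurable fun ω => ψ (X 0 ω) := hψ.comp hX
    exact (h3.mul h2).aestronglyMeasurable
  · exact abs_mul_unit_le le_rfl (resInd_nonneg _ _ _ _ _) (resInd_le_one _ _ _ _ _)

theorem sum_Icc_one_eq_sum_range {M : Type*} [AddCommMonoid M] (f : ℕ → M) (n : ℕ) :
    ∑ t ∈ Finset.Icc 1 n, f t = ∑ t ∈ Finset.range n, f (t + 1) := by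
  induction n with
  | zero => simp
  | succ n ih => rw [Finset.sum_Icc_succ_top (by omega), ih, Finset.sum_range_succ]

end

section

variable {q : ℕ} {Ω : Type*} [mΩ : MeasurableSpace Ω]

theorem weightBound_one {P : Measure Ω} [IsProbabilityMeasure P] (X₀ : Ω → Fin (q + 1) → ℝ)
    (Θ : Set (Fin (q + 1) → ℝ)) {B : ℝ} (hB : 1 ≤ B) (β : ℝ) :
    WeightBound P X₀ Θ (fun _ _ => 1) (fun _ => 1) (fun _ => 0) B β where
  measurable _ _ := measurable_const
  measurable_Φ := measurable_const
  measurable_M := measurable_const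
  le_Φ _ _ _ := by simp
  Φ_nonneg _ := zero_le_one
  M_nonneg _ := le_rfl
  lipschitz _ _ _ _ _ := by simp
  integrable_Φ := integrable_const _
  moment_Φ := by simpa using hB
  tail_Φ x hx := by
    have : {ω : Ω | x < 1} = ∅ := by
      ext ω
      simpa using hx
    rw [this, measureReal_empty]
    have : 0 < x := by linarith
    positivity
  integrable_M := integrable_const _
  moment_M := by simpa using zero_le_one.trans hB

/-- The weight functions of the theorem satisfy the domination conditions, after modification on a
Lebesgue null set. -/
theorem WeightRegular.exists_weightBound {P : Measure Ω} [IsProbabilityMeasure P] {βa : ℝ}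
    {S : Set (Fin (q + 1) → ℝ)}
    {φ : (Fin (q + 1) → ℝ) → (Fin (q + 1) → ℝ) → Fin (q + 1) → ℝ}
    {y : (Fin (q + 1) → ℝ) → ℤ → Ω → ℝ}
    (hφ : WeightRegular P (Theta (q + 1) βa) S φ y) (k : Fin (q + 1)) :
    ∃ (ψ : (Fin (q + 1) → ℝ) → (Fin (q + 1) → ℝ) → ℝ) (Φ M : (Fin (q + 1) → ℝ) → ℝ) (B β : ℝ),
      1 ≤ B ∧ 0 < β ∧ (∀ᵐ U : Fin (q + 1) → ℝ, ∀ θ, ψ U θ = φ U θ k) ∧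
      ∀ a ∈ S, ∀ X₀ : Ω → Fin (q + 1) → ℝ, Measurable X₀ → X₀ =ᵐ[P] lags (q + 1) (y a) 0 →
        WeightBound P X₀ (Theta (q + 1) βa) ψ Φ M B β := by
  classical
  obtain ⟨hmeas, Φ, M, d, β, hΦm, hMm, hβ, hΦ, hDΦ, hd, hDM⟩ := hφ
  obtain ⟨N, hN⟩ : ∃ N, N = toMeasurable volume {U : Fin (q + 1) → ℝ | ¬ ∀ j k,
      ContinuousOn (d j k U) (Theta (q + 1) βa) ∧ ∀ θ ∈ Theta (q + 1) βa,
        HasDerivWithinAt (fun s : ℝ => φ U (Function.update θ k s) j) (d j k U θ)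
          {s | Function.update θ k s ∈ Theta (q + 1) βa} (θ k) ∧ |d j k U θ| ≤ M U} := ⟨_, rfl⟩
  have hNm : MeasurableSet N := by
    rw [hN]
    exact measurableSet_toMeasurable _ _
  have hN0 : volume N = 0 := by
    rw [hN, measure_toMeasurable]
    exact ae_iff.1 hd
  have hNd : ∀ U ∉ N, ∀ θ ∈ Theta (q + 1) βa, ∀ θ' ∈ Theta (q + 1) βa,
      |φ U θ k - φ U θ' k| ≤ |M U| * l1norm (θ - θ') := by
    intro U hU θ hθ θ' hθ'
    have h1 : ∀ j k, ContinuousOn (d j k U) (Theta (q + 1) βa) ∧ ∀ θ ∈ Theta (q + 1) βa,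
        HasDerivWithinAt (fun s : ℝ => φ U (Function.update θ k s) j) (d j k U θ)
          {s | Function.update θ k s ∈ Theta (q + 1) βa} (θ k) ∧ |d j k U θ| ≤ M U := by
      by_contra hcon
      refine hU ?_
      rw [hN]
      exact subset_toMeasurable _ _ hcon
    exact abs_sub_le_of_partial_deriv (f := fun θ => φ U θ k) (d := fun i => d k i U)
      (fun i ϑ hϑ => ⟨((h1 k i).2 ϑ hϑ).1, (((h1 k i).2 ϑ hϑ).2).trans (le_abs_self _)⟩) hθ hθ'
  obtain ⟨D₁, hD₁⟩ : ∃ D, D = (⨆ a ∈ S, ∫⁻ ω, ‖Φ (lags (q + 1) (y a) 0 ω)‖ₑ ^ (4 + β) ∂P).toReal :=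
    ⟨_, rfl⟩
  obtain ⟨D₂, hD₂⟩ : ∃ D, D = (⨆ a ∈ S, ∫⁻ ω, ‖M (lags (q + 1) (y a) 0 ω)‖ₑ ^ (2 + β) ∂P).toReal :=
    ⟨_, rfl⟩
  have hD₁0 : 0 ≤ D₁ := hD₁ ▸ ENNReal.toReal_nonneg
  have hD₂0 : 0 ≤ D₂ := hD₂ ▸ ENNReal.toReal_nonneg
  refine ⟨fun U θ => if U ∈ N then 0 else φ U θ k, fun U => |Φ U|, fun U => |M U|, 1 + D₁ + D₂, β,
    by linarith, hβ, ?_, ?_⟩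
  · have : ∀ᵐ U : Fin (q + 1) → ℝ, U ∉ N := by
      rw [ae_iff]
      simpa using hN0
    filter_upwards [this] with U hU θ
    simp [hU]
  · intro a ha X₀ hX₀ hXy
    have hΦi := integrable_rpow_of_lintegral_le (P := P) (f := fun ω => |Φ (X₀ ω)|) (r := 4 + β)
      (D := D₁) (continuous_abs.measurable.comp (hΦm.comp hX₀)) (fun ω => abs_nonneg _) (by linarith)
      hD₁0 (by
        rw [hD₁, ENNReal.ofReal_toReal hDΦ.ne]
        refine le_trans (le_of_eq ?_)
          (le_iSup₂ (f := fun a _ => ∫⁻ ω, ‖Φ (lags (q + 1) (y a) 0 ω)‖ₑ ^ (4 + β) ∂P) a ha)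
        refine lintegral_congr_ae ?_
        filter_upwards [hXy] with ω hω
        simp only [hω, Real.enorm_abs])
    have hMi := integrable_rpow_of_lintegral_le (P := P) (f := fun ω => |M (X₀ ω)|) (r := 2 + β)
      (D := D₂) (continuous_abs.measurable.comp (hMm.comp hX₀)) (fun ω => abs_nonneg _) (by linarith)
      hD₂0 (by
        rw [hD₂, ENNReal.ofReal_toReal hDM.ne]
        refine le_trans (le_of_eq ?_)
          (le_iSup₂ (f := fun a _ => ∫⁻ ω, ‖M (lags (q + 1) (y a) 0 ω)‖ₑ ^ (2 + β) ∂P) a ha)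
        refine lintegral_congr_ae ?_
        filter_upwards [hXy] with ω hω
        simp only [hω, Real.enorm_abs])
    have hΦ4 := integral_pow_le_of_rpow (m := 4)
      (continuous_abs.measurable.comp (hΦm.comp hX₀)) (fun ω => abs_nonneg _)
      (by push_cast; linarith) hΦi.1 hΦi.2
    have hM2 := integral_pow_le_of_rpow (m := 2)
      (continuous_abs.measurable.comp (hMm.comp hX₀)) (fun ω => abs_nonneg _)
      (by push_cast; linarith) hMi.1 hMi.2
    exact
      { measurable := fun θ hθ => Measurable.ite hNm measurable_const (hmeas θ hθ k)
        measurable_Φ := continuous_abs.measurable.comp hΦm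
        measurable_M := continuous_abs.measurable.comp hMm
        le_Φ := fun U θ hθ => by
          split_ifs
          · rw [abs_zero]
            exact abs_nonneg _
          · exact (hΦ U θ hθ k).trans (le_abs_self _)
        Φ_nonneg := fun U => abs_nonneg _
        M_nonneg := fun U => abs_nonneg _
        lipschitz := fun U θ hθ θ' hθ' => by
          split_ifs with hU
          · rw [sub_zero, abs_zero]
            exact mul_nonneg (abs_nonneg _) (l1norm_nonneg _)
          · exact hNd U hU θ hθ θ' hθ'
        integrable_Φ := hΦ4.1
        moment_Φ := hΦ4.2.trans (by linarith)
        tail_Φ := fun x hx =>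
          (measureReal_lt_le_rpow (fun ω => abs_nonneg _) (by linarith) hΦi.1 hΦi.2 hx).trans
            (mul_le_mul_of_nonneg_right (by linarith) (Real.rpow_nonneg (by linarith) _))
        integrable_M := hM2.1
        moment_M := hM2.2.trans (by linarith) }

/-- The residual indicators in terms of the chain. -/
theorem residualInd_eq_resInd {a θ : Fin (q + 1) → ℝ} (hθ : ∀ i, 0 ≤ θ i) {y : ℤ → Ω → ℝ}
    {U : Fin (q + 1) → ℝ} {u : ℝ} {t : ℤ} {ω : Ω} (hU : lags (q + 1) y (t - 1) ω = U)
    (hy : y t ω = √(vol a U) * u) (x : ℝ) : residualInd y x θ t ω = resInd a θ x U u := by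
  have h1 : 0 < √(vol θ U) := by linarith [one_le_sqrt_vol hθ U]
  have h2 : residual y θ t ω ≤ x ↔ √(vol a U) * u ≤ x * √(vol θ U) := by
    rw [residual, hU, hy, div_le_iff₀ h1]
  unfold residualInd resInd
  by_cases h : √(vol a U) * u ≤ x * √(vol θ U)
  · rw [if_pos h]
    exact Set.indicator_of_mem (s := {ω | residual y θ t ω ≤ x}) (h2.2 h) 1
  · rw [if_neg h]
    exact Set.indicator_of_notMem (s := {ω | residual y θ t ω ≤ x}) (fun hc => h (h2.1 hc)) 1

/-- Algebraic decomposition of the self-centred weighted empirical process. -/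
theorem abs_weighted_centered_le {n : ℕ} (hn : 1 ≤ n) (w I : ℕ → ℝ) (hI0 : ∀ t, 0 ≤ I t)
    (hI1 : ∀ t, I t ≤ 1) {m₁ m₂ m₃ L κ : ℝ} (hm₃ : |m₃| ≤ κ)
    (h₁ : |∑ t ∈ Finset.range n, w t * I t - n * m₁| ≤ √n * L)
    (h₂ : |∑ t ∈ Finset.range n, I t - n * m₂| ≤ √n * L)
    (h₃ : |∑ t ∈ Finset.range n, w t - n * m₃| ≤ √n * L) :
    |(√(n : ℝ))⁻¹ * ∑ t ∈ Finset.range n,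
      w t * (I t - (n : ℝ)⁻¹ * ∑ s ∈ Finset.range n, I s) - √n * (m₁ - m₃ * m₂)| ≤ (2 + κ) * L := by
  have hn0 : (0 : ℝ) < n := by exact_mod_cast hn
  have hs : 0 < √(n : ℝ) := Real.sqrt_pos.2 hn0
  have hss : √(n : ℝ) * √(n : ℝ) = n := Real.mul_self_sqrt hn0.le
  obtain ⟨A, hA⟩ : ∃ A, A = ∑ t ∈ Finset.range n, w t * I t := ⟨_, rfl⟩
  obtain ⟨J, hJ⟩ : ∃ J, J = ∑ t ∈ Finset.range n, I t := ⟨_, rfl⟩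
  obtain ⟨V, hV⟩ : ∃ V, V = ∑ t ∈ Finset.range n, w t := ⟨_, rfl⟩
  have e1 : ∑ t ∈ Finset.range n, w t * (I t - (n : ℝ)⁻¹ * J) = A - V * ((n : ℝ)⁻¹ * J) := by
    rw [hA, hV, Finset.sum_mul, ← Finset.sum_sub_distrib]
    simp only [mul_sub]
  have hJ0 : 0 ≤ (n : ℝ)⁻¹ * J := by
    rw [hJ]
    exact mul_nonneg (by positivity) (Finset.sum_nonneg fun t _ => hI0 t)
  have hJ1 : (n : ℝ)⁻¹ * J ≤ 1 := by
    rw [inv_mul_le_iff₀ hn0, mul_one, hJ]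
    calc _ ≤ ∑ _t ∈ Finset.range n, (1 : ℝ) := Finset.sum_le_sum fun t _ => hI1 t
      _ = n := by simp
  rw [← hA] at h₁
  rw [← hJ] at h₂ ⊢
  rw [← hV] at h₃
  rw [e1]
  have e2 : (√(n : ℝ))⁻¹ * (A - V * ((n : ℝ)⁻¹ * J)) - √n * (m₁ - m₃ * m₂) =
      (√(n : ℝ))⁻¹ * ((A - n * m₁) - (V - n * m₃) * ((n : ℝ)⁻¹ * J) - m₃ * (J - n * m₂)) := by
    rw [eq_inv_mul_iff_mul_eq₀ hs.ne', mul_sub, mul_inv_cancel_left₀ hs.ne',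
      ← mul_assoc √(n : ℝ) √(n : ℝ), hss]
    field_simp
    ring
  rw [e2, abs_mul, abs_of_pos (inv_pos.2 hs), inv_mul_le_iff₀ hs]
  have hL : 0 ≤ √n * L := (abs_nonneg _).trans h₁
  have k3 : |(V - n * m₃) * ((n : ℝ)⁻¹ * J)| ≤ √n * L := abs_mul_unit_le h₃ hJ0 hJ1
  have k2 : |m₃ * (J - n * m₂)| ≤ κ * (√n * L) := by
    rw [abs_mul]
    exact mul_le_mul hm₃ h₂ (abs_nonneg _) ((abs_nonneg _).trans hm₃)
  have k4 := abs_sub ((A - n * m₁) - (V - n * m₃) * ((n : ℝ)⁻¹ * J)) (m₃ * (J - n * m₂))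
  have k5 := abs_sub (A - n * m₁) ((V - n * m₃) * ((n : ℝ)⁻¹ * J))
  calc _ ≤ √n * L + √n * L + κ * (√n * L) := by linarith
    _ = _ := by ring

end

section

variable {q : ℕ} {Ω : Type*} [mΩ : MeasurableSpace Ω]

theorem uniformOp_of_forall_exists_bound {p : ℕ} {P : Measure Ω} {S : Set (Fin p → ℝ)}
    {Z : (Fin p → ℝ) → ℕ → Ω → ℝ≥0∞}
    (h : ∀ η : ℝ, 0 < η → ∃ T : ℝ, 0 ≤ T ∧ ∀ a ∈ S, ∀ n : ℕ, 1 ≤ n → ∃ E : Set Ω,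
      P E ≤ ENNReal.ofReal η ∧ ∀ ω ∉ E, Z a n ω ≤ ENNReal.ofReal T) : UniformOp P S Z := by
  unfold UniformOp
  rw [ENNReal.tendsto_nhds_zero]
  intro η hη
  obtain ⟨η', hη'0, hη'⟩ : ∃ η' : ℝ, 0 < η' ∧ ENNReal.ofReal η' ≤ η := by
    obtain ⟨r, hr0, hr⟩ := ENNReal.lt_iff_exists_nnreal_btwn.1 hη
    exact ⟨r, by exact_mod_cast hr0, by simpa using hr.le⟩
  obtain ⟨T, hT0, hT⟩ := h η' hη'0
  filter_upwards [eventually_gt_atTop T] with C hC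
  refine iSup₂_le fun a ha => iSup₂_le fun n hn => ?_
  obtain ⟨E, hE, hEω⟩ := hT a ha n hn
  refine (measure_mono fun ω (hω : ENNReal.ofReal C ≤ Z a n ω) => ?_).trans (hE.trans hη')
  by_contra hcon
  have h1 := hω.trans (hEω ω hcon)
  rw [ENNReal.ofReal_le_ofReal_iff hT0] at h1
  linarith

/-- Identification of the process and of its bias in terms of the chain. -/
theorem ErgodicChain.abs_Wproc_sub_bias_le {P : Measure Ω} [IsProbabilityMeasure P]
    {ν : Measure ℝ} {a : Fin (q + 1) → ℝ} {X : ℕ → Ω → Fin (q + 1) → ℝ} {ε : ℤ → Ω → ℝ}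
    {ℱ : Filtration ℕ mΩ} {C γ : ℝ}
    (h : ErgodicChain P ν a X (fun t : ℕ => ε (t + 1)) ℱ C γ)
    {y : ℤ → Ω → ℝ} (hy : IsStationaryArch P ε a y) (hXy : ∀ t : ℕ, X t =ᵐ[P] lags (q + 1) y t)
    {βa : ℝ} {φ : (Fin (q + 1) → ℝ) → (Fin (q + 1) → ℝ) → Fin (q + 1) → ℝ} {k : Fin (q + 1)}
    {ψ : (Fin (q + 1) → ℝ) → (Fin (q + 1) → ℝ) → ℝ} {Φ M : (Fin (q + 1) → ℝ) → ℝ} {B β : ℝ}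
    (w : WeightBound P (X 0) (Theta (q + 1) βa) ψ Φ M B β)
    (hψ : ∀ t : ℕ, ∀ᵐ ω ∂P, ∀ θ, ψ (X t ω) θ = φ (X t ω) θ k) {n : ℕ} (hn : 1 ≤ n)
    {E₁ E₂ : Set Ω} {T ρ : ℝ}
    (h₁ : ∀ ω ∉ E₁, ∀ x : ℝ, ∀ θ ∈ Theta (q + 1) βa,
      |centeredSum P X (fun t : ℕ => ε (t + 1)) n (fun U u => ψ U θ * resInd a θ x U u) ω| ≤
          √n * (T + ρ * (√n * l1norm (θ - a))))
    (h₂ : ∀ ω ∉ E₂, ∀ x : ℝ, ∀ θ ∈ Theta (q + 1) βa,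
      |centeredSum P X (fun t : ℕ => ε (t + 1)) n (fun U u => 1 * resInd a θ x U u) ω| ≤
          √n * (T + ρ * (√n * l1norm (θ - a)))) :
    ∀ᵐ ω ∂P, ω ∉ E₁ → ω ∉ E₂ → ∀ x : ℝ, ∀ θ ∈ Theta (q + 1) βa,
      |Wproc φ y k n x θ ω - √n * bias P φ y k x θ| ≤
        (3 + B) * (T + ρ * (√n * l1norm (θ - a))) := by
  have hX := h.measurable_X 0
  have he := h.measurable_e 0
  have hae : ∀ᵐ ω ∂P, (∀ t : ℕ, X t ω = lags (q + 1) y t ω) ∧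
      ∀ t : ℕ, ∀ θ, ψ (X t ω) θ = φ (X t ω) θ k :=
    (ae_all_iff.2 hXy).and (ae_all_iff.2 hψ)
  have hind : ∀ ω, (∀ t : ℕ, X t ω = lags (q + 1) y t ω) → ∀ (t : ℕ) (x : ℝ),
      ∀ θ ∈ Theta (q + 1) βa,
      residualInd y x θ ((t + 1 : ℕ) : ℤ) ω = resInd a θ x (X t ω) (ε (t + 1) ω) := by
    intro ω hω t x θ hθ
    refine residualInd_eq_resInd hθ.1 ?_ ?_ x
    · rw [hω t]
      push_cast
      rw [add_sub_cancel_right]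
    · have h3 := congrFun (hω (t + 1)) 0
      rw [h.recursion t ω, step_zero] at h3
      rw [h3]
      simp [lags]
  have hbias : ∀ x, ∀ θ ∈ Theta (q + 1) βa, bias P φ y k x θ =
      (∫ ω, ψ (X 0 ω) θ * resInd a θ x (X 0 ω) (ε ((0 : ℕ) + 1) ω) ∂P) -
        (∫ ω, ψ (X 0 ω) θ ∂P) * ∫ ω, 1 * resInd a θ x (X 0 ω) (ε ((0 : ℕ) + 1) ω) ∂P := by
    intro x θ hθ
    have e1 : ∫ ω, φ (lags (q + 1) y 0 ω) θ k * residualInd y x θ 1 ω ∂P =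
        ∫ ω, ψ (X 0 ω) θ * resInd a θ x (X 0 ω) (ε ((0 : ℕ) + 1) ω) ∂P := by
      refine integral_congr_ae ?_
      filter_upwards [hae] with ω hω
      have := hind ω hω.1 0 x θ hθ
      simp only [zero_add, Nat.cast_one] at this
      rw [hω.2 0, this, hω.1 0]
      rfl
    have e2 : ∫ ω, φ (lags (q + 1) y 0 ω) θ k ∂P = ∫ ω, ψ (X 0 ω) θ ∂P := by
      refine integral_congr_ae ?_
      filter_upwards [hae] with ω hω
      rw [hω.2 0, hω.1 0]
      rfl
    have e3 : P.real {ω | residual y θ 1 ω ≤ x} =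
        ∫ ω, 1 * resInd a θ x (X 0 ω) (ε ((0 : ℕ) + 1) ω) ∂P := by
      have hm : Measurable fun ω => residual y θ 1 ω := by
        have hv : Measurable fun ω => vol θ (lags (q + 1) y (1 - 1) ω) :=
          (measurable_vol θ).comp (hy.measurable_lags _)
        exact (hy.measurable 1).div hv.sqrt
      rw [← integral_indicator_one (measurableSet_le hm measurable_const)]
      refine integral_congr_ae ?_
      filter_upwards [hae] with ω hω
      have := hind ω hω.1 0 x θ hθ
      simp only [zero_add, Nat.cast_one] at this
      rw [one_mul]
      exact this
    rw [bias, e1, e2, e3]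
  filter_upwards [hae] with ω hω hω1 hω2 x θ hθ
  have hψi : Integrable (fun ω => ψ (X 0 ω) θ) P :=
    (w.integrable_envelope hX).mono' ((w.measurable θ hθ).comp hX).aestronglyMeasurable
      (Eventually.of_forall fun ω => w.le_Φ _ θ hθ)
  have hm₃ : |∫ ω, ψ (X 0 ω) θ ∂P| ≤ 1 + B :=
    (norm_integral_le_of_norm_le (f := fun ω => ψ (X 0 ω) θ) (w.integrable_envelope hX)
      (Eventually.of_forall fun ω => w.le_Φ _ θ hθ)).trans (w.integral_envelope_le hX)
  have k1 := h₁ ω hω1 x θ hθ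
  have k2 := h₂ ω hω2 x θ hθ
  have k3 : |centeredSum P X (fun t : ℕ => ε (t + 1)) n (fun U _ => ψ U θ) ω| ≤
      √n * (T + ρ * (√n * l1norm (θ - a))) := by
    refine le_of_tendsto (tendsto_centeredSum_resInd (a := a) hX he hθ.1 (w.measurable θ hθ) hψi n ω).abs
      (Eventually.of_forall fun x => h₁ ω hω1 x θ hθ)
  rw [centeredSum_eq] at k1 k2 k3
  simp only [one_mul] at k2
  have hmain := abs_weighted_centered_le hn (fun t => ψ (X t ω) θ)
    (fun t => resInd a θ x (X t ω) (ε (t + 1) ω)) (fun t => resInd_nonneg _ _ _ _ _)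
    (fun t => resInd_le_one _ _ _ _ _) hm₃ k1 k2 k3
  have hW : Wproc φ y k n x θ ω = (√(n : ℝ))⁻¹ * ∑ t ∈ Finset.range n,
      ψ (X t ω) θ * (resInd a θ x (X t ω) (ε (t + 1) ω) -
        (n : ℝ)⁻¹ * ∑ s ∈ Finset.range n, resInd a θ x (X s ω) (ε (s + 1) ω)) := by
    have hG : Gemp y n x θ ω =
        (n : ℝ)⁻¹ * ∑ s ∈ Finset.range n, resInd a θ x (X s ω) (ε (s + 1) ω) := by
      rw [Gemp, sum_Icc_one_eq_sum_range fun t : ℕ => residualInd y x θ (t : ℤ) ω]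
      congr 1
      exact Finset.sum_congr rfl fun t _ => hind ω hω.1 t x θ hθ
    rw [Wproc, hG, sum_Icc_one_eq_sum_range fun t : ℕ => φ (lags (q + 1) y ((t : ℤ) - 1) ω) θ k *
      (residualInd y x θ (t : ℤ) ω -
        (n : ℝ)⁻¹ * ∑ s ∈ Finset.range n, resInd a θ x (X s ω) (ε (s + 1) ω))]
    congr 1
    refine Finset.sum_congr rfl fun t _ => ?_
    rw [hind ω hω.1 t x θ hθ, hω.2 t, hω.1 t]
    push_cast
    rw [add_sub_cancel_right]
  rw [hW, hbias x θ hθ]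
  simp only [one_mul]
  refine hmain.trans (le_of_eq ?_)
  ring

/-- Uniform bound in probability for the deviation of the residual empirical process from its
bias. -/
theorem exists_bound_Wproc {P : Measure Ω} [IsProbabilityMeasure P] {βa : ℝ} (hβa : 0 < βa)
    {ε : ℤ → Ω → ℝ} {g : ℝ → ℝ} (hε : IsInnovation P ε g) (hβaε : βa ≤ ∫ ω, ε 1 ω ^ 2 ∂P)
    (hg : DensityRegular g) {b : Fin (q + 1) → ℝ} {δ : ℝ} (hδ : 0 < δ)
    (hbδ : (∫ ω, ε 1 ω ^ 2 ∂P) * (l1norm b + δ) < 1) {y : (Fin (q + 1) → ℝ) → ℤ → Ω → ℝ}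
    (hy : ∀ a ∈ ThetaNear (q + 1) βa b δ, IsStationaryArch P ε a (y a))
    {φ : (Fin (q + 1) → ℝ) → (Fin (q + 1) → ℝ) → Fin (q + 1) → ℝ}
    (hφ : WeightRegular P (Theta (q + 1) βa) (ThetaNear (q + 1) βa b δ) φ y) (k : Fin (q + 1))
    {ρ : ℝ} (hρ : 0 < ρ) {η : ℝ} (hη : 0 < η) :
    ∃ T : ℝ, 0 ≤ T ∧ ∀ a ∈ ThetaNear (q + 1) βa b δ, ∀ n : ℕ, 1 ≤ n → ∃ E : Set Ω,
      P E ≤ ENNReal.ofReal η ∧ ∀ ω ∉ E, ∀ x : ℝ, ∀ θ ∈ Theta (q + 1) βa,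
        |Wproc φ (y a) k n x θ ω - √n * bias P φ (y a) k x θ| ≤ T + √n * (ρ * l2norm (θ - a)) := by
  have hprob : IsProbabilityMeasure (noiseLaw g) := by
    rw [noiseLaw, ← hε.density 1]
    exact Measure.isProbabilityMeasure_map (hε.measurable 1).aemeasurable
  obtain ⟨Bt, hν⟩ := hg.regularNoise hε.pos hprob hε.integrable_sq_noiseLaw
  obtain ⟨m₂, hm₂⟩ : ∃ m, m = ∫ x, x ^ 2 ∂(noiseLaw g) := ⟨_, rfl⟩
  rw [hε.integral_sq 1, ← hm₂] at hβaε hbδ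
  rw [← hm₂] at hν
  obtain ⟨A, hA⟩ : ∃ A, A = l1norm b + δ := ⟨_, rfl⟩
  rw [← hA] at hbδ
  have hA0 : 0 < A := by
    rw [hA]
    linarith [l1norm_nonneg b]
  have hm0 : 0 < m₂ := by linarith
  have hr : 0 < m₂ * A := mul_pos hm0 hA0
  obtain ⟨γ, hγdef⟩ : ∃ γ : ℝ, γ = (m₂ * A) ^ ((1 : ℝ) / ((q + 1 : ℕ) : ℝ)) := ⟨_, rfl⟩
  have hγ : 0 < γ := by
    rw [hγdef]
    positivity
  have hγ1 : γ < 1 := by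
    rw [hγdef]
    exact Real.rpow_lt_one hr.le hbδ (by positivity)
  have hγA : m₂ * A ≤ γ ^ (q + 1) := by
    rw [hγdef, ← Real.rpow_natCast, ← Real.rpow_mul hr.le, one_div_mul_cancel (by positivity),
      Real.rpow_one]
  obtain ⟨C, hC, hchain⟩ := exists_ergodicChain (q := q) hε hν hA0.le hγ hγ1 hγA hbδ
  obtain ⟨ψ, Φ, M, B, β, hB, hβ, hψφ, hW⟩ := hφ.exists_weightBound k
  have hB0 : 0 ≤ B := by linarith
  have hη2 : 0 < η / 2 := by positivity
  have hρ' : 0 < ρ / ((3 + B) * ((q + 1 : ℕ) : ℝ)) := by positivity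
  obtain ⟨T, hT0, hT⟩ := exists_bound_process (q := q) (P := P) hν hC hγ hγ1 hβa hB0 hβ hρ' hη2
  refine ⟨(3 + B) * T, by positivity, ?_⟩
  intro a ha n hn
  have haΘ : a ∈ Theta (q + 1) βa := ha.2
  have haA : ∑ i, a i ≤ A := by
    have h1 : ∑ i, a i ≤ l1norm a := Finset.sum_le_sum fun i _ => le_abs_self _
    have h2 : l1norm a ≤ l1norm (a - b) + l1norm b := by
      unfold l1norm
      rw [← Finset.sum_add_distrib]
      refine Finset.sum_le_sum fun i _ => ?_
      have := abs_add_le ((a - b) i) (b i)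
      simpa using this
    have h3 : l1norm (a - b) ≤ δ := ha.1
    rw [hA]
    linarith
  obtain ⟨X, ℱ, h, hXy⟩ := hchain haΘ.1 haA (hy a ha)
  have w := hW a ha (X 0) (h.measurable_X 0) (by simpa using hXy 0)
  obtain ⟨E₁, hE₁, h₁⟩ := hT h haΘ w hn
  obtain ⟨E₂, hE₂, h₂⟩ := hT h haΘ (weightBound_one (X 0) _ hB β) hn
  have hψX : ∀ t : ℕ, ∀ᵐ ω ∂P, ∀ θ, ψ (X t ω) θ = φ (X t ω) θ k := fun t => by
    have h1 := (h.map_absolutelyContinuous haΘ.1 hν.ac).ae_le hψφ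
    rw [← h.stationary t] at h1
    exact ae_of_ae_map (h.measurable_X t).aemeasurable h1
  have hfin := h.abs_Wproc_sub_bias_le (hy a ha) hXy w hψX hn h₁ h₂
  obtain ⟨E₃, hE₃⟩ : ∃ E₃, E₃ = {ω | ¬ (ω ∉ E₁ → ω ∉ E₂ → ∀ x : ℝ, ∀ θ ∈ Theta (q + 1) βa,
      |Wproc φ (y a) k n x θ ω - √n * bias P φ (y a) k x θ| ≤
        (3 + B) * (T + ρ / ((3 + B) * ((q + 1 : ℕ) : ℝ)) * (√n * l1norm (θ - a))))} := ⟨_, rfl⟩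
  have hE₃0 : P E₃ = 0 := by
    rw [hE₃]
    exact ae_iff.1 hfin
  have htoReal : ∀ {E : Set Ω}, P.real E ≤ η / 2 → P E ≤ ENNReal.ofReal (η / 2) := fun {E} hE => by
    rw [← ofReal_measureReal]
    exact ENNReal.ofReal_le_ofReal hE
  refine ⟨E₁ ∪ E₂ ∪ E₃, ?_, ?_⟩
  · calc P (E₁ ∪ E₂ ∪ E₃) ≤ P E₁ + P E₂ + P E₃ :=
          (measure_union_le _ _).trans (add_le_add_left (measure_union_le _ _) _)
      _ ≤ ENNReal.ofReal (η / 2) + ENNReal.ofReal (η / 2) + 0 := by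
          rw [hE₃0]
          exact add_le_add_left (add_le_add (htoReal hE₁) (htoReal hE₂)) _
      _ = ENNReal.ofReal η := by
          rw [add_zero, ← ENNReal.ofReal_add hη2.le hη2.le, add_halves]
  · intro ω hω x θ hθ
    simp only [Set.mem_union, not_or] at hω
    obtain ⟨⟨hω1, hω2⟩, hω3⟩ := hω
    rw [hE₃] at hω3
    have h3 := not_not.1 hω3 hω1 hω2 x θ hθ
    refine h3.trans ?_
    have h4 := l1norm_le_mul_l2norm (θ - a)
    rw [mul_add]
    refine add_le_add le_rfl ?_
    calc (3 + B) * (ρ / ((3 + B) * ((q + 1 : ℕ) : ℝ)) * (√n * l1norm (θ - a)))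
        ≤ (3 + B) * (ρ / ((3 + B) * ((q + 1 : ℕ) : ℝ)) *
            (√n * (((q + 1 : ℕ) : ℝ) * l2norm (θ - a)))) := by gcongr
      _ = √n * (ρ * l2norm (θ - a)) := by
          field_simp

theorem iSup_ofReal_le {p : ℕ} {Θ : Set (Fin p → ℝ)} {f : ℝ → (Fin p → ℝ) → ℝ} {T : ℝ}
    (h : ∀ x, ∀ θ ∈ Θ, f x θ ≤ T) :
    ⨆ x : ℝ, ⨆ θ ∈ Θ, ENNReal.ofReal (f x θ) ≤ ENNReal.ofReal T :=
  iSup_le fun x => iSup₂_le fun θ hθ => ENNReal.ofReal_le_ofReal (h x θ hθ)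

end

end ArchResidual

end

theorem mainTheorem3 {Ω : Type*} [MeasurableSpace Ω] (P : Measure Ω) [IsProbabilityMeasure P]
    (p : ℕ) (βa : ℝ) (hβa : 0 < βa)
    (ε : ℤ → Ω → ℝ) (g : ℝ → ℝ)
    (hε : ArchResidual.IsInnovation P ε g)
    (hβaε : βa ≤ ∫ ω, ε 1 ω ^ 2 ∂P)
    (hg : ArchResidual.DensityRegular g)
    (hmom : ∃ β₁ : ℝ, 0 < β₁ ∧ Integrable (fun ω => |ε 1 ω| ^ (8 + β₁)) P)
    (b : Fin p → ℝ) (hb : b ∈ ArchResidual.Theta p βa)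
    (δ : ℝ) (hδ : 0 < δ)
    (hbδ : (∫ ω, ε 1 ω ^ 2 ∂P) * (ArchResidual.l1norm b + δ) < 1)
    (y : (Fin p → ℝ) → ℤ → Ω → ℝ)
    (hy : ∀ a ∈ ArchResidual.ThetaNear p βa b δ, ArchResidual.IsStationaryArch P ε a (y a))
    (φ : (Fin p → ℝ) → (Fin p → ℝ) → Fin p → ℝ)
    (hφ : ArchResidual.WeightRegular P (ArchResidual.Theta p βa)
      (ArchResidual.ThetaNear p βa b δ) φ y)
    (k : Fin p) (ρ : ℝ) (hρ : 0 < ρ) :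
    ArchResidual.UniformOp P (ArchResidual.ThetaNear p βa b δ) (fun a n ω =>
      ⨆ x : ℝ, ⨆ θ ∈ ArchResidual.Theta p βa, ENNReal.ofReal
        (ArchResidual.Wproc φ (y a) k n x θ ω
          - √(n : ℝ) * (ArchResidual.bias P φ (y a) k x θ
              + ρ * ArchResidual.l2norm (θ - a)))⁺) ∧
    ArchResidual.UniformOp P (ArchResidual.ThetaNear p βa b δ) (fun a n ω =>
      ⨆ x : ℝ, ⨆ θ ∈ ArchResidual.Theta p βa, ENNReal.ofReal
        (ArchResidual.Wproc φ (y a) k n x θ ω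
          - √(n : ℝ) * (ArchResidual.bias P φ (y a) k x θ
              - ρ * ArchResidual.l2norm (θ - a)))⁻) := by
  obtain _ | q := p
  · exact k.elim0
  have hbound := fun (η : ℝ) (hη : 0 < η) =>
    ArchResidual.exists_bound_Wproc hβa hε hβaε hg hδ hbδ hy hφ k hρ hη
  constructor <;> refine ArchResidual.uniformOp_of_forall_exists_bound fun η hη => ?_
  all_goals
    obtain ⟨T, hT0, hT⟩ := hbound η hη
    refine ⟨T, hT0, fun a ha n hn => ?_⟩
    obtain ⟨E, hE, hEω⟩ := hT a ha n hn
    refine ⟨E, hE, fun ω hω => ArchResidual.iSup_ofReal_le fun x θ hθ => ?_⟩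
    have h1 := abs_le.1 (hEω ω hω x θ hθ)
  · refine sup_le ?_ hT0
    rw [mul_add]
    linarith
  · refine sup_le ?_ hT0
    rw [mul_sub]
    linarith
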